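/- **Setting.** Let $G_2\subset GL(7,\mathbb R)$ be the split real group, the automorphism group of the imaginary split octonions. Let $M=G_2/P_1$ be the orbit of the highest weight line, $K=G_2/P_2$ the orbit of the special null planes, and $G_2/P_{12}$ the space of flags (line in plane), with its projections $\pi_l$ to $M$ and $\pi_r$ to $K$. On an affine chart $(x,y,p,q,z)$ of $M$ the invariant distribution is $\Pi=\langle\partial_x+p\partial_y+q\partial_p+q^2\partial_z,\ \partial_q\rangle$ and the invariant conformal metric is $g=q^2dx^2-2q\,dx\,dp+6p\,dx\,dq-3\,dx\,dz-6\,dy\,dq+4\,dp^2$. On an affine chart $(x,y,p,q,z)$ of $K$ the contact distribution is $D=\ker(dz-p\,dx-q\,dy)$, with the cone of lines $\xi_r=\langle(\partial_x+p\partial_z)+\sqrt3\,r\,\partial_q+\sqrt3\,r^2(\partial_y+q\partial_z)+r^3\partial_p\rangle$, whose projectivization $[\Gamma]\subset\mathbb PD$ is a field of rational normal curves. The space $G_2/P_{12}$ has the chart $\hat M=\{(x,y,p,q,z,r)\}$ of lines $\langle\partial_x+p\partial_y+q\partial_p+q^2\partial_z+r\partial_q\rangle\subset\Pi$ and the chart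 $\hat K=\{(x,y,p,q,z,r)\}$ of lines $\xi_r\subset D$; in these charts $\pi_l$ and $\pi_r$ forget $r$. Curves are smooth graphs over the $x$-axis, unparametrized jets are described by $x$ and the derivatives $y_k,p_k,q_k,z_k$ (and $r_k$), $D_x$ is the total derivative, and $J^\infty(\cdot,1)$ denotes the corresponding charts of the spaces of infinite jets of curves. Curves in $M$ (or in $K$) are congruent by $h\in G_2$ if $h$ maps one to the other up to reparametrization. 1. **Points.** The charts are bijective onto the subsets of $M$, $K$, $G_2/P_{12}$ given by the non-vanishing of one coordinate or $2\times2$ minor of the line and the plane, and the projections of $G_2/P_{12}$ to $M$ and $K$ are onto. The map $$\varphi(x,y,p,q,z,r)=\Bigl(-\tfrac1r,\ \sqrt3\bigl(2p-\tfrac{q^2}r\bigr),\ 3z-\tfrac{q^3}r,\ \sqrt3\bigl(x-\tfrac qr\bigr),\ 6(xp-y)-\tfrac3r(z+xq^2)+\tfrac{2q^3}{r^2},\ q\Bigr)$$ is a diffeomorphism of $\{r\ne0\}\subset\hat M$ onto $\{x\neq0\}\subset\hat K$. It sends each flag to the same flag, it maps the line of $\partial_x+p\partial_y+q\partial_p+q^2\partial_z+r\partial_q$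 to that of $\partial_r$, and it maps the line of $\partial_r$ to that of $\partial_x+p\partial_z+\sqrt3r\partial_q+\sqrt3r^2(\partial_y+q\partial_z)+r^3\partial_p$. 2. **Left lift.** On the open dense set $y_1\ne p$ of $J^\infty(M,1)$, the lift $\jmath_l(x,y,p,q,z)=\bigl(x,y,p,q,z,\frac{2qp_1-z_1-q^2}{2(y_1-p)}\bigr)$, with its prolongations, is right inverse to $\pi_l$ and sends the jet of a curve to the jet of the lifted curve. Its coordinate $r$ is the only one for which $Y=\partial_x+p\partial_y+q\partial_p+q^2\partial_z+r\partial_q$ satisfies $g(X,Y)=0$, where $X$ is the velocity of the curve (so the lift is 1:1). It is $G_2$-equivariant. 3. **The vector $\Upsilon_X$.** For a 2-jet of a curve in $K$ with velocity $X\notin D$ there is a distinguished curve $s\mapsto h\exp(sE)P_2$ ($h\in G_2$, $E\in\mathfrak g_{-2}$), unparametrized, with the same 1-jet. The 2-jets of all such curves coincide, and the difference of the given 2-jet and this one is, modulo $X$, the vector $\Upsilon_X\in D$ with $\Upsilon_X=a(\partial_x+p\partial_z)+b\,\partial_q+c(\partial_y+q\partial_z)+d\,\partial_p$, where for $s=qy_1+p-z_1$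 $$a=\tfrac{2\sqrt3q_1^3-9qy_2-18y_1q_1+9z_2}{9s},\qquad b=q_2-\tfrac{2\sqrt3y_1^2+3qq_1y_2+2y_1q_1^2-3q_1z_2}{3s},$$ $$c=y_2+\tfrac{2\sqrt3p_1q_1^2-3qy_1y_2-4y_1^2q_1-6y_1p_1+3y_1z_2}{3s},\qquad d=p_2-\tfrac{2\sqrt3y_1^3+9qp_1y_2+18p_1^2-9p_1z_2}{9s}.$$ 4. **Right lifts.** Let $U\subset J^\infty(K,1)$ be the set where $s\ne0$, $\sqrt3ac-b^2\neq0$ and $\delta:=(3ad-bc)^2-4(\sqrt3ac-b^2)(\sqrt3bd-c^2)\ne0$; it is open and dense. On $U$ put $$\lambda^\pm=\frac{3ad-bc\pm\sqrt\delta}{2(\sqrt3ac-b^2)}\in\mathbb C,\qquad \jmath_r^\pm(x,y,p,q,z)=(x,y,p,q,z,\lambda^\pm),$$ with prolongations. The lifts $\jmath_r^\pm$ are right inverse to $\pi_r$ and send jets of curves to jets of lifted curves. The numbers $\lambda^+\ne\lambda^-$ are exactly the parameters of the points in which the bisecants through $[\Upsilon_X]$ of the (complexified) rational normal curve meet it,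 and a generic curve has exactly two continuous lifts consisting of such points (so the lifts are 1:2). The lifts are real where $\delta>0$ and complex conjugate to each other where $\delta<0$. 5. **Branches.** For a generic curve in $K$ (with jets in $U$), $c^\pm=\pi_l\circ\varphi^{-1}\circ\jmath_r^\pm$ give two distinct points of $M$ (of its complexification where $\delta<0$) for each point of the curve, and these span the plane that represents this point. On the open dense subset $U'\subset U$ where the $x$-coordinates of $c^\pm$ have non-zero total derivative, they induce maps $\beta^\pm$ to the infinite jets of curves in (the complexification of) $M$, real where $\delta>0$, compatible with the projection of curves. For any non-zero polynomial $Q$ in the jet coordinates, $Q\circ\beta^\pm\ne0$ on a dense set. 6. **Reduction.** Let $\gamma_1,\gamma_2$ be curve germs in $K$ with jets in $U$, let $h\in G_2$ and let $\tau$ be a local reparametrization. Then $h$ maps $\gamma_1$ to $\gamma_2$ with the change of parameter $\tau$ if and only if it maps the pair of curves $c_1^\pm$ to the pair $c_2^{\pm}$, or to $c_2^{\mp}$, with the same change of parameter. If $I$ is a rational differential invariant of $G_2$ of order $\le k$ for curves in $M$, then the average $\frac12(I\circ\beta^++I\circ\beta^-)$ over the two branches is, wherever both sides are defined on $U'$,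 a rational differential invariant of $G_2$ of order $\le k+2$ for curves in $K$. -/

import Mathlib

open Set Filter Topology
open scoped ContDiff

/-! ### The split group `G₂` and its flag varieties -/

/-- The product of the 7-dimensional algebra of imaginary split octonions (half of the commutator),
in Zorn's vector-matrix form.  A vector is `(a, u, v)` with `a` the entry `0`, `u` the entries
`1, 2, 3` and `v` the entries `4, 5, 6`; the product is
`((u·v' - u'·v)/2, a u' - a' u - v × v', a' v - a v' + u × u')`. -/
def octCross {𝔽 : Type*} [Field 𝔽] (s t : Fin 7 → 𝔽) : Fin 7 → 𝔽 :=
  ![(s 1 * t 4 + s 2 * t 5 + s 3 * t 6 - t 1 * s 4 - t 2 * s 5 - t 3 * s 6) / 2,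
    s 0 * t 1 - t 0 * s 1 - (s 5 * t 6 - s 6 * t 5),
    s 0 * t 2 - t 0 * s 2 - (s 6 * t 4 - s 4 * t 6),
    s 0 * t 3 - t 0 * s 3 - (s 4 * t 5 - s 5 * t 4),
    t 0 * s 4 - s 0 * t 4 + (s 2 * t 3 - s 3 * t 2),
    t 0 * s 5 - s 0 * t 5 + (s 3 * t 1 - s 1 * t 3),
    t 0 * s 6 - s 0 * t 6 + (s 1 * t 2 - s 2 * t 1)]

/-- The split real group `G₂`: the automorphism group of the imaginary split octonions. -/
def G2 : Subgroup (Matrix.GeneralLinearGroup (Fin 7) ℝ) where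
  carrier := {g | ∀ s t : Fin 7 → ℝ,
    (g : Matrix (Fin 7) (Fin 7) ℝ).mulVec (octCross s t) =
      octCross ((g : Matrix (Fin 7) (Fin 7) ℝ).mulVec s)
        ((g : Matrix (Fin 7) (Fin 7) ℝ).mulVec t)}
  one_mem' := by
    intro s t
    simp
  mul_mem' := by
    intro g h hg hh s t
    have e : ∀ v : Fin 7 → ℝ, ((g * h : Matrix.GeneralLinearGroup (Fin 7) ℝ) :
        Matrix (Fin 7) (Fin 7) ℝ).mulVec v =
        (g : Matrix (Fin 7) (Fin 7) ℝ).mulVec ((h : Matrix (Fin 7) (Fin 7) ℝ).mulVec v) := by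
      intro v
      rw [Matrix.mulVec_mulVec]
      rfl
    rw [e, e, e, hh s t, hg]
  inv_mem' := by
    intro g hg s t
    have e1 : ∀ v : Fin 7 → ℝ, (g : Matrix (Fin 7) (Fin 7) ℝ).mulVec
        (((g⁻¹ : Matrix.GeneralLinearGroup (Fin 7) ℝ) : Matrix (Fin 7) (Fin 7) ℝ).mulVec v)
          = v := by
      intro v
      rw [Matrix.mulVec_mulVec, ← Units.val_mul, mul_inv_cancel, Units.val_one,
        Matrix.one_mulVec]
    have e2 : ∀ v : Fin 7 → ℝ,
        ((g⁻¹ : Matrix.GeneralLinearGroup (Fin 7) ℝ) : Matrix (Fin 7) (Fin 7) ℝ).mulVec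
        ((g : Matrix (Fin 7) (Fin 7) ℝ).mulVec v) = v := by
      intro v
      rw [Matrix.mulVec_mulVec, ← Units.val_mul, inv_mul_cancel, Units.val_one,
        Matrix.one_mulVec]
    have h := hg (((g⁻¹ : Matrix.GeneralLinearGroup (Fin 7) ℝ) :
        Matrix (Fin 7) (Fin 7) ℝ).mulVec s)
      (((g⁻¹ : Matrix.GeneralLinearGroup (Fin 7) ℝ) : Matrix (Fin 7) (Fin 7) ℝ).mulVec t)
    rw [e1, e1] at h
    rw [← h, e2]

/-- The image of a subspace of `𝔽⁷` (`𝔽 = ℝ` or `ℂ`) under a real matrix. -/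
noncomputable def moved {𝔽 : Type*} [RCLike 𝔽] (g : Matrix (Fin 7) (Fin 7) ℝ)
    (S : Submodule 𝔽 (Fin 7 → 𝔽)) : Submodule 𝔽 (Fin 7 → 𝔽) :=
  S.map (Matrix.toLin' (g.map (algebraMap ℝ 𝔽)))

/-- The highest weight line; its stabilizer is the parabolic subgroup `P₁`. -/
def baseLine : Submodule ℝ (Fin 7 → ℝ) := Submodule.span ℝ {Pi.single 1 1}

/-- The special null plane through it; its stabilizer is `P₂`, and that of the flag is `P₁₂`. -/
def basePlane : Submodule ℝ (Fin 7 → ℝ) := Submodule.span ℝ {Pi.single 1 1, Pi.single 6 1}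

/-- `M = G₂/P₁`, as the orbit of the base line. -/
def FlagP1 : Set (Submodule ℝ (Fin 7 → ℝ)) :=
  {L | ∃ g ∈ G2, L = moved (g : Matrix (Fin 7) (Fin 7) ℝ) baseLine}

/-- `K = G₂/P₂`, as the orbit of the base plane. -/
def FlagP2 : Set (Submodule ℝ (Fin 7 → ℝ)) :=
  {P | ∃ g ∈ G2, P = moved (g : Matrix (Fin 7) (Fin 7) ℝ) basePlane}

/-- `M̂ = K̂ = G₂/P₁₂`, as the orbit of the base flag. -/
def FlagP12 : Set (Submodule ℝ (Fin 7 → ℝ) × Submodule ℝ (Fin 7 → ℝ)) :=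
  {F | ∃ g ∈ G2, F = (moved (g : Matrix (Fin 7) (Fin 7) ℝ) baseLine,
    moved (g : Matrix (Fin 7) (Fin 7) ℝ) basePlane)}

/-! ### Affine charts

Points of the charts of `M` and `K` are `(x,y,p,q,z)`, indexed by `0,…,4`; points of the charts of
`M̂` and `K̂` are `(x,y,p,q,z,r)`, indexed by `0,…,5`. -/

/-- Homogeneous coordinates on the chart of `M`. -/
def vecM {𝔽 : Type*} [Field 𝔽] (m : Fin 5 → 𝔽) : Fin 7 → 𝔽 :=
  let x := m 0; let y := m 1; let p := m 2; let q := m 3; let z := m 4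
  let a := 2 * p - x * q
  let u₂ := 2 * p * q - 3 * z
  let u₃ := 4 * x * p - 6 * y - x ^ 2 * q
  ![a, 1, u₂, u₃, -a ^ 2 - u₂ * x - u₃ * q, x, q]

/-- The point of `M` (a line in `𝔽⁷`) with given coordinates. -/
def lineM {𝔽 : Type*} [Field 𝔽] (m : Fin 5 → 𝔽) : Submodule 𝔽 (Fin 7 → 𝔽) :=
  Submodule.span 𝔽 {vecM m}

/-- First basis vector of the plane that represents a point of the chart of `K`. -/
noncomputable def vecK₁ (b : Fin 5 → ℝ) : Fin 7 → ℝ :=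
  let x := b 0; let y := b 1; let p := b 2; let q := b 3; let z := b 4
  ![y / √3, 1, -p, z - x * p - q * y / 3, p * q / √3 - y ^ 2 / 3, q / √3, 0]

/-- Second basis vector of the plane that represents a point of the chart of `K`. -/
noncomputable def vecK₂ (b : Fin 5 → ℝ) : Fin 7 → ℝ :=
  let x := b 0; let y := b 1; let q := b 3; let z := b 4
  ![-q / √3, 0, y / √3, x * y / √3 - q ^ 2 / 3, 2 * q * y / 3 - z, -x, 1]

/-- The point of `K` (a plane in `ℝ⁷`) with given coordinates. -/
noncomputable def planeK (b : Fin 5 → ℝ) : Submodule ℝ (Fin 7 → ℝ) :=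
  Submodule.span ℝ {vecK₁ b, vecK₂ b}

/-- `∂ₓ + p∂_y + q∂_p + q²∂_z + r∂_q`, which spans the line in `Π` with parameter `r`
(the other generator of `Π` is `∂_q`). -/
def dirM (m : Fin 5 → ℝ) (r : ℝ) : Fin 5 → ℝ := ![1, m 2, m 3, r, m 3 ^ 2]

/-- The conformal metric `q²dx² - 2q dx dp + 6p dx dq - 3 dx dz - 6 dy dq + 4dp²` on `M`,
as a symmetric bilinear form. -/
noncomputable def metricM (m v w : Fin 5 → ℝ) : ℝ :=
  m 3 ^ 2 * (v 0 * w 0) - m 3 * (v 0 * w 2 + v 2 * w 0) + 3 * m 2 * (v 0 * w 3 + v 3 * w 0)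
    - 3 / 2 * (v 0 * w 4 + v 4 * w 0) - 3 * (v 1 * w 3 + v 3 * w 1) + 4 * (v 2 * w 2)

/-- The projection `(x,y,p,q,z,r) ↦ (x,y,p,q,z)`: this is `π_l` on `M̂` and `π_r` on `K̂`. -/
def dropLast {𝔽 : Type*} (m : Fin 6 → 𝔽) : Fin 5 → 𝔽 := fun i => m i.castSucc

/-- The chart of `M̂ = ℙΠ`: the point `(a, r)` is the line of `a` together with the plane that
contains it and the derivative of the line in the direction of `Π` with parameter `r`. -/
noncomputable def flagMhat (m : Fin 6 → ℝ) :
    Submodule ℝ (Fin 7 → ℝ) × Submodule ℝ (Fin 7 → ℝ) :=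
  (lineM (dropLast m), Submodule.span ℝ
    {vecM (dropLast m), lineDeriv ℝ vecM (dropLast m) (dirM (dropLast m) (m 5))})

/-- The chart of `K̂`: the point `(b, r)` is the plane of `b` with a line in it. -/
noncomputable def flagKhat (n : Fin 6 → ℝ) :
    Submodule ℝ (Fin 7 → ℝ) × Submodule ℝ (Fin 7 → ℝ) :=
  (Submodule.span ℝ {vecK₁ (dropLast n) + n 5 • vecK₂ (dropLast n)}, planeK (dropLast n))

/-- The transformation `φ : M̂ → K̂`, in the charts. -/
noncomputable def phi (m : Fin 6 → ℝ) : Fin 6 → ℝ :=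
  let x := m 0; let y := m 1; let p := m 2; let q := m 3; let z := m 4; let r := m 5
  ![-1 / r, √3 * (2 * p - q ^ 2 / r), 3 * z - q ^ 3 / r, √3 * (x - q / r),
    6 * (x * p - y) - 3 / r * (z + x * q ^ 2) + 2 * q ^ 3 / r ^ 2, q]

/-- First generator of the distribution `Δ` on `M̂`; the second generator is `∂_r`. -/
def horMhat (m : Fin 6 → ℝ) : Fin 6 → ℝ := ![1, m 2, m 3, m 5, m 3 ^ 2, 0]

/-- First generator of the distribution on `K̂`; the second generator is `∂_r`. -/
noncomputable def horKhat (n : Fin 6 → ℝ) : Fin 6 → ℝ :=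
  ![1, √3 * n 5 ^ 2, n 5 ^ 3, √3 * n 5, n 2 + √3 * n 5 ^ 2 * n 3, 0]

/-- `∂_r`. -/
def vert : Fin 6 → ℝ := Pi.single 5 1

/-- The map `π_l ∘ φ⁻¹` from `K̂` to `M`, in the charts (it is polynomial). -/
noncomputable def toM {𝔽 : Type*} [RCLike 𝔽] (n : Fin 6 → 𝔽) : Fin 5 → 𝔽 :=
  let c : 𝔽 := ((√3 : ℝ) : 𝔽)
  let X := n 0; let Y := n 1; let P := n 2; let Q := n 3; let Z := n 4; let R := n 5
  let x := Q / c - R * X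
  let p := (Y / c - R ^ 2 * X) / 2
  let z := (P - R ^ 3 * X) / 3
  ![x, x * p + (3 * X * (z + x * R ^ 2) + 2 * R ^ 3 * X ^ 2 - Z) / 6, p, R, z]

/-! ### Jets of unparametrized curves

Curves transversal to the foliation `x = const` are graphs over the `x`-axis. -/

/-- The affine chart of the space of infinite jets of curves in `𝔽 × 𝔽ⁿ`: the pair `(x, u)`, where
`u k i` is the `k`-th derivative of the `i`-th dependent variable.  The dependent variables are
`y, p, q, z` (indices `0,1,2,3`) and, on the six-dimensional spaces, also `r` (index `4`). The
topology is the product topology, that is the one of the inverse limit of the finite jet spaces. -/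
abbrev Jet (𝔽 : Type*) (n : ℕ) : Type _ := 𝔽 × (ℕ → Fin n → 𝔽)

/-- The point over which a jet lies. -/
def Jet.pt {𝔽 : Type*} {n : ℕ} (θ : Jet 𝔽 n) : Fin (n + 1) → 𝔽 := Matrix.vecCons θ.1 (θ.2 0)

/-- The velocity `∂ₓ + y₁∂_y + p₁∂_p + q₁∂_q + z₁∂_z` of a jet. -/
def Jet.vel {n : ℕ} (θ : Jet ℝ n) : Fin (n + 1) → ℝ := Matrix.vecCons 1 (θ.2 1)

/-- A real jet as a complex one. -/
def Jet.toComplex {n : ℕ} (θ : Jet ℝ n) : Jet ℂ n := ((θ.1 : ℂ), fun k i => (θ.2 k i : ℂ))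

/-- The complex conjugate jet. -/
def Jet.conj {n : ℕ} (θ : Jet ℂ n) : Jet ℂ n :=
  (starRingEnd ℂ θ.1, fun k i => starRingEnd ℂ (θ.2 k i))

/-- The projection of jets of curves that forgets the coordinate `r`; it is induced by `π_l`
on `M̂` and by `π_r` on `K̂`. -/
def Jet.proj {𝔽 : Type*} (θ : Jet 𝔽 5) : Jet 𝔽 4 := (θ.1, fun k i => θ.2 k i.castSucc)

/-- The point of the graph of `γ` over `t`. -/
def graphPt {n : ℕ} (γ : ℝ → Fin n → ℝ) (t : ℝ) : Fin (n + 1) → ℝ := Matrix.vecCons t (γ t)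

/-- The infinite jet at `x` of the graph of `γ`. -/
noncomputable def jetOf {𝔽 : Type*} [RCLike 𝔽] {n : ℕ} (γ : ℝ → Fin n → 𝔽) (x : ℝ) : Jet 𝔽 n :=
  ((x : 𝔽), fun k => iteratedDeriv k γ x)

/-- The total derivative `∂ₓ + ∑ₖ uₖ₊₁ ∂/∂uₖ`. -/
noncomputable def totalD {E : Type*} [NormedAddCommGroup E] [NormedSpace ℝ E] {n : ℕ}
    (F : Jet ℝ n → E) (θ : Jet ℝ n) : E :=
  lineDeriv ℝ F θ ((1 : ℝ), fun k => θ.2 (k + 1))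

/-- Fibre coordinates of the prolongation: `u'₀ = U`, `u'ₖ₊₁ = D u'ₖ / D X`. -/
noncomputable def prolongCoeff {𝔽 : Type*} [RCLike 𝔽] {n m : ℕ}
    (X : Jet ℝ n → 𝔽) (U : Jet ℝ n → Fin m → 𝔽) : ℕ → Jet ℝ n → Fin m → 𝔽
  | 0 => U
  | k + 1 => fun θ => (totalD X θ)⁻¹ • totalD (prolongCoeff X U k) θ

/-- The prolongation to infinite jets of the differential operator that sends a curve to the curve
with the independent variable `X` and the dependent variables `U` (functions of finite jets). -/
noncomputable def prolong {𝔽 : Type*} [RCLike 𝔽] {n m : ℕ}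
    (X : Jet ℝ n → 𝔽) (U : Jet ℝ n → Fin m → 𝔽) (θ : Jet ℝ n) : Jet 𝔽 m :=
  (X θ, fun k => prolongCoeff X U k θ)

/-! ### The left lift -/

/-- The domain of the left lift. -/
def GenM : Set (Jet ℝ 4) := {θ | θ.2 1 0 ≠ θ.2 0 1}

/-- The coordinate `r = (2 q p₁ - z₁ - q²) / (2 (y₁ - p))` of the left lift. -/
noncomputable def rLeft (θ : Jet ℝ 4) : ℝ :=
  (2 * θ.2 0 2 * θ.2 1 1 - θ.2 1 3 - θ.2 0 2 ^ 2) / (2 * (θ.2 1 0 - θ.2 0 1))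

/-- The left lift `J^∞(M,1) ⇢ J^∞(M̂,1)`, `(x,y,p,q,z) ↦ (x,y,p,q,z,r)` with its prolongations. -/
noncomputable def jLeft : Jet ℝ 4 → Jet ℝ 5 :=
  prolong (fun θ => θ.1) (fun θ => ![θ.2 0 0, θ.2 0 1, θ.2 0 2, θ.2 0 3, rLeft θ])

/-! ### The right lifts -/

/-- `q y₁ + p - z₁`, which vanishes for jets tangent to the contact distribution
`D = ker (dz - p dx - q dy)` of `K`. -/
def contactDefect (θ : Jet ℝ 4) : ℝ := θ.2 0 2 * θ.2 1 0 + θ.2 0 1 - θ.2 1 3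

/-- The vector `a(∂ₓ + p∂_z) + b∂_q + c(∂_y + q∂_z) + d∂_p` of `D` at a point of `K`,
for `v = (a,b,c,d)`. -/
def frameD (k : Fin 5 → ℝ) (v : Fin 4 → ℝ) : Fin 5 → ℝ :=
  ![v 0, v 2, v 3, v 1, v 0 * k 2 + v 2 * k 3]

/-- Components `(1, √3 r, √3 r², r³)`, in the frame above, of the generator of the line `ξ_r` of
the rational normal cone `Γ ⊂ D` (complexified). -/
noncomputable def xi (r : ℂ) : Fin 4 → ℂ := ![1, ((√3 : ℝ) : ℂ) * r, ((√3 : ℝ) : ℂ) * r ^ 2, r ^ 3]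

/-- Components `(a,b,c,d)`, in the frame above, of the vector `Υ_X ∈ D` of a 2-jet. -/
noncomputable def upsilon (θ : Jet ℝ 4) : Fin 4 → ℝ :=
  let p := θ.2 0 1; let q := θ.2 0 2
  let y₁ := θ.2 1 0; let p₁ := θ.2 1 1; let q₁ := θ.2 1 2; let z₁ := θ.2 1 3
  let y₂ := θ.2 2 0; let p₂ := θ.2 2 1; let q₂ := θ.2 2 2; let z₂ := θ.2 2 3
  let s := q * y₁ + p - z₁
  ![(2 * √3 * q₁ ^ 3 - 9 * q * y₂ - 18 * y₁ * q₁ + 9 * z₂) / (9 * s),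
    q₂ - (2 * √3 * y₁ ^ 2 + 3 * q * q₁ * y₂ + 2 * y₁ * q₁ ^ 2 - 3 * q₁ * z₂) / (3 * s),
    y₂ + (2 * √3 * p₁ * q₁ ^ 2 - 3 * q * y₁ * y₂ - 4 * y₁ ^ 2 * q₁ - 6 * y₁ * p₁ + 3 * y₁ * z₂)
      / (3 * s),
    p₂ - (2 * √3 * y₁ ^ 3 + 9 * q * p₁ * y₂ + 18 * p₁ ^ 2 - 9 * p₁ * z₂) / (9 * s)]

/-- Leading coefficient `√3 ac - b²` of the quadratic equation for the secant points. -/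
noncomputable def secLead (v : Fin 4 → ℝ) : ℝ := √3 * v 0 * v 2 - v 1 ^ 2

/-- `3ad - bc`. -/
def secMid (v : Fin 4 → ℝ) : ℝ := 3 * v 0 * v 3 - v 1 * v 2

/-- The discriminant `(3ad - bc)² - 4(√3 ac - b²)(√3 bd - c²)`; up to a constant it is the equation
of the tangent variety `TΓ`. -/
noncomputable def secDisc (v : Fin 4 → ℝ) : ℝ :=
  secMid v ^ 2 - 4 * secLead v * (√3 * v 1 * v 3 - v 2 ^ 2)

/-- A square root in `ℂ` of a real number; it is smooth away from `0`
(`Real.sqrt` vanishes on negative numbers). -/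
noncomputable def csqrt (d : ℝ) : ℂ := (√d : ℂ) + Complex.I * (√(-d) : ℂ)

/-- The parameters `λ^±` of the two points of the rational normal curve on its secant line through
`[v]`; `ε = ±1` is the sign. They are complex conjugate where the discriminant is negative. -/
noncomputable def lam (ε : ℤˣ) (v : Fin 4 → ℝ) : ℂ :=
  ((secMid v : ℂ) + ((ε : ℤ) : ℂ) * csqrt (secDisc v)) / (2 * (secLead v : ℂ))

/-- `r` is the parameter of a point in which a bisecant of the (complexified) rational normal curve
through `[v]` meets this curve. -/
def IsSecantPt (v : Fin 4 → ℝ) (r : ℂ) : Prop :=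
  ∃ s : ℂ, s ≠ r ∧ (fun i => (v i : ℂ)) ∈ Submodule.span ℂ {xi r, xi s}

/-- The domain of the right lifts: the jet is not tangent to `D`, the point `[Υ_X]` is not on the
tangent variety, and both secant points have finite parameter (that is, the lifts stay in the chart
of `K̂`). -/
def GenK : Set (Jet ℝ 4) :=
  {θ | contactDefect θ ≠ 0 ∧ secLead (upsilon θ) ≠ 0 ∧ secDisc (upsilon θ) ≠ 0}

/-- The right lifts `J^∞(K,1) ⇢ J^∞(K̂,1)`, `(x,y,p,q,z) ↦ (x,y,p,q,z,λ^±)` with their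
prolongations. -/
noncomputable def jRight (ε : ℤˣ) : Jet ℝ 4 → Jet ℂ 5 :=
  prolong (fun θ => (θ.1 : ℂ))
    (fun θ => ![(θ.2 0 0 : ℂ), (θ.2 0 1 : ℂ), (θ.2 0 2 : ℂ), (θ.2 0 3 : ℂ), lam ε (upsilon θ)])

/-- The point of `M` under the value of the right lift of a jet: `π_l ∘ φ⁻¹ ∘ j_r^±`. -/
noncomputable def branchPt (ε : ℤˣ) (θ : Jet ℝ 4) : Fin 5 → ℂ :=
  toM ![(θ.1 : ℂ), (θ.2 0 0 : ℂ), (θ.2 0 1 : ℂ), (θ.2 0 2 : ℂ), (θ.2 0 3 : ℂ), lam ε (upsilon θ)]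

/-- The transformation `J^∞(K,1) ⇢ J^∞(M,1)` given by `π_l ∘ φ⁻¹ ∘ j_r^±` on curves; the
independent variable changes, so that the `x`-derivatives are `D / D(x)`. -/
noncomputable def branch (ε : ℤˣ) : Jet ℝ 4 → Jet ℂ 4 :=
  prolong (fun θ => branchPt ε θ 0) (fun θ i => branchPt ε θ i.succ)

/-- The domain of both branches: the projected curves are transversal to `x = const`. -/
def GenBranch : Set (Jet ℝ 4) :=
  {θ | θ ∈ GenK ∧ ∀ ε : ℤˣ, totalD (fun η => branchPt ε η 0) θ ≠ 0}

/-- A long root vector of `Lie(G₂)` that spans `𝔤₋₂` of the contact grading attached to `P₂`;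
its square is zero, so that `exp (sE) = 1 + sE`. -/
def longRoot : Matrix (Fin 7) (Fin 7) ℝ := Matrix.single 3 1 1 - Matrix.single 4 6 1

/-- Near `x` the graph of `δ` is a (reparametrized) distinguished curve `s ↦ g exp(sE) P₂` of `K`,
with `E` in `𝔤₋₂`. -/
def IsDistinguished (δ : ℝ → Fin 4 → ℝ) (x : ℝ) : Prop :=
  ∃ g ∈ G2, ∃ s : ℝ → ℝ, ∀ᶠ t in 𝓝 x,
    planeK (graphPt δ t) =
      moved ((g : Matrix (Fin 7) (Fin 7) ℝ) * (1 + s t • longRoot)) basePlane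

/-! ### Congruence and rational differential invariants -/

/-- Near `x`, the matrix `g` maps the graph of `γ₁` to that of `γ₂`, with the change of parameter
`τ`. Points are given by `S = lineM` for curves in `M` and by `S = planeK` for curves in `K`. -/
def CurvesCongruent (S : (Fin 5 → ℝ) → Submodule ℝ (Fin 7 → ℝ)) (g : Matrix (Fin 7) (Fin 7) ℝ)
    (γ₁ γ₂ : ℝ → Fin 4 → ℝ) (τ : ℝ → ℝ) (x : ℝ) : Prop :=
  ContDiffAt ℝ ∞ τ x ∧ deriv τ x ≠ 0 ∧
    ∀ᶠ t in 𝓝 x, moved g (S (graphPt γ₁ t)) = S (graphPt γ₂ (τ t))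

/-- Polynomials in the jet coordinates: `none` is `x` and `some (k, i)` is the `k`-th derivative of
the `i`-th dependent variable. -/
abbrev JetPoly : Type := MvPolynomial (Option (ℕ × Fin 4)) ℝ

/-- The value of a polynomial at a real or complex jet. -/
noncomputable def JetPoly.evalAt {𝔽 : Type*} [RCLike 𝔽] (P : JetPoly) (θ : Jet 𝔽 4) : 𝔽 :=
  MvPolynomial.aeval (fun v => Option.elim v θ.1 (fun ki => θ.2 ki.1 ki.2)) P

/-- The polynomial is a function on the space of `k`-jets. -/
def JetPoly.OrderLE (k : ℕ) (P : JetPoly) : Prop :=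
  ∀ (j : ℕ) (i : Fin 4), some (j, i) ∈ P.vars → j ≤ k

/-- The rational function `P / Q` on the space of `k`-jets of curves is a differential invariant of
`G₂`, for curves in `M` (`S = lineM`) or in `K` (`S = planeK`). -/
def IsRatInvariant (S : (Fin 5 → ℝ) → Submodule ℝ (Fin 7 → ℝ)) (k : ℕ) (P Q : JetPoly) : Prop :=
  Q ≠ 0 ∧ P.OrderLE k ∧ Q.OrderLE k ∧
    ∀ g ∈ G2, ∀ γ₁ γ₂ : ℝ → Fin 4 → ℝ, ContDiff ℝ ∞ γ₁ → ContDiff ℝ ∞ γ₂ →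
      ∀ (τ : ℝ → ℝ) (x : ℝ), CurvesCongruent S (g : Matrix (Fin 7) (Fin 7) ℝ) γ₁ γ₂ τ x →
        Q.evalAt (jetOf γ₁ x) ≠ 0 → Q.evalAt (jetOf γ₂ (τ x)) ≠ 0 →
          P.evalAt (jetOf γ₁ x) / Q.evalAt (jetOf γ₁ x) =
            P.evalAt (jetOf γ₂ (τ x)) / Q.evalAt (jetOf γ₂ (τ x))

/-!
The split octonion product `×` on `ℝ⁷` determines an invariant quadratic form (`octCross_octCross`)
and the invariant alternating trilinear form `triple u v w = ⟨u × v, w⟩`; everything below is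
expressed through them. The charts of `G₂/P₁`, `G₂/P₂` and `G₂/P₁₂` are the normal forms of null
vectors and of planes on which the product vanishes: explicit one-parameter groups of automorphisms
move the base flag to every flag in the charts (`flagKhat_mem`, `flagMhat_mem`), and conversely the
equations `⟨v, v⟩ = 0` and `v × w = 0` solve for the remaining coordinates (`exists_lineM_eq`,
`exists_planeK_eq`). A flag is a point of both charts of `G₂/P₁₂`, and `φ` is the change of chart
(`flagKhat_phi`). The conformal metric of `M` is the quadratic form on tangent vectors
(`octForm_vecMd`), hence the left lift picks the special null plane whose direction is orthogonal to
the velocity, which is an equivariant construction (`jLeft_equivariant`).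

A curve in `K` is a moving special null plane `⟨A, B⟩`. For a section `W = σA + ρB` the number
`triple W W' W''` is a binary cubic form in `(σ, ρ)` that does not depend on the extension of `W`
along the curve and is equivariant up to a power of the derivative of the parameter
(`triple_change`, `cubicJet_of_congruent`). In the coordinates of the chart it is, up to a factor,
the cubic form of the vector `Υ` (`cubicK_eq`). The planes of a distinguished curve stay in a
four-dimensional space on which `triple` is zero, so its cubic form vanishes; since `Υ` is affine in
the 2-jet, it is the difference of the 2-jet from that of the distinguished curve
(`upsilon_distinguished`). The bisecants of the rational normal curve through `[Υ]` correspond to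
writing the cubic form as a sum of two cubes, and the secant points are the zeros of its Hessian
(`isSecantPt_iff`, `hessForm_one`). The Hessian is a covariant, so congruences of curves in `K`
permute the secant points (`lam_of_congruent`), and by continuity they do so with a permutation that
is locally constant along the curve. Conversely, the two branches span the plane, so that a
congruence of the pair of branches is a congruence of the curve (`congruent_iff_branchPt`).

Functions on jets are handled by classes that contain the defining functions of a lift and are
closed under the total derivative (`IsJetClass`). For the right lifts and the branches the class
consists of the pairs `R₁ ± R₂ √δ` with rational `R₁`, `R₂` (`IsAlg`). The product of the two
conjugates is rational (`IsAlg.norm`), which reduces density to the fact that a non-zero polynomial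
on the space of jets is non-zero on a dense set (`dense_evalAt_ne_zero`); their average is `R₁`,
which gives the rationality of the averaged invariant (`exists_average`).

That no non-zero polynomial vanishes identically on the branches is proved by realizing an open set
of jets of curves in `M` as branches. A function `r` along a curve in `M` gives a curve of flags and
its projection to `K`; the given curve is one of the branches of the projection if the cubic form of
the projection is the sum of a cube and a multiple of the cube of the linear form that vanishes at
the given point (`mem_GenK_of_isBranch`). This is one equation, a first order differential equation
for `r` (`exists_branch_of_ineq`), and since the discriminant takes negative values, where the
branches are conjugate, a polynomial that does not vanish on one branch does not vanish on the other
(`IsAlg.eq_zero_of_norm`).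

The average of an invariant is compared for congruent curves through their branches. Where `δ > 0`
these are real curves in `M`, and the invariance applies to them directly
(`IsRatInvariant.branch_eq`). Where `δ < 0` there are no real branches; but the invariance of a
rational function under a fixed group element is an identity of rational functions on the space of
jets, so that it is enough to have it on the non-empty open set `δ > 0`
(`isRatInvariant_planeK_of_isOpen`).
-/

/-! ### The split octonion product and one-parameter groups of automorphisms -/

/-- The polar form of the quadratic form `a² + u·v` whose null vectors are the points of `M`. -/
def octForm (s t : Fin 7 → ℝ) : ℝ :=
  2 * s 0 * t 0 + s 1 * t 4 + s 2 * t 5 + s 3 * t 6 + t 1 * s 4 + t 2 * s 5 + t 3 * s 6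

/-- This identity recovers the quadratic form from the product, so that the automorphisms of the
product preserve the form. -/
theorem octCross_octCross (s t : Fin 7 → ℝ) :
    octCross s (octCross s t) = (octForm s s / 2) • t - (octForm s t / 2) • s := by
  ext i
  fin_cases i <;> simp [octCross, octForm] <;> ring

theorem octCross_add_left (s s' t : Fin 7 → ℝ) :
    octCross (s + s') t = octCross s t + octCross s' t := by
  ext i
  fin_cases i <;> simp [octCross] <;> ring

theorem octCross_smul_left (c : ℝ) (s t : Fin 7 → ℝ) :
    octCross (c • s) t = c • octCross s t := by
  ext i
  fin_cases i <;> simp [octCross] <;> ring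

theorem octCross_comm (s t : Fin 7 → ℝ) : octCross s t = -octCross t s := by
  ext i
  fin_cases i <;> simp [octCross] <;> ring

theorem octCross_add_right (s t t' : Fin 7 → ℝ) :
    octCross s (t + t') = octCross s t + octCross s t' := by
  ext i
  fin_cases i <;> simp [octCross] <;> ring

theorem octCross_smul_right (c : ℝ) (s t : Fin 7 → ℝ) :
    octCross s (c • t) = c • octCross s t := by
  ext i
  fin_cases i <;> simp [octCross] <;> ring

theorem octForm_comm (s t : Fin 7 → ℝ) : octForm s t = octForm t s := by
  simp only [octForm]; ring

theorem octForm_add_left (s s' t : Fin 7 → ℝ) :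
    octForm (s + s') t = octForm s t + octForm s' t := by
  simp only [octForm, Pi.add_apply]; ring

theorem octForm_smul_left (c : ℝ) (s t : Fin 7 → ℝ) :
    octForm (c • s) t = c * octForm s t := by
  simp only [octForm, Pi.smul_apply, smul_eq_mul]; ring

theorem octForm_add_right (s t t' : Fin 7 → ℝ) :
    octForm s (t + t') = octForm s t + octForm s t' := by
  simp only [octForm, Pi.add_apply]; ring

theorem octForm_smul_right (c : ℝ) (s t : Fin 7 → ℝ) :
    octForm s (c • t) = c * octForm s t := by
  simp only [octForm, Pi.smul_apply, smul_eq_mul]; ring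

/-- `f` is the action of an element of `G₂` on column vectors. -/
def IsAut (f : (Fin 7 → ℝ) → Fin 7 → ℝ) : Prop :=
  ∃ g ∈ G2, ∀ v, (g : Matrix (Fin 7) (Fin 7) ℝ).mulVec v = f v

theorem isAut_of_inverse {f f' : (Fin 7 → ℝ) → Fin 7 → ℝ}
    (hadd : ∀ s t, f (s + t) = f s + f t) (hsmul : ∀ (c : ℝ) s, f (c • s) = c • f s)
    (h1 : ∀ v, f (f' v) = v) (h2 : ∀ v, f' (f v) = v)
    (hc : ∀ s t, f (octCross s t) = octCross (f s) (f t)) : IsAut f := by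
  let e : (Fin 7 → ℝ) ≃ₗ[ℝ] (Fin 7 → ℝ) :=
    { toFun := f, map_add' := hadd, map_smul' := hsmul, invFun := f', left_inv := h2,
      right_inv := h1 }
  let g : Matrix.GeneralLinearGroup (Fin 7) ℝ :=
    ⟨LinearMap.toMatrix' e.toLinearMap, LinearMap.toMatrix' e.symm.toLinearMap, by
      rw [← LinearMap.toMatrix'_comp]; simp, by
      rw [← LinearMap.toMatrix'_comp]; simp⟩
  have hg : ∀ v, (g : Matrix (Fin 7) (Fin 7) ℝ).mulVec v = f v := by
    intro v
    exact LinearMap.toMatrix'_mulVec e.toLinearMap v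
  refine ⟨g, ?_, hg⟩
  intro s t
  rw [hg, hg, hg, hc]

theorem IsAut.comp {f f' : (Fin 7 → ℝ) → Fin 7 → ℝ} (h : IsAut f) (h' : IsAut f') :
    IsAut (fun v => f (f' v)) := by
  obtain ⟨g, hg, e⟩ := h
  obtain ⟨g', hg', e'⟩ := h'
  refine ⟨g * g', G2.mul_mem hg hg', fun v => ?_⟩
  rw [Units.val_mul, ← Matrix.mulVec_mulVec, e', e]

section roots

variable (t : ℝ) (v : Fin 7 → ℝ)

/-- One of the five root subgroups of the unipotent group opposite to `P₂`, which acts simply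
transitively on the chart of `K`. They are named after the coordinate of the base plane that they
change. -/
def expNegX : Fin 7 → ℝ := ![v 0, v 1, v 2, v 3 + t * v 2, v 4, v 5 - t * v 6, v 6]
/-- The root subgroup opposite to `P₂` that changes the coordinate `p` of the base plane. -/
def expNegP : Fin 7 → ℝ := ![v 0, v 1, v 2 - t * v 1, v 3, v 4 + t * v 5, v 5, v 6]
/-- The root subgroup opposite to `P₂` that changes the coordinate `z` of the base plane: it
consists of the elements `1 + t • longRoot`. -/
def expNegZ : Fin 7 → ℝ := ![v 0, v 1, v 2, v 3 + t * v 1, v 4 - t * v 6, v 5, v 6]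
/-- The root subgroup opposite to `P₂` that changes the rescaled coordinate `y` of the base plane.
The root is short: the square of the generator does not vanish. -/
def expNegY : Fin 7 → ℝ :=
  ![v 0 + t * v 1, v 1, v 2 + t * v 6, v 3 - t * v 5, v 4 - 2 * t * v 0 - t ^ 2 * v 1, v 5, v 6]
/-- The root subgroup opposite to `P₂` that changes the rescaled coordinate `q` of the base plane.
-/
def expNegQ : Fin 7 → ℝ :=
  ![v 0 - t * v 6, v 1, v 2, v 3 + 2 * t * v 0 - t ^ 2 * v 6, v 4 - t * v 2, v 5 + t * v 1, v 6]
/-- One of four root subgroups of the unipotent radical of `P₂`. They are named after the component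
of the velocity of the standard distinguished curve in the base plane that they change. -/
def expPosX : Fin 7 → ℝ := ![v 0, v 1 - t * v 2, v 2, v 3, v 4, v 5 + t * v 4, v 6]
/-- The root subgroup of the stabilizer of the base plane that is opposite to `expNegX`. -/
def expPosP : Fin 7 → ℝ := ![v 0, v 1, v 2 - t * v 3, v 3, v 4, v 5, v 6 + t * v 5]
/-- The short root subgroup of the stabilizer of the base plane that changes the component `y` of
velocities. -/
def expPosY : Fin 7 → ℝ :=
  ![v 0 + t * v 3, v 1 + t * v 5, v 2 - t * v 4, v 3, v 4, v 5, v 6 - 2 * t * v 0 - t ^ 2 * v 3]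
/-- The short root subgroup of the stabilizer of the base plane that changes the component `q` of
velocities. -/
def expPosQ : Fin 7 → ℝ :=
  ![v 0 + t * v 4, v 1 - 2 * t * v 0 - t ^ 2 * v 4, v 2, v 3, v 4, v 5 + t * v 3, v 6 - t * v 2]
/-- A root subgroup of the Levi factor of `P₂`: it preserves the base plane and moves the base line
in it. -/
def expLevi : Fin 7 → ℝ :=
  ![v 0 + t * v 5, v 1, v 2 - 2 * t * v 0 - t ^ 2 * v 5, v 3, v 4 - t * v 3, v 5, v 6 + t * v 1]
/-- An element of the Levi factor of `P₁`: it fixes the base line and turns the special null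
planes through it. -/
def weylM : Fin 7 → ℝ := ![v 0, v 1, t * v 2 + v 3, -v 2, v 4, v 6, t * v 6 - v 5]

end roots

theorem isAut_expNegX (t : ℝ) : IsAut (expNegX t) := by
  refine isAut_of_inverse (f' := expNegX (-t)) ?_ ?_ ?_ ?_ ?_ <;> intros <;> ext i <;>
    fin_cases i <;> simp [octCross, expNegX] <;> ring

theorem isAut_expNegP (t : ℝ) : IsAut (expNegP t) := by
  refine isAut_of_inverse (f' := expNegP (-t)) ?_ ?_ ?_ ?_ ?_ <;> intros <;> ext i <;>
    fin_cases i <;> simp [octCross, expNegP] <;> ring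

theorem isAut_expNegZ (t : ℝ) : IsAut (expNegZ t) := by
  refine isAut_of_inverse (f' := expNegZ (-t)) ?_ ?_ ?_ ?_ ?_ <;> intros <;> ext i <;>
    fin_cases i <;> simp [octCross, expNegZ] <;> ring

theorem isAut_expNegY (t : ℝ) : IsAut (expNegY t) := by
  refine isAut_of_inverse (f' := expNegY (-t)) ?_ ?_ ?_ ?_ ?_ <;> intros <;> ext i <;>
    fin_cases i <;> simp [octCross, expNegY] <;> ring

theorem isAut_expNegQ (t : ℝ) : IsAut (expNegQ t) := by
  refine isAut_of_inverse (f' := expNegQ (-t)) ?_ ?_ ?_ ?_ ?_ <;> intros <;> ext i <;>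
    fin_cases i <;> simp [octCross, expNegQ] <;> ring

theorem isAut_expPosX (t : ℝ) : IsAut (expPosX t) := by
  refine isAut_of_inverse (f' := expPosX (-t)) ?_ ?_ ?_ ?_ ?_ <;> intros <;> ext i <;>
    fin_cases i <;> simp [octCross, expPosX] <;> ring

theorem isAut_expPosP (t : ℝ) : IsAut (expPosP t) := by
  refine isAut_of_inverse (f' := expPosP (-t)) ?_ ?_ ?_ ?_ ?_ <;> intros <;> ext i <;>
    fin_cases i <;> simp [octCross, expPosP] <;> ring

theorem isAut_expPosY (t : ℝ) : IsAut (expPosY t) := by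
  refine isAut_of_inverse (f' := expPosY (-t)) ?_ ?_ ?_ ?_ ?_ <;> intros <;> ext i <;>
    fin_cases i <;> simp [octCross, expPosY] <;> ring

theorem isAut_expPosQ (t : ℝ) : IsAut (expPosQ t) := by
  refine isAut_of_inverse (f' := expPosQ (-t)) ?_ ?_ ?_ ?_ ?_ <;> intros <;> ext i <;>
    fin_cases i <;> simp [octCross, expPosQ] <;> ring

theorem isAut_expLevi (t : ℝ) : IsAut (expLevi t) := by
  refine isAut_of_inverse (f' := expLevi (-t)) ?_ ?_ ?_ ?_ ?_ <;> intros <;> ext i <;>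
    fin_cases i <;> simp [octCross, expLevi] <;> ring

theorem isAut_weylM (t : ℝ) : IsAut (weylM t) := by
  refine isAut_of_inverse (f' := fun v => ![v 0, v 1, -v 3, v 2 + t * v 3, v 4, t * v 5 - v 6, v 5])
    ?_ ?_ ?_ ?_ ?_ <;> intros <;> ext i <;>
    fin_cases i <;> simp [octCross, weylM] <;> ring

/-! ### Invariance of the quadratic form -/

section G2

variable {g : Matrix.GeneralLinearGroup (Fin 7) ℝ}

theorem mulVec_inj (g : Matrix.GeneralLinearGroup (Fin 7) ℝ) {s t : Fin 7 → ℝ}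
    (h : (g : Matrix (Fin 7) (Fin 7) ℝ).mulVec s = (g : Matrix (Fin 7) (Fin 7) ℝ).mulVec t) :
    s = t :=
  Matrix.mulVec_injective_of_isUnit g.isUnit h

/-- The quadratic form is recovered from the product through `s × (s × t) = N(s) t - ⟨s,t⟩ s / 2`,
so automorphisms of the product preserve it. -/
theorem octForm_self_mulVec (hg : g ∈ G2) (s : Fin 7 → ℝ) :
    octForm ((g : Matrix (Fin 7) (Fin 7) ℝ).mulVec s) ((g : Matrix (Fin 7) (Fin 7) ℝ).mulVec s) =
      octForm s s := by
  set G := (g : Matrix (Fin 7) (Fin 7) ℝ) with hG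
  have key : ∀ t, ∃ c : ℝ, (octForm (G.mulVec s) (G.mulVec s) - octForm s s) • t = c • s := by
    intro t
    refine ⟨octForm (G.mulVec s) (G.mulVec t) - octForm s t, mulVec_inj g ?_⟩
    have h1 : G.mulVec (octCross s (octCross s t)) =
        octCross (G.mulVec s) (octCross (G.mulVec s) (G.mulVec t)) := by
      rw [hg, hg]
    rw [octCross_octCross, octCross_octCross, Matrix.mulVec_sub, Matrix.mulVec_smul,
      Matrix.mulVec_smul] at h1
    rw [Matrix.mulVec_smul, Matrix.mulVec_smul]
    ext i
    have h2 := congrFun h1 i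
    simp only [Pi.sub_apply, Pi.smul_apply, smul_eq_mul] at h2 ⊢
    linear_combination -2 * h2
  by_contra hne
  have hd : octForm (G.mulVec s) (G.mulVec s) - octForm s s ≠ 0 := sub_ne_zero.2 hne
  obtain ⟨a, ha⟩ := key (Pi.single 0 1)
  obtain ⟨b, hb⟩ := key (Pi.single 1 1)
  have a0 := congrFun ha 0
  have a1 := congrFun ha 1
  have b0 := congrFun hb 0
  have b1 := congrFun hb 1
  simp at a0 a1 b0 b1
  rcases a1 with h | h
  · exact hd (by rw [a0, h, zero_mul])
  · exact hd (by rw [b1, h, mul_zero])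

theorem octForm_mulVec (hg : g ∈ G2) (s t : Fin 7 → ℝ) :
    octForm ((g : Matrix (Fin 7) (Fin 7) ℝ).mulVec s) ((g : Matrix (Fin 7) (Fin 7) ℝ).mulVec t) =
      octForm s t := by
  have h := octForm_self_mulVec hg (s + t)
  have hs := octForm_self_mulVec hg s
  have ht := octForm_self_mulVec hg t
  rw [Matrix.mulVec_add] at h
  simp only [octForm_add_left, octForm_add_right] at h
  rw [octForm_comm t s, octForm_comm (Matrix.mulVec _ t) (Matrix.mulVec _ s)] at h
  linarith

end G2

/-! ### Images of lines and planes -/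

theorem moved_span {g : Matrix (Fin 7) (Fin 7) ℝ} {S : Set (Fin 7 → ℝ)} :
    moved g (Submodule.span ℝ S) = Submodule.span ℝ (g.mulVec '' S) := by
  rw [moved, Submodule.map_span]
  congr 1

theorem moved_span_singleton (g : Matrix (Fin 7) (Fin 7) ℝ) (v : Fin 7 → ℝ) :
    moved g (Submodule.span ℝ {v}) = Submodule.span ℝ {g.mulVec v} := by
  rw [moved_span, Set.image_singleton]

theorem moved_span_pair (g : Matrix (Fin 7) (Fin 7) ℝ) (v w : Fin 7 → ℝ) :
    moved g (Submodule.span ℝ {v, w}) = Submodule.span ℝ {g.mulVec v, g.mulVec w} := by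
  rw [moved_span, Set.image_pair]

theorem moved_mul (g h : Matrix (Fin 7) (Fin 7) ℝ) (S : Submodule ℝ (Fin 7 → ℝ)) :
    moved (g * h) S = moved g (moved h S) := by
  simp only [moved]
  rw [← Submodule.map_comp, ← Matrix.toLin'_mul]
  simp

/-- Two coordinates that separate the vectors of a plane have an invertible coordinate matrix on a
basis of the plane. -/
theorem det_ne_zero_of_coords {𝔽 : Type*} [Field 𝔽] {v w : Fin 7 → 𝔽} {i j : Fin 7}
    (h : ∀ u ∈ Submodule.span 𝔽 {v, w}, u i = 0 → u j = 0 → u = 0)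
    (hvw : ∀ a b : 𝔽, a • v + b • w = 0 → a = 0 ∧ b = 0) :
    v i * w j - v j * w i ≠ 0 := by
  intro h0
  have mem : ∀ a b : 𝔽, a • v + b • w ∈ Submodule.span 𝔽 {v, w} := fun a b =>
    Submodule.mem_span_pair.2 ⟨a, b, rfl⟩
  have h1 := hvw _ _ (h _ (mem (w j) (-v j)) (by simp; linear_combination h0) (by simp; ring))
  have h2 := hvw _ _ (h _ (mem (w i) (-v i)) (by simp; ring) (by simp; linear_combination -h0))
  have h3 := hvw 1 0 (h _ (mem 1 0) (by simpa using h2.2) (by simpa using h1.2))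
  exact one_ne_zero h3.1

theorem span_pair_eq {𝔽 : Type*} [Field 𝔽] {v w v' w' : Fin 7 → 𝔽} {a b c d : 𝔽}
    (hv : v' = a • v + b • w) (hw : w' = c • v + d • w) (hd : a * d - b * c ≠ 0) :
    Submodule.span 𝔽 {v', w'} = Submodule.span 𝔽 {v, w} := by
  apply le_antisymm
  · rw [Submodule.span_le]
    rintro u (rfl | rfl)
    · exact Submodule.mem_span_pair.2 ⟨a, b, hv.symm⟩
    · exact Submodule.mem_span_pair.2 ⟨c, d, hw.symm⟩
  · rw [Submodule.span_le]
    rintro u (rfl | rfl)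
    · refine Submodule.mem_span_pair.2 ⟨d / (a * d - b * c), -b / (a * d - b * c), ?_⟩
      rw [hv, hw]
      ext i
      simp only [Pi.add_apply, Pi.smul_apply, smul_eq_mul]
      rw [div_mul_eq_mul_div, div_mul_eq_mul_div, ← add_div, div_eq_iff hd]
      ring
    · refine Submodule.mem_span_pair.2 ⟨-c / (a * d - b * c), a / (a * d - b * c), ?_⟩
      rw [hv, hw]
      ext i
      simp only [Pi.add_apply, Pi.smul_apply, smul_eq_mul]
      rw [div_mul_eq_mul_div, div_mul_eq_mul_div, ← add_div, div_eq_iff hd]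
      ring

/-! ### Charts -/

section hat

variable {𝔽 : Type*} [Field 𝔽]

/-- First basis vector of the plane of a point of `K`, in the coordinates `(x, y/√3, p, q/√3, z)`,
in which it has rational coefficients. -/
def kA (b : Fin 5 → 𝔽) : Fin 7 → 𝔽 :=
  ![b 1, 1, -b 2, b 4 - b 0 * b 2 - b 3 * b 1, b 2 * b 3 - b 1 ^ 2, b 3, 0]

/-- Second basis vector of the plane of a point of `K`, in the coordinates
`(x, y/√3, p, q/√3, z)`. -/
def kB (b : Fin 5 → 𝔽) : Fin 7 → 𝔽 :=
  ![-b 3, 0, b 1, b 0 * b 1 - b 3 ^ 2, 2 * b 3 * b 1 - b 4, -b 0, 1]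

/-- The vector `dirM` applied to the homogeneous coordinates on `M`. -/
def tanM (m : Fin 5 → 𝔽) (r : 𝔽) : Fin 7 → 𝔽 :=
  ![m 3 - r * m 0, 0, 2 * m 2 * r - m 3 ^ 2, -2 * m 2 + 2 * m 3 * m 0 - r * m 0 ^ 2,
    -4 * m 2 * m 3 - 2 * m 2 * r * m 0 + m 3 ^ 2 * m 0 + 6 * r * m 1 + 3 * m 4, 1, r]

end hat

/-- Rescaled coordinates on `K`. -/
noncomputable def hat (b : Fin 5 → ℝ) : Fin 5 → ℝ := ![b 0, b 1 / √3, b 2, b 3 / √3, b 4]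

/-- The inverse of the rescaling `hat`. -/
noncomputable def unhat (b : Fin 5 → ℝ) : Fin 5 → ℝ := ![b 0, √3 * b 1, b 2, √3 * b 3, b 4]

theorem sqrt3_sq : √3 ^ 2 = (3 : ℝ) := Real.sq_sqrt (by norm_num)

theorem sqrt3_pos : 0 < √(3 : ℝ) := by positivity

theorem sqrt3_ne : √(3 : ℝ) ≠ 0 := sqrt3_pos.ne'

theorem unhat_hat (b : Fin 5 → ℝ) : unhat (hat b) = b := by
  ext i
  fin_cases i <;> simp [hat, unhat] <;> field_simp

theorem hat_unhat (b : Fin 5 → ℝ) : hat (unhat b) = b := by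
  ext i
  fin_cases i <;> simp [hat, unhat]

theorem vecK₁_eq (b : Fin 5 → ℝ) : vecK₁ b = kA (hat b) := by
  have h := sqrt3_sq
  have h0 := sqrt3_ne
  ext i
  fin_cases i <;> simp [vecK₁, kA, hat] <;> field_simp
  · rw [h]
  · linear_combination (-(b 1) ^ 2) * h

theorem vecK₂_eq (b : Fin 5 → ℝ) : vecK₂ b = kB (hat b) := by
  have h := sqrt3_sq
  have h0 := sqrt3_ne
  ext i
  fin_cases i <;> simp [vecK₂, kB, hat] <;> field_simp
  · linear_combination (-(b 3) ^ 2) * h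
  · rw [h]

theorem planeK_eq (b : Fin 5 → ℝ) : planeK b = Submodule.span ℝ {kA (hat b), kB (hat b)} := by
  rw [planeK, vecK₁_eq, vecK₂_eq]

theorem octCross_kA_kB (b : Fin 5 → ℝ) : octCross (kA b) (kB b) = 0 := by
  ext i
  fin_cases i <;> simp [octCross, kA, kB] <;> ring

/-- The plane spanned by two vectors with vanishing product, one of which has the coordinates
`(1, 0)` and the other the coordinates `(0, 1)`, lies in the chart of `K`. -/
theorem eq_kA_kB {f₁ f₂ : Fin 7 → ℝ} (h : octCross f₁ f₂ = 0) (h11 : f₁ 1 = 1) (h16 : f₁ 6 = 0)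
    (h21 : f₂ 1 = 0) (h26 : f₂ 6 = 1) :
    f₁ = kA ![-f₂ 5, f₁ 0, -f₁ 2, f₁ 5, 2 * f₁ 5 * f₁ 0 - f₂ 4] ∧
      f₂ = kB ![-f₂ 5, f₁ 0, -f₁ 2, f₁ 5, 2 * f₁ 5 * f₁ 0 - f₂ 4] := by
  have e0 := congrFun h 0
  have e1 := congrFun h 1
  have e2 := congrFun h 2
  have e5 := congrFun h 5
  have e6 := congrFun h 6
  simp [octCross, h11, h16, h21, h26] at e0 e1 e2 e5 e6
  have a0 : f₂ 0 = -f₁ 5 := by linarith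
  have a2 : f₂ 2 = f₁ 0 := by linarith
  rw [a0] at e2 e5
  rw [a2] at e0 e2
  constructor
  · ext i
    fin_cases i <;> simp [kA, h11, h16]
    · linarith
    · linarith
  · ext i
    fin_cases i <;> simp [kB, h21, h26, a0, a2]
    · linarith

theorem eq_vecM {v : Fin 7 → ℝ} (h : octForm v v = 0) (h1 : v 1 = 1) :
    v = vecM ![v 5, (4 * v 5 * ((v 0 + v 5 * v 6) / 2) - v 5 ^ 2 * v 6 - v 3) / 6,
      (v 0 + v 5 * v 6) / 2, v 6, (2 * ((v 0 + v 5 * v 6) / 2) * v 6 - v 2) / 3] := by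
  simp only [octForm, h1] at h
  ext i
  fin_cases i <;> simp [vecM, h1] <;> first | ring1 | linear_combination (1/2) * h

theorem octCross_vecM_tanM (m : Fin 5 → ℝ) (r : ℝ) : octCross (vecM m) (tanM m r) = 0 := by
  ext i
  fin_cases i <;> simp [octCross, vecM, tanM] <;> ring

/-- The vectors annihilated by a null vector form a three-dimensional space, spanned by the null
vector and the directions of the invariant distribution. -/
theorem eq_tanM {m : Fin 5 → ℝ} {w : Fin 7 → ℝ} (h : octCross (vecM m) w = 0) (h1 : w 1 = 0)
    (h5 : w 5 = 1) : w = tanM m (w 6) := by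
  have e1 := congrFun h 1
  have e2 := congrFun h 2
  have e3 := congrFun h 3
  have e5 := congrFun h 5
  have e6 := congrFun h 6
  have e0 := congrFun h 0
  simp [octCross, vecM, h1, h5] at e0 e1 e2 e3 e5 e6
  have a0 : w 0 = m 3 - w 6 * m 0 := by linarith
  rw [a0] at e2 e3 e5 e6
  have a2 : w 2 = 2 * m 2 * w 6 - m 3 ^ 2 := by linear_combination e6
  have a3 : w 3 = -2 * m 2 + 2 * m 3 * m 0 - w 6 * m 0 ^ 2 := by linear_combination -e5
  rw [a2, a3] at e0
  ext i
  fin_cases i <;> simp [tanM, h1, h5, a0, a2, a3]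
  linear_combination e0

theorem hasDerivAt_vec7 {f : ℝ → Fin 7 → ℝ} {f' : Fin 7 → ℝ} {t : ℝ}
    (h : ∀ i, HasDerivAt (fun s => f s i) (f' i) t) : HasDerivAt f f' t :=
  hasDerivAt_pi.2 h

/-- The differential of the homogeneous coordinates on `M`. -/
def vecMd (m v : Fin 5 → ℝ) : Fin 7 → ℝ :=
  ![2 * v 2 - v 0 * m 3 - m 0 * v 3, 0, 2 * (v 2 * m 3 + m 2 * v 3) - 3 * v 4,
    4 * (v 0 * m 2 + m 0 * v 2) - 6 * v 1 - 2 * m 0 * v 0 * m 3 - m 0 ^ 2 * v 3,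
    -2 * (2 * m 2 - m 0 * m 3) * (2 * v 2 - v 0 * m 3 - m 0 * v 3)
      - (2 * (v 2 * m 3 + m 2 * v 3) - 3 * v 4) * m 0 - (2 * m 2 * m 3 - 3 * m 4) * v 0
      - (4 * (v 0 * m 2 + m 0 * v 2) - 6 * v 1 - 2 * m 0 * v 0 * m 3 - m 0 ^ 2 * v 3) * m 3
      - (4 * m 0 * m 2 - 6 * m 1 - m 0 ^ 2 * m 3) * v 3,
    v 0, v 3]

theorem HasDerivAt.vecM {c : ℝ → Fin 5 → ℝ} {c' : Fin 5 → ℝ} {t : ℝ} (h : HasDerivAt c c' t) :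
    HasDerivAt (fun s => vecM (c s)) (vecMd (c t) c') t := by
  rw [hasDerivAt_pi] at h
  have h0 := h 0
  have h1 := h 1
  have h2 := h 2
  have h3 := h 3
  have h4 := h 4
  have ha := (h2.const_mul 2).sub (h0.mul h3)
  have hu2 := ((h2.const_mul 2).mul h3).sub (h4.const_mul 3)
  have hu3 := (((h0.const_mul 4).mul h2).sub (h1.const_mul 6)).sub ((h0.pow 2).mul h3)
  refine hasDerivAt_vec7 fun i => ?_
  fin_cases i
  · exact ha.congr_deriv (by simp [vecMd]; ring)
  · exact (hasDerivAt_const t (1 : ℝ)).congr_deriv (by simp [vecMd])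
  · exact hu2.congr_deriv (by simp [vecMd]; ring)
  · exact hu3.congr_deriv (by simp [vecMd]; ring)
  · exact (((ha.pow 2).neg.sub (hu2.mul h0)).sub (hu3.mul h3)).congr_deriv (by simp [vecMd]; ring)
  · exact h0.congr_deriv (by simp [vecMd])
  · exact h3.congr_deriv (by simp [vecMd])

theorem vecMd_dirM (m : Fin 5 → ℝ) (r : ℝ) : vecMd m (dirM m r) = tanM m r := by
  ext i
  fin_cases i <;> simp [vecMd, dirM, tanM] <;> ring

theorem lineDeriv_vecM (m : Fin 5 → ℝ) (r : ℝ) : lineDeriv ℝ vecM m (dirM m r) = tanM m r := by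
  have h : HasDerivAt (fun t : ℝ => m + t • dirM m r) (dirM m r) 0 := by
    simpa using ((hasDerivAt_id (0 : ℝ)).smul_const (dirM m r)).const_add m
  have h2 := h.vecM
  simp only [zero_smul, add_zero, vecMd_dirM] at h2
  exact h2.deriv

theorem flagMhat_eq (m : Fin 6 → ℝ) : flagMhat m = (lineM (dropLast m),
    Submodule.span ℝ {vecM (dropLast m), tanM (dropLast m) (m 5)}) := by
  rw [flagMhat, lineDeriv_vecM]

/-! ### The flag varieties and their charts -/

theorem mulVec_single_one {f : (Fin 7 → ℝ) → Fin 7 → ℝ} {v w v' w' : Fin 7 → ℝ} (hf : IsAut f)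
    (hv : f v = v') (hw : f w = w') : ∃ g ∈ G2,
      moved (g : Matrix (Fin 7) (Fin 7) ℝ) (Submodule.span ℝ {v}) = Submodule.span ℝ {v'} ∧
      moved (g : Matrix (Fin 7) (Fin 7) ℝ) (Submodule.span ℝ {v, w}) =
        Submodule.span ℝ {v', w'} := by
  obtain ⟨g, hg, e⟩ := hf
  exact ⟨g, hg, by rw [moved_span_singleton, e, hv], by rw [moved_span_pair, e, e, hv, hw]⟩

theorem mem_FlagP12_of_isAut {f : (Fin 7 → ℝ) → Fin 7 → ℝ} {v w : Fin 7 → ℝ} (hf : IsAut f)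
    (hv : f (Pi.single 1 1) = v) (hw : f (Pi.single 6 1) = w) :
    (Submodule.span ℝ {v}, Submodule.span ℝ {v, w}) ∈ FlagP12 := by
  obtain ⟨g, hg, h1, h2⟩ := mulVec_single_one hf hv hw
  exact ⟨g, hg, Prod.ext h1.symm h2.symm⟩

theorem fst_image_FlagP12 : Prod.fst '' FlagP12 = FlagP1 := by
  ext L
  constructor
  · rintro ⟨F, ⟨g, hg, rfl⟩, rfl⟩
    exact ⟨g, hg, rfl⟩
  · rintro ⟨g, hg, rfl⟩
    exact ⟨_, ⟨g, hg, rfl⟩, rfl⟩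

theorem snd_image_FlagP12 : Prod.snd '' FlagP12 = FlagP2 := by
  ext L
  constructor
  · rintro ⟨F, ⟨g, hg, rfl⟩, rfl⟩
    exact ⟨g, hg, rfl⟩
  · rintro ⟨g, hg, rfl⟩
    exact ⟨_, ⟨g, hg, rfl⟩, rfl⟩

/-- The unipotent element of `G₂` that moves the base plane to the point of `K` with the given
rescaled coordinates. -/
def heis (b : Fin 5 → ℝ) (v : Fin 7 → ℝ) : Fin 7 → ℝ :=
  expNegZ (b 4) (expNegX (b 0) (expNegP (b 2) (expNegY (b 1) (expNegQ (b 3) v))))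

theorem isAut_heis (b : Fin 5 → ℝ) : IsAut (heis b) :=
  (isAut_expNegZ _).comp ((isAut_expNegX _).comp ((isAut_expNegP _).comp
    ((isAut_expNegY _).comp (isAut_expNegQ _))))

theorem heis_single_one (b : Fin 5 → ℝ) : heis b (Pi.single 1 1) = kA b := by
  ext i
  fin_cases i <;> simp [heis, expNegX, expNegY, expNegP, expNegQ, expNegZ, kA] <;> ring

theorem heis_single_six (b : Fin 5 → ℝ) : heis b (Pi.single 6 1) = kB b := by
  ext i
  fin_cases i <;> simp [heis, expNegX, expNegY, expNegP, expNegQ, expNegZ, kB] <;> ring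

theorem flagKhat_eq (n : Fin 6 → ℝ) : flagKhat n =
    (Submodule.span ℝ {kA (hat (dropLast n)) + n 5 • kB (hat (dropLast n))},
      Submodule.span ℝ {kA (hat (dropLast n)), kB (hat (dropLast n))}) := by
  rw [flagKhat, planeK_eq, vecK₁_eq, vecK₂_eq]

theorem flagKhat_mem (n : Fin 6 → ℝ) : flagKhat n ∈ FlagP12 := by
  have h := mem_FlagP12_of_isAut
    (f := fun v => heis (hat (dropLast n)) (expLevi (n 5) v))
    (v := kA (hat (dropLast n)) + n 5 • kB (hat (dropLast n))) (w := kB (hat (dropLast n)))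
    ((isAut_heis _).comp (isAut_expLevi _)) ?_ ?_
  · rw [flagKhat_eq]
    convert h using 2
    exact (span_pair_eq (a := 1) (b := n 5) (c := 0) (d := 1) (by simp) (by simp)
      (by simp)).symm
  · ext i
    fin_cases i <;> simp [heis, expNegX, expNegY, expNegP, expNegQ, expNegZ, expLevi, kA, kB]
      <;> ring
  · rw [← heis_single_six]
    congr 1
    ext i
    fin_cases i <;> simp [expLevi]

theorem planeK_mem (b : Fin 5 → ℝ) : planeK b ∈ FlagP2 := by
  rw [← snd_image_FlagP12]
  refine ⟨_, flagKhat_mem (Fin.snoc b 0), ?_⟩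
  simp only [flagKhat]
  congr 1
  ext i
  simp [dropLast]

/-- The rescaled coordinates of a plane through the point `m` of `M`. -/
def kOfM (m : Fin 5 → ℝ) : Fin 5 → ℝ := ![0, 2 * m 2, 3 * m 4, m 0, 6 * (m 0 * m 2 - m 1)]

theorem flagMhat_mem (m : Fin 6 → ℝ) : flagMhat m ∈ FlagP12 := by
  rw [flagMhat_eq]
  refine mem_FlagP12_of_isAut
    (f := fun v => heis (kOfM (dropLast m)) (expLevi (m 3) (weylM (m 5) v)))
    ((isAut_heis _).comp ((isAut_expLevi _).comp (isAut_weylM _))) ?_ ?_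
  · ext i
    fin_cases i <;> simp [heis, expNegX, expNegY, expNegP, expNegQ, expNegZ, expLevi, weylM, vecM,
      kOfM, dropLast] <;> ring
  · ext i
    fin_cases i <;> simp [heis, expNegX, expNegY, expNegP, expNegQ, expNegZ, expLevi, weylM, tanM,
      kOfM, dropLast] <;> ring

theorem lineM_mem (m : Fin 5 → ℝ) : lineM m ∈ FlagP1 := by
  rw [← fst_image_FlagP12]
  refine ⟨_, flagMhat_mem (Fin.snoc m 0), ?_⟩
  simp only [flagMhat]
  congr 1
  ext i
  simp [dropLast]

section normal

variable {𝔽 : Type*} [Field 𝔽]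

theorem span_singleton_eq_iff_of_one {v w : Fin 7 → 𝔽} (hv : v 1 = 1) (hw : w 1 = 1)
    (h : Submodule.span 𝔽 {v} = Submodule.span 𝔽 {w}) : v = w := by
  have hm : v ∈ Submodule.span 𝔽 {w} := h ▸ Submodule.mem_span_singleton_self v
  obtain ⟨c, rfl⟩ := Submodule.mem_span_singleton.1 hm
  have : c = 1 := by simpa [hw] using hv
  rw [this, one_smul]

theorem mem_span_pair_coords {v w u : Fin 7 → 𝔽} {i j : Fin 7} (hvi : v i = 1) (hvj : v j = 0)
    (hwi : w i = 0) (hwj : w j = 1) (h : u ∈ Submodule.span 𝔽 {v, w}) : u = u i • v + u j • w := by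
  obtain ⟨a, b, rfl⟩ := Submodule.mem_span_pair.1 h
  simp [hvi, hvj, hwi, hwj]

theorem span_pair_eq_iff_of_coords {v w v' w' : Fin 7 → 𝔽} {i j : Fin 7} (hvi : v i = 1)
    (hvj : v j = 0) (hwi : w i = 0) (hwj : w j = 1) (hvi' : v' i = 1)
    (hvj' : v' j = 0) (hwi' : w' i = 0) (hwj' : w' j = 1)
    (h : Submodule.span 𝔽 {v, w} = Submodule.span 𝔽 {v', w'}) : v = v' ∧ w = w' := by
  have h1 : v ∈ Submodule.span 𝔽 {v', w'} := h ▸ Submodule.subset_span (by simp)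
  have h2 : w ∈ Submodule.span 𝔽 {v', w'} := h ▸ Submodule.subset_span (by simp)
  have e1 := mem_span_pair_coords hvi' hvj' hwi' hwj' h1
  have e2 := mem_span_pair_coords hvi' hvj' hwi' hwj' h2
  rw [hvi, hvj, one_smul, zero_smul, add_zero] at e1
  rw [hwi, hwj, one_smul, zero_smul, zero_add] at e2
  exact ⟨e1, e2⟩

end normal

theorem vecM_injective {𝔽 : Type*} [Field 𝔽] [CharZero 𝔽] :
    Function.Injective (vecM (𝔽 := 𝔽)) := by
  intro m m' h
  have h0 := congrFun h 0
  have h2 := congrFun h 2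
  have h3 := congrFun h 3
  have h5 := congrFun h 5
  have h6 := congrFun h 6
  simp only [vecM, Matrix.cons_val] at h0 h2 h3 h5 h6
  rw [h5, h6] at h0 h3
  rw [h6] at h2
  have hp : m 2 = m' 2 := mul_left_cancel₀ (two_ne_zero' 𝔽) (by linear_combination h0)
  rw [hp] at h2 h3
  have hz : m 4 = m' 4 := mul_left_cancel₀ (three_ne_zero : (3 : 𝔽) ≠ 0) (by linear_combination -h2)
  have hy : m 1 = m' 1 := mul_left_cancel₀ (by norm_num : (6 : 𝔽) ≠ 0) (by linear_combination -h3)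
  ext i
  fin_cases i
  exacts [h5, hy, hp, h6, hz]

theorem vecM_one {𝔽 : Type*} [Field 𝔽] (m : Fin 5 → 𝔽) : vecM m 1 = 1 := rfl

theorem lineM_injective {𝔽 : Type*} [Field 𝔽] [CharZero 𝔽] :
    Function.Injective (lineM (𝔽 := 𝔽)) := fun m m' h =>
  vecM_injective (span_singleton_eq_iff_of_one (vecM_one m) (vecM_one m') h)

theorem kA_kB_injective {b b' : Fin 5 → ℝ} (h1 : kA b = kA b') (h2 : kB b = kB b') : b = b' := by
  have h10 := congrFun h1 0
  have h12 := congrFun h1 2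
  have h15 := congrFun h1 5
  have h24 := congrFun h2 4
  have h25 := congrFun h2 5
  simp only [kA, kB, Matrix.cons_val] at h10 h12 h15 h24 h25
  rw [h10, h15] at h24
  have h4 : b 4 = b' 4 := by linear_combination -h24
  ext i
  fin_cases i
  exacts [neg_injective h25, h10, neg_injective h12, h15, h4]

theorem hat_injective : Function.Injective hat := fun b b' h => by
  rw [← unhat_hat b, h, unhat_hat]

theorem planeK_injective : Function.Injective planeK := fun b b' h => by
  rw [planeK_eq, planeK_eq] at h
  obtain ⟨h1, h2⟩ := span_pair_eq_iff_of_coords (i := 1) (j := 6) rfl rfl rfl rfl rfl rfl rfl rfl h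
  exact hat_injective (kA_kB_injective h1 h2)

/-- The rescaled coordinates of the plane spanned by two vectors. -/
noncomputable def chartK (v w : Fin 7 → ℝ) : Fin 5 → ℝ :=
  let Δ := v 1 * w 6 - v 6 * w 1
  ![-(v 1 * w 5 - w 1 * v 5) / Δ, (w 6 * v 0 - v 6 * w 0) / Δ, -(w 6 * v 2 - v 6 * w 2) / Δ,
    (w 6 * v 5 - v 6 * w 5) / Δ,
    2 * ((w 6 * v 5 - v 6 * w 5) / Δ) * ((w 6 * v 0 - v 6 * w 0) / Δ)
      - (v 1 * w 4 - w 1 * v 4) / Δ]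

theorem span_eq_planeK {v w : Fin 7 → ℝ} (h : octCross v w = 0)
    (hd : v 1 * w 6 - v 6 * w 1 ≠ 0) :
    Submodule.span ℝ {v, w} = planeK (unhat (chartK v w)) := by
  set Δ := v 1 * w 6 - v 6 * w 1 with hΔ
  set f₁ := (w 6 / Δ) • v + (-v 6 / Δ) • w with hf₁
  set f₂ := (-w 1 / Δ) • v + (v 1 / Δ) • w with hf₂
  have hc : octCross f₁ f₂ = 0 := by
    have hvv : octCross v v = 0 := by
      ext i; fin_cases i <;> simp [octCross] <;> ring
    have hww : octCross w w = 0 := by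
      ext i; fin_cases i <;> simp [octCross] <;> ring
    simp only [hf₁, hf₂, octCross_add_left, octCross_add_right, octCross_smul_left,
      octCross_smul_right, hvv, hww, h, octCross_comm w v, smul_zero, neg_zero, add_zero]
  have h11 : f₁ 1 = 1 := by simp [hf₁]; field_simp; rw [hΔ]; ring
  have h16 : f₁ 6 = 0 := by simp [hf₁]; field_simp; ring
  have h21 : f₂ 1 = 0 := by simp [hf₂]; field_simp; ring
  have h26 : f₂ 6 = 1 := by simp [hf₂]; field_simp; rw [hΔ]; ring
  obtain ⟨e1, e2⟩ := eq_kA_kB hc h11 h16 h21 h26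
  have hb : ![-f₂ 5, f₁ 0, -f₁ 2, f₁ 5, 2 * f₁ 5 * f₁ 0 - f₂ 4] = chartK v w := by
    ext i
    fin_cases i <;> simp [chartK, hf₁, hf₂, ← hΔ] <;> field_simp <;> ring
  rw [hb] at e1 e2
  rw [planeK_eq, hat_unhat, ← e1, ← e2]
  refine (span_pair_eq hf₁ hf₂ ?_).symm
  have : w 6 / Δ * (v 1 / Δ) - -v 6 / Δ * (-w 1 / Δ) = 1 / Δ := by
    field_simp; rw [hΔ]; ring
  rw [this]
  exact one_div_ne_zero hd

theorem octCross_base : octCross (Pi.single 1 1 : Fin 7 → ℝ) (Pi.single 6 1) = 0 := by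
  ext i; fin_cases i <;> simp [octCross]

theorem octForm_base : octForm (Pi.single 1 1 : Fin 7 → ℝ) (Pi.single 1 1) = 0 := by
  simp [octForm]

/-- A flag in the orbit, by a basis with vanishing product. -/
theorem exists_basis_of_mem_FlagP12 {F : Submodule ℝ (Fin 7 → ℝ) × Submodule ℝ (Fin 7 → ℝ)}
    (hF : F ∈ FlagP12) : ∃ v w : Fin 7 → ℝ, F.1 = Submodule.span ℝ {v} ∧
      F.2 = Submodule.span ℝ {v, w} ∧ octCross v w = 0 ∧ octForm v v = 0 ∧
      ∀ a b : ℝ, a • v + b • w = 0 → a = 0 ∧ b = 0 := by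
  obtain ⟨g, hg, rfl⟩ := hF
  refine ⟨_, _, moved_span_singleton _ _, moved_span_pair _ _ _, ?_, ?_, ?_⟩
  · rw [← hg, octCross_base, Matrix.mulVec_zero]
  · rw [octForm_mulVec hg, octForm_base]
  · intro a b h
    rw [← Matrix.mulVec_smul, ← Matrix.mulVec_smul, ← Matrix.mulVec_add,
      ← Matrix.mulVec_zero (g : Matrix (Fin 7) (Fin 7) ℝ)] at h
    have h2 := mulVec_inj g h
    have h3 := congrFun h2 1
    have h4 := congrFun h2 6
    simp at h3 h4
    exact ⟨h3, h4⟩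

theorem exists_flag_of_mem_FlagP2 {P : Submodule ℝ (Fin 7 → ℝ)} (hP : P ∈ FlagP2) :
    ∃ L, (L, P) ∈ FlagP12 := by
  obtain ⟨g, hg, rfl⟩ := hP
  exact ⟨_, g, hg, rfl⟩

theorem exists_planeK_eq {P : Submodule ℝ (Fin 7 → ℝ)} (hP : P ∈ FlagP2)
    (h : ∀ v ∈ P, v 1 = 0 → v 6 = 0 → v = 0) : ∃ b, planeK b = P := by
  obtain ⟨L, hL⟩ := exists_flag_of_mem_FlagP2 hP
  obtain ⟨v, w, -, h2, hc, -, hi⟩ := exists_basis_of_mem_FlagP12 hL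
  simp only at h2
  subst h2
  exact ⟨_, (span_eq_planeK hc (det_ne_zero_of_coords h hi)).symm⟩

theorem exists_lineM_eq {L : Submodule ℝ (Fin 7 → ℝ)} (hL : L ∈ FlagP1)
    (h : ∃ v ∈ L, v 1 ≠ 0) : ∃ m, lineM m = L := by
  obtain ⟨g, hg, rfl⟩ := hL
  set v := (g : Matrix (Fin 7) (Fin 7) ℝ).mulVec (Pi.single 1 1) with hv
  have e : moved (g : Matrix (Fin 7) (Fin 7) ℝ) baseLine = Submodule.span ℝ {v} :=
    moved_span_singleton _ _
  rw [e] at h ⊢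
  obtain ⟨u, hu, hu1⟩ := h
  obtain ⟨c, rfl⟩ := Submodule.mem_span_singleton.1 hu
  have hv1 : v 1 ≠ 0 := fun h0 => hu1 (by simp [h0])
  have hN : octForm v v = 0 := by rw [hv, octForm_mulVec hg, octForm_base]
  obtain ⟨m, hm⟩ : ∃ m, (v 1)⁻¹ • v = vecM m := ⟨_, eq_vecM
    (by rw [octForm_smul_left, octForm_smul_right, hN]; simp) (by simp [hv1])⟩
  refine ⟨m, ?_⟩
  rw [lineM, ← hm]
  exact Submodule.span_singleton_smul_eq (IsUnit.mk0 _ (inv_ne_zero hv1)) v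

theorem bijOn_lineM : BijOn (lineM (𝔽 := ℝ)) univ {L | L ∈ FlagP1 ∧ ∃ v ∈ L, v 1 ≠ 0} := by
  refine ⟨fun m _ => ⟨lineM_mem m, vecM m, Submodule.mem_span_singleton_self _, ?_⟩,
    lineM_injective.injOn, fun L hL => ?_⟩
  · rw [vecM_one]; exact one_ne_zero
  · obtain ⟨m, hm⟩ := exists_lineM_eq hL.1 hL.2
    exact ⟨m, mem_univ _, hm⟩

theorem span_kA_kB_coords {b : Fin 5 → ℝ} {v : Fin 7 → ℝ}
    (hv : v ∈ Submodule.span ℝ {kA b, kB b}) (h1 : v 1 = 0) (h6 : v 6 = 0) : v = 0 := by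
  have h := mem_span_pair_coords (i := 1) (j := 6) rfl rfl rfl rfl hv
  rw [h, h1, h6, zero_smul, zero_smul, add_zero]

theorem bijOn_planeK :
    BijOn planeK univ {P | P ∈ FlagP2 ∧ ∀ v ∈ P, v 1 = 0 → v 6 = 0 → v = 0} := by
  refine ⟨fun b _ => ⟨planeK_mem b, fun v hv h1 h6 => ?_⟩, planeK_injective.injOn, fun P hP => ?_⟩
  · rw [planeK_eq] at hv
    exact span_kA_kB_coords hv h1 h6
  · obtain ⟨b, hb⟩ := exists_planeK_eq hP.1 hP.2
    exact ⟨b, mem_univ _, hb⟩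

theorem eq_of_dropLast {𝔽 : Type*} {m m' : Fin 6 → 𝔽} (h : dropLast m = dropLast m')
    (h5 : m 5 = m' 5) : m = m' := by
  ext i
  refine Fin.lastCases h5 (fun j => ?_) i
  exact congrFun h j

theorem bijOn_flagMhat : BijOn flagMhat univ {F | F ∈ FlagP12 ∧ (∃ v ∈ F.1, v 1 ≠ 0) ∧
    ∀ v ∈ F.2, v 1 = 0 → v 5 = 0 → v = 0} := by
  -- the second basis vector is normalized by its coordinates `1` and `5`
  have key : ∀ (m : Fin 5 → ℝ) (r : ℝ), Submodule.span ℝ {vecM m, tanM m r} =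
      Submodule.span ℝ {vecM m - m 0 • tanM m r, tanM m r} := fun m r =>
    span_pair_eq (a := 1) (b := m 0) (c := 0) (d := 1) (by simp) (by simp) (by simp)
  refine ⟨fun m _ => ⟨flagMhat_mem m, ?_, ?_⟩, fun m _ m' _ h => ?_, fun F hF => ?_⟩
  · rw [flagMhat_eq]
    exact ⟨_, Submodule.mem_span_singleton_self _, by rw [vecM_one]; exact one_ne_zero⟩
  · rw [flagMhat_eq]
    intro v hv h1 h5
    simp only [key] at hv
    have h := mem_span_pair_coords (i := 1) (j := 5) (by simp [vecM, tanM]) (by simp [vecM, tanM])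
      (by simp [tanM]) (by simp [tanM]) hv
    rw [h, h1, h5, zero_smul, zero_smul, add_zero]
  · rw [flagMhat_eq, flagMhat_eq, Prod.mk.injEq] at h
    have hm : dropLast m = dropLast m' := lineM_injective h.1
    refine eq_of_dropLast hm ?_
    have h2 := h.2
    rw [hm, key, key] at h2
    have h3 := (span_pair_eq_iff_of_coords (i := 1) (j := 5) (by simp [vecM, tanM])
      (by simp [vecM, tanM]) (by simp [tanM]) (by simp [tanM]) (by simp [vecM, tanM])
      (by simp [vecM, tanM]) (by simp [tanM]) (by simp [tanM]) h2).2
    exact congrFun h3 6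
  · obtain ⟨hF, hL, hP⟩ := hF
    have hL1 : F.1 ∈ FlagP1 := by rw [← fst_image_FlagP12]; exact ⟨F, hF, rfl⟩
    obtain ⟨m, hm⟩ := exists_lineM_eq hL1 hL
    obtain ⟨v, w, h1, h2, hc, -, hi⟩ := exists_basis_of_mem_FlagP12 hF
    rw [h2] at hP
    have hd := det_ne_zero_of_coords hP hi
    have hv : vecM m ∈ Submodule.span ℝ {v} := by
      rw [← h1, ← hm]; exact Submodule.mem_span_singleton_self _
    obtain ⟨c, hcv⟩ := Submodule.mem_span_singleton.1 hv
    have hc0 : c ≠ 0 := by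
      rintro rfl
      have := congrFun hcv 1
      simp [vecM_one] at this
    have hcv1 : c * v 1 = 1 := by simpa [vecM_one] using congrFun hcv 1
    have hv1 : v 1 ≠ 0 := right_ne_zero_of_mul_eq_one hcv1
    set Δ := v 1 * w 5 - v 5 * w 1 with hΔ
    set u := (-w 1 / Δ) • v + (v 1 / Δ) • w with hu
    have hvv : octCross v v = 0 := by
      ext i; fin_cases i <;> simp [octCross] <;> ring
    have hcu : octCross (vecM m) u = 0 := by
      rw [← hcv, hu]
      simp only [octCross_add_right, octCross_smul_left, octCross_smul_right, hvv, hc, smul_zero,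
        add_zero]
    have hut := eq_tanM hcu (by simp [hu]; field_simp; ring)
      (by simp [hu]; field_simp; rw [hΔ]; ring)
    refine ⟨Fin.snoc m (u 6), mem_univ _, ?_⟩
    have e1 : dropLast (Fin.snoc m (u 6) : Fin 6 → ℝ) = m := by ext i; simp [dropLast]
    have e2 : (Fin.snoc m (u 6) : Fin 6 → ℝ) 5 = u 6 := Fin.snoc_last (α := fun _ => ℝ) _ _
    rw [flagMhat_eq, e1, e2, ← hut, hm]
    refine Prod.ext rfl ?_
    rw [h2]
    refine span_pair_eq (a := c) (b := 0) (by rw [hcv]; simp) hu ?_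
    rw [zero_mul, sub_zero]
    exact mul_ne_zero hc0 (div_ne_zero hv1 hd)

theorem bijOn_flagKhat : BijOn flagKhat univ {F | F ∈ FlagP12 ∧ (∃ v ∈ F.1, v 1 ≠ 0) ∧
    ∀ v ∈ F.2, v 1 = 0 → v 6 = 0 → v = 0} := by
  refine ⟨fun n _ => ⟨flagKhat_mem n, ?_, ?_⟩, fun n _ n' _ h => ?_, fun F hF => ?_⟩
  · rw [flagKhat_eq]
    exact ⟨_, Submodule.mem_span_singleton_self _, by simp [kA, kB]⟩
  · rw [flagKhat_eq]
    exact fun v hv => span_kA_kB_coords hv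
  · have hp : planeK (dropLast n) = planeK (dropLast n') := (Prod.mk.injEq _ _ _ _ ▸ h).2
    have hm := planeK_injective hp
    refine eq_of_dropLast hm ?_
    rw [flagKhat_eq, flagKhat_eq, Prod.mk.injEq, hm] at h
    have h2 := span_singleton_eq_iff_of_one (by simp [kA, kB]) (by simp [kA, kB]) h.1
    simpa [kA, kB] using congrFun h2 6
  · obtain ⟨hF, ⟨u, huL, hu1⟩, hP⟩ := hF
    have hL1 : F.2 ∈ FlagP2 := by rw [← snd_image_FlagP12]; exact ⟨F, hF, rfl⟩
    obtain ⟨b, hb⟩ := exists_planeK_eq hL1 hP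
    obtain ⟨v, w, h1, h2, -, -, -⟩ := exists_basis_of_mem_FlagP12 hF
    rw [h1] at huL
    obtain ⟨c, rfl⟩ := Submodule.mem_span_singleton.1 huL
    have hv1 : v 1 ≠ 0 := fun h0 => hu1 (by simp [h0])
    have hv : v ∈ Submodule.span ℝ {kA (hat b), kB (hat b)} := by
      rw [← planeK_eq, hb, h2]; exact Submodule.subset_span (by simp)
    have hv2 := mem_span_pair_coords (i := 1) (j := 6) rfl rfl rfl rfl hv
    refine ⟨Fin.snoc b (v 6 / v 1), mem_univ _, ?_⟩
    have e1 : dropLast (Fin.snoc b (v 6 / v 1) : Fin 6 → ℝ) = b := by ext i; simp [dropLast]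
    have e2 : (Fin.snoc b (v 6 / v 1) : Fin 6 → ℝ) 5 = v 6 / v 1 :=
      Fin.snoc_last (α := fun _ => ℝ) _ _
    refine Prod.ext ?_ ?_
    · rw [flagKhat_eq, e1, e2, h1]
      rw [← Submodule.span_singleton_smul_eq (IsUnit.mk0 _ (inv_ne_zero hv1)) v]
      have hvn : kA (hat b) + (v 6 / v 1) • kB (hat b) = (v 1)⁻¹ • v := by
        ext i
        have h3 := congrFun hv2 i
        simp only [Pi.add_apply, Pi.smul_apply, smul_eq_mul] at h3 ⊢
        rw [h3]
        field_simp
      rw [hvn]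
    · rw [flagKhat, e1, hb]

/-! ### The transformation `φ` -/

/-- The inverse of `φ`. -/
noncomputable def phiInv (n : Fin 6 → ℝ) : Fin 6 → ℝ :=
  ![toM n 0, toM n 1, toM n 2, toM n 3, toM n 4, -1 / n 0]

theorem toM_phi {m : Fin 6 → ℝ} (hr : m 5 ≠ 0) : toM (phi m) = dropLast m := by
  have h0 := sqrt3_ne
  ext i
  fin_cases i <;> simp [toM, phi, dropLast] <;> field_simp <;> ring

theorem phiInv_phi {m : Fin 6 → ℝ} (hr : m 5 ≠ 0) : phiInv (phi m) = m := by
  refine eq_of_dropLast ?_ ?_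
  · rw [← toM_phi hr]
    ext i
    fin_cases i <;> rfl
  · simp [phiInv, phi]

theorem phi_phiInv (n : Fin 6 → ℝ) : phi (phiInv n) = n := by
  have h0 := sqrt3_ne
  ext i
  fin_cases i <;> simp [toM, phi, phiInv] <;> field_simp <;> ring

theorem contDiffOn_phi : ContDiffOn ℝ ∞ phi {m | m 5 ≠ 0} := by
  rw [contDiffOn_pi]
  intro i
  have hr : ContDiffOn ℝ ∞ (fun m : Fin 6 → ℝ => (m 5)⁻¹) {m | m 5 ≠ 0} :=
    ContDiffOn.inv (by fun_prop) fun m hm => hm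
  fin_cases i <;> simp only [phi, div_eq_mul_inv, ← inv_pow, Fin.zero_eta, Fin.mk_one,
    Fin.reduceFinMk, Matrix.cons_val] <;> fun_prop

theorem contDiffOn_phiInv : ContDiffOn ℝ ∞ phiInv {n | n 0 ≠ 0} := by
  rw [contDiffOn_pi]
  intro i
  have hr : ContDiffOn ℝ ∞ (fun m : Fin 6 → ℝ => (m 0)⁻¹) {m | m 0 ≠ 0} :=
    ContDiffOn.inv (by fun_prop) fun m hm => hm
  fin_cases i <;> simp only [phiInv, toM, div_eq_mul_inv, Fin.zero_eta, Fin.mk_one,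
    Fin.reduceFinMk, Matrix.cons_val] <;> fun_prop

theorem bijOn_phi : BijOn phi {m | m 5 ≠ 0} {n | n 0 ≠ 0} := by
  have h1 : MapsTo phi {m | m 5 ≠ 0} {n | n 0 ≠ 0} := fun m (hm : m 5 ≠ 0) => by
    simp [phi, hm]
  have h2 : MapsTo phiInv {n | n 0 ≠ 0} {m | m 5 ≠ 0} := fun m (hm : m 0 ≠ 0) => by
    simp [phiInv, hm]
  exact InvOn.bijOn (f' := phiInv) ⟨fun m hm => phiInv_phi hm, fun n _ => phi_phiInv n⟩ h1 h2

/-- The differential of `φ`. -/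
noncomputable def phid (m v : Fin 6 → ℝ) : Fin 6 → ℝ :=
  ![v 5 / m 5 ^ 2, √3 * (2 * v 2 - 2 * m 3 * v 3 / m 5 + m 3 ^ 2 * v 5 / m 5 ^ 2),
    3 * v 4 - 3 * m 3 ^ 2 * v 3 / m 5 + m 3 ^ 3 * v 5 / m 5 ^ 2,
    √3 * (v 0 - v 3 / m 5 + m 3 * v 5 / m 5 ^ 2),
    6 * (v 0 * m 2 + m 0 * v 2 - v 1) + 3 * v 5 / m 5 ^ 2 * (m 4 + m 0 * m 3 ^ 2)
      - 3 / m 5 * (v 4 + v 0 * m 3 ^ 2 + 2 * m 0 * m 3 * v 3)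
      + 6 * m 3 ^ 2 * v 3 / m 5 ^ 2 - 4 * m 3 ^ 3 * v 5 / m 5 ^ 3, v 3]

theorem hasDerivAt_phi {c : ℝ → Fin 6 → ℝ} {c' : Fin 6 → ℝ} {t : ℝ} (h : HasDerivAt c c' t)
    (hr : c t 5 ≠ 0) : HasDerivAt (fun s => phi (c s)) (phid (c t) c') t := by
  rw [hasDerivAt_pi] at h ⊢
  have h0 := h 0
  have h1 := h 1
  have h2 := h 2
  have h3 := h 3
  have h4 := h 4
  have h5 := h 5
  have hi := h5.inv hr
  intro i
  fin_cases i
  · exact ((hi.const_mul (-1)).congr_deriv (by simp [phid]; field_simp)).congr_of_eventuallyEq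
      (Eventually.of_forall fun s => by simp [phi, div_eq_mul_inv])
  · exact ((((h2.const_mul 2).sub ((h3.pow 2).mul hi)).const_mul (√3)).congr_deriv
      (by simp [phid]; field_simp; ring)).congr_of_eventuallyEq
      (Eventually.of_forall fun s => by simp [phi, div_eq_mul_inv])
  · exact (((h4.const_mul 3).sub ((h3.pow 3).mul hi)).congr_deriv
      (by simp [phid]; field_simp; ring)).congr_of_eventuallyEq
      (Eventually.of_forall fun s => by simp [phi, div_eq_mul_inv])
  · exact (((h0.sub (h3.mul hi)).const_mul (√3)).congr_deriv
      (by simp [phid]; field_simp; ring)).congr_of_eventuallyEq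
      (Eventually.of_forall fun s => by simp [phi, div_eq_mul_inv])
  · exact ((((((h0.mul h2).sub h1).const_mul 6).sub ((hi.const_mul 3).mul
      (h4.add (h0.mul (h3.pow 2))))).add (((h3.pow 3).const_mul 2).mul (hi.pow 2))).congr_deriv
      (by simp [phid]; field_simp; ring)).congr_of_eventuallyEq
      (Eventually.of_forall fun s => by simp [phi, div_eq_mul_inv])
  · exact h3

theorem fderiv_phi {m : Fin 6 → ℝ} (hr : m 5 ≠ 0) (v : Fin 6 → ℝ) :
    fderiv ℝ phi m v = phid m v := by
  have ho : IsOpen {m : Fin 6 → ℝ | m 5 ≠ 0} := isOpen_ne_fun (by fun_prop) continuous_const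
  have hd : DifferentiableAt ℝ phi m :=
    (contDiffOn_phi.contDiffAt (ho.mem_nhds hr)).differentiableAt (by simp)
  have h : HasDerivAt (fun t : ℝ => m + t • v) v 0 := by
    simpa using ((hasDerivAt_id (0 : ℝ)).smul_const v).const_add m
  have h1 := hasDerivAt_phi h (by simpa using hr)
  simp only [zero_smul, add_zero] at h1
  rw [← hd.lineDeriv_eq_fderiv]
  exact h1.deriv

theorem fderiv_phi_horMhat {m : Fin 6 → ℝ} (hr : m 5 ≠ 0) :
    fderiv ℝ phi m (horMhat m) = m 5 • vert := by
  rw [fderiv_phi hr]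
  ext i
  fin_cases i <;> simp [phid, horMhat, vert] <;> field_simp <;> ring

theorem fderiv_phi_vert {m : Fin 6 → ℝ} (hr : m 5 ≠ 0) :
    fderiv ℝ phi m vert = (1 / m 5 ^ 2) • horKhat (phi m) := by
  have h3 := sqrt3_sq
  rw [fderiv_phi hr]
  ext i
  fin_cases i <;> simp [phid, horKhat, vert, phi] <;> field_simp
  linear_combination (-(m 3 ^ 2 * (m 0 * m 5 - m 3))) * h3

section toM

variable {𝔽 : Type*} [Field 𝔽] [CharZero 𝔽]

/-- The point of `M` of the flag of the plane with rescaled coordinates `b` and the line with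
parameter `r`. -/
def toMhat (b : Fin 5 → 𝔽) (r : 𝔽) : Fin 5 → 𝔽 :=
  let x := b 3 - r * b 0
  let p := (b 1 - r ^ 2 * b 0) / 2
  let z := (b 2 - r ^ 3 * b 0) / 3
  ![x, x * p + (3 * b 0 * (z + x * r ^ 2) + 2 * r ^ 3 * b 0 ^ 2 - b 4) / 6, p, r, z]

theorem vecM_toMhat (b : Fin 5 → 𝔽) (r : 𝔽) : vecM (toMhat b r) = kA b + r • kB b := by
  ext i
  fin_cases i <;> simp [vecM, toMhat, kA, kB] <;> field_simp <;> ring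

end toM

theorem toM_eq (n : Fin 6 → ℝ) : toM n = toMhat (hat (dropLast n)) (n 5) := by
  ext i
  fin_cases i <;> simp [toM, toMhat, hat, dropLast]

theorem vecM_toM (n : Fin 6 → ℝ) :
    vecM (toM n) = vecK₁ (dropLast n) + n 5 • vecK₂ (dropLast n) := by
  rw [toM_eq, vecM_toMhat, vecK₁_eq, vecK₂_eq]

theorem flagKhat_phi {m : Fin 6 → ℝ} (hr : m 5 ≠ 0) : flagKhat (phi m) = flagMhat m := by
  rw [flagMhat_eq, flagKhat, ← vecM_toM, toM_phi hr]
  refine Prod.ext rfl ?_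
  simp only
  rw [planeK_eq]
  have h5 : phi m 5 = m 3 := rfl
  have h1 : vecM (dropLast m) = (1 : ℝ) • kA (hat (dropLast (phi m))) +
      m 3 • kB (hat (dropLast (phi m))) := by
    rw [← toM_phi hr, vecM_toM, vecK₁_eq, vecK₂_eq, one_smul, h5]
  have h2 : tanM (dropLast m) (m 5) = (0 : ℝ) • kA (hat (dropLast (phi m))) +
      m 5 • kB (hat (dropLast (phi m))) := by
    have h0 := sqrt3_ne
    ext i
    fin_cases i <;> simp [tanM, kB, hat, phi, dropLast] <;> field_simp <;> ring
  exact (span_pair_eq h1 h2 (by simpa using hr)).symm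

theorem diffeomorphism_phi : BijOn phi {m | m 5 ≠ 0} {n | n 0 ≠ 0} ∧
      ContDiffOn ℝ ∞ phi {m | m 5 ≠ 0} ∧
      (∃ ψ : (Fin 6 → ℝ) → (Fin 6 → ℝ), ContDiffOn ℝ ∞ ψ {n | n 0 ≠ 0} ∧
        InvOn ψ phi {m | m 5 ≠ 0} {n | n 0 ≠ 0}) ∧
      ∀ m : Fin 6 → ℝ, m 5 ≠ 0 →
        flagKhat (phi m) = flagMhat m ∧ toM (phi m) = dropLast m ∧
        (∃ c : ℝ, c ≠ 0 ∧ fderiv ℝ phi m (horMhat m) = c • vert) ∧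
        (∃ c : ℝ, c ≠ 0 ∧ fderiv ℝ phi m vert = c • horKhat (phi m)) :=
  ⟨bijOn_phi, contDiffOn_phi, ⟨phiInv, contDiffOn_phiInv, fun _ hm => phiInv_phi hm,
    fun n _ => phi_phiInv n⟩, fun m hm => ⟨flagKhat_phi hm, toM_phi hm,
    ⟨m 5, hm, fderiv_phi_horMhat hm⟩, ⟨1 / m 5 ^ 2, one_div_ne_zero (pow_ne_zero 2 hm),
      fderiv_phi_vert hm⟩⟩⟩

/-! ### Polynomials on jet spaces -/

namespace JetPoly

variable {𝔽 : Type*} [RCLike 𝔽]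

theorem evalAt_add (P Q : JetPoly) (θ : Jet 𝔽 4) :
    (P + Q).evalAt θ = P.evalAt θ + Q.evalAt θ := map_add _ _ _

theorem evalAt_sub (P Q : JetPoly) (θ : Jet 𝔽 4) :
    (P - Q).evalAt θ = P.evalAt θ - Q.evalAt θ := map_sub _ _ _

theorem evalAt_mul (P Q : JetPoly) (θ : Jet 𝔽 4) :
    (P * Q).evalAt θ = P.evalAt θ * Q.evalAt θ := map_mul _ _ _

theorem evalAt_pow (P : JetPoly) (k : ℕ) (θ : Jet 𝔽 4) :
    (P ^ k).evalAt θ = P.evalAt θ ^ k := map_pow _ _ _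

theorem evalAt_zero (θ : Jet 𝔽 4) : (0 : JetPoly).evalAt θ = 0 := map_zero _

theorem evalAt_one (θ : Jet 𝔽 4) : (1 : JetPoly).evalAt θ = 1 := map_one _

theorem evalAt_C (c : ℝ) (θ : Jet 𝔽 4) :
    JetPoly.evalAt (MvPolynomial.C c) θ = algebraMap ℝ 𝔽 c := MvPolynomial.aeval_C _ _

theorem evalAt_X_none (θ : Jet 𝔽 4) : JetPoly.evalAt (MvPolynomial.X none) θ = θ.1 :=
  MvPolynomial.aeval_X _ _

theorem evalAt_X_some (k : ℕ) (i : Fin 4) (θ : Jet 𝔽 4) :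
    JetPoly.evalAt (MvPolynomial.X (some (k, i))) θ = θ.2 k i := MvPolynomial.aeval_X _ _

/-- The formal total derivative of polynomials in the jet coordinates. -/
noncomputable def D : Derivation ℝ JetPoly JetPoly :=
  MvPolynomial.mkDerivation ℝ
    (fun v => Option.elim v 1 (fun ki => MvPolynomial.X (some (ki.1 + 1, ki.2))))

theorem D_X_none : D (MvPolynomial.X none) = 1 := MvPolynomial.mkDerivation_X _ _ _

theorem D_X_some (k : ℕ) (i : Fin 4) :
    D (MvPolynomial.X (some (k, i))) = MvPolynomial.X (some (k + 1, i)) :=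
  MvPolynomial.mkDerivation_X _ _ _

end JetPoly

/-- At the parameter `t` the curve `J` of jets moves with velocity `μ` along the total derivative,
as the curve of jets of a parametrized curve does. -/
def HolonomicAt {𝔽 : Type*} [RCLike 𝔽] (J : ℝ → Jet 𝔽 4) (μ : 𝔽) (t : ℝ) : Prop :=
  HasDerivAt (fun s => (J s).1) μ t ∧
    ∀ k i, HasDerivAt (fun s => (J s).2 k i) (μ * (J t).2 (k + 1) i) t

theorem HolonomicAt.continuousAt {𝔽 : Type*} [RCLike 𝔽] {J : ℝ → Jet 𝔽 4} {μ : 𝔽} {t : ℝ}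
    (h : HolonomicAt J μ t) : ContinuousAt J t :=
  ContinuousAt.prodMk h.1.continuousAt
    (continuousAt_pi.2 fun k => continuousAt_pi.2 fun i => (h.2 k i).continuousAt)

theorem HolonomicAt.hasDerivAt_evalAt {𝔽 : Type*} [RCLike 𝔽] {J : ℝ → Jet 𝔽 4} {μ : 𝔽} {t : ℝ}
    (h : HolonomicAt J μ t) (P : JetPoly) :
    HasDerivAt (fun s => P.evalAt (J s)) (μ * (JetPoly.D P).evalAt (J t)) t := by
  induction P using MvPolynomial.induction_on with
  | C c =>
    simp only [JetPoly.evalAt_C]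
    have : JetPoly.D (MvPolynomial.C c) = 0 := JetPoly.D.map_algebraMap c
    rw [this, JetPoly.evalAt_zero, mul_zero]
    exact hasDerivAt_const _ _
  | add p q hp hq =>
    simp only [JetPoly.evalAt_add, map_add, mul_add]
    exact hp.add hq
  | mul_X p v hp =>
    simp only [JetPoly.evalAt_mul, Derivation.leibniz, smul_eq_mul, JetPoly.evalAt_add]
    rcases v with _ | ⟨k, i⟩
    · simp only [JetPoly.evalAt_X_none, JetPoly.D_X_none, JetPoly.evalAt_one]
      exact (hp.mul h.1).congr_deriv (by ring)
    · simp only [JetPoly.evalAt_X_some, JetPoly.D_X_some]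
      exact (hp.mul (h.2 k i)).congr_deriv (by ring)

/-- The line through a jet along which the total derivative is taken. -/
theorem holonomicAt_line (θ : Jet ℝ 4) :
    HolonomicAt (fun s : ℝ => θ + s • (((1 : ℝ), fun k => θ.2 (k + 1)) : Jet ℝ 4)) 1 0 := by
  constructor
  · simpa using (hasDerivAt_id (0 : ℝ)).const_add θ.1
  · intro k i
    have h := ((hasDerivAt_id (0 : ℝ)).mul_const (θ.2 (k + 1) i)).const_add (θ.2 k i)
    simpa using h

theorem holonomicAt_jetOf {γ : ℝ → Fin 4 → ℝ} {t : ℝ} (h : ContDiffAt ℝ ∞ γ t) :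
    HolonomicAt (fun s => jetOf γ s) 1 t := by
  refine ⟨hasDerivAt_id t, fun k i => ?_⟩
  have h1 : DifferentiableAt ℝ (iteratedDeriv k γ) t := by
    rw [← differentiableWithinAt_univ, ← iteratedDerivWithin_univ]
    exact (h.contDiffWithinAt (s := univ)).differentiableWithinAt_iteratedDerivWithin
      (by exact_mod_cast WithTop.coe_lt_top _) (by simp)
  have h2 := hasDerivAt_pi.1 h1.hasDerivAt i
  simpa [jetOf, iteratedDeriv_succ] using h2

theorem continuous_evalAt {𝔽 : Type*} [RCLike 𝔽] (P : JetPoly) :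
    Continuous (fun θ : Jet 𝔽 4 => P.evalAt θ) := by
  induction P using MvPolynomial.induction_on with
  | C c => simp only [JetPoly.evalAt_C]; exact continuous_const
  | add p q hp hq => simp only [JetPoly.evalAt_add]; exact hp.add hq
  | mul_X p v hp =>
    simp only [JetPoly.evalAt_mul]
    refine hp.mul ?_
    rcases v with _ | ⟨k, i⟩
    · exact (continuous_fst : Continuous fun θ : Jet 𝔽 4 => θ.1).congr
        fun θ => (JetPoly.evalAt_X_none θ).symm
    · exact (by fun_prop : Continuous fun θ : Jet 𝔽 4 => θ.2 k i).congr
        fun θ => (JetPoly.evalAt_X_some k i θ).symm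

/-! ### The order of a polynomial -/

/-- The variables of order at most `k`. -/
def jetVars (k : ℕ) : Set (Option (ℕ × Fin 4)) := {v | ∀ j i, v = some (j, i) → j ≤ k}

theorem orderLE_iff {k : ℕ} {P : JetPoly} :
    P.OrderLE k ↔ P ∈ MvPolynomial.supported ℝ (jetVars k) := by
  rw [MvPolynomial.mem_supported]
  constructor
  · rintro h v hv j i rfl
    exact h j i hv
  · intro h j i hv
    exact h hv j i rfl

namespace JetPoly.OrderLE

variable {k l : ℕ} {P Q : JetPoly}

theorem mono (h : P.OrderLE k) (hkl : k ≤ l) : P.OrderLE l := fun j i hv => (h j i hv).trans hkl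

theorem add (hP : P.OrderLE k) (hQ : Q.OrderLE k) : (P + Q).OrderLE k := by
  rw [orderLE_iff] at *; exact add_mem hP hQ

theorem sub (hP : P.OrderLE k) (hQ : Q.OrderLE k) : (P - Q).OrderLE k := by
  rw [orderLE_iff] at *; exact sub_mem hP hQ

theorem mul (hP : P.OrderLE k) (hQ : Q.OrderLE k) : (P * Q).OrderLE k := by
  rw [orderLE_iff] at *; exact mul_mem hP hQ

theorem C (c : ℝ) : JetPoly.OrderLE k (MvPolynomial.C c) := by
  rw [orderLE_iff]; exact Subalgebra.algebraMap_mem _ c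

theorem one : JetPoly.OrderLE k 1 := by
  rw [orderLE_iff]; exact one_mem _

theorem X_none : JetPoly.OrderLE k (MvPolynomial.X none) := by
  rw [orderLE_iff]
  exact Algebra.subset_adjoin ⟨none, ⟨fun _ _ h => (Option.some_ne_none _ h.symm).elim, rfl⟩⟩

theorem X_some {j : ℕ} (hj : j ≤ k) (i : Fin 4) :
    JetPoly.OrderLE k (MvPolynomial.X (some (j, i))) := by
  rw [orderLE_iff]
  refine Algebra.subset_adjoin ⟨some (j, i), fun _ _ h => ?_, rfl⟩
  cases h
  exact hj

/-- Induction over the polynomials of bounded order. -/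
theorem induction {k : ℕ} {p : JetPoly → Prop} (hC : ∀ c, p (MvPolynomial.C c))
    (hx : p (MvPolynomial.X none)) (hX : ∀ j ≤ k, ∀ i, p (MvPolynomial.X (some (j, i))))
    (hadd : ∀ P Q, p P → p Q → p (P + Q)) (hmul : ∀ P Q, p P → p Q → p (P * Q))
    {P : JetPoly} (hP : P.OrderLE k) : p P := by
  rw [orderLE_iff] at hP
  refine Algebra.adjoin_induction (p := fun P _ => p P) ?_ hC
    (fun P Q _ _ => hadd P Q) (fun P Q _ _ => hmul P Q) hP
  rintro _ ⟨v, hv, rfl⟩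
  rcases v with _ | ⟨j, i⟩
  · exact hx
  · exact hX j (hv j i rfl) i

theorem D (hP : P.OrderLE k) : (JetPoly.D P).OrderLE (k + 1) := by
  suffices h : P.OrderLE (k + 1) ∧ (JetPoly.D P).OrderLE (k + 1) from h.2
  refine induction (k := k) (p := fun P => P.OrderLE (k + 1) ∧ (JetPoly.D P).OrderLE (k + 1))
    ?_ ?_ ?_ ?_ ?_ hP
  · intro c
    refine ⟨C c, ?_⟩
    have : JetPoly.D (MvPolynomial.C c) = 0 := JetPoly.D.map_algebraMap c
    rw [this, ← map_zero MvPolynomial.C]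
    exact C 0
  · rw [JetPoly.D_X_none]; exact ⟨X_none, one⟩
  · intro j hj i
    rw [JetPoly.D_X_some]
    exact ⟨X_some (by omega) i, X_some (by omega) i⟩
  · rintro P Q ⟨h1, h2⟩ ⟨h3, h4⟩
    rw [map_add]
    exact ⟨h1.add h3, h2.add h4⟩
  · rintro P Q ⟨h1, h2⟩ ⟨h3, h4⟩
    rw [Derivation.leibniz, smul_eq_mul, smul_eq_mul]
    exact ⟨h1.mul h3, (h1.mul h4).add (h3.mul h2)⟩

end JetPoly.OrderLE

/-! ### Density of the non-vanishing sets -/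

theorem JetPoly.evalAt_toComplex (P : JetPoly) (θ : Jet ℝ 4) :
    P.evalAt θ.toComplex = ((P.evalAt θ : ℝ) : ℂ) := by
  induction P using MvPolynomial.induction_on with
  | C c => simp [JetPoly.evalAt_C]
  | add p q hp hq => simp only [JetPoly.evalAt_add, hp, hq]; push_cast; rfl
  | mul_X p v hp =>
    simp only [JetPoly.evalAt_mul, hp]
    rcases v with _ | ⟨k, i⟩
    · simp [JetPoly.evalAt_X_none, Jet.toComplex]
    · simp [JetPoly.evalAt_X_some, Jet.toComplex]

/-- A polynomial that is non-zero at one jet is non-zero on a dense set of jets: restrict it to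
lines. -/
theorem dense_evalAt_ne_zero {P : JetPoly} {θ₀ : Jet ℝ 4} (h : P.evalAt θ₀ ≠ 0) :
    Dense {θ : Jet ℝ 4 | P.evalAt θ ≠ 0} := by
  intro θ
  let L : ℝ → Jet ℝ 4 := fun t => θ + t • (θ₀ - θ)
  have hL : Continuous L := by fun_prop
  -- the restriction to the line is a polynomial in one variable
  obtain ⟨p, hp⟩ : ∃ p : Polynomial ℝ, ∀ t, P.evalAt (L t) = p.eval t := by
    clear h
    induction P using MvPolynomial.induction_on with
    | C c => exact ⟨Polynomial.C c, fun t => by simp [JetPoly.evalAt_C]⟩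
    | add p q hp hq =>
      obtain ⟨a, ha⟩ := hp
      obtain ⟨b, hb⟩ := hq
      exact ⟨a + b, fun t => by rw [JetPoly.evalAt_add, ha, hb, Polynomial.eval_add]⟩
    | mul_X p v hp =>
      obtain ⟨a, ha⟩ := hp
      rcases v with _ | ⟨k, i⟩
      · refine ⟨a * (Polynomial.C θ.1 + Polynomial.X * Polynomial.C (θ₀.1 - θ.1)), fun t => ?_⟩
        rw [JetPoly.evalAt_mul, ha, JetPoly.evalAt_X_none]
        simp [L]
      · refine ⟨a * (Polynomial.C (θ.2 k i) + Polynomial.X * Polynomial.C (θ₀.2 k i - θ.2 k i)),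
          fun t => ?_⟩
        rw [JetPoly.evalAt_mul, ha, JetPoly.evalAt_X_some]
        simp [L]
  have hp0 : p ≠ 0 := by
    rintro rfl
    have h1 := hp 1
    simp only [L, one_smul, add_sub_cancel, Polynomial.eval_zero] at h1
    exact h h1
  have hfin : {t : ℝ | p.eval t = 0}.Finite := by
    refine (p.roots.toFinset.finite_toSet).subset fun t ht => ?_
    simpa [hp0] using ht
  have hd : Dense {t : ℝ | p.eval t ≠ 0} := by
    have := hfin.countable.dense_compl ℝ
    exact this
  have h0 : L 0 = θ := by simp [L]
  rw [← h0]
  refine map_mem_closure hL (hd 0) fun t ht => ?_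
  simpa only [mem_ofPred_eq, hp] using ht

theorem JetPoly.eq_zero_of_evalAt {P : JetPoly} (h : ∀ θ : Jet ℝ 4, P.evalAt θ = 0) : P = 0 := by
  refine MvPolynomial.funext fun x => ?_
  have := h (x none, fun k i => x (some (k, i)))
  rw [map_zero]
  convert this using 1
  rw [JetPoly.evalAt, MvPolynomial.aeval_eq_eval]
  congr 2
  ext v
  rcases v with _ | ⟨k, i⟩ <;> rfl

theorem JetPoly.exists_evalAt_ne_zero {P : JetPoly} (h : P ≠ 0) : ∃ θ : Jet ℝ 4, P.evalAt θ ≠ 0 := by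
  by_contra! hc
  exact h (JetPoly.eq_zero_of_evalAt hc)

/-- A polynomial that vanishes on a non-empty open set of real jets vanishes. -/
theorem JetPoly.eq_zero_of_isOpen {P : JetPoly} {U : Set (Jet ℝ 4)} (hU : IsOpen U)
    (hne : U.Nonempty) (h : ∀ θ ∈ U, P.evalAt θ = 0) : P = 0 := by
  by_contra hP
  obtain ⟨θ₀, h0⟩ := JetPoly.exists_evalAt_ne_zero hP
  obtain ⟨θ, hθ, hθ'⟩ := (dense_evalAt_ne_zero h0).inter_open_nonempty U hU hne
  exact hθ' (h θ hθ)

/-! ### Rational functions on jet spaces -/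

/-- On `S` the function `R` is a quotient of polynomials in the jet coordinates of order at most
`k`, whose denominator does not vanish on `S`. -/
def IsRat (S : Set (Jet ℝ 4)) (k : ℕ) (R : Jet ℝ 4 → ℝ) : Prop :=
  ∃ N W : JetPoly, N.OrderLE k ∧ W.OrderLE k ∧
    ∀ θ ∈ S, W.evalAt θ ≠ 0 ∧ R θ = N.evalAt θ / W.evalAt θ

theorem totalD_eq_of_hasDerivAt {E : Type*} [NormedAddCommGroup E] [NormedSpace ℝ E]
    {F : Jet ℝ 4 → E} {θ : Jet ℝ 4} {c : E}
    (h : HasDerivAt (fun s : ℝ => F (θ + s • (((1 : ℝ), fun k => θ.2 (k + 1)) : Jet ℝ 4))) c 0) :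
    totalD F θ = c := h.deriv

theorem eventually_line_mem {S : Set (Jet ℝ 4)} (hS : IsOpen S) {θ : Jet ℝ 4} (hθ : θ ∈ S) :
    ∀ᶠ s : ℝ in 𝓝 0, θ + s • (((1 : ℝ), fun k => θ.2 (k + 1)) : Jet ℝ 4) ∈ S :=
  (holonomicAt_line θ).continuousAt.eventually_mem (hS.mem_nhds (by simpa using hθ))

theorem totalD_congr {E : Type*} [NormedAddCommGroup E] [NormedSpace ℝ E]
    {F G : Jet ℝ 4 → E} {S : Set (Jet ℝ 4)} (hS : IsOpen S) (h : ∀ θ ∈ S, F θ = G θ)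
    {θ : Jet ℝ 4} (hθ : θ ∈ S) : totalD F θ = totalD G θ :=
  Filter.EventuallyEq.deriv_eq ((eventually_line_mem hS hθ).mono fun _ hs => h _ hs)

namespace IsRat

variable {S T : Set (Jet ℝ 4)} {k l : ℕ} {R R' : Jet ℝ 4 → ℝ}

theorem mono (h : IsRat S k R) (hkl : k ≤ l) (hT : T ⊆ S) : IsRat T l R := by
  obtain ⟨N, W, hN, hW, e⟩ := h
  exact ⟨N, W, hN.mono hkl, hW.mono hkl, fun θ hθ => e θ (hT hθ)⟩

theorem congr (h : IsRat S k R) (e : ∀ θ ∈ S, R' θ = R θ) : IsRat S k R' := by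
  obtain ⟨N, W, hN, hW, e'⟩ := h
  exact ⟨N, W, hN, hW, fun θ hθ => ⟨(e' θ hθ).1, (e θ hθ).trans (e' θ hθ).2⟩⟩

theorem evalAt {P : JetPoly} (hP : P.OrderLE k) : IsRat S k (fun θ => P.evalAt θ) :=
  ⟨P, 1, hP, JetPoly.OrderLE.one, fun θ _ => by simp [JetPoly.evalAt_one]⟩

theorem const (c : ℝ) : IsRat S k (fun _ => c) :=
  (evalAt (JetPoly.OrderLE.C c)).congr fun θ _ => by simp [JetPoly.evalAt_C]

theorem fst : IsRat S k (fun θ => θ.1) :=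
  (evalAt JetPoly.OrderLE.X_none).congr fun θ _ => by simp [JetPoly.evalAt_X_none]

theorem coord {j : ℕ} (hj : j ≤ k) (i : Fin 4) : IsRat S k (fun θ => θ.2 j i) :=
  (evalAt (JetPoly.OrderLE.X_some hj i)).congr fun θ _ => by simp [JetPoly.evalAt_X_some]

theorem add (h : IsRat S k R) (h' : IsRat S k R') : IsRat S k (fun θ => R θ + R' θ) := by
  obtain ⟨N, W, hN, hW, e⟩ := h
  obtain ⟨N', W', hN', hW', e'⟩ := h'
  refine ⟨N * W' + N' * W, W * W', (hN.mul hW').add (hN'.mul hW), hW.mul hW', fun θ hθ => ?_⟩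
  obtain ⟨h1, h2⟩ := e θ hθ
  obtain ⟨h1', h2'⟩ := e' θ hθ
  simp only [JetPoly.evalAt_add, JetPoly.evalAt_mul]
  refine ⟨mul_ne_zero h1 h1', ?_⟩
  rw [h2, h2']
  field_simp

theorem mul (h : IsRat S k R) (h' : IsRat S k R') : IsRat S k (fun θ => R θ * R' θ) := by
  obtain ⟨N, W, hN, hW, e⟩ := h
  obtain ⟨N', W', hN', hW', e'⟩ := h'
  refine ⟨N * N', W * W', hN.mul hN', hW.mul hW', fun θ hθ => ?_⟩
  obtain ⟨h1, h2⟩ := e θ hθ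
  obtain ⟨h1', h2'⟩ := e' θ hθ
  simp only [JetPoly.evalAt_mul]
  refine ⟨mul_ne_zero h1 h1', ?_⟩
  rw [h2, h2']
  field_simp

theorem inv (h : IsRat S k R) (h0 : ∀ θ ∈ S, R θ ≠ 0) : IsRat S k (fun θ => (R θ)⁻¹) := by
  obtain ⟨N, W, hN, hW, e⟩ := h
  refine ⟨W, N, hW, hN, fun θ hθ => ?_⟩
  obtain ⟨h1, h2⟩ := e θ hθ
  have h3 := h0 θ hθ
  rw [h2] at h3
  refine ⟨(div_ne_zero_iff.1 h3).1, ?_⟩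
  simp only [h2, inv_div]

theorem neg (h : IsRat S k R) : IsRat S k (fun θ => -R θ) :=
  ((const (-1)).mul h).congr fun θ _ => by ring

theorem sub (h : IsRat S k R) (h' : IsRat S k R') : IsRat S k (fun θ => R θ - R' θ) :=
  (h.add h'.neg).congr fun θ _ => by ring

theorem div (h : IsRat S k R) (h' : IsRat S k R') (h0 : ∀ θ ∈ S, R' θ ≠ 0) :
    IsRat S k (fun θ => R θ / R' θ) :=
  (h.mul (h'.inv h0)).congr fun _ _ => div_eq_mul_inv _ _

theorem pow (h : IsRat S k R) (n : ℕ) : IsRat S k (fun θ => R θ ^ n) := by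
  induction n with
  | zero => exact (const 1).congr fun _ _ => pow_zero _
  | succ n ih => exact (ih.mul h).congr fun _ _ => pow_succ _ _

theorem continuousOn (h : IsRat S k R) : ContinuousOn R S := by
  obtain ⟨N, W, hN, hW, e⟩ := h
  exact ((continuous_evalAt N).continuousOn.div (continuous_evalAt W).continuousOn
    fun θ hθ => (e θ hθ).1).congr fun θ hθ => (e θ hθ).2

/-- The total derivative of a rational function is rational, and it gives the derivative along
curves of jets. -/
theorem totalD_and_chain (hS : IsOpen S) (h : IsRat S k R) : IsRat S (k + 1) (totalD R) ∧
    ∀ (J : ℝ → Jet ℝ 4) (μ t : ℝ), HolonomicAt J μ t → J t ∈ S →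
      HasDerivAt (fun s => R (J s)) (μ * _root_.totalD R (J t)) t := by
  obtain ⟨N, W, hN, hW, e⟩ := h
  have chain : ∀ (J : ℝ → Jet ℝ 4) (μ t : ℝ), HolonomicAt J μ t → J t ∈ S →
      HasDerivAt (fun s => R (J s)) (μ * (((JetPoly.D N).evalAt (J t) * W.evalAt (J t) -
        N.evalAt (J t) * (JetPoly.D W).evalAt (J t)) / W.evalAt (J t) ^ 2)) t := by
    intro J μ t hJ hJt
    refine (((hJ.hasDerivAt_evalAt N).div (hJ.hasDerivAt_evalAt W)
      (e _ hJt).1).congr_deriv (by ring)).congr_of_eventuallyEq ?_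
    exact (hJ.continuousAt.eventually_mem (hS.mem_nhds hJt)).mono fun s hs => (e _ hs).2
  have key : ∀ θ ∈ S, _root_.totalD R θ = ((JetPoly.D N).evalAt θ * W.evalAt θ -
        N.evalAt θ * (JetPoly.D W).evalAt θ) / W.evalAt θ ^ 2 := by
    intro θ hθ
    have := chain _ 1 0 (holonomicAt_line θ) (by simpa using hθ)
    rw [totalD_eq_of_hasDerivAt this]
    simp
  refine ⟨⟨JetPoly.D N * W - N * JetPoly.D W, W * W, ?_, ?_, fun θ hθ => ⟨?_, ?_⟩⟩, ?_⟩
  · exact (hN.D.mul (hW.mono (by omega))).sub ((hN.mono (by omega)).mul hW.D)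
  · exact (hW.mul hW).mono (by omega)
  · rw [JetPoly.evalAt_mul]; exact mul_ne_zero (e θ hθ).1 (e θ hθ).1
  · rw [key θ hθ]
    simp only [JetPoly.evalAt_sub, JetPoly.evalAt_mul, sq]
  · intro J μ t hJ hJt
    rw [key _ hJt]
    exact chain J μ t hJ hJt

theorem totalD (hS : IsOpen S) (h : IsRat S k R) : IsRat S (k + 1) (totalD R) :=
  (totalD_and_chain hS h).1

theorem chain (hS : IsOpen S) (h : IsRat S k R) {J : ℝ → Jet ℝ 4} {μ t : ℝ}
    (hJ : HolonomicAt J μ t) (hJt : J t ∈ S) :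
    HasDerivAt (fun s => R (J s)) (μ * _root_.totalD R (J t)) t :=
  (totalD_and_chain hS h).2 J μ t hJ hJt

end IsRat

/-! ### Prolongation -/

/-- A class of functions on jets that satisfies the chain rule along curves of jets and is closed
under the derivation `D / D X`. -/
structure IsJetClass {𝔽 : Type*} [RCLike 𝔽] (S : Set (Jet ℝ 4)) (X : Jet ℝ 4 → 𝔽)
    (𝒞 : Set (Jet ℝ 4 → 𝔽)) : Prop where
  chain : ∀ F ∈ 𝒞, ∀ (J : ℝ → Jet ℝ 4) (μ t : ℝ), HolonomicAt J μ t → J t ∈ S →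
    HasDerivAt (fun s => F (J s)) (μ • totalD F (J t)) t
  step : ∀ F ∈ 𝒞, (fun θ => (totalD X θ)⁻¹ * totalD F θ) ∈ 𝒞

/-- The successive derivatives of a function by `D / D X`. -/
noncomputable def scalarProlong {𝔽 : Type*} [RCLike 𝔽] (X u : Jet ℝ 4 → 𝔽) : ℕ → Jet ℝ 4 → 𝔽
  | 0 => u
  | k + 1 => fun θ => (totalD X θ)⁻¹ * totalD (scalarProlong X u k) θ

namespace IsJetClass

variable {𝔽 : Type*} [RCLike 𝔽] {S : Set (Jet ℝ 4)} {X : Jet ℝ 4 → 𝔽} {𝒞 : Set (Jet ℝ 4 → 𝔽)}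
  {m : ℕ} {U : Jet ℝ 4 → Fin m → 𝔽}

theorem scalarProlong_mem (h : IsJetClass S X 𝒞) {u : Jet ℝ 4 → 𝔽} (hu : u ∈ 𝒞) (k : ℕ) :
    scalarProlong X u k ∈ 𝒞 := by
  induction k with
  | zero => exact hu
  | succ k ih => exact h.step _ ih

/-- Prolongation acts on each dependent variable separately. -/
theorem prolongCoeff_apply (h : IsJetClass S X 𝒞) (hS : IsOpen S)
    (hU : ∀ i, (fun θ => U θ i) ∈ 𝒞) (k : ℕ) :
    ∀ θ ∈ S, ∀ i, prolongCoeff X U k θ i = scalarProlong X (fun θ => U θ i) k θ := by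
  induction k with
  | zero => intro θ _ i; rfl
  | succ k ih =>
    intro θ hθ i
    have hd : HasDerivAt (fun s : ℝ => prolongCoeff X U k
        (θ + s • (((1 : ℝ), fun k => θ.2 (k + 1)) : Jet ℝ 4)))
        (fun i => totalD (scalarProlong X (fun θ => U θ i) k) θ) 0 := by
      refine hasDerivAt_pi.2 fun i => ?_
      have h1 := h.chain _ (h.scalarProlong_mem (hU i) k) _ 1 0 (holonomicAt_line θ)
        (by simpa using hθ)
      simp only [one_smul, zero_smul, add_zero] at h1
      exact h1.congr_of_eventuallyEq ((eventually_line_mem hS hθ).mono fun s hs => ih _ hs i)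
    simp only [prolongCoeff, scalarProlong, Pi.smul_apply, smul_eq_mul]
    rw [totalD_eq_of_hasDerivAt hd]

theorem hasDerivAt_prolongCoeff (h : IsJetClass S X 𝒞) (hS : IsOpen S)
    (hU : ∀ i, (fun θ => U θ i) ∈ 𝒞) (k : ℕ) {J : ℝ → Jet ℝ 4} {μ t : ℝ}
    (hJ : HolonomicAt J μ t) (hJt : J t ∈ S) (hX : totalD X (J t) ≠ 0) :
    HasDerivAt (fun s => prolongCoeff X U k (J s))
      ((μ • totalD X (J t)) • prolongCoeff X U (k + 1) (J t)) t := by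
  refine hasDerivAt_pi.2 fun i => ?_
  have h1 := h.chain _ (h.scalarProlong_mem (hU i) k) J μ t hJ hJt
  refine (h1.congr_deriv ?_).congr_of_eventuallyEq
    ((hJ.continuousAt.eventually_mem (hS.mem_nhds hJt)).mono fun s hs =>
      h.prolongCoeff_apply hS hU k _ hs i)
  rw [Pi.smul_apply, h.prolongCoeff_apply hS hU (k + 1) _ hJt i]
  simp only [scalarProlong, smul_eq_mul, RCLike.real_smul_eq_coe_mul]
  rw [mul_assoc, mul_inv_cancel_left₀ hX]

/-- With the original independent variable, prolongation sends the jets of a curve to the jets of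
the image curve. -/
theorem jetOf_eq_prolong (h : IsJetClass S X 𝒞) (hS : IsOpen S)
    (hU : ∀ i, (fun θ => U θ i) ∈ 𝒞) (hX : ∀ θ ∈ S, totalD X θ = 1) {γ : ℝ → Fin 4 → ℝ} {x : ℝ}
    (hγ : ∀ᶠ t in 𝓝 x, ContDiffAt ℝ ∞ γ t) (hx : jetOf γ x ∈ S) (hXx : X (jetOf γ x) = (x : 𝔽)) :
    prolong X U (jetOf γ x) = jetOf (fun t => U (jetOf γ t)) x := by
  have hc : ∀ᶠ t in 𝓝 x, jetOf γ t ∈ S :=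
    (holonomicAt_jetOf hγ.self_of_nhds).continuousAt.eventually_mem (hS.mem_nhds hx)
  have key : ∀ k, ∀ᶠ t in 𝓝 x, iteratedDeriv k (fun t => U (jetOf γ t)) t =
      prolongCoeff X U k (jetOf γ t) := by
    intro k
    induction k with
    | zero => exact Eventually.of_forall fun t => by simp [prolongCoeff]
    | succ k ih =>
      filter_upwards [ih.eventually_nhds, hγ, hc] with t ht htγ htS
      rw [iteratedDeriv_succ, Filter.EventuallyEq.deriv_eq ht]
      have h1 := h.hasDerivAt_prolongCoeff hS hU k (holonomicAt_jetOf htγ) htS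
        (by rw [hX _ htS]; exact one_ne_zero)
      rw [h1.deriv, hX _ htS, one_smul, one_smul]
  refine Prod.ext hXx ?_
  funext k
  exact (key k).self_of_nhds.symm

end IsJetClass

/-! ### The left lift -/

theorem isOpen_GenM : IsOpen GenM :=
  isOpen_ne_fun (f := fun θ : Jet ℝ 4 => θ.2 1 0) (g := fun θ : Jet ℝ 4 => θ.2 0 1)
    (by fun_prop) (by fun_prop)

theorem dense_GenM : Dense GenM := by
  let P : JetPoly := MvPolynomial.X (some (1, 0)) - MvPolynomial.X (some (0, 1))
  have hP : ∀ θ : Jet ℝ 4, P.evalAt θ = θ.2 1 0 - θ.2 0 1 := fun θ => by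
    rw [JetPoly.evalAt_sub, JetPoly.evalAt_X_some, JetPoly.evalAt_X_some]
  have h := dense_evalAt_ne_zero (P := P) (θ₀ := (0, fun k _ => if k = 1 then 1 else 0))
    (by rw [hP]; simp)
  refine h.mono fun θ hθ => ?_
  rw [mem_ofPred_eq, hP] at hθ
  exact sub_ne_zero.1 hθ

theorem isRat_rLeft : IsRat GenM 1 rLeft := by
  have c0 : ∀ i, IsRat GenM 1 (fun θ => θ.2 0 i) := fun i => IsRat.coord (by norm_num) i
  have c1 : ∀ i, IsRat GenM 1 (fun θ => θ.2 1 i) := fun i => IsRat.coord le_rfl i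
  exact ((((IsRat.const 2).mul (c0 2)).mul (c1 1)).sub (c1 3) |>.sub ((c0 2).pow 2)).div
    ((IsRat.const 2).mul ((c1 0).sub (c0 1)))
    fun θ hθ => mul_ne_zero two_ne_zero (sub_ne_zero.2 hθ)

theorem totalD_fst (θ : Jet ℝ 4) : totalD (fun η : Jet ℝ 4 => η.1) θ = 1 :=
  totalD_eq_of_hasDerivAt (holonomicAt_line θ).1

theorem totalD_coord (k : ℕ) (i : Fin 4) (θ : Jet ℝ 4) :
    totalD (fun η : Jet ℝ 4 => η.2 k i) θ = θ.2 (k + 1) i :=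
  totalD_eq_of_hasDerivAt (((holonomicAt_line θ).2 k i).congr_deriv (by simp))

/-- The rational functions form a class that is closed under prolongation. -/
theorem isJetClass_isRat {S : Set (Jet ℝ 4)} (hS : IsOpen S) {X : Jet ℝ 4 → ℝ} {k₀ : ℕ}
    (hX : IsRat S k₀ X) (h0 : ∀ θ ∈ S, totalD X θ ≠ 0) :
    IsJetClass S X {F : Jet ℝ 4 → ℝ | ∃ k, IsRat S k F} where
  chain := by
    rintro F ⟨k, hF⟩ J μ t hJ hJt
    exact hF.chain hS hJ hJt
  step := by
    rintro F ⟨k, hF⟩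
    exact ⟨max (k₀ + 1) (k + 1), (((hX.totalD hS).inv h0).mono (le_max_left _ _) subset_rfl).mul
      ((hF.totalD hS).mono (le_max_right _ _) subset_rfl)⟩

theorem isJetClass_jLeft :
    IsJetClass GenM (fun θ => θ.1) {F : Jet ℝ 4 → ℝ | ∃ k, IsRat GenM k F} :=
  isJetClass_isRat isOpen_GenM (IsRat.fst (k := 0)) fun θ _ => by
    rw [totalD_fst]; exact one_ne_zero

theorem scalarProlong_coord (i : Fin 4) (k : ℕ) :
    scalarProlong (fun θ : Jet ℝ 4 => θ.1) (fun θ => θ.2 0 i) k = fun θ => θ.2 k i := by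
  induction k with
  | zero => rfl
  | succ k ih =>
    funext θ
    simp only [scalarProlong, ih, totalD_fst, totalD_coord, inv_one, one_mul]

theorem jLeft_components : ∀ i : Fin 5, (fun θ : Jet ℝ 4 =>
    (![θ.2 0 0, θ.2 0 1, θ.2 0 2, θ.2 0 3, rLeft θ] : Fin 5 → ℝ) i) ∈
      {F : Jet ℝ 4 → ℝ | ∃ k, IsRat GenM k F} := by
  intro i
  refine ⟨1, ?_⟩
  fin_cases i
  exacts [IsRat.coord (by norm_num) 0, IsRat.coord (by norm_num) 1, IsRat.coord (by norm_num) 2,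
    IsRat.coord (by norm_num) 3, isRat_rLeft]

theorem jLeft_proj {θ : Jet ℝ 4} (hθ : θ ∈ GenM) : (jLeft θ).proj = θ := by
  refine Prod.ext rfl ?_
  funext k i
  have h := isJetClass_jLeft.prolongCoeff_apply isOpen_GenM jLeft_components k θ hθ
    i.castSucc
  have h2 : (fun θ : Jet ℝ 4 =>
      (![θ.2 0 0, θ.2 0 1, θ.2 0 2, θ.2 0 3, rLeft θ] : Fin 5 → ℝ) i.castSucc) =
      fun θ => θ.2 0 i := by
    funext η
    fin_cases i <;> rfl
  rw [h2, scalarProlong_coord] at h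
  exact h

theorem jLeft_jetOf {γ : ℝ → Fin 4 → ℝ} (hγ : ContDiff ℝ ∞ γ) {x : ℝ} (hx : jetOf γ x ∈ GenM) :
    jLeft (jetOf γ x) =
      jetOf (fun t => ![γ t 0, γ t 1, γ t 2, γ t 3, rLeft (jetOf γ t)]) x := by
  have h := isJetClass_jLeft.jetOf_eq_prolong isOpen_GenM jLeft_components
    (fun θ _ => totalD_fst θ) (Eventually.of_forall fun t => hγ.contDiffAt) hx rfl
  rw [jLeft, h]
  congr 1

theorem metricM_eq_zero_iff {θ : Jet ℝ 4} (hθ : θ ∈ GenM) (r : ℝ) :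
    metricM θ.pt θ.vel (dirM θ.pt r) = 0 ↔ r = rLeft θ := by
  have h0 : θ.2 1 0 - θ.2 0 1 ≠ 0 := sub_ne_zero.2 hθ
  rw [rLeft, eq_div_iff (mul_ne_zero two_ne_zero h0)]
  simp [metricM, dirM, Jet.pt, Jet.vel]
  constructor <;> intro h <;> linarith

theorem eq_smul_tanM {m : Fin 5 → ℝ} {w : Fin 7 → ℝ} {r : ℝ} (h : octCross (vecM m) w = 0)
    (h1 : w 1 = 0) (h6 : w 6 = r * w 5) : w = w 5 • tanM m r := by
  have e1 := congrFun h 1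
  have e2 := congrFun h 2
  have e3 := congrFun h 3
  have e5 := congrFun h 5
  have e6 := congrFun h 6
  have e0 := congrFun h 0
  simp [octCross, vecM, h1, h6] at e0 e1 e2 e3 e5 e6
  have a0 : w 0 = w 5 * (m 3 - r * m 0) := by linear_combination -e1
  rw [a0] at e2 e3 e5 e6
  have a2 : w 2 = w 5 * (2 * m 2 * r - m 3 ^ 2) := by linear_combination e6
  have a3 : w 3 = w 5 * (-2 * m 2 + 2 * m 3 * m 0 - r * m 0 ^ 2) := by linear_combination -e5
  rw [a2, a3] at e0
  ext i
  fin_cases i <;> simp [tanM, h1, h6, a0, a2, a3]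
  · linear_combination e0
  · ring

/-- The conformal metric of `M` is induced by the quadratic form. -/
theorem octForm_vecMd {m v : Fin 5 → ℝ} {w : Fin 7 → ℝ} (h : octCross (vecM m) w = 0)
    (h1 : w 1 = 0) (hv : v 0 = 1) : octForm w (vecMd m v) =
      3 * (w 5 * (2 * m 3 * v 2 - v 4 - m 3 ^ 2) - 2 * w 6 * (v 1 - m 2)) := by
  have e1 := congrFun h 1
  have e5 := congrFun h 5
  have e6 := congrFun h 6
  have e0 := congrFun h 0
  simp [octCross, vecM, h1] at e0 e1 e5 e6
  have a0 : w 0 = w 5 * m 3 - w 6 * m 0 := by linear_combination -e1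
  rw [a0] at e5 e6
  have a2 : w 2 = 2 * m 2 * w 6 - w 5 * m 3 ^ 2 := by linear_combination e6
  have a3 : w 3 = -2 * m 2 * w 5 + 2 * m 3 * m 0 * w 5 - w 6 * m 0 ^ 2 := by
    linear_combination -e5
  simp [octForm, vecMd, h1, hv, a0, a2, a3]
  ring

theorem octForm_vecM_vecMd (m v : Fin 5 → ℝ) : octForm (vecM m) (vecMd m v) = 0 := by
  simp [octForm, vecM, vecMd]; ring

theorem octForm_vecM_tanM (m : Fin 5 → ℝ) (r : ℝ) : octForm (tanM m r) (vecM m) = 0 := by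
  simp [octForm, vecM, tanM]; ring

theorem hasDerivAt_graphPt {γ : ℝ → Fin 4 → ℝ} {t : ℝ} (h : DifferentiableAt ℝ γ t) :
    HasDerivAt (graphPt γ) (Matrix.vecCons 1 (deriv γ t)) t := by
  refine hasDerivAt_pi.2 fun i => ?_
  refine Fin.cases ?_ (fun j => ?_) i
  · exact hasDerivAt_id t
  · simpa [graphPt] using hasDerivAt_pi.1 h.hasDerivAt j

theorem lineM_eq_iff {m : Fin 5 → ℝ} {w : Fin 7 → ℝ}
    (h : Submodule.span ℝ {w} = lineM m) : w = w 1 • vecM m := by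
  have : w ∈ lineM m := h ▸ Submodule.mem_span_singleton_self w
  obtain ⟨c, rfl⟩ := Submodule.mem_span_singleton.1 this
  simp [vecM_one]

theorem hasDerivAt_mulVec {f : ℝ → Fin 7 → ℝ} {f' : Fin 7 → ℝ} {t : ℝ} (h : HasDerivAt f f' t)
    (g : Matrix (Fin 7) (Fin 7) ℝ) : HasDerivAt (fun s => g.mulVec (f s)) (g.mulVec f') t :=
  (g.mulVecLin.toContinuousLinearMap.hasFDerivAt.comp_hasDerivAt t h)

theorem jLeft_equivariant {g : Matrix.GeneralLinearGroup (Fin 7) ℝ} (hg : g ∈ G2)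
    {γ₁ γ₂ : ℝ → Fin 4 → ℝ} (h₁ : ContDiff ℝ ∞ γ₁) (h₂ : ContDiff ℝ ∞ γ₂) {τ : ℝ → ℝ} {x : ℝ}
    (h : CurvesCongruent lineM (g : Matrix (Fin 7) (Fin 7) ℝ) γ₁ γ₂ τ x)
    (hx₁ : jetOf γ₁ x ∈ GenM) (hx₂ : jetOf γ₂ (τ x) ∈ GenM) :
    moved (g : Matrix (Fin 7) (Fin 7) ℝ) (flagMhat (jLeft (jetOf γ₁ x)).pt).2 =
      (flagMhat (jLeft (jetOf γ₂ (τ x))).pt).2 := by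
  obtain ⟨hτ, hτ', hc⟩ := h
  have hflag : ∀ (γ : ℝ → Fin 4 → ℝ) (t : ℝ), (flagMhat (jLeft (jetOf γ t)).pt).2 =
      Submodule.span ℝ {vecM (graphPt γ t), tanM (graphPt γ t) (rLeft (jetOf γ t))} := by
    intro γ t
    rw [flagMhat_eq]
    have e1 : dropLast (jLeft (jetOf γ t)).pt = graphPt γ t := by
      ext i
      fin_cases i <;> simp [dropLast, Jet.pt, jLeft, prolong, prolongCoeff, graphPt, jetOf]
    have e2 : (jLeft (jetOf γ t)).pt 5 = rLeft (jetOf γ t) := rfl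
    rw [e1, e2]
  rw [hflag, hflag, moved_span_pair]
  set G := (g : Matrix (Fin 7) (Fin 7) ℝ) with hG
  set m₁ := graphPt γ₁ x
  set m₂ := graphPt γ₂ (τ x)
  have hd₁ : HasDerivAt (fun t => vecM (graphPt γ₁ t))
      (vecMd m₁ (Matrix.vecCons 1 (deriv γ₁ x))) x :=
    (hasDerivAt_graphPt (h₁.differentiable (by simp) x)).vecM
  have hd₂ : HasDerivAt (fun t => vecM (graphPt γ₂ (τ t)))
      (deriv τ x • vecMd m₂ (Matrix.vecCons 1 (deriv γ₂ (τ x)))) x :=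
    (HasDerivAt.vecM (hasDerivAt_graphPt (h₂.differentiable (by simp) (τ x)))).scomp x
      (hτ.differentiableAt (by simp)).hasDerivAt
  have hl : ∀ᶠ t in 𝓝 x, G.mulVec (vecM (graphPt γ₁ t)) =
      (G.mulVec (vecM (graphPt γ₁ t)) 1) • vecM (graphPt γ₂ (τ t)) := by
    filter_upwards [hc] with t ht
    rw [lineM, moved_span_singleton] at ht
    exact lineM_eq_iff ht
  have hgd := hasDerivAt_mulVec hd₁ G
  have hgd1 := hasDerivAt_pi.1 hgd 1
  have hder := hgd.unique ((hgd1.smul hd₂).congr_of_eventuallyEq hl)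
  have hx := hl.self_of_nhds
  set l := G.mulVec (vecM m₁) 1
  set l' := G.mulVec (vecMd m₁ (Matrix.vecCons 1 (deriv γ₁ x))) 1
  change G.mulVec (vecM m₁) = l • vecM m₂ at hx
  have hl0 : l ≠ 0 := by
    intro h0
    rw [h0, zero_smul, ← Matrix.mulVec_zero G] at hx
    have := congrFun (mulVec_inj g hx) 1
    rw [vecM_one] at this
    exact one_ne_zero this
  have hd10 : deriv γ₁ x = (jetOf γ₁ x).2 1 := by simp [jetOf]
  have hd20 : deriv γ₂ (τ x) = (jetOf γ₂ (τ x)).2 1 := by simp [jetOf]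
  have hm₁ : ∀ i : Fin 4, m₁ i.succ = (jetOf γ₁ x).2 0 i := fun i => by simp [jetOf, m₁, graphPt]
  have hm₂ : ∀ i : Fin 4, m₂ i.succ = (jetOf γ₂ (τ x)).2 0 i := fun i => by
    simp [jetOf, m₂, graphPt]
  -- the plane of the left lift is the annihilator of the velocity
  have hperp : octForm (tanM m₁ (rLeft (jetOf γ₁ x)))
      (vecMd m₁ (Matrix.vecCons 1 (deriv γ₁ x))) = 0 := by
    rw [octForm_vecMd (octCross_vecM_tanM _ _) rfl rfl]
    have h0 : (jetOf γ₁ x).2 1 0 - (jetOf γ₁ x).2 0 1 ≠ 0 := sub_ne_zero.2 hx₁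
    have a2 : m₁ 2 = (jetOf γ₁ x).2 0 1 := hm₁ 1
    have a3 : m₁ 3 = (jetOf γ₁ x).2 0 2 := hm₁ 2
    rw [hd10, a2, a3]
    simp [tanM, rLeft]
    field_simp
    ring
  set u := G.mulVec (tanM m₁ (rLeft (jetOf γ₁ x))) with hu
  set w := u - u 1 • vecM m₂ with hw
  have hvv : octCross (vecM m₂) (vecM m₂) = 0 := by
    ext i; fin_cases i <;> simp [octCross] <;> ring
  have hcu : octCross (vecM m₂) u = 0 := by
    have h1 : l • octCross (vecM m₂) u = 0 := by
      rw [← octCross_smul_left, ← hx, hu, ← hg, octCross_vecM_tanM, Matrix.mulVec_zero]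
    exact (smul_eq_zero.1 h1).resolve_left hl0
  have hcw : octCross (vecM m₂) w = 0 := by
    rw [hw, sub_eq_add_neg, ← neg_smul, octCross_add_right, octCross_smul_right, hvv, hcu]
    simp
  have hw1 : w 1 = 0 := by simp [hw, vecM_one]
  have hwperp : octForm w (vecMd m₂ (Matrix.vecCons 1 (deriv γ₂ (τ x)))) = 0 := by
    have h1 : octForm u (vecM m₂) = 0 := by
      have h2 : l * octForm u (vecM m₂) = 0 := by
        rw [← octForm_smul_right, ← hx, hu, octForm_mulVec hg, octForm_vecM_tanM]
      exact (mul_eq_zero.1 h2).resolve_left hl0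
    have h3 := octForm_mulVec hg (tanM m₁ (rLeft (jetOf γ₁ x)))
      (vecMd m₁ (Matrix.vecCons 1 (deriv γ₁ x)))
    rw [hperp, hder, ← hu, octForm_add_right, octForm_smul_right, octForm_smul_right,
      octForm_smul_right, h1] at h3
    have h4 : octForm u (vecMd m₂ (Matrix.vecCons 1 (deriv γ₂ (τ x)))) = 0 := by
      simpa [hl0, hτ'] using h3
    rw [hw, sub_eq_add_neg, ← neg_smul, octForm_add_left, octForm_smul_left, octForm_vecM_vecMd,
      h4]
    simp
  have hw6 : w 6 = rLeft (jetOf γ₂ (τ x)) * w 5 := by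
    rw [octForm_vecMd hcw hw1 rfl] at hwperp
    have h0 : (jetOf γ₂ (τ x)).2 1 0 - (jetOf γ₂ (τ x)).2 0 1 ≠ 0 := sub_ne_zero.2 hx₂
    have a2 : m₂ 2 = (jetOf γ₂ (τ x)).2 0 1 := hm₂ 1
    have a3 : m₂ 3 = (jetOf γ₂ (τ x)).2 0 2 := hm₂ 2
    rw [hd20, a2, a3] at hwperp
    simp at hwperp
    rw [rLeft]
    field_simp
    linear_combination -hwperp
  have hwt := eq_smul_tanM hcw hw1 hw6
  have hw5 : w 5 ≠ 0 := by
    intro h0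
    rw [h0, zero_smul] at hwt
    have h1 : G.mulVec (l • tanM m₁ (rLeft (jetOf γ₁ x))) = G.mulVec (u 1 • vecM m₁) := by
      rw [Matrix.mulVec_smul, Matrix.mulVec_smul, hx, ← hu, sub_eq_zero.1 (hw.symm.trans hwt)]
      simp only [smul_smul, mul_comm, Pi.smul_apply, vecM_one, smul_eq_mul, one_mul]
    have h2 := mulVec_inj g h1
    have h3 := congrFun h2 1
    have h5 := congrFun h2 5
    simp [tanM, vecM] at h3 h5
    rw [← h3, zero_mul] at h5
    exact hl0 h5
  have hu2 : u = u 1 • vecM m₂ + w 5 • tanM m₂ (rLeft (jetOf γ₂ (τ x))) := by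
    rw [← hwt, hw]
    simp
  refine span_pair_eq (a := l) (b := 0) ?_ hu2 ?_
  · rw [hx]; simp
  · simpa using ⟨hl0, hw5⟩

/-! ### The invariant trilinear form -/

/-- The invariant alternating trilinear form on the imaginary split octonions. -/
noncomputable def triple (u v w : Fin 7 → ℝ) : ℝ := octForm (octCross u v) w

section triple

variable (u u' v v' w w' : Fin 7 → ℝ) (c : ℝ)

theorem triple_add₁ : triple (u + u') v w = triple u v w + triple u' v w := by
  rw [triple, octCross_add_left, octForm_add_left]; rfl
theorem triple_add₂ : triple u (v + v') w = triple u v w + triple u v' w := by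
  rw [triple, octCross_add_right, octForm_add_left]; rfl
theorem triple_add₃ : triple u v (w + w') = triple u v w + triple u v w' :=
  octForm_add_right _ _ _
theorem triple_smul₁ : triple (c • u) v w = c * triple u v w := by
  rw [triple, octCross_smul_left, octForm_smul_left]; rfl
theorem triple_smul₂ : triple u (c • v) w = c * triple u v w := by
  rw [triple, octCross_smul_right, octForm_smul_left]; rfl
theorem triple_smul₃ : triple u v (c • w) = c * triple u v w := octForm_smul_right _ _ _
theorem triple_swap₁₂ : triple u v w = -triple v u w := by
  simp [triple, octForm, octCross]; ring
theorem triple_swap₂₃ : triple u v w = -triple u w v := by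
  simp [triple, octForm, octCross]; ring

end triple

theorem triple_mulVec {g : Matrix.GeneralLinearGroup (Fin 7) ℝ} (hg : g ∈ G2)
    (u v w : Fin 7 → ℝ) : triple ((g : Matrix (Fin 7) (Fin 7) ℝ).mulVec u)
      ((g : Matrix (Fin 7) (Fin 7) ℝ).mulVec v) ((g : Matrix (Fin 7) (Fin 7) ℝ).mulVec w) =
      triple u v w := by
  rw [triple, ← hg, octForm_mulVec hg]; rfl

/-- The binary cubic form that measures the deviation of the 2-jet of a curve of special null
planes `⟨A, B⟩` from a distinguished curve. -/
noncomputable def cubic (A B A' B' A'' B'' : Fin 7 → ℝ) (σ ρ : ℝ) : ℝ :=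
  triple (σ • A + ρ • B) (σ • A' + ρ • B') (σ • A'' + ρ • B'')

/-- The cubic form does not depend on the basis of the moving plane, and it is multiplied by the
cube of the derivative under a change of the parameter.  Here `k` and `l` are the components of a
section of the moving plane. -/
theorem triple_change {A B A' B' : Fin 7 → ℝ} (A'' B'' : Fin 7 → ℝ) (h : octCross A B = 0)
    (h' : octCross A' B + octCross A B' = 0) (k l k' l' k'' l'' τ' τ'' : ℝ) :
    triple (k • A + l • B) (k • τ' • A' + l • τ' • B' + (k' • A + l' • B))
      (k • (τ' ^ 2 • A'' + τ'' • A') + l • (τ' ^ 2 • B'' + τ'' • B') +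
        (2 * k' * τ') • A' + (2 * l' * τ') • B' + (k'' • A + l'' • B)) =
      τ' ^ 3 * cubic A B A' B' A'' B'' k l := by
  have self₁ : ∀ u w, triple u u w = 0 := fun u w => by
    have := triple_swap₁₂ u u w; linarith
  have self₂ : ∀ u w, triple w u u = 0 := fun u w => by
    have := triple_swap₂₃ w u u; linarith
  have self₃ : ∀ u w, triple u w u = 0 := fun u w => by
    rw [triple_swap₂₃, self₁, neg_zero]
  have e0 : ∀ w, triple A B w = 0 := fun w => by
    rw [triple, h]; simp [octForm]
  have e0' : ∀ w, triple B A w = 0 := fun w => by rw [triple_swap₁₂, e0, neg_zero]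
  have e1 : ∀ w, triple A w B = 0 := fun w => by rw [triple_swap₂₃, e0, neg_zero]
  have e1' : ∀ w, triple B w A = 0 := fun w => by rw [triple_swap₂₃, e0', neg_zero]
  have e2 : ∀ w, triple A' B w + triple A B' w = 0 := fun w => by
    rw [triple, triple, ← octForm_add_left, h']; simp [octForm]
  have e3 : triple A A' B' = 0 := by
    have := e2 A'
    rw [self₃, zero_add] at this
    rw [triple_swap₂₃, this, neg_zero]
  have e4 : triple B A' B' = 0 := by
    have := e2 B'
    rw [self₂, add_zero] at this
    rw [triple_swap₁₂, this, neg_zero]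
  have e3' : triple A B' A' = 0 := by rw [triple_swap₂₃, e3, neg_zero]
  have e4' : triple B B' A' = 0 := by rw [triple_swap₂₃, e4, neg_zero]
  simp only [cubic, triple_add₁, triple_add₂, triple_add₃, triple_smul₁, triple_smul₂,
    triple_smul₃, self₁, self₂, self₃, e0, e0', e1, e1', e3, e4, e3', e4']
  ring

/-! ### The cubic form of a curve in `K` -/

/-- The differential of `kA`. -/
def kAd (b v : Fin 5 → ℝ) : Fin 7 → ℝ :=
  ![v 1, 0, -v 2, v 4 - v 0 * b 2 - b 0 * v 2 - v 3 * b 1 - b 3 * v 1,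
    v 2 * b 3 + b 2 * v 3 - 2 * b 1 * v 1, v 3, 0]

/-- The differential of `kB`. -/
def kBd (b v : Fin 5 → ℝ) : Fin 7 → ℝ :=
  ![-v 3, 0, v 1, v 0 * b 1 + b 0 * v 1 - 2 * b 3 * v 3, 2 * v 3 * b 1 + 2 * b 3 * v 1 - v 4,
    -v 0, 0]

/-- The second derivative of `kA` along a curve with velocity `v` and acceleration `a`. -/
def kAdd (b v a : Fin 5 → ℝ) : Fin 7 → ℝ :=
  ![a 1, 0, -a 2, a 4 - a 0 * b 2 - b 0 * a 2 - a 3 * b 1 - b 3 * a 1 - 2 * v 0 * v 2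
      - 2 * v 3 * v 1,
    a 2 * b 3 + b 2 * a 3 - 2 * b 1 * a 1 + 2 * v 2 * v 3 - 2 * v 1 ^ 2, a 3, 0]

/-- The second derivative of `kB` along a curve with velocity `v` and acceleration `a`. -/
def kBdd (b v a : Fin 5 → ℝ) : Fin 7 → ℝ :=
  ![-a 3, 0, a 1, a 0 * b 1 + b 0 * a 1 - 2 * b 3 * a 3 + 2 * v 0 * v 1 - 2 * v 3 ^ 2,
    2 * a 3 * b 1 + 2 * b 3 * a 1 - a 4 + 4 * v 3 * v 1, -a 0, 0]

theorem HasDerivAt.kA {b : ℝ → Fin 5 → ℝ} {v : Fin 5 → ℝ} {t : ℝ} (h : HasDerivAt b v t) :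
    HasDerivAt (fun s => kA (b s)) (kAd (b t) v) t := by
  rw [hasDerivAt_pi] at h
  have h0 := h 0
  have h1 := h 1
  have h2 := h 2
  have h3 := h 3
  have h4 := h 4
  refine hasDerivAt_vec7 fun i => ?_
  fin_cases i
  · exact h1
  · exact hasDerivAt_const t (1 : ℝ)
  · exact h2.neg
  · exact ((h4.sub (h0.mul h2)).sub (h3.mul h1)).congr_deriv (by simp [kAd]; ring)
  · exact ((h2.mul h3).sub (h1.pow 2)).congr_deriv (by simp [kAd])
  · exact h3
  · exact hasDerivAt_const t (0 : ℝ)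

theorem HasDerivAt.kB {b : ℝ → Fin 5 → ℝ} {v : Fin 5 → ℝ} {t : ℝ} (h : HasDerivAt b v t) :
    HasDerivAt (fun s => kB (b s)) (kBd (b t) v) t := by
  rw [hasDerivAt_pi] at h
  have h0 := h 0
  have h1 := h 1
  have h3 := h 3
  have h4 := h 4
  refine hasDerivAt_vec7 fun i => ?_
  fin_cases i
  · exact h3.neg
  · exact hasDerivAt_const t (0 : ℝ)
  · exact h1
  · exact ((h0.mul h1).sub (h3.pow 2)).congr_deriv (by simp [kBd])
  · exact (((h3.const_mul 2).mul h1).sub h4).congr_deriv (by simp [kBd])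
  · exact h0.neg
  · exact hasDerivAt_const t (1 : ℝ)

theorem HasDerivAt.kAd {b v : ℝ → Fin 5 → ℝ} {a : Fin 5 → ℝ} {t : ℝ} (h : HasDerivAt b (v t) t)
    (h' : HasDerivAt v a t) :
    HasDerivAt (fun s => kAd (b s) (v s)) (kAdd (b t) (v t) a) t := by
  rw [hasDerivAt_pi] at h h'
  have h0 := h 0
  have h1 := h 1
  have h2 := h 2
  have h3 := h 3
  have g0 := h' 0
  have g1 := h' 1
  have g2 := h' 2
  have g3 := h' 3
  have g4 := h' 4
  refine hasDerivAt_vec7 fun i => ?_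
  fin_cases i
  · exact g1
  · exact hasDerivAt_const t (0 : ℝ)
  · exact g2.neg
  · exact ((((g4.sub (g0.mul h2)).sub (h0.mul g2)).sub (g3.mul h1)).sub (h3.mul g1)).congr_deriv
      (by simp [kAdd]; ring)
  · exact (((g2.mul h3).add (h2.mul g3)).sub ((h1.const_mul 2).mul g1)).congr_deriv
      (by simp [kAdd]; ring)
  · exact g3
  · exact hasDerivAt_const t (0 : ℝ)

theorem HasDerivAt.kBd {b v : ℝ → Fin 5 → ℝ} {a : Fin 5 → ℝ} {t : ℝ} (h : HasDerivAt b (v t) t)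
    (h' : HasDerivAt v a t) :
    HasDerivAt (fun s => kBd (b s) (v s)) (kBdd (b t) (v t) a) t := by
  rw [hasDerivAt_pi] at h h'
  have h0 := h 0
  have h1 := h 1
  have h3 := h 3
  have g0 := h' 0
  have g1 := h' 1
  have g3 := h' 3
  have g4 := h' 4
  refine hasDerivAt_vec7 fun i => ?_
  fin_cases i
  · exact g3.neg
  · exact hasDerivAt_const t (0 : ℝ)
  · exact g1
  · exact (((g0.mul h1).add (h0.mul g1)).sub ((h3.const_mul 2).mul g3)).congr_deriv
      (by simp [kBdd]; ring)
  · exact ((((g3.const_mul 2).mul h1).add ((h3.const_mul 2).mul g1)).sub g4).congr_deriv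
      (by simp [kBdd]; ring)
  · exact g0.neg
  · exact hasDerivAt_const t (0 : ℝ)

/-- The cubic form of a 2-jet of a graph in `K`, given by the position, the velocity and the
acceleration in the rescaled coordinates. -/
noncomputable def cubicK (b v a : Fin 5 → ℝ) : ℝ → ℝ → ℝ :=
  cubic (kA b) (kB b) (kAd b v) (kBd b v) (kAdd b v a) (kBdd b v a)

theorem cubicK_eq {b v a : Fin 5 → ℝ} (hv : v 0 = 1) (ha : a 0 = 0) (σ ρ : ℝ) :
    cubicK b v a σ ρ =
      -((3 * b 3 * v 1 + b 2 - v 4) * a 2 - (2 * v 1 ^ 3 + 3 * b 3 * v 2 * a 1 + 2 * v 2 ^ 2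
        - v 2 * a 4)) * σ ^ 3
      + 3 * ((3 * b 3 * v 1 + b 2 - v 4) * a 1 + 2 * v 2 * v 3 ^ 2 - 3 * b 3 * v 1 * a 1
        - 4 * v 1 ^ 2 * v 3 - 2 * v 1 * v 2 + v 1 * a 4) * σ ^ 2 * ρ
      - 3 * ((3 * b 3 * v 1 + b 2 - v 4) * a 3 - (2 * v 1 ^ 2 + 3 * b 3 * v 3 * a 1
        + 2 * v 1 * v 3 ^ 2 - v 3 * a 4)) * σ * ρ ^ 2
      + (2 * v 3 ^ 3 - 3 * b 3 * a 1 - 6 * v 1 * v 3 + a 4) * ρ ^ 3 := by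
  simp [cubicK, cubic, triple, octForm, octCross, kA, kB, kAd, kBd, kAdd, kBdd, hv, ha]
  ring

/-! ### The vector `Υ` and distinguished curves -/

/-- The cubic form of a 2-jet is dual to the vector `Υ` with respect to the conformal symplectic
form of the contact distribution. -/
theorem cubicK_jet {θ : Jet ℝ 4} (h : contactDefect θ ≠ 0) (σ ρ : ℝ) :
    cubicK (hat θ.pt) (hat θ.vel) (hat (Matrix.vecCons 0 (θ.2 2))) σ ρ =
      contactDefect θ * (-upsilon θ 3 * σ ^ 3 + √3 * upsilon θ 2 * σ ^ 2 * ρ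
        - √3 * upsilon θ 1 * σ * ρ ^ 2 + upsilon θ 0 * ρ ^ 3) := by
  have hw := sqrt3_sq
  have hw4 : √(3 : ℝ) ^ 4 = 9 := by rw [show 4 = 2 * 2 from rfl, pow_mul, hw]; norm_num
  have ex : ∀ a : ℝ, ∃ Y : ℝ, a = √3 * Y := fun a => ⟨a / √3, by field_simp⟩
  obtain ⟨Y₀, hY₀⟩ := ex (θ.2 0 0)
  obtain ⟨Y₁, hY₁⟩ := ex (θ.2 1 0)
  obtain ⟨Y₂, hY₂⟩ := ex (θ.2 2 0)
  obtain ⟨Q₀, hQ₀⟩ := ex (θ.2 0 2)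
  obtain ⟨Q₁, hQ₁⟩ := ex (θ.2 1 2)
  obtain ⟨Q₂, hQ₂⟩ := ex (θ.2 2 2)
  have hs : contactDefect θ = 3 * Q₀ * Y₁ + θ.2 0 1 - θ.2 1 3 := by
    rw [contactDefect, hQ₀, hY₁]; linear_combination Q₀ * Y₁ * hw
  have f0 : contactDefect θ * upsilon θ 0 =
      2 * Q₁ ^ 3 - 3 * Q₀ * Y₂ - 6 * Y₁ * Q₁ + θ.2 2 3 := by
    simp only [upsilon, Matrix.cons_val]
    rw [← contactDefect]
    field_simp
    rw [hQ₀, hQ₁, hY₁, hY₂]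
    linear_combination (2 * Q₁ ^ 3) * hw4 - 9 * (Q₀ * Y₂ + 2 * Y₁ * Q₁) * hw
  have f1 : contactDefect θ * upsilon θ 1 = √3 * ((3 * Q₀ * Y₁ + θ.2 0 1 - θ.2 1 3) * Q₂
      - (2 * Y₁ ^ 2 + 3 * Q₀ * Q₁ * Y₂ + 2 * Y₁ * Q₁ ^ 2 - Q₁ * θ.2 2 3)) := by
    rw [← hs]
    simp only [upsilon, Matrix.cons_val]
    rw [← contactDefect]
    field_simp
    rw [hQ₀, hQ₁, hQ₂, hY₁, hY₂]
    linear_combination (-√3 * (2 * Y₁ ^ 2 + 3 * Q₀ * Q₁ * Y₂ + 2 * Y₁ * Q₁ ^ 2)) * hw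
  have f2 : contactDefect θ * upsilon θ 2 = √3 * ((3 * Q₀ * Y₁ + θ.2 0 1 - θ.2 1 3) * Y₂
      + 2 * θ.2 1 1 * Q₁ ^ 2 - 3 * Q₀ * Y₁ * Y₂ - 4 * Y₁ ^ 2 * Q₁ - 2 * Y₁ * θ.2 1 1
      + Y₁ * θ.2 2 3) := by
    rw [← hs]
    simp only [upsilon, Matrix.cons_val]
    rw [← contactDefect]
    field_simp
    rw [hQ₀, hQ₁, hY₁, hY₂]
    linear_combination (√3 * (2 * θ.2 1 1 * Q₁ ^ 2 - 3 * Q₀ * Y₁ * Y₂ - 4 * Y₁ ^ 2 * Q₁)) * hw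
  have f3 : contactDefect θ * upsilon θ 3 = (3 * Q₀ * Y₁ + θ.2 0 1 - θ.2 1 3) * θ.2 2 1
      - (2 * Y₁ ^ 3 + 3 * Q₀ * θ.2 1 1 * Y₂ + 2 * θ.2 1 1 ^ 2 - θ.2 1 1 * θ.2 2 3) := by
    rw [← hs]
    simp only [upsilon, Matrix.cons_val]
    rw [← contactDefect]
    field_simp
    rw [hQ₀, hY₁, hY₂]
    linear_combination -2 * Y₁ ^ 3 * hw4 - 9 * Q₀ * θ.2 1 1 * Y₂ * hw
  have d : ∀ Y : ℝ, √3 * Y / √3 = Y := fun Y => mul_div_cancel_left₀ Y sqrt3_ne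
  rw [cubicK_eq rfl rfl]
  simp [hat, Jet.pt, Jet.vel, hY₀, hY₁, hY₂, hQ₀, hQ₁, hQ₂, d]
  have f1' : contactDefect θ * upsilon θ 1 * √3 =
      3 * ((3 * Q₀ * Y₁ + θ.2 0 1 - θ.2 1 3) * Q₂
      - (2 * Y₁ ^ 2 + 3 * Q₀ * Q₁ * Y₂ + 2 * Y₁ * Q₁ ^ 2 - Q₁ * θ.2 2 3)) := by
    rw [f1, mul_right_comm, ← sq, hw]
  have f2' : contactDefect θ * upsilon θ 2 * √3 = 3 * ((3 * Q₀ * Y₁ + θ.2 0 1 - θ.2 1 3) * Y₂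
      + 2 * θ.2 1 1 * Q₁ ^ 2 - 3 * Q₀ * Y₁ * Y₂ - 4 * Y₁ ^ 2 * Q₁ - 2 * Y₁ * θ.2 1 1
      + Y₁ * θ.2 2 3) := by
    rw [f2, mul_right_comm, ← sq, hw]
  linear_combination σ ^ 3 * f3 - σ ^ 2 * ρ * f2' + σ * ρ ^ 2 * f1' - ρ ^ 3 * f0

theorem cubic_coeff_eq_zero {a b c d : ℝ}
    (h : ∀ σ ρ : ℝ, a * σ ^ 3 + b * σ ^ 2 * ρ + c * σ * ρ ^ 2 + d * ρ ^ 3 = 0) :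
    a = 0 ∧ b = 0 ∧ c = 0 ∧ d = 0 := by
  have h1 := h 1 0
  have h2 := h 0 1
  have h3 := h 1 1
  have h4 := h 1 (-1)
  norm_num at h1 h2 h3 h4
  refine ⟨h1, ?_, ?_, h2⟩ <;> linarith

theorem upsilon_eq_zero {θ : Jet ℝ 4} (h : contactDefect θ ≠ 0)
    (h0 : ∀ σ ρ, cubicK (hat θ.pt) (hat θ.vel) (hat (Matrix.vecCons 0 (θ.2 2))) σ ρ = 0)
    (i : Fin 4) : upsilon θ i = 0 := by
  have key : ∀ σ ρ : ℝ, (-upsilon θ 3) * σ ^ 3 + (√3 * upsilon θ 2) * σ ^ 2 * ρ +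
      (-√3 * upsilon θ 1) * σ * ρ ^ 2 + upsilon θ 0 * ρ ^ 3 = 0 := by
    intro σ ρ
    have h1 := h0 σ ρ
    rw [cubicK_jet h] at h1
    linear_combination (mul_eq_zero.1 h1).resolve_left h
  obtain ⟨h3, h2, h1, h0⟩ := cubic_coeff_eq_zero key
  have hw := sqrt3_ne
  fin_cases i
  · exact h0
  · simpa [hw] using h1
  · simpa [hw] using h2
  · simpa using h3

theorem HasDerivAt.hat {b : ℝ → Fin 5 → ℝ} {v : Fin 5 → ℝ} {t : ℝ} (h : HasDerivAt b v t) :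
    HasDerivAt (fun s => hat (b s)) (hat v) t := by
  rw [hasDerivAt_pi] at h
  refine hasDerivAt_pi.2 fun i => ?_
  fin_cases i
  exacts [h 0, (h 1).div_const _, h 2, (h 3).div_const _, h 4]

/-- Derivatives of the graph of a smooth curve in the rescaled coordinates. -/
theorem hasDerivAt_hat_graphPt {γ : ℝ → Fin 4 → ℝ} {x : ℝ} (h : ContDiffAt ℝ ∞ γ x) :
    (∀ᶠ t in 𝓝 x, HasDerivAt (fun t => hat (graphPt γ t))
      (hat (Matrix.vecCons 1 (deriv γ t))) t) ∧
    HasDerivAt (fun t => hat (Matrix.vecCons 1 (deriv γ t)))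
      (hat (Matrix.vecCons 0 (iteratedDeriv 2 γ x))) x := by
  constructor
  · have h1 : ContDiffAt ℝ 1 γ x := h.of_le (by exact_mod_cast le_top)
    filter_upwards [h1.eventually (by simp)] with t ht
    exact (hasDerivAt_graphPt (ht.differentiableAt (by simp))).hat
  · refine HasDerivAt.hat (hasDerivAt_pi.2 fun i => ?_)
    have h2 := (holonomicAt_jetOf h).2 1
    refine Fin.cases ?_ (fun j => ?_) i
    · simpa using hasDerivAt_const x (1 : ℝ)
    · simpa [jetOf] using h2 j

/-- The trilinear form vanishes on the four-dimensional space that contains a distinguished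
curve of planes. -/
theorem triple_eq_zero {u v w : Fin 7 → ℝ} (hu : u 0 = 0 ∧ u 2 = 0 ∧ u 5 = 0)
    (hv : v 0 = 0 ∧ v 2 = 0 ∧ v 5 = 0) (hw : w 0 = 0 ∧ w 2 = 0 ∧ w 5 = 0) : triple u v w = 0 := by
  simp [triple, octForm, octCross, hu, hv, hw]

theorem hasDerivAt_eq_zero_of_eventually {f : ℝ → ℝ} {f' x : ℝ} (h : HasDerivAt f f' x)
    (h0 : ∀ᶠ t in 𝓝 x, f t = 0) : f' = 0 :=
  h.unique ((hasDerivAt_const x (0 : ℝ)).congr_of_eventuallyEq h0)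

theorem mulVec_inv (g : Matrix.GeneralLinearGroup (Fin 7) ℝ) (v : Fin 7 → ℝ) :
    ((g⁻¹ : Matrix.GeneralLinearGroup (Fin 7) ℝ) : Matrix (Fin 7) (Fin 7) ℝ).mulVec
      ((g : Matrix (Fin 7) (Fin 7) ℝ).mulVec v) = v := by
  rw [Matrix.mulVec_mulVec, ← Units.val_mul, inv_mul_cancel, Units.val_one, Matrix.one_mulVec]

theorem moved_longRoot_basePlane (g : Matrix (Fin 7) (Fin 7) ℝ) (s : ℝ) :
    moved (g * (1 + s • longRoot)) basePlane = Submodule.span ℝ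
      {g.mulVec (Pi.single 1 1) + s • g.mulVec (Pi.single 3 1),
        g.mulVec (Pi.single 6 1) - s • g.mulVec (Pi.single 4 1)} := by
  have h1 : (1 + s • longRoot : Matrix (Fin 7) (Fin 7) ℝ).mulVec (Pi.single 1 1) =
      Pi.single 1 1 + s • Pi.single 3 1 := by
    ext i
    fin_cases i <;> simp [longRoot, Matrix.single]
  have h6 : (1 + s • longRoot : Matrix (Fin 7) (Fin 7) ℝ).mulVec (Pi.single 6 1) =
      Pi.single 6 1 - s • Pi.single 4 1 := by
    ext i
    fin_cases i <;> simp [longRoot, Matrix.single]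
  rw [basePlane, moved_span_pair, ← Matrix.mulVec_mulVec, ← Matrix.mulVec_mulVec, h1, h6,
    Matrix.mulVec_add, Matrix.mulVec_sub, Matrix.mulVec_smul, Matrix.mulVec_smul]

/-- The cubic form of a distinguished curve vanishes: all its planes lie in one four-dimensional
space, on which the trilinear form is zero. -/
theorem cubicK_distinguished {δ : ℝ → Fin 4 → ℝ} {x : ℝ} (hs : ContDiffAt ℝ ∞ δ x)
    (hd : IsDistinguished δ x) (σ ρ : ℝ) :
    cubicK (hat (graphPt δ x)) (hat (Matrix.vecCons 1 (deriv δ x)))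
      (hat (Matrix.vecCons 0 (iteratedDeriv 2 δ x))) σ ρ = 0 := by
  obtain ⟨g, hg, s, h⟩ := hd
  obtain ⟨hb, hv⟩ := hasDerivAt_hat_graphPt hs
  set G := ((g⁻¹ : Matrix.GeneralLinearGroup (Fin 7) ℝ) : Matrix (Fin 7) (Fin 7) ℝ) with hG
  -- the coordinates `0, 2, 5` of `g⁻¹ v` vanish for all vectors `v` of the moving plane
  have hmem : ∀ᶠ t in 𝓝 x, ∀ v ∈ planeK (graphPt δ t), ∀ i : Fin 7, (i = 0 ∨ i = 2 ∨ i = 5) →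
      G.mulVec v i = 0 := by
    filter_upwards [h] with t ht v hv i hi
    rw [ht, moved_longRoot_basePlane] at hv
    obtain ⟨a, b, rfl⟩ := Submodule.mem_span_pair.1 hv
    simp only [Matrix.mulVec_add, Matrix.mulVec_sub, Matrix.mulVec_smul, hG, mulVec_inv]
    rcases hi with rfl | rfl | rfl <;> simp
  have key : ∀ (f f₁ : ℝ → Fin 7 → ℝ) (f₂ : Fin 7 → ℝ), (∀ᶠ t in 𝓝 x, HasDerivAt f (f₁ t) t) →
      HasDerivAt f₁ f₂ x → (∀ᶠ t in 𝓝 x, f t ∈ planeK (graphPt δ t)) →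
      ∀ i : Fin 7, (i = 0 ∨ i = 2 ∨ i = 5) →
        G.mulVec (f x) i = 0 ∧ G.mulVec (f₁ x) i = 0 ∧ G.mulVec f₂ i = 0 := by
    intro f f₁ f₂ h1 h2 hm i hi
    have e0 : ∀ᶠ t in 𝓝 x, G.mulVec (f t) i = 0 := by
      filter_upwards [hm, hmem] with t h3 h4
      exact h4 _ h3 i hi
    have e1 : ∀ᶠ t in 𝓝 x, G.mulVec (f₁ t) i = 0 := by
      filter_upwards [e0.eventually_nhds, h1] with t h3 h4
      exact hasDerivAt_eq_zero_of_eventually (hasDerivAt_pi.1 (hasDerivAt_mulVec h4 G) i) h3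
    exact ⟨e0.self_of_nhds, e1.self_of_nhds,
      hasDerivAt_eq_zero_of_eventually (hasDerivAt_pi.1 (hasDerivAt_mulVec h2 G) i) e1⟩
  have hA := key _ _ _ (hb.mono fun t ht => ht.kA) (hb.self_of_nhds.kAd hv)
    (Eventually.of_forall fun t => by rw [planeK_eq]; exact Submodule.subset_span (by simp))
  have hB := key _ _ _ (hb.mono fun t ht => ht.kB) (hb.self_of_nhds.kBd hv)
    (Eventually.of_forall fun t => by rw [planeK_eq]; exact Submodule.subset_span (by simp))
  rw [cubicK, cubic, ← triple_mulVec (G2.inv_mem hg)]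
  refine triple_eq_zero ?_ ?_ ?_ <;>
    simp only [Matrix.mulVec_add, Matrix.mulVec_smul, Pi.add_apply, Pi.smul_apply, smul_eq_mul] <;>
    refine ⟨?_, ?_, ?_⟩ <;> simp [hA, hB, ← hG]

/-- For a fixed 1-jet, `Υ` is an affine function of the 2-jet whose linear part is the projection to
the contact distribution along the velocity, and it vanishes on the 2-jets of distinguished curves,
since the cubic form does. -/
theorem upsilon_distinguished {δ : ℝ → Fin 4 → ℝ} {θ : Jet ℝ 4} (hθ : contactDefect θ ≠ 0)
    (hs : ContDiffAt ℝ ∞ δ θ.1) (hd : IsDistinguished δ θ.1) (h0 : δ θ.1 = θ.2 0)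
    (h1 : deriv δ θ.1 = θ.2 1) : ∃ c : ℝ, Matrix.vecCons 0 (θ.2 2 - iteratedDeriv 2 δ θ.1) =
            frameD θ.pt (upsilon θ) + c • θ.vel := by
  have j0 : (jetOf δ θ.1).2 0 = θ.2 0 := by simp [jetOf, h0]
  have j1 : (jetOf δ θ.1).2 1 = θ.2 1 := by simp [jetOf, h1]
  have hs' : contactDefect (jetOf δ θ.1) ≠ 0 := by
    rwa [contactDefect, j0, j1]
  have hu := upsilon_eq_zero hs' (fun σ ρ => by
    have := cubicK_distinguished hs hd σ ρ
    simpa [Jet.pt, Jet.vel, jetOf, graphPt] using this)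
  have hne : θ.2 0 2 * θ.2 1 0 + θ.2 0 1 - θ.2 1 3 ≠ 0 := hθ
  have u0 := hu 0
  have u1 := hu 1
  have u2 := hu 2
  have u3 := hu 3
  simp only [upsilon, Matrix.cons_val, j0, j1] at u0 u1 u2 u3
  have j2 : (jetOf δ θ.1).2 2 = iteratedDeriv 2 δ θ.1 := rfl
  rw [j2] at u0 u1 u2 u3
  set s := θ.2 0 2 * θ.2 1 0 + θ.2 0 1 - θ.2 1 3 with hsdef
  set a := iteratedDeriv 2 δ θ.1
  refine ⟨-upsilon θ 0, ?_⟩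
  have k0 := hne
  field_simp at u0 u1 u2 u3
  ext i
  fin_cases i
  · simp [frameD, Jet.vel, Jet.pt]
  · simp [frameD, Jet.vel, Jet.pt, upsilon, ← hsdef]
    field_simp
    linear_combination (-9) * u2 + 3 * θ.2 1 0 * u0
  · simp [frameD, Jet.vel, Jet.pt, upsilon, ← hsdef]
    field_simp
    linear_combination (-1) * u3 + θ.2 1 1 * u0
  · simp [frameD, Jet.vel, Jet.pt, upsilon, ← hsdef]
    field_simp
    linear_combination (-9) * u1 + 3 * θ.2 1 2 * u0
  · simp [frameD, Jet.vel, Jet.pt, upsilon, ← hsdef]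
    field_simp
    linear_combination (3 * θ.2 1 3 - 3 * θ.2 0 1) * u0 - 9 * θ.2 0 2 * u2
      + 27 * ((θ.2 2 3 - a 3) - θ.2 0 2 * (θ.2 2 0 - a 0)) * hsdef

/-- The inverse function theorem for real functions of one variable. -/
theorem exists_local_inverse {f : ℝ → ℝ} {a : ℝ} (hf : ContDiffAt ℝ ∞ f a) (h : deriv f a ≠ 0) :
    ∃ k : ℝ → ℝ, ContDiffAt ℝ ∞ k (f a) ∧ k (f a) = a ∧ (∀ᶠ t in 𝓝 (f a), f (k t) = t) ∧
      (∀ᶠ s in 𝓝 a, k (f s) = s) := by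
  let e : ℝ ≃L[ℝ] ℝ := ContinuousLinearEquiv.unitsEquivAut ℝ (Units.mk0 _ h)
  have hd : HasFDerivAt f (e : ℝ →L[ℝ] ℝ) a := by
    have h1 := (hf.differentiableAt (by simp)).hasDerivAt.hasFDerivAt
    have he : (e : ℝ →L[ℝ] ℝ) = ContinuousLinearMap.toSpanSingleton ℝ (deriv f a) := by
      ext
      simp [e]
    rw [he]
    exact h1
  have hn : (∞ : WithTop ℕ∞) ≠ 0 := by simp
  have hs := hf.hasStrictFDerivAt' hd hn
  exact ⟨hf.localInverse hd hn, hf.to_localInverse hd hn, hf.localInverse_apply_image hd hn,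
    hs.eventually_right_inverse, hs.eventually_left_inverse⟩

/-- Coordinates of the plane spanned by two moving vectors. -/
theorem hasDerivAt_chartK {v₀ v' w₀ w' : Fin 7 → ℝ} (h1 : v₀ 1 = 1) (h6 : v₀ 6 = 0)
    (g1 : w₀ 1 = 0) (g6 : w₀ 6 = 1) : HasDerivAt (fun s : ℝ => chartK (v₀ + s • v') (w₀ + s • w'))
      (![-w' 5 + w' 1 * v₀ 5 + w' 6 * w₀ 5, v' 0 - v' 6 * w₀ 0 - v' 1 * v₀ 0,
        -v' 2 + v' 6 * w₀ 2 + v' 1 * v₀ 2, v' 5 - v' 6 * w₀ 5 - v' 1 * v₀ 5,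
        2 * (v' 5 - v' 6 * w₀ 5 - v' 1 * v₀ 5) * v₀ 0
          + 2 * v₀ 5 * (v' 0 - v' 6 * w₀ 0 - v' 1 * v₀ 0)
          - w' 4 + w' 1 * v₀ 4 + w' 6 * w₀ 4]) 0 := by
  have L : ∀ i, HasDerivAt (fun s : ℝ => v₀ i + s * v' i) (v' i) 0 := fun i => by
    simpa using ((hasDerivAt_id (0 : ℝ)).mul_const (v' i)).const_add (v₀ i)
  have M : ∀ i, HasDerivAt (fun s : ℝ => w₀ i + s * w' i) (w' i) 0 := fun i => by
    simpa using ((hasDerivAt_id (0 : ℝ)).mul_const (w' i)).const_add (w₀ i)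
  have hΔ := ((L 1).mul (M 6)).sub ((L 6).mul (M 1))
  have h0 : (v₀ 1 + 0 * v' 1) * (w₀ 6 + 0 * w' 6) - (v₀ 6 + 0 * v' 6) * (w₀ 1 + 0 * w' 1) ≠ 0 := by
    simp [h1, h6, g1, g6]
  have hy := (((M 6).mul (L 0)).sub ((L 6).mul (M 0))).div hΔ h0
  have hp := ((((M 6).mul (L 2)).sub ((L 6).mul (M 2))).neg).div hΔ h0
  have hq := (((M 6).mul (L 5)).sub ((L 6).mul (M 5))).div hΔ h0
  have hx := ((((L 1).mul (M 5)).sub ((M 1).mul (L 5))).neg).div hΔ h0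
  have hz := (((hq.const_mul 2).mul hy)).sub ((((L 1).mul (M 4)).sub ((M 1).mul (L 4))).div hΔ h0)
  refine hasDerivAt_pi.2 fun i => ?_
  fin_cases i
  · exact hx.congr_deriv (by simp [h1, h6, g1, g6]; ring)
  · exact hy.congr_deriv (by simp [h1, h6, g1, g6]; ring)
  · exact hp.congr_deriv (by simp [h1, h6, g1, g6]; ring)
  · exact hq.congr_deriv (by simp [h1, h6, g1, g6]; ring)
  · exact hz.congr_deriv (by simp [h1, h6, g1, g6]; ring)

theorem contDiffAt_chartK {v₀ v' w₀ w' : Fin 7 → ℝ} (h1 : v₀ 1 = 1) (h6 : v₀ 6 = 0)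
    (g1 : w₀ 1 = 0) (g6 : w₀ 6 = 1) :
    ContDiffAt ℝ ∞ (fun s : ℝ => chartK (v₀ + s • v') (w₀ + s • w')) 0 := by
  have L : ∀ i, ContDiffAt ℝ ∞ (fun s : ℝ => v₀ i + s * v' i) 0 := fun i => by fun_prop
  have M : ∀ i, ContDiffAt ℝ ∞ (fun s : ℝ => w₀ i + s * w' i) 0 := fun i => by fun_prop
  have hΔ := ((L 1).mul (M 6)).sub ((L 6).mul (M 1))
  have h0 : (v₀ 1 + 0 * v' 1) * (w₀ 6 + 0 * w' 6) - (v₀ 6 + 0 * v' 6) * (w₀ 1 + 0 * w' 1) ≠ 0 := by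
    simp [h1, h6, g1, g6]
  have hy := (((M 6).mul (L 0)).sub ((L 6).mul (M 0))).div hΔ h0
  have hp := ((((M 6).mul (L 2)).sub ((L 6).mul (M 2))).neg).div hΔ h0
  have hq := (((M 6).mul (L 5)).sub ((L 6).mul (M 5))).div hΔ h0
  have hx := ((((L 1).mul (M 5)).sub ((M 1).mul (L 5))).neg).div hΔ h0
  have hz := (((contDiffAt_const (c := (2 : ℝ))).mul hq).mul hy).sub
    ((((L 1).mul (M 4)).sub ((M 1).mul (L 4))).div hΔ h0)
  refine contDiffAt_pi.2 fun i => ?_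
  fin_cases i
  exacts [hx, hy, hp, hq, hz]

theorem chartK_kA_kB (b : Fin 5 → ℝ) : chartK (kA b) (kB b) = b := by
  ext i
  fin_cases i <;> simp [chartK, kA, kB]

/-- An element of the stabilizer of the base plane. -/
def fixK (x p y q : ℝ) (v : Fin 7 → ℝ) : Fin 7 → ℝ := expPosX x (expPosP p (expPosY y (expPosQ q v)))

theorem isAut_fixK (x p y q : ℝ) : IsAut (fixK x p y q) :=
  (isAut_expPosX _).comp ((isAut_expPosP _).comp ((isAut_expPosY _).comp (isAut_expPosQ _)))

theorem fixK_single_one (x p y q : ℝ) : fixK x p y q (Pi.single 1 1) = Pi.single 1 1 := by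
  ext i
  fin_cases i <;> simp [fixK, expPosX, expPosP, expPosY, expPosQ]

theorem fixK_single_six (x p y q : ℝ) : fixK x p y q (Pi.single 6 1) = Pi.single 6 1 := by
  ext i
  fin_cases i <;> simp [fixK, expPosX, expPosP, expPosY, expPosQ]

theorem fixK_single_three (x p y q : ℝ) : fixK x p y q (Pi.single 3 1) =
    ![y, p * x + q * y, -p, 1, 0, q, p * q - y ^ 2] := by
  ext i
  fin_cases i <;> simp [fixK, expPosX, expPosP, expPosY, expPosQ] <;> ring

theorem fixK_single_four (x p y q : ℝ) : fixK x p y q (Pi.single 4 1) =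
    ![q, -q ^ 2 + x * y, -y, 0, 1, x, -2 * q * y] := by
  ext i
  fin_cases i <;> simp [fixK, expPosX, expPosP, expPosY, expPosQ] <;> ring

/-- The distinguished curve through the plane with the coordinates `b` that is obtained from the
standard one by `fixK` and `heis` has the velocity `(x, …)` transversal to the contact
distribution. -/
theorem hasDerivAt_chartK_fixK (b : Fin 5 → ℝ) (x p y q : ℝ) :
    HasDerivAt (fun s : ℝ => chartK (kA b + s • heis b (fixK x p y q (Pi.single 3 1)))
      (kB b + s • -heis b (fixK x p y q (Pi.single 4 1))))
      ![x, y, p, q, 1 + 3 * b 3 * y + x * b 2] 0 := by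
  rw [fixK_single_three, fixK_single_four]
  refine (hasDerivAt_chartK rfl rfl rfl rfl).congr_deriv ?_
  ext i
  fin_cases i <;> simp [heis, expNegX, expNegY, expNegP, expNegQ, expNegZ, kA, kB] <;> ring

/-- There is a distinguished curve through each point of `K` in each direction transversal to the
contact distribution: the stabilizer of the point acts transitively on these directions. -/
theorem exists_distinguished {θ : Jet ℝ 4} (hθ : contactDefect θ ≠ 0) :
    ∃ δ : ℝ → Fin 4 → ℝ, ContDiffAt ℝ ∞ δ θ.1 ∧ IsDistinguished δ θ.1 ∧
      δ θ.1 = θ.2 0 ∧ deriv δ θ.1 = θ.2 1 := by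
  set S := contactDefect θ with hS
  set b := hat θ.pt with hb
  set V := hat θ.vel with hV
  obtain ⟨f, hfe⟩ : ∃ f : (Fin 7 → ℝ) → Fin 7 → ℝ,
      f = fun v => heis b (fixK (-1 / S) (-V 2 / S) (-V 1 / S) (-V 3 / S) v) := ⟨_, rfl⟩
  have hf : IsAut f := hfe ▸ (isAut_heis b).comp (isAut_fixK _ _ _ _)
  have f1 : f (Pi.single 1 1) = kA b := by
    simp only [hfe, fixK_single_one, heis_single_one]
  have f6 : f (Pi.single 6 1) = kB b := by
    simp only [hfe, fixK_single_six, heis_single_six]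
  obtain ⟨g, hg, hgf⟩ := hf
  set v' := f (Pi.single 3 1) with hv'
  set w' := -f (Pi.single 4 1) with hw'
  obtain ⟨β, hβe⟩ : ∃ β : ℝ → Fin 5 → ℝ, β = fun s => chartK (kA b + s • v') (kB b + s • w') :=
    ⟨_, rfl⟩
  have hβ0 : β 0 = b := by simp only [hβe, zero_smul, add_zero, chartK_kA_kB]
  have hβ : HasDerivAt β ((-1 / S) • V) 0 := by
    simp only [hβe, hv', hw', hfe]
    refine (hasDerivAt_chartK_fixK b _ _ _ _).congr_deriv ?_
    have hSV : S = 3 * b 3 * V 1 + b 2 - V 4 := by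
      simp [hS, contactDefect, hb, hV, hat, Jet.pt, Jet.vel]
      field_simp
      rw [sqrt3_sq]
    have hV0 : V 0 = 1 := by simp [hV, hat, Jet.vel]
    ext i
    fin_cases i <;> simp [hV0] <;> field_simp
    linear_combination hSV
  have hβs : ContDiffAt ℝ ∞ β 0 := hβe ▸ contDiffAt_chartK rfl rfl rfl rfl
  have hx : HasDerivAt (fun s => β s 0) (-1 / S) 0 := by
    simpa [hV, hat, Jet.vel] using hasDerivAt_pi.1 hβ 0
  have hb0 : β 0 0 = θ.1 := by rw [hβ0, hb]; rfl
  obtain ⟨k, hk, hk0, hkr, -⟩ := exists_local_inverse (contDiffAt_pi.1 hβs 0)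
    (by rw [hx.deriv]; exact div_ne_zero (by norm_num) hθ)
  simp only [hb0] at hk hk0 hkr
  have hkd : HasDerivAt k (-S) θ.1 := by
    have h1 := (hk.differentiableAt (by simp)).hasDerivAt
    rw [← hk0] at hx
    have h2 := (hx.comp θ.1 h1).unique ((hasDerivAt_id θ.1).congr_of_eventuallyEq hkr)
    have h3 : deriv k θ.1 = -S := by field_simp at h2; linarith
    rwa [h3] at h1
  have hu : ∀ i : Fin 5, ∃ c : ℝ, ∀ b, unhat b i = c * b i ∧ c * hat b i = b i := by
    intro i
    have := sqrt3_ne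
    fin_cases i
    · exact ⟨1, fun b => by simp [hat, unhat]⟩
    · exact ⟨√3, fun b => by simp [hat, unhat]; field_simp⟩
    · exact ⟨1, fun b => by simp [hat, unhat]⟩
    · exact ⟨√3, fun b => by simp [hat, unhat]; field_simp⟩
    · exact ⟨1, fun b => by simp [hat, unhat]⟩
  have hδ : ∀ i : Fin 5, HasDerivAt (fun t => unhat (β (k t)) i) (θ.vel i) θ.1 := by
    intro i
    obtain ⟨c, hc⟩ := hu i
    simp only [fun b => (hc b).1]
    rw [← hk0] at hβ
    have h1 := ((hasDerivAt_pi.1 hβ i).comp θ.1 hkd).const_mul c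
    refine h1.congr_deriv ?_
    rw [← (hc θ.vel).2, ← hV, Pi.smul_apply, smul_eq_mul]
    field_simp
  refine ⟨fun t i => unhat (β (k t)) i.succ, ?_, ?_, ?_, ?_⟩
  · refine contDiffAt_pi.2 fun i => ?_
    obtain ⟨c, hc⟩ := hu i.succ
    simp only [fun b => (hc b).1]
    rw [← hk0] at hβs
    exact contDiffAt_const.mul ((contDiffAt_pi.1 hβs i.succ).comp θ.1 hk)
  · refine ⟨g, hg, k, ?_⟩
    have hne : ∀ᶠ t in 𝓝 θ.1, (kA b + k t • v') 1 * (kB b + k t • w') 6 -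
        (kA b + k t • v') 6 * (kB b + k t • w') 1 ≠ 0 := by
      refine ContinuousAt.eventually_ne ?_ ?_
      · have := hk.continuousAt
        simp only [Pi.add_apply, Pi.smul_apply]
        fun_prop
      · simp [hk0, kA, kB]
    filter_upwards [hkr, hne] with t ht hne
    have hG : graphPt (fun t i => unhat (β (k t)) i.succ) t = unhat (β (k t)) := by
      ext i
      refine Fin.cases ?_ (fun j => rfl) i
      simpa [graphPt, unhat] using ht.symm
    rw [hG, moved_longRoot_basePlane, hgf, hgf, hgf, hgf, f1, f6]
    have e : kB b - k t • f (Pi.single 4 1) = kB b + k t • w' := by rw [hw', smul_neg, sub_eq_add_neg]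
    rw [e]
    simp only [hβe]
    refine (span_eq_planeK ?_ hne).symm
    rw [← e, ← f1, ← f6, hv', ← hgf, ← hgf, ← hgf, ← hgf, ← Matrix.mulVec_smul,
      ← Matrix.mulVec_smul, ← Matrix.mulVec_add, ← Matrix.mulVec_sub, ← hg]
    have e0 : octCross (Pi.single 1 1 + k t • Pi.single 3 1 : Fin 7 → ℝ)
        (Pi.single 6 1 - k t • Pi.single 4 1) = 0 := by
      ext i
      fin_cases i <;> simp [octCross]
    rw [e0, Matrix.mulVec_zero]
  · ext i
    simp only [hk0, hβ0, hb, unhat_hat]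
    rfl
  · exact (hasDerivAt_pi.2 fun i : Fin 4 => hδ i.succ).deriv

/-! ### The domain of the right lifts -/

theorem isOpen_contact : IsOpen {θ : Jet ℝ 4 | contactDefect θ ≠ 0} :=
  isOpen_ne_fun (by unfold contactDefect; fun_prop) continuous_const

theorem isRat_upsilon (i : Fin 4) :
    IsRat {θ | contactDefect θ ≠ 0} 2 (fun θ => upsilon θ i) := by
  have c0 : ∀ i, IsRat {θ | contactDefect θ ≠ 0} 2 (fun θ => θ.2 0 i) :=
    fun i => IsRat.coord (by norm_num) i
  have c1 : ∀ i, IsRat {θ | contactDefect θ ≠ 0} 2 (fun θ => θ.2 1 i) :=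
    fun i => IsRat.coord (by norm_num) i
  have c2 : ∀ i, IsRat {θ | contactDefect θ ≠ 0} 2 (fun θ => θ.2 2 i) :=
    fun i => IsRat.coord (by norm_num) i
  have k : ∀ c, IsRat {θ | contactDefect θ ≠ 0} 2 (fun _ => c) := IsRat.const
  have hs : IsRat {θ | contactDefect θ ≠ 0} 2 contactDefect :=
    (((c0 2).mul (c1 0)).add (c0 1)).sub (c1 3)
  have h9 := (k 9).mul hs
  have h3 := (k 3).mul hs
  have n9 : ∀ θ ∈ {θ | contactDefect θ ≠ 0}, 9 * contactDefect θ ≠ 0 :=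
    fun θ hθ => mul_ne_zero (by norm_num) hθ
  have n3 : ∀ θ ∈ {θ | contactDefect θ ≠ 0}, 3 * contactDefect θ ≠ 0 :=
    fun θ hθ => mul_ne_zero (by norm_num) hθ
  fin_cases i
  · exact ((((((k (2 * √3)).mul ((c1 2).pow 3)).sub (((k 9).mul (c0 2)).mul (c2 0))).sub
      (((k 18).mul (c1 0)).mul (c1 2))).add ((k 9).mul (c2 3)))).div h9 n9
  · exact (c2 2).sub ((((((k (2 * √3)).mul ((c1 0).pow 2)).add
      ((((k 3).mul (c0 2)).mul (c1 2)).mul (c2 0))).add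
      (((k 2).mul (c1 0)).mul ((c1 2).pow 2))).sub (((k 3).mul (c1 2)).mul (c2 3))).div h3 n3)
  · exact (c2 0).add ((((((((k (2 * √3)).mul (c1 1)).mul ((c1 2).pow 2)).sub
      ((((k 3).mul (c0 2)).mul (c1 0)).mul (c2 0))).sub
      (((k 4).mul ((c1 0).pow 2)).mul (c1 2))).sub (((k 6).mul (c1 0)).mul (c1 1))).add
      (((k 3).mul (c1 0)).mul (c2 3))).div h3 n3)
  · exact (c2 1).sub ((((((k (2 * √3)).mul ((c1 0).pow 3)).add
      ((((k 9).mul (c0 2)).mul (c1 1)).mul (c2 0))).add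
      ((k 18).mul ((c1 1).pow 2))).sub (((k 9).mul (c1 1)).mul (c2 3))).div h9 n9)

theorem isRat_secLead : IsRat {θ | contactDefect θ ≠ 0} 2 (fun θ => secLead (upsilon θ)) :=
  (((IsRat.const √3).mul (isRat_upsilon 0)).mul (isRat_upsilon 2)).sub ((isRat_upsilon 1).pow 2)

theorem isRat_secMid : IsRat {θ | contactDefect θ ≠ 0} 2 (fun θ => secMid (upsilon θ)) :=
  (((IsRat.const 3).mul (isRat_upsilon 0)).mul (isRat_upsilon 3)).sub
    ((isRat_upsilon 1).mul (isRat_upsilon 2))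

theorem isRat_secDisc : IsRat {θ | contactDefect θ ≠ 0} 2 (fun θ => secDisc (upsilon θ)) :=
  (isRat_secMid.pow 2).sub (((IsRat.const 4).mul isRat_secLead).mul
    ((((IsRat.const √3).mul (isRat_upsilon 1)).mul (isRat_upsilon 3)).sub ((isRat_upsilon 2).pow 2)))

theorem IsRat.isOpen {S : Set (Jet ℝ 4)} {k : ℕ} {R : Jet ℝ 4 → ℝ} (hS : IsOpen S)
    (h : IsRat S k R) {T : Set ℝ} (hT : IsOpen T) : IsOpen {θ | θ ∈ S ∧ R θ ∈ T} :=
  h.continuousOn.isOpen_inter_preimage hS hT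

/-- A rational function on the complement of a hypersurface that is non-zero at `θ₀` is non-zero on
the complement of a larger hypersurface that does not contain `θ₀`. -/
theorem IsRat.exists_poly_ne_zero {S : Set (Jet ℝ 4)} {k : ℕ} {R : Jet ℝ 4 → ℝ} {P : JetPoly}
    (h : IsRat S k R) (hS : ∀ θ, P.evalAt θ ≠ 0 → θ ∈ S) {θ₀ : Jet ℝ 4} (hP : P.evalAt θ₀ ≠ 0)
    (h0 : R θ₀ ≠ 0) : ∃ P' : JetPoly, P'.evalAt θ₀ ≠ 0 ∧ ∀ θ, P'.evalAt θ ≠ 0 →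
      P.evalAt θ ≠ 0 ∧ R θ ≠ 0 := by
  obtain ⟨N, W, -, -, e⟩ := h
  refine ⟨P * N, ?_, fun θ hθ => ?_⟩
  · rw [(e _ (hS _ hP)).2] at h0
    rw [JetPoly.evalAt_mul]
    exact mul_ne_zero hP (div_ne_zero_iff.1 h0).1
  · rw [JetPoly.evalAt_mul] at hθ
    have h1 := e θ (hS θ (left_ne_zero_of_mul hθ))
    exact ⟨left_ne_zero_of_mul hθ, h1.2 ▸ div_ne_zero (right_ne_zero_of_mul hθ) h1.1⟩

/-- The polynomial `q y₁ + p - z₁`. -/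
noncomputable def contactPoly : JetPoly :=
  MvPolynomial.X (some (0, 2)) * MvPolynomial.X (some (1, 0)) + MvPolynomial.X (some (0, 1))
    - MvPolynomial.X (some (1, 3))

theorem evalAt_contactPoly (θ : Jet ℝ 4) : contactPoly.evalAt θ = contactDefect θ := by
  simp only [contactPoly, JetPoly.evalAt_sub, JetPoly.evalAt_add, JetPoly.evalAt_mul,
    JetPoly.evalAt_X_some, contactDefect]

theorem GenK_subset : GenK ⊆ {θ | contactDefect θ ≠ 0} := fun _ h => h.1

theorem isOpen_GenK : IsOpen GenK := by
  have h1 := isRat_secLead.isOpen isOpen_contact (T := {0}ᶜ) isOpen_compl_singleton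
  have h2 := isRat_secDisc.isOpen isOpen_contact (T := {0}ᶜ) isOpen_compl_singleton
  convert h1.inter h2 using 1
  ext θ
  exact ⟨fun h => ⟨⟨h.1, h.2.1⟩, h.1, h.2.2⟩, fun h => ⟨h.1.1, h.1.2, h.2.2⟩⟩

/-- A jet with `Υ = ∂ₓ + p∂_z + c(∂_y + q∂_z)`. Its discriminant has the sign of `c`. -/
def sampleJet (c : ℝ) : Jet ℝ 4 :=
  (0, fun k => if k = 0 then ![0, 1, 0, 0] else if k = 2 then ![c, 0, 0, 1] else 0)

theorem contactDefect_sampleJet (c : ℝ) : contactDefect (sampleJet c) = 1 := by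
  simp [contactDefect, sampleJet]

theorem upsilon_sampleJet (c : ℝ) : upsilon (sampleJet c) = ![1, 0, c, 0] := by
  ext i
  fin_cases i <;> simp [upsilon, sampleJet]

theorem secLead_sampleJet (c : ℝ) : secLead (upsilon (sampleJet c)) = √3 * c := by
  simp [upsilon_sampleJet, secLead]

theorem secDisc_sampleJet (c : ℝ) : secDisc (upsilon (sampleJet c)) = 4 * √3 * c ^ 3 := by
  simp [upsilon_sampleJet, secDisc, secMid, secLead]; ring

/-- The domain of the right lifts contains the complement of a hypersurface. -/
theorem exists_poly_GenK {c : ℝ} (hc : c ≠ 0) : ∃ P : JetPoly, P.evalAt (sampleJet c) ≠ 0 ∧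
    ∀ θ, P.evalAt θ ≠ 0 → θ ∈ GenK := by
  have h0 : contactPoly.evalAt (sampleJet c) ≠ 0 := by
    rw [evalAt_contactPoly, contactDefect_sampleJet]; exact one_ne_zero
  have hS : ∀ θ : Jet ℝ 4, contactPoly.evalAt θ ≠ 0 → θ ∈ {θ | contactDefect θ ≠ 0} :=
    fun θ h => by rwa [evalAt_contactPoly] at h
  have h3 := sqrt3_ne
  obtain ⟨P, hP, hP'⟩ := isRat_secLead.exists_poly_ne_zero hS h0 (by rw [secLead_sampleJet]; positivity)
  obtain ⟨P', h, h'⟩ := isRat_secDisc.exists_poly_ne_zero (P := P) (fun θ h => hS θ (hP' θ h).1) hP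
    (by rw [secDisc_sampleJet]; positivity)
  exact ⟨P', h, fun θ hθ => ⟨hS θ (hP' θ (h' θ hθ).1).1, (hP' θ (h' θ hθ).1).2, (h' θ hθ).2⟩⟩

theorem dense_GenK : Dense GenK := by
  obtain ⟨P, h, h'⟩ := exists_poly_GenK one_ne_zero
  exact (dense_evalAt_ne_zero h).mono h'

/-! ### The secant points -/

theorem csqrt_of_nonneg {d : ℝ} (hd : 0 ≤ d) : csqrt d = (√d : ℂ) := by
  simp [csqrt, Real.sqrt_eq_zero_of_nonpos (neg_nonpos.2 hd)]

theorem csqrt_of_nonpos {d : ℝ} (hd : d ≤ 0) : csqrt d = Complex.I * (√(-d) : ℂ) := by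
  simp [csqrt, Real.sqrt_eq_zero_of_nonpos hd]

theorem csqrt_sq (d : ℝ) : csqrt d ^ 2 = d := by
  rcases le_total 0 d with h | h
  · rw [csqrt_of_nonneg h, ← Complex.ofReal_pow, Real.sq_sqrt h]
  · rw [csqrt_of_nonpos h, mul_pow, ← Complex.ofReal_pow, Real.sq_sqrt (by linarith)]
    simp

theorem csqrt_ne_zero {d : ℝ} (hd : d ≠ 0) : csqrt d ≠ 0 := fun h => by
  have := csqrt_sq d
  rw [h] at this
  exact hd (by simpa using this.symm)

theorem continuous_csqrt : Continuous csqrt := by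
  unfold csqrt
  fun_prop

theorem hasDerivAt_csqrt {d : ℝ} (hd : d ≠ 0) : HasDerivAt csqrt (csqrt d / (2 * d)) d := by
  have hd' : (d : ℂ) ≠ 0 := by exact_mod_cast hd
  rcases hd.lt_or_gt with h | h
  · have h1 : HasDerivAt (fun d : ℝ => ((√(-d) : ℝ) : ℂ)) ((-1 / (2 * √(-d)) : ℝ) : ℂ) d :=
      ((hasDerivAt_neg d).sqrt (by linarith)).ofReal_comp
    refine ((h1.const_mul Complex.I).congr_deriv ?_).congr_of_eventuallyEq
      ((gt_mem_nhds h).mono fun t ht => csqrt_of_nonpos (le_of_lt ht))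
    have hs : ((√(-d) : ℝ) : ℂ) ≠ 0 := by exact_mod_cast (Real.sqrt_pos.2 (by linarith)).ne'
    have h2 : ((√(-d) : ℝ) : ℂ) ^ 2 = -d := by
      rw [← Complex.ofReal_pow, Real.sq_sqrt (by linarith)]; simp
    rw [csqrt_of_nonpos h.le]
    push_cast
    field_simp
    rw [h2]
  · have h1 : HasDerivAt (fun d : ℝ => ((√d : ℝ) : ℂ)) ((1 / (2 * √d) : ℝ) : ℂ) d :=
      ((hasDerivAt_id d).sqrt h.ne').ofReal_comp
    refine (h1.congr_deriv ?_).congr_of_eventuallyEq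
      ((lt_mem_nhds h).mono fun t ht => csqrt_of_nonneg (le_of_lt ht))
    have hs : ((√d : ℝ) : ℂ) ≠ 0 := by exact_mod_cast (Real.sqrt_pos.2 h).ne'
    have h2 : ((√d : ℝ) : ℂ) ^ 2 = d := by
      rw [← Complex.ofReal_pow, Real.sq_sqrt h.le]
    rw [csqrt_of_nonneg h.le]
    push_cast
    field_simp
    rw [h2]

theorem unit_cast_sq (ε : ℤˣ) : ((ε : ℤ) : ℂ) ^ 2 = 1 := by
  rcases Int.units_eq_one_or ε with rfl | rfl <;> simp

section secant

variable {v : Fin 4 → ℝ}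

theorem complex_sqrt3_sq : ((√3 : ℝ) : ℂ) ^ 2 = 3 := by
  rw [← Complex.ofReal_pow, sqrt3_sq]; norm_num

theorem lam_quadratic (hL : secLead v ≠ 0) (ε : ℤˣ) :
    2 * (secLead v : ℂ) * lam ε v - (secMid v : ℂ) = ((ε : ℤ) : ℂ) * csqrt (secDisc v) := by
  have : (secLead v : ℂ) ≠ 0 := by exact_mod_cast hL
  rw [lam]
  field_simp
  ring

/-- The quadratic equation for the secant points. -/
theorem quadratic_iff (hL : secLead v ≠ 0) (r : ℂ) :
    (secLead v : ℂ) * r ^ 2 - (secMid v : ℂ) * r + (√3 * v 1 * v 3 - v 2 ^ 2 : ℝ) = 0 ↔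
      ∃ ε : ℤˣ, r = lam ε v := by
  have hL' : (secLead v : ℂ) ≠ 0 := by exact_mod_cast hL
  have hs := csqrt_sq (secDisc v)
  have hd : ((secDisc v : ℝ) : ℂ) = (secMid v : ℂ) ^ 2 -
      4 * (secLead v : ℂ) * (√3 * v 1 * v 3 - v 2 ^ 2 : ℝ) := by
    rw [secDisc]; push_cast; ring
  constructor
  · intro h
    have h2 : (2 * (secLead v : ℂ) * r - secMid v) ^ 2 = csqrt (secDisc v) ^ 2 := by
      rw [hs, hd]; linear_combination 4 * (secLead v : ℂ) * h
    rcases sq_eq_sq_iff_eq_or_eq_neg.1 h2 with h3 | h3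
    · refine ⟨1, ?_⟩
      rw [lam, eq_div_iff (mul_ne_zero two_ne_zero hL')]
      simp only [Units.val_one, Int.cast_one]
      linear_combination h3
    · refine ⟨-1, ?_⟩
      rw [lam, eq_div_iff (mul_ne_zero two_ne_zero hL')]
      simp only [Units.val_neg, Units.val_one, Int.cast_neg, Int.cast_one]
      linear_combination h3
  · rintro ⟨ε, rfl⟩
    have h1 := lam_quadratic hL ε
    have h2 : 4 * (secLead v : ℂ) * ((secLead v : ℂ) * lam ε v ^ 2 - (secMid v : ℂ) * lam ε v +
        (√3 * v 1 * v 3 - v 2 ^ 2 : ℝ)) = 0 := by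
      linear_combination (2 * (secLead v : ℂ) * lam ε v - (secMid v : ℂ) +
        ((ε : ℤ) : ℂ) * csqrt (secDisc v)) * h1 + csqrt (secDisc v) ^ 2 * unit_cast_sq ε + hs + hd
    exact (mul_eq_zero.1 h2).resolve_left (mul_ne_zero (by norm_num) hL')

theorem lam_add (hL : secLead v ≠ 0) (ε : ℤˣ) :
    (secLead v : ℂ) * (lam ε v + lam (-ε) v) = secMid v := by
  have h1 := lam_quadratic hL ε
  have h2 := lam_quadratic hL (-ε)
  simp only [Units.val_neg, Int.cast_neg] at h2
  linear_combination (h1 + h2) / 2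

theorem lam_mul (hL : secLead v ≠ 0) (ε : ℤˣ) :
    (secLead v : ℂ) * (lam ε v * lam (-ε) v) = (√3 * v 1 * v 3 - v 2 ^ 2 : ℝ) := by
  have h1 := (quadratic_iff hL _).2 ⟨ε, rfl⟩
  have h2 := lam_add hL ε
  linear_combination lam ε v * h2 - h1

theorem lam_ne (hL : secLead v ≠ 0) (hd : secDisc v ≠ 0) (ε : ℤˣ) : lam ε v ≠ lam (-ε) v := by
  intro h
  have h1 := lam_quadratic hL ε
  have h2 := lam_quadratic hL (-ε)
  rw [← h] at h2
  simp only [Units.val_neg, Int.cast_neg] at h2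
  have h3 : ((ε : ℤ) : ℂ) * csqrt (secDisc v) = 0 := by linear_combination (h2 - h1) / 2
  rcases mul_eq_zero.1 h3 with h4 | h4
  · have := unit_cast_sq ε
    rw [h4] at this
    simp at this
  · exact csqrt_ne_zero hd h4

theorem isSecantPt_iff (hL : secLead v ≠ 0) (hd : secDisc v ≠ 0) (r : ℂ) :
    IsSecantPt v r ↔ ∃ ε : ℤˣ, r = lam ε v := by
  have hw := complex_sqrt3_sq
  have hw0 : ((√3 : ℝ) : ℂ) ≠ 0 := by exact_mod_cast sqrt3_ne
  constructor
  · rintro ⟨s, -, h⟩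
    obtain ⟨α, β, h⟩ := Submodule.mem_span_pair.1 h
    have h0 := congrFun h 0
    have h1 := congrFun h 1
    have h2 := congrFun h 2
    have h3 := congrFun h 3
    simp only [xi, Pi.add_apply, Pi.smul_apply, smul_eq_mul, Matrix.cons_val] at h0 h1 h2 h3
    rw [← quadratic_iff hL, secLead, secMid]
    push_cast
    rw [← h0, ← h1, ← h2, ← h3]
    generalize ((√3 : ℝ) : ℂ) = w at *
    linear_combination (α * β * r * s ^ 3 + α * β * r ^ 4 + α ^ 2 * r ^ 4 + β ^ 2 * r * s ^ 3) * hw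
  · rintro ⟨ε, rfl⟩
    have hne := lam_ne hL hd ε
    have ha := lam_add hL ε
    have hm := lam_mul hL ε
    have hL' : (secLead v : ℂ) ≠ 0 := by exact_mod_cast hL
    refine ⟨lam (-ε) v, hne.symm, ?_⟩
    obtain ⟨b, hb⟩ : ∃ b : ℂ, (v 1 : ℂ) = ((√3 : ℝ) : ℂ) * b := ⟨v 1 / ((√3 : ℝ) : ℂ), by field_simp⟩
    obtain ⟨c, hc⟩ : ∃ c : ℂ, (v 2 : ℂ) = ((√3 : ℝ) : ℂ) * c := ⟨v 2 / ((√3 : ℝ) : ℂ), by field_simp⟩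
    generalize lam ε v = r at *
    generalize lam (-ε) v = s at *
    have hrs : r - s ≠ 0 := sub_ne_zero.2 hne
    have hLe : (secLead v : ℂ) = 3 * ((v 0 : ℂ) * c - b ^ 2) := by
      rw [secLead]; push_cast; rw [hb, hc]; linear_combination ((v 0 : ℂ) * c - b ^ 2) * hw
    have ha' : ((v 0 : ℂ) * c - b ^ 2) * (r + s) = (v 0 : ℂ) * v 3 - b * c := by
      rw [hLe, secMid] at ha; push_cast at ha; rw [hb, hc] at ha
      linear_combination ha / 3 - (b * c / 3) * hw
    have hm' : ((v 0 : ℂ) * c - b ^ 2) * (r * s) = b * v 3 - c ^ 2 := by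
      rw [hLe] at hm; push_cast at hm; rw [hb, hc] at hm
      linear_combination hm / 3 + ((b * v 3 - c ^ 2) / 3) * hw
    have hL0 : (v 0 : ℂ) * c - b ^ 2 ≠ 0 := by
      intro h
      rw [hLe, h, mul_zero] at hL'
      exact hL' rfl
    have e2 : c = (r + s) * b - r * s * v 0 := by
      apply mul_left_cancel₀ hL0
      linear_combination -b * ha' + v 0 * hm'
    have e3 : (v 3 : ℂ) = (r + s) * c - r * s * b := by
      apply mul_left_cancel₀ hL0
      linear_combination -c * ha' + b * hm'
    refine Submodule.mem_span_pair.2 ⟨(b - v 0 * s) / (r - s), (v 0 * r - b) / (r - s), ?_⟩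
    funext i
    fin_cases i <;>
      simp only [xi, Pi.add_apply, Pi.smul_apply, smul_eq_mul, Matrix.cons_val, Fin.zero_eta,
        Fin.mk_one, Fin.reduceFinMk, hb, hc] <;> field_simp
    · ring
    · ring
    · linear_combination (-(r - s)) * e2
    · linear_combination (-(r - s)) * e3 - (r - s) * (r + s) * e2

end secant

/-! ### Functions that are algebraic over the rational functions -/

/-- On `S` the pair of functions `F 1`, `F (-1)` is of the form `R₁ ± R₂ √δ`, where `R₁` and `R₂`
are rational functions on the space of `k`-jets and `δ` is the discriminant. -/
def IsAlg (S : Set (Jet ℝ 4)) (k : ℕ) (F : ℤˣ → Jet ℝ 4 → ℂ) : Prop :=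
  ∃ R₁ R₂ : Jet ℝ 4 → ℝ, IsRat S k R₁ ∧ IsRat S k R₂ ∧ ∀ θ ∈ S, ∀ ε : ℤˣ,
    F ε θ = R₁ θ + ((ε : ℤ) : ℂ) * csqrt (secDisc (upsilon θ)) * R₂ θ

theorem eventuallyEq_comp_of_eqOn {E : Type*} [NormedAddCommGroup E] [NormedSpace ℝ E]
    {F : Jet ℝ 4 → E} {R : Jet ℝ 4 → E} {S : Set (Jet ℝ 4)} (hS : IsOpen S)
    (h : ∀ θ ∈ S, F θ = R θ) {J : ℝ → Jet ℝ 4} {t : ℝ} (hJ : ContinuousAt J t) (ht : J t ∈ S) :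
    (fun s => F (J s)) =ᶠ[𝓝 t] fun s => R (J s) :=
  (hJ.eventually_mem (hS.mem_nhds ht)).mono fun _ hs => h _ hs

namespace IsAlg

variable {S T : Set (Jet ℝ 4)} {k l : ℕ} {F G : ℤˣ → Jet ℝ 4 → ℂ}

theorem mono (h : IsAlg S k F) (hkl : k ≤ l) (hT : T ⊆ S) : IsAlg T l F := by
  obtain ⟨R₁, R₂, h1, h2, e⟩ := h
  exact ⟨R₁, R₂, h1.mono hkl hT, h2.mono hkl hT, fun θ hθ => e θ (hT hθ)⟩

theorem congr (h : IsAlg S k F) (e : ∀ θ ∈ S, ∀ ε, G ε θ = F ε θ) : IsAlg S k G := by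
  obtain ⟨R₁, R₂, h1, h2, e'⟩ := h
  exact ⟨R₁, R₂, h1, h2, fun θ hθ ε => (e θ hθ ε).trans (e' θ hθ ε)⟩

theorem ofReal {R : Jet ℝ 4 → ℝ} (h : IsRat S k R) : IsAlg S k (fun _ θ => (R θ : ℂ)) :=
  ⟨R, fun _ => 0, h, IsRat.const 0, fun θ _ ε => by simp⟩

theorem const (c : ℝ) : IsAlg S k (fun _ _ => (c : ℂ)) := ofReal (IsRat.const c)

theorem coord {j : ℕ} (hj : j ≤ k) (i : Fin 4) : IsAlg S k (fun _ θ => (θ.2 j i : ℂ)) :=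
  ofReal (IsRat.coord hj i)

theorem add (hF : IsAlg S k F) (hG : IsAlg S k G) : IsAlg S k (fun ε θ => F ε θ + G ε θ) := by
  obtain ⟨R₁, R₂, h1, h2, e⟩ := hF
  obtain ⟨R₁', R₂', h1', h2', e'⟩ := hG
  refine ⟨_, _, h1.add h1', h2.add h2', fun θ hθ ε => ?_⟩
  simp only [e θ hθ, e' θ hθ]
  push_cast
  ring

section

variable (hS : S ⊆ GenK) (hk : 2 ≤ k)

include hS hk

theorem mul (hF : IsAlg S k F) (hG : IsAlg S k G) : IsAlg S k (fun ε θ => F ε θ * G ε θ) := by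
  obtain ⟨R₁, R₂, h1, h2, e⟩ := hF
  obtain ⟨R₁', R₂', h1', h2', e'⟩ := hG
  have hd : IsRat S k (fun θ => secDisc (upsilon θ)) :=
    isRat_secDisc.mono hk (hS.trans GenK_subset)
  refine ⟨_, _, (h1.mul h1').add (hd.mul (h2.mul h2')), (h1.mul h2').add (h2.mul h1'),
    fun θ hθ ε => ?_⟩
  simp only [e θ hθ, e' θ hθ]
  have hs := csqrt_sq (secDisc (upsilon θ))
  have hε := unit_cast_sq ε
  push_cast
  linear_combination (R₂ θ * R₂' θ : ℂ) * ((csqrt (secDisc (upsilon θ))) ^ 2 * hε + hs)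

theorem pow (hF : IsAlg S k F) (n : ℕ) : IsAlg S k (fun ε θ => F ε θ ^ n) := by
  induction n with
  | zero => exact (const 1).congr fun _ _ _ => by simp
  | succ n ih => exact (mul hS hk ih hF).congr fun _ _ _ => pow_succ _ _

theorem neg (hF : IsAlg S k F) : IsAlg S k (fun ε θ => -F ε θ) :=
  (mul hS hk (const (-1)) hF).congr fun _ _ _ => by push_cast; ring

theorem sub (hF : IsAlg S k F) (hG : IsAlg S k G) : IsAlg S k (fun ε θ => F ε θ - G ε θ) :=
  (hF.add (neg hS hk hG)).congr fun _ _ _ => by ring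

/-- The product of the two conjugates is rational. -/
theorem norm (hF : IsAlg S k F) : ∃ N : Jet ℝ 4 → ℝ, IsRat S k N ∧
    ∀ θ ∈ S, (N θ : ℂ) = F 1 θ * F (-1) θ := by
  obtain ⟨R₁, R₂, h1, h2, e⟩ := hF
  have hd : IsRat S k (fun θ => secDisc (upsilon θ)) :=
    isRat_secDisc.mono hk (hS.trans GenK_subset)
  refine ⟨_, (h1.pow 2).sub (hd.mul (h2.pow 2)), fun θ hθ => ?_⟩
  simp only [e θ hθ]
  have hs := csqrt_sq (secDisc (upsilon θ))
  push_cast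
  linear_combination (R₂ θ : ℂ) ^ 2 * hs

theorem inv (hF : IsAlg S k F) (h0 : ∀ θ ∈ S, ∀ ε, F ε θ ≠ 0) :
    IsAlg S k (fun ε θ => (F ε θ)⁻¹) := by
  obtain ⟨N, hN, eN⟩ := norm hS hk hF
  have hN0 : ∀ θ ∈ S, N θ ≠ 0 := fun θ hθ h => by
    have := eN θ hθ
    rw [h, Complex.ofReal_zero] at this
    rcases mul_eq_zero.1 this.symm with h | h <;> exact h0 θ hθ _ h
  have hF' : IsAlg S k (fun ε θ => F (-ε) θ) := by
    obtain ⟨R₁, R₂, h1, h2, e⟩ := hF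
    refine ⟨R₁, fun θ => -R₂ θ, h1, h2.neg, fun θ hθ ε => ?_⟩
    simp only [e θ hθ, Units.val_neg, Int.cast_neg]
    push_cast
    ring
  refine (mul hS hk hF' (ofReal (hN.inv hN0))).congr fun θ hθ ε => ?_
  have h1 := h0 θ hθ ε
  have h2 := h0 θ hθ (-ε)
  push_cast
  rw [eN θ hθ]
  rcases Int.units_eq_one_or ε with rfl | rfl
  · field_simp
  · rw [neg_neg] at *; field_simp

theorem div (hF : IsAlg S k F) (hG : IsAlg S k G) (h0 : ∀ θ ∈ S, ∀ ε, G ε θ ≠ 0) :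
    IsAlg S k (fun ε θ => F ε θ / G ε θ) :=
  (mul hS hk hF (inv hS hk hG h0)).congr fun _ _ _ => div_eq_mul_inv _ _

end

/-- The total derivative of an algebraic function is algebraic, and it gives the derivative along
curves of jets. -/
theorem totalD_and_chain (ho : IsOpen S) (hS : S ⊆ GenK) (hk : 2 ≤ k) (hF : IsAlg S k F) :
    IsAlg S (k + 1) (fun ε => _root_.totalD (F ε)) ∧
    ∀ (ε : ℤˣ) (J : ℝ → Jet ℝ 4) (μ t : ℝ), HolonomicAt J μ t → J t ∈ S →
      HasDerivAt (fun s => F ε (J s)) (μ • _root_.totalD (F ε) (J t)) t := by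
  obtain ⟨R₁, R₂, h1, h2, e⟩ := hF
  have hd : IsRat S k (fun θ => secDisc (upsilon θ)) :=
    isRat_secDisc.mono hk (hS.trans GenK_subset)
  have chain : ∀ (ε : ℤˣ) (J : ℝ → Jet ℝ 4) (μ t : ℝ), HolonomicAt J μ t → J t ∈ S →
      HasDerivAt (fun s => F ε (J s)) (μ • (((_root_.totalD R₁ (J t) : ℝ) : ℂ) + ((ε : ℤ) : ℂ) *
        csqrt (secDisc (upsilon (J t))) * ((_root_.totalD R₂ (J t) + _root_.totalD (fun θ => secDisc (upsilon θ))
          (J t) / (2 * secDisc (upsilon (J t))) * R₂ (J t) : ℝ) : ℂ))) t := by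
    intro ε J μ t hJ hJt
    have hd0 : secDisc (upsilon (J t)) ≠ 0 := (hS hJt).2.2
    have hd0' : (secDisc (upsilon (J t)) : ℂ) ≠ 0 := by exact_mod_cast hd0
    have a1 := (h1.chain ho hJ hJt).ofReal_comp
    have a2 := (h2.chain ho hJ hJt).ofReal_comp
    have a3 := HasDerivAt.scomp (g₁ := csqrt) (h := fun s => secDisc (upsilon (J s))) t
      (hasDerivAt_csqrt hd0) (hd.chain ho hJ hJt)
    refine ((a1.add ((a3.const_mul ((ε : ℤ) : ℂ)).mul a2)).congr_deriv ?_).congr_of_eventuallyEq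
      (eventuallyEq_comp_of_eqOn ho (fun θ hθ => e θ hθ ε) hJ.continuousAt hJt)
    simp only [Function.comp_apply, Complex.real_smul]
    push_cast
    field_simp
    ring
  have key : ∀ ε, ∀ θ ∈ S, _root_.totalD (F ε) θ = ((_root_.totalD R₁ θ : ℝ) : ℂ) + ((ε : ℤ) : ℂ) *
        csqrt (secDisc (upsilon θ)) * ((_root_.totalD R₂ θ + _root_.totalD (fun θ => secDisc (upsilon θ))
          θ / (2 * secDisc (upsilon θ)) * R₂ θ : ℝ) : ℂ) := by
    intro ε θ hθ
    have := chain ε _ 1 0 (holonomicAt_line θ) (by simpa using hθ)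
    rw [totalD_eq_of_hasDerivAt this]
    simp
  refine ⟨⟨_, _, h1.totalD ho, (h2.totalD ho).add (((hd.totalD ho).div ((IsRat.const 2).mul
    (hd.mono k.le_succ subset_rfl)) fun θ hθ => mul_ne_zero two_ne_zero (hS hθ).2.2).mul
      (h2.mono k.le_succ subset_rfl)), fun θ hθ ε => key ε θ hθ⟩, ?_⟩
  intro ε J μ t hJ hJt
  rw [key ε _ hJt]
  exact chain ε J μ t hJ hJt

theorem totalD (ho : IsOpen S) (hS : S ⊆ GenK) (hk : 2 ≤ k) (hF : IsAlg S k F) :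
    IsAlg S (k + 1) (fun ε => _root_.totalD (F ε)) :=
  (totalD_and_chain ho hS hk hF).1

theorem continuousOn (hS : S ⊆ GenK) (hF : IsAlg S k F) (ε : ℤˣ) : ContinuousOn (F ε) S := by
  obtain ⟨R₁, R₂, h1, h2, e⟩ := hF
  have hd : ContinuousOn (fun θ => secDisc (upsilon θ)) S :=
    (isRat_secDisc.mono le_rfl (hS.trans GenK_subset)).continuousOn
  refine ContinuousOn.congr ?_ fun θ hθ => e θ hθ ε
  exact (Complex.continuous_ofReal.comp_continuousOn h1.continuousOn).add
    ((continuousOn_const.mul (continuous_csqrt.comp_continuousOn hd)).mul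
      (Complex.continuous_ofReal.comp_continuousOn h2.continuousOn))

end IsAlg

/-- The branches of algebraic functions form a class that is closed under prolongation. -/
theorem isJetClass_isAlg {S : Set (Jet ℝ 4)} (ho : IsOpen S) (hS : S ⊆ GenK) {k₀ : ℕ}
    {X : ℤˣ → Jet ℝ 4 → ℂ} (hk₀ : 2 ≤ k₀) (hX : IsAlg S k₀ X)
    (hX0 : ∀ θ ∈ S, ∀ ε, totalD (X ε) θ ≠ 0) (ε : ℤˣ) :
    IsJetClass S (X ε) {F | ∃ G k, 2 ≤ k ∧ IsAlg S k G ∧ F = G ε} where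
  chain := by
    rintro _ ⟨G, k, hk, hG, rfl⟩ J μ t hJ hJt
    exact (hG.totalD_and_chain ho hS hk).2 ε J μ t hJ hJt
  step := by
    rintro _ ⟨G, k, hk, hG, rfl⟩
    refine ⟨fun ε θ => (totalD (X ε) θ)⁻¹ * totalD (G ε) θ, max k₀ k + 1, by omega, ?_, rfl⟩
    exact IsAlg.mul hS (by omega) (IsAlg.inv hS (by omega)
      ((hX.totalD ho hS hk₀).mono (by omega) subset_rfl) hX0)
      ((hG.totalD ho hS hk).mono (by omega) subset_rfl)

theorem isAlg_lam : IsAlg GenK 2 (fun ε θ => lam ε (upsilon θ)) := by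
  have hL := isRat_secLead.mono le_rfl GenK_subset
  have hM := isRat_secMid.mono le_rfl GenK_subset
  have h2 : ∀ θ ∈ GenK, 2 * secLead (upsilon θ) ≠ 0 := fun θ hθ => mul_ne_zero two_ne_zero hθ.2.1
  refine ⟨_, _, hM.div ((IsRat.const 2).mul hL) h2,
    (IsRat.const 1).div ((IsRat.const 2).mul hL) h2, fun θ hθ ε => ?_⟩
  have : (secLead (upsilon θ) : ℂ) ≠ 0 := by exact_mod_cast hθ.2.1
  simp only [lam]
  push_cast
  field_simp

/-! ### The right lifts -/

theorem totalD_ofReal_fst (θ : Jet ℝ 4) : totalD (fun η : Jet ℝ 4 => (η.1 : ℂ)) θ = 1 :=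
  totalD_eq_of_hasDerivAt (by simpa using (holonomicAt_line θ).1.ofReal_comp)

theorem totalD_ofReal_coord (k : ℕ) (i : Fin 4) (θ : Jet ℝ 4) :
    totalD (fun η : Jet ℝ 4 => (η.2 k i : ℂ)) θ = θ.2 (k + 1) i :=
  totalD_eq_of_hasDerivAt (by simpa using ((holonomicAt_line θ).2 k i).ofReal_comp)

theorem isJetClass_jRight (ε : ℤˣ) : IsJetClass GenK (fun θ => (θ.1 : ℂ))
    {F | ∃ G k, 2 ≤ k ∧ IsAlg GenK k G ∧ F = G ε} :=
  isJetClass_isAlg (X := fun _ θ => (θ.1 : ℂ)) isOpen_GenK subset_rfl le_rfl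
    (IsAlg.ofReal IsRat.fst) (fun θ _ _ => by rw [totalD_ofReal_fst]; exact one_ne_zero) ε

theorem scalarProlong_ofReal_coord (i : Fin 4) (k : ℕ) :
    scalarProlong (fun θ : Jet ℝ 4 => (θ.1 : ℂ)) (fun θ => (θ.2 0 i : ℂ)) k =
      fun θ => (θ.2 k i : ℂ) := by
  induction k with
  | zero => rfl
  | succ k ih =>
    funext θ
    simp only [scalarProlong, ih, totalD_ofReal_fst, totalD_ofReal_coord, inv_one, one_mul]

theorem jRight_components (ε : ℤˣ) : ∀ i : Fin 5, (fun θ : Jet ℝ 4 =>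
    (![(θ.2 0 0 : ℂ), (θ.2 0 1 : ℂ), (θ.2 0 2 : ℂ), (θ.2 0 3 : ℂ), lam ε (upsilon θ)] :
      Fin 5 → ℂ) i) ∈ {F : Jet ℝ 4 → ℂ | ∃ G k, 2 ≤ k ∧ IsAlg GenK k G ∧ F = G ε} := by
  intro i
  fin_cases i
  exacts [⟨_, 2, le_rfl, IsAlg.coord (j := 0) (by norm_num) 0, rfl⟩,
    ⟨_, 2, le_rfl, IsAlg.coord (j := 0) (by norm_num) 1, rfl⟩,
    ⟨_, 2, le_rfl, IsAlg.coord (j := 0) (by norm_num) 2, rfl⟩,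
    ⟨_, 2, le_rfl, IsAlg.coord (j := 0) (by norm_num) 3, rfl⟩, ⟨_, 2, le_rfl, isAlg_lam, rfl⟩]

theorem jRight_proj {θ : Jet ℝ 4} (hθ : θ ∈ GenK) (ε : ℤˣ) :
    (jRight ε θ).proj = θ.toComplex := by
  refine Prod.ext rfl ?_
  funext k i
  have h := (isJetClass_jRight ε).prolongCoeff_apply isOpen_GenK (jRight_components ε) k θ hθ
    i.castSucc
  have h2 : (fun θ : Jet ℝ 4 => (![(θ.2 0 0 : ℂ), (θ.2 0 1 : ℂ), (θ.2 0 2 : ℂ), (θ.2 0 3 : ℂ),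
      lam ε (upsilon θ)] : Fin 5 → ℂ) i.castSucc) = fun θ => (θ.2 0 i : ℂ) := by
    funext η
    fin_cases i <;> rfl
  rw [h2, scalarProlong_ofReal_coord] at h
  exact h

theorem jRight_jetOf {γ : ℝ → Fin 4 → ℝ} (hγ : ContDiff ℝ ∞ γ) {x : ℝ} (hx : jetOf γ x ∈ GenK)
    (ε : ℤˣ) : jRight ε (jetOf γ x) =
      jetOf (fun t => ![(γ t 0 : ℂ), (γ t 1 : ℂ), (γ t 2 : ℂ), (γ t 3 : ℂ),
        lam ε (upsilon (jetOf γ t))]) x := by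
  have h := (isJetClass_jRight ε).jetOf_eq_prolong isOpen_GenK (jRight_components ε)
    (fun θ _ => totalD_ofReal_fst θ) (Eventually.of_forall fun t => hγ.contDiffAt) hx rfl
  rw [jRight, h]
  congr 1

theorem continuous_jetOf {γ : ℝ → Fin 4 → ℝ} (hγ : ContDiff ℝ ∞ γ) :
    Continuous (fun t => jetOf γ t) :=
  continuous_iff_continuousAt.2 fun _ => (holonomicAt_jetOf hγ.contDiffAt).continuousAt

/-- The continuous lifts of a curve by secant points: the quotient
`(2 (√3 ac - b²) ρ - (3ad - bc)) / √δ` is continuous with the values `±1`. -/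
theorem continuous_lift_iff {γ : ℝ → Fin 4 → ℝ} (hγ : ContDiff ℝ ∞ γ) {s : Set ℝ}
    (hs : IsPreconnected s) (h : ∀ t ∈ s, jetOf γ t ∈ GenK) {ρ : ℝ → ℂ} (hρ : ContinuousOn ρ s) :
    (∀ t ∈ s, IsSecantPt (upsilon (jetOf γ t)) (ρ t)) ↔
      ∃ ε : ℤˣ, ∀ t ∈ s, ρ t = lam ε (upsilon (jetOf γ t)) := by
  constructor
  · intro hsec
    have hc : ∀ {R : Jet ℝ 4 → ℝ}, IsRat {θ | contactDefect θ ≠ 0} 2 R →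
        ContinuousOn (fun t => R (jetOf γ t)) s := fun hR =>
      hR.continuousOn.comp (continuous_jetOf hγ).continuousOn fun t ht => (h t ht).1
    have hL := Complex.continuous_ofReal.comp_continuousOn (hc isRat_secLead)
    have hM := Complex.continuous_ofReal.comp_continuousOn (hc isRat_secMid)
    have hD := continuous_csqrt.comp_continuousOn (hc isRat_secDisc)
    have hf : ContinuousOn (fun t => (2 * (secLead (upsilon (jetOf γ t)) : ℂ) * ρ t -
        (secMid (upsilon (jetOf γ t)) : ℂ)) / csqrt (secDisc (upsilon (jetOf γ t)))) s :=
      (((continuousOn_const.mul hL).mul hρ).sub hM).div hD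
        fun t ht => csqrt_ne_zero (h t ht).2.2
    have hlam : ∀ t ∈ s, ∃ ε : ℤˣ, ρ t = lam ε (upsilon (jetOf γ t)) := fun t ht =>
      (isSecantPt_iff (h t ht).2.1 (h t ht).2.2 _).1 (hsec t ht)
    have hval : ∀ t ∈ s, ∀ ε : ℤˣ, ρ t = lam ε (upsilon (jetOf γ t)) ↔
        (2 * (secLead (upsilon (jetOf γ t)) : ℂ) * ρ t - (secMid (upsilon (jetOf γ t)) : ℂ)) /
          csqrt (secDisc (upsilon (jetOf γ t))) = ((ε : ℤ) : ℂ) := by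
      intro t ht ε
      have hL0 : (secLead (upsilon (jetOf γ t)) : ℂ) ≠ 0 := by exact_mod_cast (h t ht).2.1
      rw [div_eq_iff (csqrt_ne_zero (h t ht).2.2), ← lam_quadratic (h t ht).2.1]
      constructor
      · rintro h; rw [h]
      · intro h
        apply mul_left_cancel₀ (mul_ne_zero two_ne_zero hL0)
        linear_combination h
    obtain ⟨y, ⟨ε, rfl⟩, hy⟩ := hs.eqOn_const_of_mapsTo (T := range fun ε : ℤˣ => ((ε : ℤ) : ℂ))
      (finite_range _).isDiscrete hf (fun t ht => by
        obtain ⟨ε, hε⟩ := hlam t ht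
        exact ⟨ε, ((hval t ht ε).1 hε).symm⟩) (range_nonempty _)
    exact ⟨ε, fun t ht => (hval t ht ε).2 (hy ht)⟩
  · rintro ⟨ε, hε⟩ t ht
    exact (isSecantPt_iff (h t ht).2.1 (h t ht).2.2 _).2 ⟨ε, hε t ht⟩

/-! ### Complex conjugation -/

theorem totalD_star {E : Type*} [NormedAddCommGroup E] [NormedSpace ℝ E] [StarAddMonoid E]
    [ContinuousStar E] [StarModule ℝ E] (F : Jet ℝ 4 → E) (θ : Jet ℝ 4) :
    totalD (fun η => star (F η)) θ = star (totalD F θ) :=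
  deriv.star

/-- Complex conjugation of the defining functions conjugates the prolongation. -/
theorem prolong_conj {S : Set (Jet ℝ 4)} (hS : IsOpen S) {n : ℕ} {X X' : Jet ℝ 4 → ℂ}
    {U U' : Jet ℝ 4 → Fin n → ℂ} (hX : ∀ θ ∈ S, X' θ = star (X θ))
    (hU : ∀ θ ∈ S, U' θ = star (U θ)) {θ : Jet ℝ 4} (hθ : θ ∈ S) :
    prolong X' U' θ = (prolong X U θ).conj := by
  have key : ∀ k, ∀ θ ∈ S, prolongCoeff X' U' k θ = star (prolongCoeff X U k θ) := by
    intro k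
    induction k with
    | zero => exact hU
    | succ k ih =>
      intro θ hθ
      simp only [prolongCoeff]
      rw [totalD_congr hS hX hθ, totalD_congr hS ih hθ, totalD_star, totalD_star, star_smul,
        star_inv₀]
  refine Prod.ext (hX θ hθ) ?_
  funext k i
  exact congrFun (key k θ hθ) i

theorem exists_toComplex_of_conj {n : ℕ} {η : Jet ℂ n} (h : η = η.conj) :
    ∃ η' : Jet ℝ n, η = η'.toComplex := by
  refine ⟨(η.1.re, fun k i => (η.2 k i).re), Prod.ext ?_ ?_⟩
  · exact (Complex.conj_eq_iff_re.1 (congrArg Prod.fst h).symm).symm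
  · funext k i
    exact (Complex.conj_eq_iff_re.1 (congrFun (congrFun (congrArg Prod.snd h) k) i).symm).symm

theorem isOpen_disc {T : Set ℝ} (hT : IsOpen T) :
    IsOpen {θ | θ ∈ GenK ∧ secDisc (upsilon θ) ∈ T} :=
  (isRat_secDisc.mono le_rfl GenK_subset).isOpen isOpen_GenK hT

theorem star_lam_of_pos {v : Fin 4 → ℝ} (h : 0 < secDisc v) (ε : ℤˣ) :
    lam ε v = star (lam ε v) := by
  rw [lam, csqrt_of_nonneg h.le]
  simp

theorem star_lam_of_neg {v : Fin 4 → ℝ} (h : secDisc v < 0) (ε : ℤˣ) :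
    lam (-ε) v = star (lam ε v) := by
  rw [lam, lam, csqrt_of_nonpos h.le]
  simp

theorem star_vec5 {a b c d e a' b' c' d' e' : ℂ} (ha : a' = star a) (hb : b' = star b)
    (hc : c' = star c) (hd : d' = star d) (he : e' = star e) :
    (![a', b', c', d', e'] : Fin 5 → ℂ) = star ![a, b, c, d, e] := by
  funext i
  fin_cases i
  exacts [ha, hb, hc, hd, he]

theorem jRight_real {θ : Jet ℝ 4} (hθ : θ ∈ GenK) (hd : 0 < secDisc (upsilon θ)) (ε : ℤˣ) :
    ∃ η : Jet ℝ 5, jRight ε θ = η.toComplex :=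
  exists_toComplex_of_conj (prolong_conj (isOpen_disc isOpen_Ioi) (fun _ _ => by simp)
    (fun _ hη => star_vec5 (by simp) (by simp) (by simp) (by simp) (star_lam_of_pos hη.2 ε))
    ⟨hθ, hd⟩)

theorem jRight_conj {θ : Jet ℝ 4} (hθ : θ ∈ GenK) (hd : secDisc (upsilon θ) < 0) (ε : ℤˣ) :
    jRight (-ε) θ = (jRight ε θ).conj :=
  prolong_conj (isOpen_disc isOpen_Iio) (fun _ _ => by simp)
    (fun _ hη => star_vec5 (by simp) (by simp) (by simp) (by simp) (star_lam_of_neg hη.2 ε))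
    ⟨hθ, hd⟩

/-! ### The two branches -/

/-- The rescaled coordinates of the point of `K` under a jet, as complex numbers. -/
noncomputable def hatC (θ : Jet ℝ 4) : Fin 5 → ℂ := fun i => (hat θ.pt i : ℂ)

theorem kA_ofReal (b : Fin 5 → ℝ) (i : Fin 7) : ((kA b i : ℝ) : ℂ) = kA (fun i => (b i : ℂ)) i := by
  fin_cases i <;> simp [kA]

theorem kB_ofReal (b : Fin 5 → ℝ) (i : Fin 7) : ((kB b i : ℝ) : ℂ) = kB (fun i => (b i : ℂ)) i := by
  fin_cases i <;> simp [kB]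

theorem branchPt_eq (ε : ℤˣ) (θ : Jet ℝ 4) :
    branchPt ε θ = toMhat (hatC θ) (lam ε (upsilon θ)) := by
  funext i
  fin_cases i <;> simp [branchPt, toM, toMhat, hatC, hat, Jet.pt]

theorem vecM_branchPt (ε : ℤˣ) (θ : Jet ℝ 4) :
    vecM (branchPt ε θ) = kA (hatC θ) + lam ε (upsilon θ) • kB (hatC θ) := by
  rw [branchPt_eq, vecM_toMhat]

theorem branchPt_ne {θ : Jet ℝ 4} (hθ : θ ∈ GenK) : branchPt 1 θ ≠ branchPt (-1) θ := by
  intro h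
  have h3 := congrFun h 3
  rw [branchPt_eq, branchPt_eq] at h3
  exact lam_ne hθ.2.1 hθ.2.2 1 h3

theorem lineM_sup_branchPt {θ : Jet ℝ 4} (hθ : θ ∈ GenK) :
    lineM (branchPt 1 θ) ⊔ lineM (branchPt (-1) θ) =
      Submodule.span ℂ {(fun i => (vecK₁ θ.pt i : ℂ)), (fun i => (vecK₂ θ.pt i : ℂ))} := by
  have h1 : (fun i => (vecK₁ θ.pt i : ℂ)) = kA (hatC θ) := by
    funext i; rw [vecK₁_eq, kA_ofReal]; rfl
  have h2 : (fun i => (vecK₂ θ.pt i : ℂ)) = kB (hatC θ) := by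
    funext i; rw [vecK₂_eq, kB_ofReal]; rfl
  rw [h1, h2, lineM, lineM, ← Submodule.span_union, Set.singleton_union, vecM_branchPt,
    vecM_branchPt]
  refine span_pair_eq (a := 1) (c := 1) (by rw [one_smul]) (by rw [one_smul]) ?_
  rw [one_mul, mul_one]
  exact sub_ne_zero.2 (lam_ne hθ.2.1 hθ.2.2 1).symm

theorem isAlg_hatC (i : Fin 5) : IsAlg GenK 2 (fun _ θ => hatC θ i) := by
  have c : ∀ i, IsRat GenK 2 (fun θ => θ.2 0 i) := fun i => IsRat.coord (by norm_num) i
  refine IsAlg.ofReal (R := fun θ => hat θ.pt i) ?_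
  fin_cases i
  exacts [IsRat.fst, (c 0).div (IsRat.const √3) fun _ _ => sqrt3_ne, c 1,
    (c 2).div (IsRat.const √3) fun _ _ => sqrt3_ne, c 3]

theorem isAlg_branchPt (i : Fin 5) : IsAlg GenK 2 (fun ε θ => branchPt ε θ i) := by
  have s : GenK ⊆ GenK := subset_rfl
  have k : 2 ≤ 2 := le_rfl
  have q : ∀ c : ℝ, IsAlg GenK 2 (fun _ _ => (c : ℂ)) := fun c => IsAlg.const c
  have r := isAlg_lam
  have b := isAlg_hatC
  have m := fun {F G : ℤˣ → Jet ℝ 4 → ℂ} (hF : IsAlg GenK 2 F) (hG : IsAlg GenK 2 G) =>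
    IsAlg.mul s k hF hG
  have sub := fun {F G : ℤˣ → Jet ℝ 4 → ℂ} (hF : IsAlg GenK 2 F) (hG : IsAlg GenK 2 G) =>
    IsAlg.sub s k hF hG
  have p := fun {F : ℤˣ → Jet ℝ 4 → ℂ} (hF : IsAlg GenK 2 F) (n : ℕ) => IsAlg.pow s k hF n
  have x := sub (b 3) (m r (b 0))
  have y := m (sub (b 1) (m (p r 2) (b 0))) (q (1 / 2))
  have z := m (sub (b 2) (m (p r 3) (b 0))) (q (1 / 3))
  simp only [branchPt_eq]
  fin_cases i
  · exact x
  · exact ((m x y).add (m (sub ((m (m (q 3) (b 0)) (z.add (m x (p r 2)))).add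
      (m (m (q 2) (p r 3)) (p (b 0) 2))) (b 4)) (q (1 / 6)))).congr
      fun θ _ ε => by simp [toMhat]; ring
  · exact y.congr fun θ _ ε => by simp [toMhat]; ring
  · exact r
  · exact z.congr fun θ _ ε => by simp [toMhat]; ring

theorem isAlg_totalD_branchPt : IsAlg GenK 3 (fun ε => totalD (fun η => branchPt ε η 0)) :=
  (isAlg_branchPt 0).totalD isOpen_GenK subset_rfl le_rfl

/-- The domain of one of the two branches. -/
def BranchDom (ε : ℤˣ) : Set (Jet ℝ 4) :=
  {θ | θ ∈ GenK ∧ totalD (fun η => branchPt ε η 0) θ ≠ 0}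

theorem isOpen_BranchDom (ε : ℤˣ) : IsOpen (BranchDom ε) :=
  (isAlg_totalD_branchPt.continuousOn subset_rfl ε).isOpen_inter_preimage isOpen_GenK
    isOpen_compl_singleton

theorem isOpen_GenBranch : IsOpen GenBranch := by
  convert (isOpen_BranchDom 1).inter (isOpen_BranchDom (-1)) using 1
  ext θ
  constructor
  · rintro ⟨h1, h2⟩
    exact ⟨⟨h1, h2 1⟩, h1, h2 (-1)⟩
  · rintro ⟨⟨h1, h2⟩, -, h3⟩
    refine ⟨h1, fun ε => ?_⟩
    rcases Int.units_eq_one_or ε with rfl | rfl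
    exacts [h2, h3]

/-- On the fibre `x = 0` the total derivative of the coordinate `x` of a branch is
`q₁/√3 - λ`. -/
theorem totalD_branchPt_of_fst_eq_zero {θ : Jet ℝ 4} (hθ : θ ∈ GenK) (h0 : θ.1 = 0) (ε : ℤˣ) :
    totalD (fun η => branchPt ε η 0) θ = θ.2 1 2 / ((√3 : ℝ) : ℂ) - lam ε (upsilon θ) := by
  have hl := (isAlg_lam.totalD_and_chain isOpen_GenK subset_rfl le_rfl).2 ε _ 1 0
    (holonomicAt_line θ) (by simpa using hθ)
  have hx : HasDerivAt (fun s : ℝ => (((θ + s • (((1 : ℝ), fun k => θ.2 (k + 1)) : Jet ℝ 4)).1 : ℝ) :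
      ℂ)) ((1 : ℝ) : ℂ) 0 := (holonomicAt_line θ).1.ofReal_comp
  have hq := ((holonomicAt_line θ).2 0 2).ofReal_comp
  have h := (hq.div_const ((√3 : ℝ) : ℂ)).sub (hl.mul hx)
  have h' := totalD_eq_of_hasDerivAt (F := fun η => branchPt ε η 0) (θ := θ) (h.congr_of_eventuallyEq
    (Eventually.of_forall fun s => by
      simp [branchPt_eq, toMhat, hatC, hat, Jet.pt]))
  rw [h']
  simp [h0]

/-- The set over which both branches are defined contains the complement of a hypersurface. -/
theorem exists_poly_GenBranch {c : ℝ} (hc : c ≠ 0) : ∃ P : JetPoly,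
    P.evalAt (sampleJet c) ≠ 0 ∧ ∀ θ, P.evalAt θ ≠ 0 → θ ∈ GenBranch := by
  obtain ⟨P, hP, hP'⟩ := exists_poly_GenK hc
  obtain ⟨N, hN, eN⟩ := isAlg_totalD_branchPt.norm subset_rfl (by norm_num)
  have hθ := hP' _ hP
  have hlam : ∀ ε : ℤˣ, totalD (fun η => branchPt ε η 0) (sampleJet c) ≠ 0 := by
    intro ε h
    rw [totalD_branchPt_of_fst_eq_zero hθ rfl] at h
    have hq : (sampleJet c).2 1 2 = 0 := by simp [sampleJet]
    have hl : lam ε (upsilon (sampleJet c)) = 0 := by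
      rw [hq] at h; simpa using h
    have h2 := (quadratic_iff hθ.2.1 _).2 ⟨ε, rfl⟩
    rw [hl, upsilon_sampleJet] at h2
    simp [hc] at h2
  obtain ⟨P', h, h'⟩ := hN.exists_poly_ne_zero hP' hP (fun h0 => by
    have := eN _ hθ
    rw [h0, Complex.ofReal_zero] at this
    rcases mul_eq_zero.1 this.symm with h | h
    exacts [hlam _ h, hlam _ h])
  refine ⟨P', h, fun θ hθ => ⟨hP' _ (h' θ hθ).1, fun ε h0 => (h' θ hθ).2 ?_⟩⟩
  have := eN _ (hP' _ (h' θ hθ).1)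
  have h3 : (N θ : ℂ) = 0 := by
    rw [this]
    rcases Int.units_eq_one_or ε with rfl | rfl
    · rw [h0, zero_mul]
    · rw [h0, mul_zero]
  exact_mod_cast h3

theorem dense_GenBranch : Dense GenBranch := by
  obtain ⟨P, h, h'⟩ := exists_poly_GenBranch one_ne_zero
  exact (dense_evalAt_ne_zero h).mono h'

theorem GenBranch_subset : GenBranch ⊆ GenK := fun _ h => h.1

theorem GenBranch_subset_BranchDom (ε : ℤˣ) : GenBranch ⊆ BranchDom ε := fun _ h => ⟨h.1, h.2 ε⟩

/-- Functions of the form `H / (D x)ᵉ`, with `H` algebraic on the domain of the right lifts and `x`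
the independent variable of the branch. -/
def BranchAlg (F : ℤˣ → Jet ℝ 4 → ℂ) : Prop :=
  ∃ (H : ℤˣ → Jet ℝ 4 → ℂ) (e k : ℕ), 2 ≤ k ∧ IsAlg GenK k H ∧ ∀ ε, ∀ θ ∈ BranchDom ε,
    F ε θ = H ε θ / totalD (fun η => branchPt ε η 0) θ ^ e

namespace BranchAlg

variable {F G : ℤˣ → Jet ℝ 4 → ℂ}

theorem of_isAlg {k : ℕ} (h : IsAlg GenK k F) : BranchAlg F :=
  ⟨F, 0, max k 2, le_max_right _ _, h.mono (le_max_left _ _) subset_rfl, fun _ _ _ => by simp⟩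

theorem congr (h : BranchAlg F) (e : ∀ ε, ∀ θ ∈ BranchDom ε, G ε θ = F ε θ) : BranchAlg G := by
  obtain ⟨H, n, k, hk, hH, hF⟩ := h
  exact ⟨H, n, k, hk, hH, fun ε θ hθ => (e ε θ hθ).trans (hF ε θ hθ)⟩

theorem add (hF : BranchAlg F) (hG : BranchAlg G) : BranchAlg (fun ε θ => F ε θ + G ε θ) := by
  obtain ⟨H, n, k, hk, hH, hF⟩ := hF
  obtain ⟨H', n', k', hk', hH', hG⟩ := hG
  have hx := isAlg_totalD_branchPt.mono (show 3 ≤ max 3 (max k k') by omega) subset_rfl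
  have h2 : 2 ≤ max 3 (max k k') := by omega
  refine ⟨_, n + n', max 3 (max k k'), h2,
    (IsAlg.mul subset_rfl h2 (hH.mono (by omega) subset_rfl) (IsAlg.pow subset_rfl h2 hx n')).add
    (IsAlg.mul subset_rfl h2 (hH'.mono (by omega) subset_rfl) (IsAlg.pow subset_rfl h2 hx n)),
    fun ε θ hθ => ?_⟩
  have h0 := hθ.2
  simp only [hF ε θ hθ, hG ε θ hθ]
  field_simp
  ring

theorem mul (hF : BranchAlg F) (hG : BranchAlg G) : BranchAlg (fun ε θ => F ε θ * G ε θ) := by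
  obtain ⟨H, n, k, hk, hH, hF⟩ := hF
  obtain ⟨H', n', k', hk', hH', hG⟩ := hG
  refine ⟨_, n + n', max k k', by omega, IsAlg.mul subset_rfl (by omega)
    (hH.mono (le_max_left _ _) subset_rfl) (hH'.mono (le_max_right _ _) subset_rfl),
    fun ε θ hθ => ?_⟩
  have h0 := hθ.2
  simp only [hF ε θ hθ, hG ε θ hθ]
  field_simp
  ring

theorem totalD_and_chain (hF : BranchAlg F) :
    BranchAlg (fun ε θ => (totalD (fun η => branchPt ε η 0) θ)⁻¹ * totalD (F ε) θ) ∧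
    ∀ (ε : ℤˣ) (J : ℝ → Jet ℝ 4) (μ t : ℝ), HolonomicAt J μ t → J t ∈ BranchDom ε →
      HasDerivAt (fun s => F ε (J s)) (μ • totalD (F ε) (J t)) t := by
  obtain ⟨H, n, k, hk, hH, e⟩ := hF
  set x₁ : ℤˣ → Jet ℝ 4 → ℂ := fun ε => totalD (fun η => branchPt ε η 0) with hx₁
  have hx : IsAlg GenK 3 x₁ := isAlg_totalD_branchPt
  have chain : ∀ (ε : ℤˣ) (J : ℝ → Jet ℝ 4) (μ t : ℝ), HolonomicAt J μ t → J t ∈ BranchDom ε →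
      HasDerivAt (fun s => F ε (J s)) (μ • ((totalD (H ε) (J t) * x₁ ε (J t) -
        n * H ε (J t) * totalD (x₁ ε) (J t)) / x₁ ε (J t) ^ (n + 1))) t := by
    intro ε J μ t hJ hJt
    have h0 : x₁ ε (J t) ≠ 0 := hJt.2
    have a1 := (hH.totalD_and_chain isOpen_GenK subset_rfl hk).2 ε J μ t hJ hJt.1
    have a2 := (hx.totalD_and_chain isOpen_GenK subset_rfl (by norm_num)).2 ε J μ t hJ hJt.1
    refine ((a1.div (a2.pow n) (pow_ne_zero n h0)).congr_deriv ?_).congr_of_eventuallyEq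
      (eventuallyEq_comp_of_eqOn (isOpen_BranchDom ε) (e ε) hJ.continuousAt hJt)
    rcases n with _ | n
    · simp; field_simp; simp
    · simp only [Complex.real_smul, Nat.add_sub_cancel, Pi.pow_apply]
      field_simp
      ring
  have key : ∀ ε, ∀ θ ∈ BranchDom ε, totalD (F ε) θ = (totalD (H ε) θ * x₁ ε θ -
        n * H ε θ * totalD (x₁ ε) θ) / x₁ ε θ ^ (n + 1) := by
    intro ε θ hθ
    have := chain ε _ 1 0 (holonomicAt_line θ) (by simpa using hθ)
    rw [totalD_eq_of_hasDerivAt this]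
    simp
  have h2 : 2 ≤ max 4 (k + 1) := by omega
  refine ⟨⟨_, n + 2, max 4 (k + 1), h2, IsAlg.sub subset_rfl h2 (IsAlg.mul subset_rfl h2
    ((hH.totalD isOpen_GenK subset_rfl hk).mono (by omega) subset_rfl)
      (hx.mono (by omega) subset_rfl)) (IsAlg.mul subset_rfl h2 (IsAlg.mul subset_rfl h2
        (IsAlg.const n) (hH.mono (by omega) subset_rfl))
      ((hx.totalD isOpen_GenK subset_rfl (by norm_num)).mono (by omega) subset_rfl)),
    fun ε θ hθ => ?_⟩, fun ε J μ t hJ hJt => by rw [key ε _ hJt]; exact chain ε J μ t hJ hJt⟩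
  have h0 : x₁ ε θ ≠ 0 := hθ.2
  change (x₁ ε θ)⁻¹ * totalD (F ε) θ = _ / x₁ ε θ ^ (n + 2)
  rw [key ε θ hθ]
  push_cast
  field_simp
  ring

end BranchAlg

theorem isJetClass_branch (ε : ℤˣ) : IsJetClass (BranchDom ε) (fun θ => branchPt ε θ 0)
    {F | ∃ G, BranchAlg G ∧ F = G ε} where
  chain := by
    rintro _ ⟨G, hG, rfl⟩
    exact hG.totalD_and_chain.2 ε
  step := by
    rintro _ ⟨G, hG, rfl⟩
    exact ⟨_, hG.totalD_and_chain.1, rfl⟩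

theorem branch_components (ε : ℤˣ) (i : Fin 4) : (fun θ => branchPt ε θ i.succ) ∈
    {F | ∃ G, BranchAlg G ∧ F = G ε} :=
  ⟨_, BranchAlg.of_isAlg (isAlg_branchPt i.succ), rfl⟩

theorem branchAlg_scalarProlong (i : Fin 4) (k : ℕ) : BranchAlg (fun ε =>
    scalarProlong (fun θ => branchPt ε θ 0) (fun θ => branchPt ε θ i.succ) k) := by
  induction k with
  | zero => exact BranchAlg.of_isAlg (isAlg_branchPt i.succ)
  | succ k ih => exact ih.totalD_and_chain.1

theorem branch_snd {ε : ℤˣ} {θ : Jet ℝ 4} (hθ : θ ∈ BranchDom ε) (k : ℕ) (i : Fin 4) :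
    (branch ε θ).2 k i =
      scalarProlong (fun θ => branchPt ε θ 0) (fun θ => branchPt ε θ i.succ) k θ :=
  (isJetClass_branch ε).prolongCoeff_apply (isOpen_BranchDom ε) (branch_components ε) k θ hθ i

/-- Polynomials in the jet coordinates of a branch. -/
theorem branchAlg_evalAt (Q : JetPoly) : BranchAlg (fun ε θ => Q.evalAt (branch ε θ)) := by
  induction Q using MvPolynomial.induction_on with
  | C c => simp only [JetPoly.evalAt_C]; exact BranchAlg.of_isAlg (IsAlg.const (S := GenK) (k := 0) c)
  | add p q hp hq => simp only [JetPoly.evalAt_add]; exact hp.add hq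
  | mul_X p v hp =>
    simp only [JetPoly.evalAt_mul]
    refine hp.mul ?_
    rcases v with _ | ⟨k, i⟩
    · simp only [JetPoly.evalAt_X_none]
      exact BranchAlg.of_isAlg (isAlg_branchPt 0)
    · simp only [JetPoly.evalAt_X_some]
      exact (branchAlg_scalarProlong i k).congr fun ε θ hθ => branch_snd hθ k i

theorem star_branchPt {θ : Jet ℝ 4} {ε ε' : ℤˣ}
    (h : lam ε' (upsilon θ) = star (lam ε (upsilon θ))) (i : Fin 5) :
    branchPt ε' θ i = star (branchPt ε θ i) := by
  have hb : ∀ i, star (hatC θ i) = hatC θ i := fun i => Complex.conj_ofReal _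
  simp only [Complex.star_def] at h hb
  rw [branchPt_eq, branchPt_eq, h]
  fin_cases i <;> simp [toMhat, hb]

theorem branch_real {θ : Jet ℝ 4} (hθ : θ ∈ GenBranch) (hd : 0 < secDisc (upsilon θ)) (ε : ℤˣ) :
    ∃ η : Jet ℝ 4, branch ε θ = η.toComplex :=
  exists_toComplex_of_conj (prolong_conj (isOpen_disc isOpen_Ioi)
    (fun _ hη => star_branchPt (star_lam_of_pos hη.2 ε) 0)
    (fun _ hη => funext fun i => star_branchPt (star_lam_of_pos hη.2 ε) i.succ) ⟨hθ.1, hd⟩)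

theorem holonomicAt_branch {J : ℝ → Jet ℝ 4} {μ t : ℝ} (hJ : HolonomicAt J μ t) (ε : ℤˣ)
    (ht : J t ∈ BranchDom ε) : HolonomicAt (fun s => branch ε (J s))
      (μ • totalD (fun η => branchPt ε η 0) (J t)) t := by
  refine ⟨(isJetClass_branch ε).chain _ ⟨_, BranchAlg.of_isAlg (isAlg_branchPt 0), rfl⟩ J μ t hJ ht,
    fun k i => ?_⟩
  have h := (isJetClass_branch ε).hasDerivAt_prolongCoeff (U := fun θ i => branchPt ε θ i.succ)
    (isOpen_BranchDom ε) (branch_components ε) k hJ ht ht.2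
  exact hasDerivAt_pi.1 h i

/-- Two curves of jets of the same parametrized curve coincide. -/
theorem HolonomicAt.unique {𝔽 : Type*} [RCLike 𝔽] {J J' : ℝ → Jet 𝔽 4} {μ μ' : ℝ → 𝔽} {x : ℝ}
    (h : ∀ᶠ t in 𝓝 x, HolonomicAt J (μ t) t) (h' : ∀ᶠ t in 𝓝 x, HolonomicAt J' (μ' t) t)
    (h0 : ∀ᶠ t in 𝓝 x, μ t ≠ 0) (e : ∀ᶠ t in 𝓝 x, (J t).pt = (J' t).pt) : J x = J' x := by
  have e1 : ∀ᶠ t in 𝓝 x, (J t).1 = (J' t).1 := e.mono fun t ht => congrFun ht 0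
  have e2 : ∀ᶠ t in 𝓝 x, μ t = μ' t := by
    filter_upwards [e1.eventually_nhds, h, h'] with t h1 h2 h3
    exact h2.1.unique (h3.1.congr_of_eventuallyEq h1)
  have key : ∀ k, ∀ᶠ t in 𝓝 x, (J t).2 k = (J' t).2 k := by
    intro k
    induction k with
    | zero => exact e.mono fun t ht => funext fun i => congrFun ht i.succ
    | succ k ih =>
      filter_upwards [ih.eventually_nhds, h, h', h0, e2] with t h1 h2 h3 h4 h5
      funext i
      have := (h2.2 k i).unique ((h3.2 k i).congr_of_eventuallyEq
        (h1.mono fun s hs => congrFun hs i))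
      rw [← h5] at this
      exact mul_left_cancel₀ h4 this
  exact Prod.ext e1.self_of_nhds (funext fun k => (key k).self_of_nhds)

theorem HolonomicAt.comp {J : ℝ → Jet ℝ 4} {X : ℝ → ℝ} {X' μ t : ℝ} (hJ : HolonomicAt J μ (X t))
    (hX : HasDerivAt X X' t) : HolonomicAt (fun s => J (X s)) (μ * X') t :=
  ⟨hJ.1.comp t hX, fun k i => ((hJ.2 k i).comp t hX).congr_deriv (by ring)⟩

theorem HolonomicAt.toComplex {J : ℝ → Jet ℝ 4} {μ t : ℝ} (hJ : HolonomicAt J μ t) :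
    HolonomicAt (fun s => (J s).toComplex) (μ : ℂ) t :=
  ⟨hJ.1.ofReal_comp, fun k i => by simpa [Jet.toComplex] using (hJ.2 k i).ofReal_comp⟩

theorem eventually_jetOf_mem {γ : ℝ → Fin 4 → ℝ} {S : Set (Jet ℝ 4)} (hS : IsOpen S)
    {x : ℝ} (hγ : ContDiffAt ℝ ∞ γ x) (hx : jetOf γ x ∈ S) : ∀ᶠ t in 𝓝 x, jetOf γ t ∈ S :=
  (holonomicAt_jetOf hγ).continuousAt.eventually_mem (hS.mem_nhds hx)

/-- The branches of the jet of a curve in `K` are the jets of the projected curves. -/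
theorem branch_jetOf {γ c : ℝ → Fin 4 → ℝ} {x : ℝ}
    (hγ : ∀ᶠ t in 𝓝 x, ContDiffAt ℝ ∞ γ t) (hc : ContDiff ℝ ∞ c) {X : ℝ → ℝ} {ε : ℤˣ}
    (hx : jetOf γ x ∈ BranchDom ε)
    (h : ∀ᶠ t in 𝓝 x, branchPt ε (jetOf γ t) = fun i => (graphPt c (X t) i : ℂ)) :
    branch ε (jetOf γ x) = (jetOf c (X x)).toComplex := by
  have hmem := eventually_jetOf_mem (isOpen_BranchDom ε) hγ.self_of_nhds hx
  have hβ : ∀ᶠ t in 𝓝 x, HolonomicAt (fun s => branch ε (jetOf γ s))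
      ((1 : ℝ) • totalD (fun η => branchPt ε η 0) (jetOf γ t)) t :=
    (hmem.and hγ).mono fun t ht => holonomicAt_branch (holonomicAt_jetOf ht.2) ε ht.1
  -- the parameter `X` is differentiable, as the real part of a coordinate of the branch
  have hX : ∀ᶠ t in 𝓝 x, DifferentiableAt ℝ X t := by
    filter_upwards [hβ, h.eventually_nhds] with t ht h1
    have h2 := Complex.reCLM.hasFDerivAt.comp_hasDerivAt t ht.1
    refine (h2.differentiableAt).congr_of_eventuallyEq (h1.mono fun s hs => ?_)
    have := congrFun hs 0
    change branchPt ε (jetOf γ s) 0 = (X s : ℂ) at this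
    simp [branch, prolong, this]
  refine HolonomicAt.unique (J := fun s => branch ε (jetOf γ s))
    (J' := fun s => (jetOf c (X s)).toComplex) hβ
    (hX.mono fun t ht => ((holonomicAt_jetOf hc.contDiffAt).comp ht.hasDerivAt).toComplex)
    (hmem.mono fun t ht => by rw [one_smul]; exact ht.2) ?_
  filter_upwards [h] with t ht
  funext i
  have := congrFun ht i
  refine Fin.cases ?_ (fun j => ?_) i
  · exact congrFun ht 0
  · simpa [Jet.pt, branch, prolong, prolongCoeff, Jet.toComplex, jetOf, graphPt] using
      congrFun ht j.succ

/-! ### Congruence of curves in `K` and of pairs of curves in `M` -/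

theorem octCross_kAd_kB (b v : Fin 5 → ℝ) :
    octCross (kAd b v) (kB b) + octCross (kA b) (kBd b v) = 0 := by
  ext i
  fin_cases i <;> simp [octCross, kA, kB, kAd, kBd] <;> ring

/-- The cubic form of a jet, as a function of the components of a vector of the plane. -/
noncomputable def cubicJet (θ : Jet ℝ 4) : ℝ → ℝ → ℝ :=
  cubicK (hat θ.pt) (hat θ.vel) (hat (Matrix.vecCons 0 (θ.2 2)))

theorem hasDerivAt_deriv {τ : ℝ → ℝ} {x : ℝ} (hτ : ContDiffAt ℝ 2 τ x) :
    HasDerivAt (deriv τ) (deriv (deriv τ) x) x := by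
  have h1 : DifferentiableAt ℝ (iteratedDeriv 1 τ) x := by
    rw [← differentiableWithinAt_univ, ← iteratedDerivWithin_univ]
    exact (hτ.contDiffWithinAt (s := univ)).differentiableWithinAt_iteratedDerivWithin
      (by norm_num) (by simp)
  rw [iteratedDeriv_one] at h1
  exact h1.hasDerivAt

/-- For a section `W` of the moving plane, the trilinear form of `W`, `W'`, `W''` is the value of
the cubic form, up to the cube of the derivative of the parameter. -/
theorem triple_section {γ : ℝ → Fin 4 → ℝ} {τ : ℝ → ℝ} {x : ℝ} (hγ : ContDiffAt ℝ ∞ γ (τ x))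
    (hτ : ContDiffAt ℝ 2 τ x) {W W₁ : ℝ → Fin 7 → ℝ} {W₂ : Fin 7 → ℝ}
    (h1 : ∀ᶠ t in 𝓝 x, HasDerivAt W (W₁ t) t) (h2 : HasDerivAt W₁ W₂ x)
    (hW : ∀ᶠ t in 𝓝 x, W t ∈ planeK (graphPt γ (τ t))) :
    triple (W x) (W₁ x) W₂ = deriv τ x ^ 3 * cubicJet (jetOf γ (τ x)) (W x 1) (W x 6) := by
  obtain ⟨hb, hv⟩ := hasDerivAt_hat_graphPt hγ
  have hτ1 : ∀ᶠ t in 𝓝 x, HasDerivAt τ (deriv τ t) t :=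
    (hτ.eventually (by simp)).mono fun t ht => (ht.differentiableAt (by simp)).hasDerivAt
  have hτ2 := hasDerivAt_deriv hτ
  have hb' : ∀ᶠ t in 𝓝 x, HasDerivAt (fun t => hat (graphPt γ t))
      (hat (Matrix.vecCons 1 (deriv γ (τ t)))) (τ t) := hτ.continuousAt.eventually hb
  set b : ℝ → Fin 5 → ℝ := fun t => hat (graphPt γ t) with hbdef
  set v : ℝ → Fin 5 → ℝ := fun t => hat (Matrix.vecCons 1 (deriv γ t)) with hvdef
  set a : Fin 5 → ℝ := hat (Matrix.vecCons 0 (iteratedDeriv 2 γ (τ x))) with ha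
  have hWe : ∀ᶠ t in 𝓝 x, W t = W t 1 • kA (b (τ t)) + W t 6 • kB (b (τ t)) :=
    hW.mono fun t ht => mem_span_pair_coords (i := 1) (j := 6) rfl rfl rfl rfl
      (by rwa [planeK_eq] at ht)
  have e1 : ∀ᶠ t in 𝓝 x, W₁ t = (W t 1 • (deriv τ t • kAd (b (τ t)) (v (τ t))) +
      W₁ t 1 • kA (b (τ t))) + (W t 6 • (deriv τ t • kBd (b (τ t)) (v (τ t))) +
        W₁ t 6 • kB (b (τ t))) := by
    filter_upwards [hWe.eventually_nhds, hb', h1, hτ1] with t g1 g2 g3 g4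
    have hA := HasDerivAt.scomp (g₁ := fun s => kA (b s)) t g2.kA g4
    have hB := HasDerivAt.scomp (g₁ := fun s => kB (b s)) t g2.kB g4
    exact g3.unique ((((hasDerivAt_pi.1 g3 1).smul hA).add
      ((hasDerivAt_pi.1 g3 6).smul hB)).congr_of_eventuallyEq g1)
  have g1 := h1.self_of_nhds
  have g2 := hb'.self_of_nhds
  have g4 := hτ1.self_of_nhds
  have hA := HasDerivAt.scomp (g₁ := fun s => kA (b s)) x g2.kA g4
  have hB := HasDerivAt.scomp (g₁ := fun s => kB (b s)) x g2.kB g4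
  have hA' := HasDerivAt.scomp (g₁ := fun s => kAd (b s) (v s)) x (g2.kAd hv) g4
  have hB' := HasDerivAt.scomp (g₁ := fun s => kBd (b s) (v s)) x (g2.kBd hv) g4
  have e2 := h2.unique (((((hasDerivAt_pi.1 g1 1).smul (hτ2.smul hA')).add
    ((hasDerivAt_pi.1 h2 1).smul hA)).add (((hasDerivAt_pi.1 g1 6).smul (hτ2.smul hB')).add
    ((hasDerivAt_pi.1 h2 6).smul hB))).congr_of_eventuallyEq e1)
  have key := triple_change (kAdd (b (τ x)) (v (τ x)) a) (kBdd (b (τ x)) (v (τ x)) a)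
    (octCross_kA_kB (b (τ x))) (octCross_kAd_kB (b (τ x)) (v (τ x))) (W x 1) (W x 6) (W₁ x 1)
    (W₁ x 6) (W₂ 1) (W₂ 6) (deriv τ x) (deriv (deriv τ) x)
  have hj : cubicJet (jetOf γ (τ x)) (W x 1) (W x 6) = cubic (kA (b (τ x))) (kB (b (τ x)))
      (kAd (b (τ x)) (v (τ x))) (kBd (b (τ x)) (v (τ x))) (kAdd (b (τ x)) (v (τ x)) a)
      (kBdd (b (τ x)) (v (τ x)) a) (W x 1) (W x 6) := by
    simp [cubicJet, cubicK, Jet.pt, Jet.vel, jetOf, graphPt, hbdef, hvdef, ha]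
  rw [hj, ← key]
  congr 1
  · exact hWe.self_of_nhds
  · exact e1.self_of_nhds.trans (by abel)
  · refine e2.trans ?_
    simp only [Function.comp_apply, Pi.smul_apply']
    module

/-- Three times the Hessian of the cubic form of a vector `(a, b, c, d)` of the contact
distribution; its zeros are the secant points. -/
noncomputable def hessForm (v : Fin 4 → ℝ) (σ ρ : ℂ) : ℂ :=
  (secLead v : ℂ) * ρ ^ 2 - (secMid v : ℂ) * (σ * ρ) + (√3 * v 1 * v 3 - v 2 ^ 2 : ℝ) * σ ^ 2

/-- The Hessian of a binary cubic form is a covariant. -/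
theorem hessForm_covariant {u v : Fin 4 → ℝ} {k l m n c : ℝ}
    (h : ∀ σ ρ : ℝ, -u 3 * σ ^ 3 + √3 * u 2 * σ ^ 2 * ρ - √3 * u 1 * σ * ρ ^ 2 + u 0 * ρ ^ 3 =
      c * (-v 3 * (k * σ + m * ρ) ^ 3 + √3 * v 2 * (k * σ + m * ρ) ^ 2 * (l * σ + n * ρ)
        - √3 * v 1 * (k * σ + m * ρ) * (l * σ + n * ρ) ^ 2 + v 0 * (l * σ + n * ρ) ^ 3))
    (σ ρ : ℂ) : hessForm u σ ρ =
      c ^ 2 * (k * n - l * m) ^ 2 * hessForm v (k * σ + m * ρ) (l * σ + n * ρ) := by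
  have hw := sqrt3_sq
  have ex : ∀ a : ℝ, ∃ Y : ℝ, a = √3 * Y := fun a => ⟨a / √3, by field_simp⟩
  obtain ⟨u1, hu1⟩ := ex (u 1)
  obtain ⟨u2, hu2⟩ := ex (u 2)
  obtain ⟨v1, hv1⟩ := ex (v 1)
  obtain ⟨v2, hv2⟩ := ex (v 2)
  have key : ∀ σ ρ : ℝ,
      (-u 3 - c * (-v 3 * k ^ 3 + 3 * v2 * k ^ 2 * l - 3 * v1 * k * l ^ 2 + v 0 * l ^ 3)) * σ ^ 3 +
      (3 * u2 - c * (-3 * v 3 * k ^ 2 * m + 3 * v2 * (2 * k * m * l + k ^ 2 * n)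
        - 3 * v1 * (m * l ^ 2 + 2 * k * l * n) + 3 * v 0 * l ^ 2 * n)) * σ ^ 2 * ρ +
      (-3 * u1 - c * (-3 * v 3 * k * m ^ 2 + 3 * v2 * (m ^ 2 * l + 2 * k * m * n)
        - 3 * v1 * (2 * m * l * n + k * n ^ 2) + 3 * v 0 * l * n ^ 2)) * σ * ρ ^ 2 +
      (u 0 - c * (-v 3 * m ^ 3 + 3 * v2 * m ^ 2 * n - 3 * v1 * m * n ^ 2 + v 0 * n ^ 3)) * ρ ^ 3
        = 0 := by
    intro σ ρ
    have h1 := h σ ρ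
    rw [hu1, hu2, hv1, hv2] at h1
    linear_combination h1 - (u2 * σ ^ 2 * ρ - u1 * σ * ρ ^ 2 - c * (v2 * (k * σ + m * ρ) ^ 2 *
      (l * σ + n * ρ) - v1 * (k * σ + m * ρ) * (l * σ + n * ρ) ^ 2)) * hw
  obtain ⟨h3, h2, h1, h0⟩ := cubic_coeff_eq_zero key
  have k3 : u 3 = -(c * (-v 3 * k ^ 3 + 3 * v2 * k ^ 2 * l - 3 * v1 * k * l ^ 2 + v 0 * l ^ 3)) := by
    linear_combination -h3
  have k2 : u2 = c * (-v 3 * k ^ 2 * m + v2 * (2 * k * m * l + k ^ 2 * n)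
        - v1 * (m * l ^ 2 + 2 * k * l * n) + v 0 * l ^ 2 * n) := by linear_combination h2 / 3
  have k1 : u1 = -(c * (-v 3 * k * m ^ 2 + v2 * (m ^ 2 * l + 2 * k * m * n)
        - v1 * (2 * m * l * n + k * n ^ 2) + v 0 * l * n ^ 2)) := by linear_combination -h1 / 3
  have k0 : u 0 = c * (-v 3 * m ^ 3 + 3 * v2 * m ^ 2 * n - 3 * v1 * m * n ^ 2 + v 0 * n ^ 3) := by
    linear_combination h0
  have e : ∀ a b c d : ℝ, ∀ σ ρ : ℂ, hessForm ![a, √3 * b, √3 * c, d] σ ρ =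
      3 * ((a * c - b ^ 2 : ℂ) * ρ ^ 2 - (a * d - b * c) * (σ * ρ) + (b * d - c ^ 2) * σ ^ 2) := by
    intro a b c d σ ρ
    have hw := complex_sqrt3_sq
    simp only [hessForm, secLead, secMid, Matrix.cons_val]
    push_cast
    linear_combination ((a * c - b ^ 2 : ℂ) * ρ ^ 2 + b * c * (σ * ρ) + (b * d - c ^ 2) * σ ^ 2) * hw
  have eu : u = ![u 0, √3 * u1, √3 * u2, u 3] := by
    ext i; fin_cases i <;> simp [hu1, hu2]
  have ev : v = ![v 0, √3 * v1, √3 * v2, v 3] := by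
    ext i; fin_cases i <;> simp [hv1, hv2]
  rw [eu, ev, e, e, k0, k1, k2, k3]
  push_cast
  ring

theorem hessForm_one (v : Fin 4 → ℝ) (hL : secLead v ≠ 0) (r : ℂ) :
    hessForm v 1 r = 0 ↔ ∃ ε : ℤˣ, r = lam ε v := by
  rw [← quadratic_iff hL, hessForm]
  simp only [one_pow, one_mul, mul_one]

theorem hessForm_homogeneous (v : Fin 4 → ℝ) {σ : ℂ} (hσ : σ ≠ 0) (ρ : ℂ) :
    σ ^ 2 * hessForm v 1 (ρ / σ) = hessForm v σ ρ := by
  simp only [hessForm]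
  field_simp

theorem jetOf_pt (γ : ℝ → Fin 4 → ℝ) (t : ℝ) : (jetOf γ t).pt = graphPt γ t := by
  simp [Jet.pt, jetOf, graphPt]

theorem map_mulVec_ofReal (g : Matrix (Fin 7) (Fin 7) ℝ) (v : Fin 7 → ℝ) :
    (g.map (algebraMap ℝ ℂ)).mulVec (fun i => (v i : ℂ)) = fun i => ((g.mulVec v i : ℝ) : ℂ) := by
  funext i
  exact (RingHom.map_mulVec (algebraMap ℝ ℂ) g v i).symm

theorem moved_lineM (g : Matrix (Fin 7) (Fin 7) ℝ) (m : Fin 5 → ℂ) :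
    moved g (lineM m) = Submodule.span ℂ {(g.map (algebraMap ℝ ℂ)).mulVec (vecM m)} := by
  rw [moved, lineM, Submodule.map_span, Set.image_singleton]
  rfl

/-- The matrix of a motion from a plane to another plane is invertible. -/
theorem det_ne_zero_of_mulVec {g : Matrix.GeneralLinearGroup (Fin 7) ℝ} {b c : Fin 5 → ℝ}
    {k l m n : ℝ} (hA : (g : Matrix (Fin 7) (Fin 7) ℝ).mulVec (kA b) = k • kA c + l • kB c)
    (hB : (g : Matrix (Fin 7) (Fin 7) ℝ).mulVec (kB b) = m • kA c + n • kB c) :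
    k * n - l * m ≠ 0 := by
  intro h
  have h1 : n • kA b - l • kB b = 0 := mulVec_inj g (by
    rw [Matrix.mulVec_sub, Matrix.mulVec_smul, Matrix.mulVec_smul, hA, hB, Matrix.mulVec_zero]
    have : n • (k • kA c + l • kB c) - l • (m • kA c + n • kB c) = (k * n - l * m) • kA c := by
      module
    rw [this, h, zero_smul])
  have h2 : m • kA b - k • kB b = 0 := mulVec_inj g (by
    rw [Matrix.mulVec_sub, Matrix.mulVec_smul, Matrix.mulVec_smul, hA, hB, Matrix.mulVec_zero]
    have : m • (k • kA c + l • kB c) - k • (m • kA c + n • kB c) = (-(k * n - l * m)) • kB c := by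
      module
    rw [this, h, neg_zero, zero_smul])
  have hm : m = 0 := by simpa [kA, kB] using congrFun h2 1
  have hn : n = 0 := by simpa [kA, kB] using congrFun h1 1
  have h3 : kB b = 0 := mulVec_inj g (by rw [hB, hm, hn, Matrix.mulVec_zero]; simp)
  simpa [kB] using congrFun h3 6

section congruence

variable {g : Matrix.GeneralLinearGroup (Fin 7) ℝ} {γ₁ γ₂ : ℝ → Fin 4 → ℝ}
  {τ : ℝ → ℝ}

theorem mulVec_kA_kB_of_moved {x : ℝ} (h : moved (g : Matrix (Fin 7) (Fin 7) ℝ)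
    (planeK (graphPt γ₁ x)) = planeK (graphPt γ₂ (τ x))) {v : Fin 7 → ℝ}
    (hv : v ∈ planeK (graphPt γ₁ x)) : (g : Matrix (Fin 7) (Fin 7) ℝ).mulVec v =
      (g : Matrix (Fin 7) (Fin 7) ℝ).mulVec v 1 • kA (hat (graphPt γ₂ (τ x))) +
        (g : Matrix (Fin 7) (Fin 7) ℝ).mulVec v 6 • kB (hat (graphPt γ₂ (τ x))) := by
  refine mem_span_pair_coords (i := 1) (j := 6) rfl rfl rfl rfl ?_
  rw [← planeK_eq, ← h, moved]
  exact Submodule.mem_map_of_mem hv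

theorem kA_mem (b : Fin 5 → ℝ) : kA (hat b) ∈ planeK b := by
  rw [planeK_eq]; exact Submodule.subset_span (by simp)

theorem kB_mem (b : Fin 5 → ℝ) : kB (hat b) ∈ planeK b := by
  rw [planeK_eq]; exact Submodule.subset_span (by simp)

variable (hg : g ∈ G2) (h₁ : ContDiff ℝ ∞ γ₁) (h₂ : ContDiff ℝ ∞ γ₂)

include hg h₁ h₂

/-- The cubic forms of congruent curves correspond to each other. -/
theorem cubicJet_of_congruent {x : ℝ} (hτ : ContDiffAt ℝ 2 τ x)
    (h : ∀ᶠ t in 𝓝 x, moved (g : Matrix (Fin 7) (Fin 7) ℝ) (planeK (graphPt γ₁ t)) =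
      planeK (graphPt γ₂ (τ t))) (σ ρ : ℝ) :
    cubicJet (jetOf γ₁ x) σ ρ = deriv τ x ^ 3 * cubicJet (jetOf γ₂ (τ x))
      ((g : Matrix (Fin 7) (Fin 7) ℝ).mulVec
        (σ • kA (hat (graphPt γ₁ x)) + ρ • kB (hat (graphPt γ₁ x))) 1)
      ((g : Matrix (Fin 7) (Fin 7) ℝ).mulVec
        (σ • kA (hat (graphPt γ₁ x)) + ρ • kB (hat (graphPt γ₁ x))) 6) := by
  set G := (g : Matrix (Fin 7) (Fin 7) ℝ)
  obtain ⟨hb, hv⟩ := hasDerivAt_hat_graphPt (h₁.contDiffAt (x := x))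
  have hW : ∀ᶠ t in 𝓝 x, G.mulVec (σ • kA (hat (graphPt γ₁ t)) + ρ • kB (hat (graphPt γ₁ t))) ∈
      planeK (graphPt γ₂ (τ t)) := by
    filter_upwards [h] with t ht
    rw [← ht, moved]
    exact Submodule.mem_map_of_mem (add_mem (Submodule.smul_mem _ _ (kA_mem _))
      (Submodule.smul_mem _ _ (kB_mem _)))
  have key := triple_section h₂.contDiffAt hτ
    (hb.mono fun t ht => hasDerivAt_mulVec ((ht.kA.const_smul σ).add (ht.kB.const_smul ρ)) G)
    (hasDerivAt_mulVec (((hb.self_of_nhds.kAd hv).const_smul σ).add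
      ((hb.self_of_nhds.kBd hv).const_smul ρ)) G) hW
  refine Eq.trans (Eq.trans ?_ (triple_mulVec hg _ _ _).symm) key
  simp only [cubicJet, cubicK, cubic, jetOf_pt]
  simp [Jet.vel, jetOf]

/-- A motion of curves in `K` maps the secant points to secant points. -/
theorem lam_of_congruent {x : ℝ} (hτ : ContDiffAt ℝ 2 τ x) (hτ' : deriv τ x ≠ 0)
    (hx₁ : jetOf γ₁ x ∈ GenK) (hx₂ : jetOf γ₂ (τ x) ∈ GenK)
    (h : ∀ᶠ t in 𝓝 x, moved (g : Matrix (Fin 7) (Fin 7) ℝ) (planeK (graphPt γ₁ t)) =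
      planeK (graphPt γ₂ (τ t))) {k l m n : ℝ}
    (hA : (g : Matrix (Fin 7) (Fin 7) ℝ).mulVec (kA (hat (graphPt γ₁ x))) =
      k • kA (hat (graphPt γ₂ (τ x))) + l • kB (hat (graphPt γ₂ (τ x))))
    (hB : (g : Matrix (Fin 7) (Fin 7) ℝ).mulVec (kB (hat (graphPt γ₁ x))) =
      m • kA (hat (graphPt γ₂ (τ x))) + n • kB (hat (graphPt γ₂ (τ x)))) (ε : ℤˣ) :
    (k : ℂ) + m * lam ε (upsilon (jetOf γ₁ x)) ≠ 0 ∧ ∃ ε' : ℤˣ,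
      ((l : ℂ) + n * lam ε (upsilon (jetOf γ₁ x))) / (k + m * lam ε (upsilon (jetOf γ₁ x))) =
        lam ε' (upsilon (jetOf γ₂ (τ x))) ∧
      moved (g : Matrix (Fin 7) (Fin 7) ℝ) (lineM (branchPt ε (jetOf γ₁ x))) =
        lineM (branchPt ε' (jetOf γ₂ (τ x))) := by
  have hdet := det_ne_zero_of_mulVec hA hB
  have hdet' : (k * n - l * m : ℂ) ≠ 0 := by exact_mod_cast hdet
  have s1 := hx₁.1
  have s2 := hx₂.1
  have hcub := cubicJet_of_congruent hg h₁ h₂ hτ h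
  have cov := hessForm_covariant (u := upsilon (jetOf γ₁ x)) (v := upsilon (jetOf γ₂ (τ x)))
    (k := k) (l := l) (m := m) (n := n) (c := deriv τ x ^ 3 * contactDefect (jetOf γ₂ (τ x)) /
      contactDefect (jetOf γ₁ x)) (fun σ ρ => by
    have h1 := hcub σ ρ
    rw [Matrix.mulVec_add, Matrix.mulVec_smul, Matrix.mulVec_smul, hA, hB, cubicJet,
      cubicJet, cubicK_jet s1, cubicK_jet s2] at h1
    have e1 : (σ • (k • kA (hat (graphPt γ₂ (τ x))) + l • kB (hat (graphPt γ₂ (τ x)))) +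
      ρ • (m • kA (hat (graphPt γ₂ (τ x))) + n • kB (hat (graphPt γ₂ (τ x))))) 1 =
        k * σ + m * ρ := by simp [kA, kB]; ring
    have e6 : (σ • (k • kA (hat (graphPt γ₂ (τ x))) + l • kB (hat (graphPt γ₂ (τ x)))) +
      ρ • (m • kA (hat (graphPt γ₂ (τ x))) + n • kB (hat (graphPt γ₂ (τ x))))) 6 =
        l * σ + n * ρ := by simp [kA, kB]; ring
    rw [e1, e6] at h1
    rw [div_mul_eq_mul_div, eq_div_iff s1]
    linear_combination h1)
  have hz := (hessForm_one _ hx₁.2.1 _).2 ⟨ε, rfl⟩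
  set r := lam ε (upsilon (jetOf γ₁ x)) with hr
  rw [cov, mul_one, mul_one] at hz
  have hc : ((deriv τ x ^ 3 * contactDefect (jetOf γ₂ (τ x)) / contactDefect (jetOf γ₁ x) : ℝ) : ℂ)
      ≠ 0 := by
    exact_mod_cast div_ne_zero (mul_ne_zero (pow_ne_zero 3 hτ') s2) s1
  have hz' : hessForm (upsilon (jetOf γ₂ (τ x))) (k + m * r) (l + n * r) = 0 :=
    (mul_eq_zero.1 hz).resolve_left (mul_ne_zero (pow_ne_zero 2 hc) (pow_ne_zero 2 hdet'))
  have hL : (secLead (upsilon (jetOf γ₂ (τ x))) : ℂ) ≠ 0 := by exact_mod_cast hx₂.2.1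
  have hne : (k : ℂ) + m * r ≠ 0 := by
    intro h0
    rw [h0, hessForm] at hz'
    have h1 : (l : ℂ) + n * r = 0 := by simpa [hL] using hz'
    exact hdet' (by linear_combination (n : ℂ) * h0 - m * h1)
  have hroot : hessForm (upsilon (jetOf γ₂ (τ x))) 1 ((l + n * r) / (k + m * r)) = 0 := by
    rw [← hessForm_homogeneous _ hne] at hz'
    exact (mul_eq_zero.1 hz').resolve_left (pow_ne_zero 2 hne)
  obtain ⟨ε', hε'⟩ := (hessForm_one _ hx₂.2.1 _).1 hroot
  refine ⟨hne, ε', hε', ?_⟩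
  have hk : ∀ (γ : ℝ → Fin 4 → ℝ) (t : ℝ),
      kA (hatC (jetOf γ t)) = (fun i => ((kA (hat (graphPt γ t)) i : ℝ) : ℂ)) ∧
      kB (hatC (jetOf γ t)) = (fun i => ((kB (hat (graphPt γ t)) i : ℝ) : ℂ)) := by
    intro γ t
    constructor <;> funext i
    · rw [kA_ofReal, ← jetOf_pt]; rfl
    · rw [kB_ofReal, ← jetOf_pt]; rfl
  have hv : ((g : Matrix (Fin 7) (Fin 7) ℝ).map (algebraMap ℝ ℂ)).mulVec
      (vecM (branchPt ε (jetOf γ₁ x))) = (k + m * r) • vecM (branchPt ε' (jetOf γ₂ (τ x))) := by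
    rw [vecM_branchPt, vecM_branchPt, ← hε', Matrix.mulVec_add, Matrix.mulVec_smul, ← hr,
      (hk γ₁ x).1, (hk γ₁ x).2, (hk γ₂ (τ x)).1, (hk γ₂ (τ x)).2, map_mulVec_ofReal,
      map_mulVec_ofReal, hA, hB]
    funext i
    have hq := mul_div_cancel₀ ((l : ℂ) + n * r) hne
    simp only [Pi.add_apply, Pi.smul_apply, smul_eq_mul]
    push_cast
    linear_combination (-((kB (hat (graphPt γ₂ (τ x))) i : ℝ) : ℂ)) * hq
  rw [moved_lineM, hv, lineM]
  exact Submodule.span_singleton_smul_eq (IsUnit.mk0 _ hne) _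

/-- Motions of curves in `K` induce motions of the pair of branches; the permutation of the branches
is locally constant, since the secant points move continuously and do not collide. -/
theorem branchPt_of_congruent {x : ℝ} (hτ : ContDiffAt ℝ ∞ τ x) (hτ' : deriv τ x ≠ 0)
    (hx₁ : jetOf γ₁ x ∈ GenK) (hx₂ : jetOf γ₂ (τ x) ∈ GenK)
    (h : ∀ᶠ t in 𝓝 x, moved (g : Matrix (Fin 7) (Fin 7) ℝ) (planeK (graphPt γ₁ t)) =
      planeK (graphPt γ₂ (τ t))) : ∃ σ : ℤˣ, ∀ᶠ t in 𝓝 x, ∀ ε : ℤˣ,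
        moved (g : Matrix (Fin 7) (Fin 7) ℝ) (lineM (branchPt ε (jetOf γ₁ t))) =
          lineM (branchPt (σ * ε) (jetOf γ₂ (τ t))) := by
  set G := (g : Matrix (Fin 7) (Fin 7) ℝ) with hG
  have hτ2 : ContDiffAt ℝ 2 τ x := contDiffAt_infty.1 hτ 2
  have hτc : ContinuousAt τ x := hτ.continuousAt
  have m₁ := eventually_jetOf_mem isOpen_GenK (h₁.contDiffAt (x := x)) hx₁
  have m₂ := hτc.eventually (eventually_jetOf_mem isOpen_GenK (h₂.contDiffAt (x := τ x)) hx₂)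
  have hd : ∀ᶠ t in 𝓝 x, deriv τ t ≠ 0 := by
    exact (hasDerivAt_deriv hτ2).continuousAt.eventually_ne hτ'
  let k : ℝ → ℝ := fun t => G.mulVec (kA (hat (graphPt γ₁ t))) 1
  let l : ℝ → ℝ := fun t => G.mulVec (kA (hat (graphPt γ₁ t))) 6
  let m : ℝ → ℝ := fun t => G.mulVec (kB (hat (graphPt γ₁ t))) 1
  let n : ℝ → ℝ := fun t => G.mulVec (kB (hat (graphPt γ₁ t))) 6
  let r : ℝ → ℂ := fun t => lam 1 (upsilon (jetOf γ₁ t))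
  have key : ∀ᶠ t in 𝓝 x, ∀ ε : ℤˣ, (k t : ℂ) + m t * lam ε (upsilon (jetOf γ₁ t)) ≠ 0 ∧ ∃ ε' : ℤˣ,
      ((l t : ℂ) + n t * lam ε (upsilon (jetOf γ₁ t))) /
        (k t + m t * lam ε (upsilon (jetOf γ₁ t))) = lam ε' (upsilon (jetOf γ₂ (τ t))) ∧
      moved G (lineM (branchPt ε (jetOf γ₁ t))) = lineM (branchPt ε' (jetOf γ₂ (τ t))) := by
    filter_upwards [h.eventually_nhds, hτ2.eventually (by simp), m₁, m₂, hd]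
      with t h1 h2 h3 h4 h5 ε
    exact lam_of_congruent hg h₁ h₂ h2 h5 h3 h4 h1
      (mulVec_kA_kB_of_moved h1.self_of_nhds (kA_mem _))
      (mulVec_kA_kB_of_moved h1.self_of_nhds (kB_mem _)) ε
  obtain ⟨hne, σ, hσ, -⟩ := key.self_of_nhds 1
  refine ⟨σ, ?_⟩
  -- continuity of all ingredients at `x`
  have hb : ContinuousAt (fun t => hat (graphPt γ₁ t)) x :=
    (hasDerivAt_hat_graphPt (h₁.contDiffAt (x := x))).1.self_of_nhds.continuousAt
  have hA : ContinuousAt (fun t => G.mulVec (kA (hat (graphPt γ₁ t)))) x :=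
    (hasDerivAt_mulVec (hasDerivAt_hat_graphPt
      (h₁.contDiffAt (x := x))).1.self_of_nhds.kA G).continuousAt
  have hB : ContinuousAt (fun t => G.mulVec (kB (hat (graphPt γ₁ t)))) x :=
    (hasDerivAt_mulVec (hasDerivAt_hat_graphPt
      (h₁.contDiffAt (x := x))).1.self_of_nhds.kB G).continuousAt
  have hlam : ∀ (ε : ℤˣ) (γ : ℝ → Fin 4 → ℝ) (t : ℝ), ContDiff ℝ ∞ γ → jetOf γ t ∈ GenK →
      ContinuousAt (fun t => lam ε (upsilon (jetOf γ t))) t := fun ε γ t hγ ht =>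
    ContinuousAt.comp (g := fun θ => lam ε (upsilon θ))
      ((isAlg_lam.continuousOn subset_rfl ε).continuousAt (isOpen_GenK.mem_nhds ht))
      (continuous_jetOf hγ).continuousAt
  have cast : ∀ {f : ℝ → Fin 7 → ℝ} (i : Fin 7), ContinuousAt f x →
      ContinuousAt (fun t => (f t i : ℂ)) x := fun i hf =>
    Complex.continuous_ofReal.continuousAt.comp (continuousAt_pi.1 hf i)
  have hr : ContinuousAt (fun t => ((l t : ℂ) + n t * r t) / (k t + m t * r t)) x :=
    ((cast 6 hA).add ((cast 6 hB).mul (hlam 1 γ₁ x h₁ hx₁))).div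
      ((cast 1 hA).add ((cast 1 hB).mul (hlam 1 γ₁ x h₁ hx₁))) hne
  have hs : ContinuousAt (fun t => lam (-σ) (upsilon (jetOf γ₂ (τ t)))) x :=
    ContinuousAt.comp (g := fun t => lam (-σ) (upsilon (jetOf γ₂ t))) (hlam (-σ) γ₂ _ h₂ hx₂) hτc
  have hsep : ∀ᶠ t in 𝓝 x, ((l t : ℂ) + n t * r t) / (k t + m t * r t) ≠
      lam (-σ) (upsilon (jetOf γ₂ (τ t))) :=
    (hr.ne_iff_eventually_ne hs).1 (by rw [hσ]; exact lam_ne hx₂.2.1 hx₂.2.2 σ)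
  filter_upwards [key, hsep, m₁] with t h1 h2 h3
  have units : ∀ ε ε' : ℤˣ, ε = ε' ∨ ε = -ε' := by decide
  have first : moved G (lineM (branchPt 1 (jetOf γ₁ t))) = lineM (branchPt σ (jetOf γ₂ (τ t))) := by
    obtain ⟨-, ε', e1, e2⟩ := h1 1
    rcases units ε' σ with rfl | rfl
    · exact e2
    · exact absurd e1 h2
  intro ε
  rcases units ε 1 with rfl | rfl
  · rw [mul_one]; exact first
  · obtain ⟨-, ε', -, e2⟩ := h1 (-1)
    rcases units ε' σ with rfl | rfl
    · exfalso
      rw [← first, moved_lineM, moved_lineM] at e2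
      have hinj : Function.Injective ((G.map (algebraMap ℝ ℂ)).mulVec) := by
        refine Matrix.mulVec_injective_of_isUnit ?_
        exact (g.isUnit).map (algebraMap ℝ ℂ).mapMatrix
      have e3 : lineM (branchPt (-1) (jetOf γ₁ t)) = lineM (branchPt 1 (jetOf γ₁ t)) := by
        have : Function.Injective (Submodule.map (Matrix.toLin' (G.map (algebraMap ℝ ℂ)))) :=
          Submodule.map_injective_of_injective hinj
        refine this ?_
        have e4 : ∀ m, (lineM m).map (Matrix.toLin' (G.map (algebraMap ℝ ℂ))) =
            moved G (lineM m) := fun m => rfl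
        rw [e4, e4, moved_lineM, moved_lineM, e2]
      exact branchPt_ne h3 (lineM_injective e3).symm
    · rw [mul_neg, mul_one]; exact e2

omit hg h₁ h₂ in
/-- A motion of the pair of branches is a motion of the curve, since the branches span the plane. -/
theorem moved_planeK_of_branchPt {x : ℝ} {σ : ℤˣ} (hx₁ : jetOf γ₁ x ∈ GenK)
    (hx₂ : jetOf γ₂ (τ x) ∈ GenK)
    (h : ∀ ε : ℤˣ, moved (g : Matrix (Fin 7) (Fin 7) ℝ) (lineM (branchPt ε (jetOf γ₁ x))) =
          lineM (branchPt (σ * ε) (jetOf γ₂ (τ x)))) :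
    moved (g : Matrix (Fin 7) (Fin 7) ℝ) (planeK (graphPt γ₁ x)) = planeK (graphPt γ₂ (τ x)) := by
  set G := (g : Matrix (Fin 7) (Fin 7) ℝ) with hG
  have hsup : moved G (lineM (branchPt 1 (jetOf γ₁ x)) ⊔ lineM (branchPt (-1) (jetOf γ₁ x))) =
      lineM (branchPt 1 (jetOf γ₂ (τ x))) ⊔ lineM (branchPt (-1) (jetOf γ₂ (τ x))) := by
    rw [moved, Submodule.map_sup]
    change moved G _ ⊔ moved G _ = _
    rw [h, h]
    rcases Int.units_eq_one_or σ with rfl | rfl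
    · simp
    · rw [sup_comm]; simp
  rw [lineM_sup_branchPt hx₁, lineM_sup_branchPt hx₂, jetOf_pt, jetOf_pt] at hsup
  simp only [vecK₁_eq, vecK₂_eq, kA_ofReal, kB_ofReal] at hsup
  have key : ∀ v ∈ planeK (graphPt γ₁ x), G.mulVec v = G.mulVec v 1 • kA (hat (graphPt γ₂ (τ x))) +
      G.mulVec v 6 • kB (hat (graphPt γ₂ (τ x))) := by
    intro v hv
    rw [planeK_eq] at hv
    obtain ⟨a, b, rfl⟩ := Submodule.mem_span_pair.1 hv
    have h1 : (fun i => (((a • kA (hat (graphPt γ₁ x)) + b • kB (hat (graphPt γ₁ x))) i : ℝ) : ℂ)) ∈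
        Submodule.span ℂ {kA (fun i => (hat (graphPt γ₁ x) i : ℂ)),
          kB (fun i => (hat (graphPt γ₁ x) i : ℂ))} := by
      refine Submodule.mem_span_pair.2 ⟨a, b, ?_⟩
      funext i
      simp [← kA_ofReal, ← kB_ofReal]
    have h2 := Submodule.mem_map_of_mem (f := Matrix.toLin' (G.map (algebraMap ℝ ℂ))) h1
    change _ ∈ moved G _ at h2
    simp only [hsup] at h2
    have h3 := mem_span_pair_coords (i := 1) (j := 6) rfl rfl rfl rfl h2
    rw [Matrix.toLin'_apply, map_mulVec_ofReal] at h3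
    funext i
    have h4 := congrFun h3 i
    simp only [Pi.add_apply, Pi.smul_apply, smul_eq_mul, ← kA_ofReal, ← kB_ofReal] at h4 ⊢
    exact_mod_cast h4
  have hA := key _ (kA_mem _)
  have hB := key _ (kB_mem _)
  rw [planeK_eq, planeK_eq, moved_span_pair]
  exact span_pair_eq hA hB (det_ne_zero_of_mulVec hA hB)

theorem congruent_iff_branchPt {x : ℝ} (hτ : ContDiffAt ℝ ∞ τ x) (hτ' : deriv τ x ≠ 0)
    (hx₁ : jetOf γ₁ x ∈ GenK) (hx₂ : jetOf γ₂ (τ x) ∈ GenK) :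
    CurvesCongruent planeK (g : Matrix (Fin 7) (Fin 7) ℝ) γ₁ γ₂ τ x ↔
      ∃ σ : ℤˣ, ∀ᶠ t in 𝓝 x, ∀ ε : ℤˣ,
        moved (g : Matrix (Fin 7) (Fin 7) ℝ) (lineM (branchPt ε (jetOf γ₁ t))) =
          lineM (branchPt (σ * ε) (jetOf γ₂ (τ t))) := by
  constructor
  · rintro ⟨-, -, h⟩
    exact branchPt_of_congruent hg h₁ h₂ hτ hτ' hx₁ hx₂ h
  · rintro ⟨σ, h⟩
    refine ⟨hτ, hτ', ?_⟩
    filter_upwards [h, eventually_jetOf_mem isOpen_GenK (h₁.contDiffAt (x := x)) hx₁,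
      hτ.continuousAt.eventually
        (eventually_jetOf_mem isOpen_GenK (h₂.contDiffAt (x := τ x)) hx₂)] with t h1 h2 h3
    exact moved_planeK_of_branchPt h2 h3 h1

end congruence

/-! ### Density of the non-vanishing sets of the branches -/

theorem sampleJet_mem_GenK {c : ℝ} (hc : c ≠ 0) : sampleJet c ∈ GenK := by
  obtain ⟨P, hP, hP'⟩ := exists_poly_GenK hc
  exact hP' _ hP

/-- Since the discriminant takes negative values, an algebraic function whose norm vanishes is
zero. -/
theorem IsAlg.eq_zero_of_norm {k : ℕ} {H : ℤˣ → Jet ℝ 4 → ℂ} (hH : IsAlg GenK k H)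
    (h : ∀ θ ∈ GenK, H 1 θ * H (-1) θ = 0) (ε : ℤˣ) {θ : Jet ℝ 4} (hθ : θ ∈ GenK) :
    H ε θ = 0 := by
  obtain ⟨R₁, R₂, h1, h2, e⟩ := hH
  have ho : IsOpen {θ | θ ∈ GenK ∧ secDisc (upsilon θ) ∈ Iio (0 : ℝ)} := isOpen_disc isOpen_Iio
  have hne : {θ | θ ∈ GenK ∧ secDisc (upsilon θ) ∈ Iio (0 : ℝ)}.Nonempty :=
    ⟨sampleJet (-1), sampleJet_mem_GenK (by norm_num), by
      rw [secDisc_sampleJet, mem_Iio]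
      have := sqrt3_pos
      linarith⟩
  have key : ∀ η ∈ {θ | θ ∈ GenK ∧ secDisc (upsilon θ) ∈ Iio (0 : ℝ)}, R₁ η = 0 ∧ R₂ η = 0 := by
    rintro η ⟨h3, h4⟩
    have h5 := h η h3
    have hs := csqrt_sq (secDisc (upsilon η))
    have h6 : ((R₁ η ^ 2 - secDisc (upsilon η) * R₂ η ^ 2 : ℝ) : ℂ) = 0 := by
      rw [← h5, e η h3, e η h3]
      push_cast
      linear_combination (R₂ η : ℂ) ^ 2 * hs
    have h7 : R₁ η ^ 2 - secDisc (upsilon η) * R₂ η ^ 2 = 0 := by exact_mod_cast h6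
    rw [mem_Iio] at h4
    have h8 : R₂ η ^ 2 = 0 := by
      nlinarith [sq_nonneg (R₁ η), sq_nonneg (R₂ η), mul_nonneg (neg_pos.2 h4).le (sq_nonneg (R₂ η))]
    have h9 : R₂ η = 0 := by simpa using h8
    rw [h9] at h7
    exact ⟨by simpa using h7, h9⟩
  have zero : ∀ R : Jet ℝ 4 → ℝ, IsRat GenK k R →
      (∀ η ∈ {θ | θ ∈ GenK ∧ secDisc (upsilon θ) ∈ Iio (0 : ℝ)}, R η = 0) → R θ = 0 := by
    rintro R ⟨N, W, -, -, hR⟩ hz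
    have hN : N = 0 := JetPoly.eq_zero_of_isOpen ho hne fun η hη => by
      have := hz η hη
      rw [(hR η hη.1).2] at this
      exact (div_eq_zero_iff.1 this).resolve_right (hR η hη.1).1
    rw [(hR θ hθ).2, hN, JetPoly.evalAt_zero, zero_div]
  rw [e θ hθ, zero R₁ h1 fun η hη => (key η hη).1, zero R₂ h2 fun η hη => (key η hη).2]
  simp

/-- The set over which a polynomial is non-zero at both branches contains the complement of a
hypersurface, unless the polynomial vanishes on both branches. -/
theorem exists_poly_evalAt_branch_of_exists {Q : JetPoly}
    (h : ∃ ε : ℤˣ, ∃ θ ∈ BranchDom ε, Q.evalAt (branch ε θ) ≠ 0) :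
    ∃ T : JetPoly, T ≠ 0 ∧ ∀ θ, T.evalAt θ ≠ 0 →
      θ ∈ GenBranch ∧ ∀ ε : ℤˣ, Q.evalAt (branch ε θ) ≠ 0 := by
  obtain ⟨H, e, k, hk, hH, hF⟩ := branchAlg_evalAt Q
  beta_reduce at hF
  obtain ⟨N, hN, eN⟩ := hH.norm subset_rfl hk
  have hne : ∃ θ₀ ∈ GenK, N θ₀ ≠ 0 := by
    by_contra! hc
    obtain ⟨ε, θ, hθ, h0⟩ := h
    refine h0 ?_
    rw [hF ε θ hθ, hH.eq_zero_of_norm (fun η hη => by rw [← eN η hη, hc η hη]; simp) ε hθ.1, zero_div]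
  obtain ⟨θ₀, hθ₀, h0⟩ := hne
  obtain ⟨A, W, -, -, hA⟩ := hN
  have hA0 : A ≠ 0 := fun h1 => h0 (by
    rw [(hA θ₀ hθ₀).2, h1, JetPoly.evalAt_zero, zero_div])
  obtain ⟨P, hP, hP'⟩ := exists_poly_GenBranch one_ne_zero
  refine ⟨A * P, mul_ne_zero hA0 fun h1 => hP (by rw [h1, JetPoly.evalAt_zero]), fun θ hT => ?_⟩
  rw [JetPoly.evalAt_mul] at hT
  have hθ := hP' θ (right_ne_zero_of_mul hT)
  refine ⟨hθ, fun ε => ?_⟩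
  rw [hF ε θ (GenBranch_subset_BranchDom ε hθ)]
  refine div_ne_zero (fun h1 => ?_) (pow_ne_zero _ (hθ.2 ε))
  have h2 : (N θ : ℂ) = 0 := by
    rw [eN θ hθ.1]
    rcases Int.units_eq_one_or ε with rfl | rfl
    · rw [h1, zero_mul]
    · rw [h1, mul_zero]
  have h3 : N θ = 0 := by exact_mod_cast h2
  rw [(hA θ hθ.1).2] at h3
  exact (div_eq_zero_iff.1 h3).elim (left_ne_zero_of_mul hT) (hA θ hθ.1).1

/-! ### Curves with a given finite jet -/

/-- The polynomial curve with the derivatives `a 0, …, a (N - 1)` at `x`. -/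
noncomputable def taylorCurve (x : ℝ) (N : ℕ) (a : ℕ → Fin 4 → ℝ) (t : ℝ) : Fin 4 → ℝ :=
  ∑ k ∈ Finset.range N, ((t - x) ^ k / k.factorial) • a k

theorem contDiff_taylorCurve (x : ℝ) (N : ℕ) (a : ℕ → Fin 4 → ℝ) :
    ContDiff ℝ ∞ (taylorCurve x N a) := by
  unfold taylorCurve
  fun_prop

theorem deriv_taylorCurve (x : ℝ) (N : ℕ) (a : ℕ → Fin 4 → ℝ) :
    deriv (taylorCurve x (N + 1) a) = taylorCurve x N (fun k => a (k + 1)) := by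
  funext t
  refine HasDerivAt.deriv ?_
  have h : taylorCurve x (N + 1) a = fun t => (∑ k ∈ Finset.range N,
      ((t - x) ^ (k + 1) / (k + 1).factorial) • a (k + 1)) + a 0 := by
    funext t
    simp [taylorCurve, Finset.sum_range_succ']
  rw [h]
  refine HasDerivAt.add_const _ (HasDerivAt.fun_sum fun k _ => ?_)
  have h1 := ((((hasDerivAt_id t).sub_const x).pow (k + 1)).div_const
    ((k + 1).factorial : ℝ)).smul_const (a (k + 1))
  refine h1.congr_deriv ?_
  congr 1
  have : ((k + 1 : ℕ) : ℝ) ≠ 0 := by positivity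
  have : (k.factorial : ℝ) ≠ 0 := by positivity
  rw [Nat.factorial_succ]
  push_cast at *
  simp
  field_simp

theorem iteratedDeriv_taylorCurve (x : ℝ) : ∀ (k N : ℕ) (a : ℕ → Fin 4 → ℝ), k < N →
    iteratedDeriv k (taylorCurve x N a) x = a k := by
  intro k
  induction k with
  | zero =>
    rintro (_ | N) a h
    · omega
    · simp [taylorCurve, Finset.sum_range_succ']
  | succ k ih =>
    rintro (_ | N) a h
    · omega
    · rw [iteratedDeriv_succ', deriv_taylorCurve, ih N _ (by omega)]

/-! ### Smooth solutions of ordinary differential equations -/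

/-- Local existence of smooth solutions of `r' = F (t, r)`. -/
theorem exists_smooth_solution {F : ℝ × ℝ → ℝ} {U : Set (ℝ × ℝ)} (hU : IsOpen U)
    (hF : ContDiffOn ℝ ∞ F U) {t₀ r₀ : ℝ} (h₀ : (t₀, r₀) ∈ U) :
    ∃ r : ℝ → ℝ, r t₀ = r₀ ∧
      ∀ᶠ t in 𝓝 t₀, (t, r t) ∈ U ∧ HasDerivAt r (F (t, r t)) t ∧ ContDiffAt ℝ ∞ r t := by
  let G : ℝ × ℝ → ℝ × ℝ := fun y => (1, F y)
  have hG : ContDiffOn ℝ ∞ G U := contDiffOn_const.prodMk hF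
  obtain ⟨α, hα0, δ, hδ, hα⟩ :=
    (((hG.contDiffAt (hU.mem_nhds h₀)).of_le
      (by exact_mod_cast le_top) : ContDiffAt ℝ 1 G (t₀, r₀))).exists_forall_mem_closedBall_exists_eq_forall_mem_Ioo_hasDerivAt₀ t₀
  have hfst : ∀ t ∈ Ioo (t₀ - δ) (t₀ + δ), (α t).1 = t := by
    have h1 : ∀ t ∈ Ioo (t₀ - δ) (t₀ + δ), HasDerivAt (fun s => (α s).1 - s) 0 t := fun t ht => by
      have := ((ContinuousLinearMap.fst ℝ ℝ ℝ).hasFDerivAt.comp_hasDerivAt t (hα t ht)).sub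
        (hasDerivAt_id t)
      exact this.congr_deriv (by simp [G])
    have h2 : ∀ t ∈ Ioo (t₀ - δ) (t₀ + δ), (α t).1 - t = (α t₀).1 - t₀ := fun t ht =>
      isOpen_Ioo.is_const_of_deriv_eq_zero isPreconnected_Ioo
        (fun s hs => (h1 s hs).differentiableAt.differentiableWithinAt)
        (fun s hs => (h1 s hs).deriv) ht ⟨by linarith, by linarith⟩
    intro t ht
    have := h2 t ht
    rw [hα0] at this
    linarith
  have hcont : ContinuousAt α t₀ := (hα t₀ ⟨by linarith, by linarith⟩).continuousAt
  have hev : ∀ᶠ t in 𝓝 t₀, α t ∈ U ∧ t ∈ Ioo (t₀ - δ) (t₀ + δ) :=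
    (hcont.eventually_mem (hU.mem_nhds (by rwa [hα0]))).and
      (Ioo_mem_nhds (by linarith) (by linarith))
  refine ⟨fun t => (α t).2, congrArg Prod.snd hα0, ?_⟩
  filter_upwards [hev.eventually_nhds] with t ht
  obtain ⟨hU1, ht1⟩ := ht.self_of_nhds
  have hpair : α t = (t, (α t).2) := Prod.ext (hfst t ht1) rfl
  refine ⟨hpair ▸ hU1, ?_, ?_⟩
  · have := (ContinuousLinearMap.snd ℝ ℝ ℝ).hasFDerivAt.comp_hasDerivAt t (hα t ht1)
    rw [← hpair]
    exact this
  · obtain ⟨ρ, hρ, hball⟩ := Metric.eventually_nhds_iff_ball.1 ht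
    have hIcc : ∀ s ∈ Icc (t - ρ / 2) (t + ρ / 2), α s ∈ U ∧ s ∈ Ioo (t₀ - δ) (t₀ + δ) := by
      intro s hs
      refine hball s ?_
      rw [Metric.mem_ball, Real.dist_eq, abs_lt]
      constructor <;> linarith [hs.1, hs.2]
    have hsm : ContDiffOn ℝ ∞ α (Icc (t - ρ / 2) (t + ρ / 2)) :=
      ODE.contDiffOn_enat_Icc_of_hasDerivWithinAt (f := fun _ y => G y) (n := ⊤) (u := U)
        (hG.comp contDiffOn_snd fun y hy => hy.2)
        (fun s hs => (hα s (hIcc s hs).2).hasDerivWithinAt) fun s hs => (hIcc s hs).1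
    exact contDiffAt_snd.comp t
      (hsm.contDiffAt (Icc_mem_nhds (by linarith) (by linarith)))

/-! ### Flags along a curve in `M` -/

/-- The derivative of `vecMd` along a curve with velocity `v` and acceleration `a`. -/
def vecMdd (m v a : Fin 5 → ℝ) : Fin 7 → ℝ :=
  ![2 * a 2 - a 0 * m 3 - a 3 * m 0 - 2 * v 0 * v 3,
    0,
    -3 * a 4 + 2 * a 2 * m 3 + 2 * a 3 * m 2 + 4 * v 2 * v 3,
    -6 * a 1 + 4 * a 0 * m 2 + 4 * a 2 * m 0 - a 3 * m 0 ^ 2 - 2 * m 3 * v 0 ^ 2 + 8 * v 0 * v 2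
      - 2 * a 0 * m 0 * m 3 - 4 * m 0 * v 0 * v 3,
    -8 * v 2 ^ 2 + 3 * a 0 * m 4 + 6 * a 1 * m 3 - 8 * a 2 * m 2 + 6 * a 3 * m 1 + 3 * a 4 * m 0
      + 6 * v 0 * v 4 + 12 * v 1 * v 3 - 2 * a 0 * m 2 * m 3 - 2 * a 2 * m 0 * m 3
      - 2 * a 3 * m 0 * m 2 - 4 * m 0 * v 2 * v 3 - 4 * m 2 * v 0 * v 3 - 4 * m 3 * v 0 * v 2,
    a 0,
    a 3]

/-- The derivative of `tanM`. -/
def tanMd (m v : Fin 5 → ℝ) (r r₁ : ℝ) : Fin 7 → ℝ :=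
  ![v 3 - m 0 * r₁ - r * v 0,
    0,
    2 * m 2 * r₁ - 2 * m 3 * v 3 + 2 * r * v 2,
    -2 * v 2 + 2 * m 0 * v 3 - m 0 ^ 2 * r₁ + 2 * m 3 * v 0 - 2 * m 0 * r * v 0,
    3 * v 4 + 6 * m 1 * r₁ - 4 * m 2 * v 3 - 4 * m 3 * v 2 + m 3 ^ 2 * v 0 + 6 * r * v 1
      - 2 * m 0 * m 2 * r₁ + 2 * m 0 * m 3 * v 3 - 2 * m 0 * r * v 2 - 2 * m 2 * r * v 0,
    0,
    r₁]

/-- The second derivative of `tanM`. -/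
def tanMdd (m v a : Fin 5 → ℝ) (r r₁ r₂ : ℝ) : Fin 7 → ℝ :=
  ![a 3 - a 0 * r - m 0 * r₂ - 2 * r₁ * v 0,
    0,
    -2 * v 3 ^ 2 + 2 * a 2 * r - 2 * a 3 * m 3 + 2 * m 2 * r₂ + 4 * r₁ * v 2,
    -2 * a 2 + 2 * a 0 * m 3 + 2 * a 3 * m 0 - m 0 ^ 2 * r₂ - 2 * r * v 0 ^ 2 + 4 * v 0 * v 3
      - 2 * a 0 * m 0 * r - 4 * m 0 * r₁ * v 0,
    3 * a 4 + a 0 * m 3 ^ 2 + 6 * a 1 * r - 4 * a 2 * m 3 - 4 * a 3 * m 2 + 2 * m 0 * v 3 ^ 2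
      + 6 * m 1 * r₂ + 12 * r₁ * v 1 - 8 * v 2 * v 3 - 2 * a 0 * m 2 * r - 2 * a 2 * m 0 * r
      + 2 * a 3 * m 0 * m 3 - 2 * m 0 * m 2 * r₂ - 4 * m 0 * r₁ * v 2 - 4 * m 2 * r₁ * v 0
      + 4 * m 3 * v 0 * v 3 - 4 * r * v 0 * v 2,
    0,
    r₂]

section derivatives

variable {m v : ℝ → Fin 5 → ℝ} {a : Fin 5 → ℝ} {r r₁ : ℝ → ℝ} {r₂ t : ℝ}

theorem HasDerivAt.vecMd (h : HasDerivAt m (v t) t) (h' : HasDerivAt v a t) :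
    HasDerivAt (fun s => vecMd (m s) (v s)) (vecMdd (m t) (v t) a) t := by
  rw [hasDerivAt_pi] at h h'
  have h0 := h 0
  have h1 := h 1
  have h2 := h 2
  have h3 := h 3
  have h4 := h 4
  have g0 := h' 0
  have g1 := h' 1
  have g2 := h' 2
  have g3 := h' 3
  have g4 := h' 4
  have ha := (h2.const_mul 2).sub (h0.mul h3)
  have hu2 := ((h2.const_mul 2).mul h3).sub (h4.const_mul 3)
  have hu3 := (((h0.const_mul 4).mul h2).sub (h1.const_mul 6)).sub ((h0.pow 2).mul h3)
  have k0 := ((g2.const_mul 2).sub (g0.mul h3)).sub (h0.mul g3)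
  have k2 := (((g2.mul h3).add (h2.mul g3)).const_mul 2).sub (g4.const_mul 3)
  have k3 := (((((g0.mul h2).add (h0.mul g2)).const_mul 4).sub (g1.const_mul 6)).sub
    (((h0.const_mul 2).mul g0).mul h3)).sub ((h0.pow 2).mul g3)
  refine hasDerivAt_vec7 fun i => ?_
  fin_cases i
  · exact k0.congr_deriv (by simp [vecMdd]; ring)
  · exact hasDerivAt_const t (0 : ℝ)
  · exact k2.congr_deriv (by simp [vecMdd]; ring)
  · exact k3.congr_deriv (by simp [vecMdd]; ring)
  · exact ((((((ha.const_mul (-2)).mul k0).sub (k2.mul h0)).sub (hu2.mul g0)).sub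
      (k3.mul h3)).sub (hu3.mul g3)).congr_deriv (by simp [vecMdd]; ring)
  · exact g0
  · exact g3

theorem HasDerivAt.tanM (h : HasDerivAt m (v t) t) (hr : HasDerivAt r (r₁ t) t) :
    HasDerivAt (fun s => tanM (m s) (r s)) (tanMd (m t) (v t) (r t) (r₁ t)) t := by
  rw [hasDerivAt_pi] at h
  have h0 := h 0
  have h1 := h 1
  have h2 := h 2
  have h3 := h 3
  have h4 := h 4
  refine hasDerivAt_vec7 fun i => ?_
  fin_cases i
  · exact (h3.sub (hr.mul h0)).congr_deriv (by simp [tanMd]; ring)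
  · exact hasDerivAt_const t (0 : ℝ)
  · exact (((h2.const_mul 2).mul hr).sub (h3.pow 2)).congr_deriv (by simp [tanMd]; ring)
  · exact (((h2.const_mul (-2)).add ((h3.const_mul 2).mul h0)).sub
      (hr.mul (h0.pow 2))).congr_deriv (by simp [tanMd]; ring)
  · exact ((((((h2.const_mul (-4)).mul h3).sub (((h2.const_mul 2).mul hr).mul h0)).add
      ((h3.pow 2).mul h0)).add ((hr.const_mul 6).mul h1)).add (h4.const_mul 3)).congr_deriv
      (by simp [tanMd]; ring)
  · exact hasDerivAt_const t (1 : ℝ)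
  · exact hr

theorem HasDerivAt.tanMd (h : HasDerivAt m (v t) t) (h' : HasDerivAt v a t)
    (hr : HasDerivAt r (r₁ t) t) (hr' : HasDerivAt r₁ r₂ t) :
    HasDerivAt (fun s => tanMd (m s) (v s) (r s) (r₁ s))
      (tanMdd (m t) (v t) a (r t) (r₁ t) r₂) t := by
  rw [hasDerivAt_pi] at h h'
  have h0 := h 0
  have h1 := h 1
  have h2 := h 2
  have h3 := h 3
  have h4 := h 4
  have g0 := h' 0
  have g1 := h' 1
  have g2 := h' 2
  have g3 := h' 3
  have g4 := h' 4
  refine hasDerivAt_vec7 fun i => ?_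
  fin_cases i
  · exact ((g3.sub (h0.mul hr')).sub (hr.mul g0)).congr_deriv (by simp [tanMdd]; ring)
  · exact hasDerivAt_const t (0 : ℝ)
  · exact ((((h2.const_mul 2).mul hr').sub ((h3.const_mul 2).mul g3)).add
      ((hr.const_mul 2).mul g2)).congr_deriv (by simp [tanMdd]; ring)
  · exact (((((g2.const_mul (-2)).add ((h0.const_mul 2).mul g3)).sub ((h0.pow 2).mul hr')).add
      ((h3.const_mul 2).mul g0)).sub (((h0.const_mul 2).mul hr).mul g0)).congr_deriv
      (by simp [tanMdd]; ring)
  · exact ((((((((((g4.const_mul 3).add ((h1.const_mul 6).mul hr')).sub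
      ((h2.const_mul 4).mul g3)).sub ((h3.const_mul 4).mul g2)).add ((h3.pow 2).mul g0)).add
      ((hr.const_mul 6).mul g1)).sub (((h0.const_mul 2).mul h2).mul hr')).add
      (((h0.const_mul 2).mul h3).mul g3)).sub (((h0.const_mul 2).mul hr).mul g2)).sub
      (((h2.const_mul 2).mul hr).mul g0)).congr_deriv (by simp [tanMdd]; ring)
  · exact hasDerivAt_const t (0 : ℝ)
  · exact hr'

end derivatives

namespace FlagCurve

/-- The jet coordinates as polynomials. -/
noncomputable def u (k : ℕ) (i : Fin 4) : JetPoly := MvPolynomial.X (some (k, i))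

/-- The constant polynomials. -/
noncomputable def num (c : ℝ) : JetPoly := MvPolynomial.C c

theorem evalAt_u (k : ℕ) (i : Fin 4) (θ : Jet ℝ 4) : (u k i).evalAt θ = θ.2 k i :=
  JetPoly.evalAt_X_some k i θ

theorem evalAt_num (c : ℝ) (θ : Jet ℝ 4) : (num c).evalAt θ = c := JetPoly.evalAt_C c θ

/-- The leading coefficient of the cubic form of a curve of flags. -/
noncomputable def C0 : JetPoly :=
  num (-36) * u 0 1 * u 2 1 * u 0 2 + num 18 * u 0 1 * u 2 3 + num (-36) * u 1 1 * u 0 2 * u 2 0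
    + num (-24) * u 1 1 * u 0 2 ^ 2 + num (-36) * u 1 1 * u 1 3 + num 24 * u 1 1 ^ 2 * u 0 2
    + num 16 * u 1 1 ^ 3 + num 36 * u 2 1 * u 0 2 * u 1 0 + num 18 * u 0 2 * u 1 3
    + num 18 * u 0 2 ^ 2 * u 2 0 + num 2 * u 0 2 ^ 3 + num (-18) * u 1 0 * u 2 3
    + num 18 * u 2 0 * u 1 3

/-- The second coefficient of the cubic form is `C10 + r C11`. -/
noncomputable def C10 : JetPoly :=
  num 36 * u 0 1 * u 1 2 ^ 2 + num (-24) * u 1 1 * u 0 2 * u 1 2 + num (-18) * u 1 1 * u 2 3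
    + num 48 * u 1 1 ^ 2 * u 1 2 + num (-18) * u 2 1 * u 0 2 ^ 2 + num 18 * u 2 1 * u 1 3
    + num 18 * u 0 2 * u 2 3 + num 12 * u 0 2 ^ 2 * u 1 2 + num (-36) * u 1 2 * u 1 3
    + num (-36) * u 1 2 ^ 2 * u 1 0

/-- The coefficient of `r` in the second coefficient of the cubic form. -/
noncomputable def C11 : JetPoly :=
  num (-36) * u 0 1 * u 2 1 + num (-48) * u 1 1 * u 0 2 + num (-36) * u 1 1 * u 2 0
    + num 24 * u 1 1 ^ 2 + num 36 * u 2 1 * u 1 0 + num 36 * u 0 2 * u 2 0 + num 6 * u 0 2 ^ 2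
    + num 18 * u 1 3

/-- The third coefficient of the cubic form is `C20 + r C21 + r² C22 + r' C23`. -/
noncomputable def C20 : JetPoly :=
  num (-18) * u 1 1 * u 0 2 * u 2 2 + num 12 * u 1 1 * u 1 2 ^ 2 + num 18 * u 2 1 * u 0 2 * u 1 2
    + num (-12) * u 0 2 * u 1 2 ^ 2 + num 9 * u 0 2 ^ 2 * u 2 2 + num (-9) * u 1 2 * u 2 3
    + num 9 * u 2 2 * u 1 3

/-- The coefficient of `r` in the third coefficient of the cubic form. -/
noncomputable def C21 : JetPoly :=
  num (-18) * u 0 1 * u 2 2 + num 12 * u 1 1 * u 1 2 + num (-18) * u 2 1 * u 0 2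
    + num 6 * u 0 2 * u 1 2 + num (-18) * u 1 2 * u 2 0 + num 18 * u 2 2 * u 1 0 + num 9 * u 2 3

/-- The coefficient of `r²` in the third coefficient of the cubic form. -/
noncomputable def C22 : JetPoly := num (-24) * u 1 1 + num 6 * u 0 2 + num 18 * u 2 0

/-- The coefficient of `r'` in the third coefficient of the cubic form. Where it
does not vanish, prescribing the third coefficient is a differential equation for `r`. -/
noncomputable def C23 : JetPoly :=
  num 36 * u 0 1 * u 1 2 + num (-12) * u 1 1 * u 0 2 + num 24 * u 1 1 ^ 2 + num 6 * u 0 2 ^ 2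
    + num (-36) * u 1 2 * u 1 0 + num (-18) * u 1 3

/-- The last coefficient of the cubic form, as a function of `r`, `r'` and `r''`. -/
noncomputable def C3 (θ : Jet ℝ 4) (r r₁ r₂ : ℝ) : ℝ :=
  let p := θ.2 0 1; let q := θ.2 0 2
  let y₁ := θ.2 1 0; let p₁ := θ.2 1 1; let q₁ := θ.2 1 2; let z₁ := θ.2 1 3
  let y₂ := θ.2 2 0; let p₂ := θ.2 2 1; let z₂ := θ.2 2 3
  12 * p * r₁ ^ 2 - 6 * p * r * r₂ - 6 * p₁ * q * r₂ + 12 * p₁ * q₁ * r₁ + 6 * p₂ * q * r₁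
    - 12 * q * q₁ * r₁ + 6 * q * r * r₁ + 3 * q ^ 2 * r₂ - 6 * q₁ * r ^ 2 + 6 * q₁ ^ 2 * r
    - 2 * q₁ ^ 3 - 6 * r * r₁ * y₂ + 6 * r * r₂ * y₁ + 2 * r ^ 3 - 3 * r₁ * z₂ - 12 * r₁ ^ 2 * y₁
    + 3 * r₂ * z₁

/-- The cubic form of the curve of flags `(m, r)` over a curve in `M`. -/
theorem cubic_eq (θ : Jet ℝ 4) (r r₁ r₂ α β : ℝ) :
    triple (α • vecM θ.pt + β • tanM θ.pt r)
      (α • vecMd θ.pt θ.vel + β • tanMd θ.pt θ.vel r r₁)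
      (α • vecMdd θ.pt θ.vel (Matrix.vecCons 0 (θ.2 2)) +
        β • tanMdd θ.pt θ.vel (Matrix.vecCons 0 (θ.2 2)) r r₁ r₂) =
      C0.evalAt θ * α ^ 3 + (C10.evalAt θ + r * C11.evalAt θ) * α ^ 2 * β
        + (C20.evalAt θ + r * C21.evalAt θ + r ^ 2 * C22.evalAt θ + r₁ * C23.evalAt θ) * α * β ^ 2
        + C3 θ r r₁ r₂ * β ^ 3 := by
  simp only [triple_add₁, triple_add₂, triple_add₃, triple_smul₁, triple_smul₂, triple_smul₃]
  set v := vecM θ.pt with hv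
  set v' := vecMd θ.pt θ.vel with hv'
  set v'' := vecMdd θ.pt θ.vel (Matrix.vecCons 0 (θ.2 2)) with hv''
  set w := tanM θ.pt r with hw
  set w' := tanMd θ.pt θ.vel r r₁ with hw'
  set w'' := tanMdd θ.pt θ.vel (Matrix.vecCons 0 (θ.2 2)) r r₁ r₂ with hw''
  have e0 : triple v v' v'' = C0.evalAt θ := by
    simp [hv, hv', hv'', triple, octForm, octCross, vecM, vecMd, vecMdd, Jet.pt, Jet.vel, C0, evalAt_num, evalAt_u,
      JetPoly.evalAt_add, JetPoly.evalAt_mul, JetPoly.evalAt_pow]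
    ring
  have e1 : triple w v' v'' + triple v w' v'' + triple v v' w'' =
      C10.evalAt θ + r * C11.evalAt θ := by
    simp [hv, hv', hv'', hw, hw', hw'', triple, octForm, octCross, vecM, vecMd, vecMdd, tanM, tanMd,
      tanMdd, Jet.pt, Jet.vel, C10, C11, evalAt_num, evalAt_u,
      JetPoly.evalAt_add, JetPoly.evalAt_mul, JetPoly.evalAt_pow]
    ring
  have e2 : triple v w' w'' + triple w v' w'' + triple w w' v'' =
      C20.evalAt θ + r * C21.evalAt θ + r ^ 2 * C22.evalAt θ + r₁ * C23.evalAt θ := by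
    simp [hv, hv', hv'', hw, hw', hw'', triple, octForm, octCross, vecM, vecMd, vecMdd, tanM, tanMd,
      tanMdd, Jet.pt, Jet.vel, C20, C21, C22, C23, evalAt_num, evalAt_u,
      JetPoly.evalAt_add, JetPoly.evalAt_mul, JetPoly.evalAt_pow]
    ring
  have e3 : triple w w' w'' = C3 θ r r₁ r₂ := by
    simp [hw, hw', hw'', triple, octForm, octCross, tanM, tanMd, tanMdd, Jet.pt, Jet.vel, C3]
    ring
  linear_combination α ^ 3 * e0 + α ^ 2 * β * e1 + α * β ^ 2 * e2 + β ^ 3 * e3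

end FlagCurve

/-! ### Curves of flags over a curve in `M` -/

/-- The inverse function theorem, with smoothness in a neighbourhood, which does not follow from
`ContDiffAt ℝ ∞` at a point. -/
theorem exists_smooth_local_inverse {f : ℝ → ℝ} {a : ℝ} (hf : ∀ᶠ t in 𝓝 a, ContDiffAt ℝ ∞ f t)
    (h : deriv f a ≠ 0) : ∃ k : ℝ → ℝ, k (f a) = a ∧ (∀ᶠ t in 𝓝 (f a), ContDiffAt ℝ ∞ k t) ∧
      (∀ᶠ t in 𝓝 (f a), f (k t) = t) ∧ ∀ᶠ s in 𝓝 a, k (f s) = s := by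
  have hn : (∞ : WithTop ℕ∞) ≠ 0 := by simp
  have hs : HasStrictFDerivAt f ((ContinuousLinearEquiv.unitsEquivAut ℝ (Units.mk0 _ h) : ℝ ≃L[ℝ] ℝ) :
      ℝ →L[ℝ] ℝ) a :=
    (hf.self_of_nhds.hasStrictDerivAt' (hf.self_of_nhds.differentiableAt (by simp)).hasDerivAt
      hn).hasStrictFDerivAt_equiv h
  set Φ := hs.toOpenPartialHomeomorph f with hΦ
  have hΦf : (Φ : ℝ → ℝ) = f := rfl
  have ha : a ∈ Φ.source := hs.mem_toOpenPartialHomeomorph_source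
  have hfa : f a ∈ Φ.target := hs.image_mem_toOpenPartialHomeomorph_target
  have hka : Φ.symm (f a) = a := Φ.left_inv ha
  have hd : ∀ᶠ t in 𝓝 a, deriv f t ≠ 0 := by
    have h2 : ContDiffAt ℝ 2 f a := contDiffAt_infty.1 hf.self_of_nhds 2
    exact (hasDerivAt_deriv h2).continuousAt.eventually_ne h
  have hc : Tendsto Φ.symm (𝓝 (f a)) (𝓝 a) := by
    have := Φ.continuousAt_symm hfa
    rwa [ContinuousAt, hka] at this
  refine ⟨Φ.symm, hka, ?_, ?_, ?_⟩
  · filter_upwards [Φ.open_target.mem_nhds hfa, hc.eventually (hf.and hd)] with t ht h1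
    exact Φ.contDiffAt_symm_deriv h1.2 ht (h1.1.differentiableAt (by simp)).hasDerivAt h1.1
  · filter_upwards [Φ.open_target.mem_nhds hfa] with t ht
    exact Φ.right_inv ht
  · filter_upwards [Φ.open_source.mem_nhds ha] with s hs
    exact Φ.left_inv hs

/-- A binary cubic form with the first three coefficients of a cube, transformed into the cubic form
of a vector of the contact distribution: the image of `(1, 0)` is a secant point. -/
theorem secant_of_cubic {v : Fin 4 → ℝ} {s q r c0 c1 c2 c3 : ℝ} (hs : s ≠ 0) (hr : r ≠ 0)
    (h : ∀ α β : ℝ, c0 * α ^ 3 + c1 * α ^ 2 * β + c2 * α * β ^ 2 + c3 * β ^ 3 =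
      s * (-v 3 * α ^ 3 + √3 * v 2 * α ^ 2 * (α * q + β * r)
        - √3 * v 1 * α * (α * q + β * r) ^ 2 + v 0 * (α * q + β * r) ^ 3))
    (h0 : c0 ≠ 0) (h1 : c1 ≠ 0) (h2 : 3 * c0 * c2 = c1 ^ 2) (h3 : 27 * c0 ^ 2 * c3 ≠ c1 ^ 3) :
    secLead v ≠ 0 ∧ secDisc v ≠ 0 ∧ ∃ ε : ℤˣ, (q : ℂ) = lam ε v := by
  have hw := sqrt3_sq
  have hw0 := sqrt3_ne
  set u : Fin 4 → ℝ := ![c3, -c2 / √3, c1 / √3, -c0] with hu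
  have cov := hessForm_covariant (u := u) (v := v) (k := 1) (l := q) (m := 0) (n := r) (c := s)
    (fun σ ρ => by
      have e1 : √3 * u 2 = c1 := by simp [hu]; field_simp
      have e2 : √3 * u 1 = -c2 := by simp [hu]; field_simp
      have e3 : -u 3 = c0 := by simp [hu]
      have e4 : u 0 = c3 := rfl
      rw [e1, e2, e3, e4]
      linear_combination h σ ρ)
  have hsr : (s ^ 2 * (1 * r - q * 0) ^ 2 : ℝ) ≠ 0 := by
    simp [hs, hr]
  have hc : ((s : ℂ) ^ 2 * (((1 : ℝ) : ℂ) * r - q * ((0 : ℝ) : ℂ)) ^ 2) ≠ 0 := by exact_mod_cast hsr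
  have uL : secLead u = (c1 * (27 * c0 ^ 2 * c3 - c1 ^ 3)) / (27 * c0 ^ 2) := by
    have : c2 = c1 ^ 2 / (3 * c0) := by field_simp; linarith
    simp only [secLead, hu, Matrix.cons_val, this]
    field_simp
    linear_combination 9 * c1 ^ 3 * hw
  have uM : secMid u = (c1 ^ 3 - 27 * c0 ^ 2 * c3) / (9 * c0) := by
    have : c2 = c1 ^ 2 / (3 * c0) := by field_simp; linarith
    simp only [secMid, hu, Matrix.cons_val, this]
    field_simp
    linear_combination -3 * c1 ^ 3 * hw
  have uN : √3 * u 1 * u 3 - u 2 ^ 2 = 0 := by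
    simp only [hu, Matrix.cons_val]
    field_simp
    linear_combination h2 + c0 * c2 * hw
  have hL0 : secLead u ≠ 0 := by
    rw [uL]
    exact div_ne_zero (mul_ne_zero h1 (sub_ne_zero.2 h3)) (by positivity)
  have hM0 : secMid u ≠ 0 := by
    rw [uM]
    exact div_ne_zero (sub_ne_zero.2 h3.symm) (by positivity)
  have real : ∀ σ ρ : ℝ, secLead u * ρ ^ 2 - secMid u * (σ * ρ) =
      s ^ 2 * r ^ 2 * (secLead v * (σ * q + ρ * r) ^ 2 - secMid v * (σ * (σ * q + ρ * r)) +
        (√3 * v 1 * v 3 - v 2 ^ 2) * σ ^ 2) := by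
    intro σ ρ
    have := cov σ ρ
    simp only [hessForm, uN] at this
    have h' : ((secLead u * ρ ^ 2 - secMid u * (σ * ρ) : ℝ) : ℂ) =
      ((s ^ 2 * r ^ 2 * (secLead v * (σ * q + ρ * r) ^ 2 - secMid v * (σ * (σ * q + ρ * r)) +
        (√3 * v 1 * v 3 - v 2 ^ 2) * σ ^ 2) : ℝ) : ℂ) := by
      push_cast
      push_cast at this
      linear_combination this
    exact_mod_cast h'
  have r01 := real 0 1
  have r10 := real 1 0
  have r11 := real 1 1
  have r12 := real 1 (-1)
  have hLv : secLead v ≠ 0 := fun hz => hL0 (by rw [hz] at r01; linear_combination r01)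
  have hroot : secLead v * q ^ 2 - secMid v * q + (√3 * v 1 * v 3 - v 2 ^ 2) = 0 := by
    have h5 : s ^ 2 * r ^ 2 * (secLead v * q ^ 2 - secMid v * q + (√3 * v 1 * v 3 - v 2 ^ 2)) = 0 := by
      linear_combination -r10
    exact (mul_eq_zero.1 h5).resolve_left (by positivity)
  refine ⟨hLv, fun hd => hM0 ?_, (hessForm_one v hLv q).1 ?_⟩
  · have h6 : (2 * secLead v * q - secMid v) ^ 2 = 0 := by
      rw [← hd, secDisc]
      linear_combination 4 * secLead v * hroot
    have h7 : 2 * secLead v * q - secMid v = 0 := by simpa using h6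
    linear_combination (-1 / 2) * (r11 - r12) - s ^ 2 * r ^ 3 * h7
  · have : ((secLead v * q ^ 2 - secMid v * q + (√3 * v 1 * v 3 - v 2 ^ 2) : ℝ) : ℂ) = 0 := by
      rw [hroot]; simp
    rw [hessForm]
    push_cast at this ⊢
    linear_combination this

/-- The flag `(m, r)` over the point of a graph. -/
def flagPt (c : ℝ → Fin 4 → ℝ) (r : ℝ → ℝ) (t : ℝ) : Fin 6 → ℝ :=
  ![t, c t 0, c t 1, c t 2, c t 3, r t]

theorem dropLast_flagPt (c : ℝ → Fin 4 → ℝ) (r : ℝ → ℝ) (t : ℝ) :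
    dropLast (flagPt c r t) = graphPt c t := by
  ext i
  fin_cases i <;> rfl

theorem planeK_phi (m : Fin 6 → ℝ) (hr : m 5 ≠ 0) : planeK (dropLast (phi m)) =
    Submodule.span ℝ {vecM (dropLast m), tanM (dropLast m) (m 5)} := by
  have h1 := congrArg Prod.snd (flagKhat_phi hr)
  rw [flagMhat_eq] at h1
  exact h1

namespace FlagCurve

/-- The contact form on the velocity of a curve of flags. -/
def contact (θ : Jet ℝ 4) (r : ℝ) : ℝ :=
  θ.2 1 3 + θ.2 0 2 ^ 2 - 2 * θ.2 1 1 * θ.2 0 2 + 2 * r * (θ.2 1 0 - θ.2 0 1)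

variable {c γ : ℝ → Fin 4 → ℝ} {r X : ℝ → ℝ} {t : ℝ}

theorem hasDerivAt_flagPt (hc : ContDiff ℝ ∞ c) {r₁ : ℝ} (hr : HasDerivAt r r₁ t) :
    HasDerivAt (flagPt c r)
      ![1, deriv c t 0, deriv c t 1, deriv c t 2, deriv c t 3, r₁] t := by
  have h := hasDerivAt_pi.1 (hc.differentiable (by simp) t).hasDerivAt
  refine hasDerivAt_pi.2 fun i => ?_
  fin_cases i
  exacts [hasDerivAt_id t, h 0, h 1, h 2, h 3, hr]

/-- Where `r' ≠ 0`, the projection of a curve of flags to `K` is a graph, and it is transversal to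
the contact distribution if and only if `contact` does not vanish. -/
theorem contactDefect_jetOf (hc : ContDiff ℝ ∞ c) (hγ : ContDiffAt ℝ ∞ γ (X t)) {r₁ : ℝ}
    (hr : HasDerivAt r r₁ t) (hr0 : r t ≠ 0) (hX : HasDerivAt X (r₁ / r t ^ 2) t)
    (h : ∀ᶠ s in 𝓝 t, graphPt γ (X s) = dropLast (phi (flagPt c r s))) :
    r₁ / r t ^ 2 * contactDefect (jetOf γ (X t)) = 3 / r t * contact (jetOf c t) (r t) := by
  have h1 := hasDerivAt_pi.1 (hasDerivAt_phi (hasDerivAt_flagPt hc hr) (show flagPt c r t 5 ≠ 0 from hr0))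
  have h2 := hasDerivAt_pi.1 (HasDerivAt.scomp t
    (hasDerivAt_graphPt (hγ.differentiableAt (by simp))) hX)
  have e : ∀ i : Fin 5, (r₁ / r t ^ 2) * (Matrix.vecCons 1 (deriv γ (X t)) : Fin 5 → ℝ) i =
      phid (flagPt c r t) ![1, deriv c t 0, deriv c t 1, deriv c t 2, deriv c t 3, r₁]
        i.castSucc := fun i =>
    (h2 i).unique ((h1 i.castSucc).congr_of_eventuallyEq (h.mono fun s hs => congrFun hs i))
  have e1 := e 1
  have e4 := e 4
  have hp : γ (X t) 1 = phi (flagPt c r t) 2 := congrFun h.self_of_nhds 2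
  have hq : γ (X t) 2 = phi (flagPt c r t) 3 := congrFun h.self_of_nhds 3
  simp [phid, flagPt] at e1 e4
  simp [phi, flagPt] at hp hq
  have hw := sqrt3_sq
  simp only [contactDefect, contact, jetOf, iteratedDeriv_zero, iteratedDeriv_one]
  rw [hp, hq]
  have hi : 3 / r t * (2 * r t * (deriv c t 0 - c t 1)) = 6 * (deriv c t 0 - c t 1) := by
    field_simp
    ring
  linear_combination √3 * (t - c t 2 / r t) * e1 - e4 - hi + (t - c t 2 / r t) *
    (2 * deriv c t 1 - 2 * c t 2 * deriv c t 2 / r t + c t 2 ^ 2 * r₁ / r t ^ 2) * hw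

end FlagCurve

namespace FlagCurve

variable {c γ : ℝ → Fin 4 → ℝ} {r X : ℝ → ℝ} {t : ℝ}

/-- The conditions under which the curve of flags `(m, r)` over a curve in `M` projects to a curve
in `K` in such a way that the original curve is one of its branches. -/
structure IsBranch (θ : Jet ℝ 4) (r r₁ r₂ : ℝ) : Prop where
  r_ne : r ≠ 0
  r₁_ne : r₁ ≠ 0
  contact_ne : contact θ r ≠ 0
  c0_ne : C0.evalAt θ ≠ 0
  c1_ne : C10.evalAt θ + r * C11.evalAt θ ≠ 0
  hess : 3 * C0.evalAt θ * (C20.evalAt θ + r * C21.evalAt θ + r ^ 2 * C22.evalAt θ +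
    r₁ * C23.evalAt θ) = (C10.evalAt θ + r * C11.evalAt θ) ^ 2
  disc : 27 * C0.evalAt θ ^ 2 * C3 θ r r₁ r₂ ≠ (C10.evalAt θ + r * C11.evalAt θ) ^ 3

/-- Under the conditions of `IsBranch`, the cubic form of the curve in `K` is the sum of the cube of
a linear form and a non-zero multiple of `β³`, so that the line of the flag is a secant point. -/
theorem mem_GenK_of_isBranch (hc : ContDiff ℝ ∞ c) (hγ : ContDiffAt ℝ ∞ γ (X t))
    (hr : ContDiffAt ℝ ∞ r t) (hX : ContDiffAt ℝ ∞ X t) (hX' : deriv X t = deriv r t / r t ^ 2)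
    (hb : IsBranch (jetOf c t) (r t) (deriv r t) (deriv (deriv r) t))
    (h : ∀ᶠ s in 𝓝 t, r s ≠ 0 ∧ graphPt γ (X s) = dropLast (phi (flagPt c r s))) :
    jetOf γ (X t) ∈ GenK ∧ ∃ ε : ℤˣ, (c t 2 : ℂ) = lam ε (upsilon (jetOf γ (X t))) := by
  have hr2 : ContDiffAt ℝ 2 r t := contDiffAt_infty.1 hr 2
  have hX2 : ContDiffAt ℝ 2 X t := contDiffAt_infty.1 hX 2
  have hr1 : ∀ᶠ s in 𝓝 t, HasDerivAt r (deriv r s) s :=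
    (hr2.eventually (by simp)).mono fun s hs => (hs.differentiableAt (by simp)).hasDerivAt
  have hcon := contactDefect_jetOf hc hγ hr1.self_of_nhds hb.r_ne
    (hX' ▸ (hX.differentiableAt (by simp)).hasDerivAt) (h.mono fun s hs => hs.2)
  have hcd : contactDefect (jetOf γ (X t)) ≠ 0 := fun h0 => by
    rw [h0, mul_zero] at hcon
    exact mul_ne_zero (div_ne_zero three_ne_zero hb.r_ne) hb.contact_ne hcon.symm
  have hm : ∀ s, HasDerivAt (graphPt c) (Matrix.vecCons 1 (deriv c s)) s :=
    fun s => hasDerivAt_graphPt (hc.differentiable (by simp) s)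
  have hv : HasDerivAt (fun s => (Matrix.vecCons 1 (deriv c s) : Fin 5 → ℝ))
      (Matrix.vecCons 0 (iteratedDeriv 2 c t)) t := by
    refine hasDerivAt_pi.2 fun i => ?_
    have h2 := (holonomicAt_jetOf (hc.contDiffAt (x := t))).2 1
    refine Fin.cases ?_ (fun j => ?_) i
    · simpa using hasDerivAt_const t (1 : ℝ)
    · simpa [jetOf] using h2 j
  have key : ∀ α β : ℝ, _ := fun α β => triple_section (W := fun s =>
      α • vecM (graphPt c s) + β • tanM (graphPt c s) (r s))
    (W₁ := fun s => α • vecMd (graphPt c s) (Matrix.vecCons 1 (deriv c s)) +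
      β • tanMd (graphPt c s) (Matrix.vecCons 1 (deriv c s)) (r s) (deriv r s)) (τ := X) hγ hX2
    (hr1.mono fun s hs => ((hm s).vecM.const_smul α).add
      (((hm s).tanM (v := fun s => Matrix.vecCons 1 (deriv c s)) (r₁ := deriv r) hs).const_smul β))
    ((((hm t).vecMd (v := fun s => Matrix.vecCons 1 (deriv c s)) hv).const_smul α).add
      (((hm t).tanMd (v := fun s => Matrix.vecCons 1 (deriv c s)) hv hr1.self_of_nhds
        (hasDerivAt_deriv hr2)).const_smul β))
    (h.mono fun s hs => by
      rw [hs.2, planeK_phi _ (show flagPt c r s 5 ≠ 0 from hs.1), dropLast_flagPt]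
      exact add_mem (Submodule.smul_mem _ _ (Submodule.subset_span (by simp)))
        (Submodule.smul_mem _ _ (Submodule.subset_span (by simp [flagPt]))))
  have hX0 : deriv X t ≠ 0 := hX' ▸ div_ne_zero hb.r₁_ne (pow_ne_zero 2 hb.r_ne)
  obtain ⟨h1, h2, h3⟩ := secant_of_cubic (v := upsilon (jetOf γ (X t)))
    (s := deriv X t ^ 3 * contactDefect (jetOf γ (X t))) (q := c t 2) (r := r t)
    (mul_ne_zero (pow_ne_zero 3 hX0) hcd) hb.r_ne (fun α β => by
      have e := cubic_eq (jetOf c t) (r t) (deriv r t) (deriv (deriv r) t) α β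
      have k := key α β
      rw [cubicJet, cubicK_jet hcd] at k
      have j0 : (jetOf c t).pt = graphPt c t := jetOf_pt c t
      have j1 : (jetOf c t).vel = Matrix.vecCons 1 (deriv c t) := by simp [Jet.vel, jetOf]
      have j2 : (jetOf c t).2 2 = iteratedDeriv 2 c t := rfl
      rw [j0, j1, j2] at e
      rw [← e]
      refine k.trans ?_
      have w1 : (α • vecM (graphPt c t) + β • tanM (graphPt c t) (r t)) 1 = α := by
        simp [vecM, tanM]
      have w6 : (α • vecM (graphPt c t) + β • tanM (graphPt c t) (r t)) 6 =
          α * c t 2 + β * r t := by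
        simp [vecM, tanM, graphPt]
      rw [w1, w6]
      ring) hb.c0_ne hb.c1_ne hb.hess hb.disc
  exact ⟨⟨hcd, h1, h2⟩, h3⟩

theorem toM_ofReal (n : Fin 6 → ℝ) (i : Fin 5) :
    ((toM n i : ℝ) : ℂ) = toM (fun i => (n i : ℂ)) i := by
  fin_cases i <;> simp [toM]

theorem branchPt_of_lam {ε : ℤˣ} (hr0 : r t ≠ 0) (h : graphPt γ (X t) = dropLast (phi (flagPt c r t)))
    (hl : (c t 2 : ℂ) = lam ε (upsilon (jetOf γ (X t)))) :
    branchPt ε (jetOf γ (X t)) = fun i => (graphPt c t i : ℂ) := by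
  rw [← dropLast_flagPt c r, ← toM_phi (show flagPt c r t 5 ≠ 0 from hr0)]
  funext i
  rw [toM_ofReal, branchPt, ← hl]
  congr 1
  funext j
  have hj := fun j => congrFun h j
  have h0 := hj 0
  have h1 := hj 1
  have h2 := hj 2
  have h3 := hj 3
  have h4 := hj 4
  simp only [graphPt, dropLast, Matrix.cons_val] at h0 h1 h2 h3 h4
  fin_cases j
  · simpa [jetOf] using congrArg Complex.ofReal h0
  · simpa [jetOf] using congrArg Complex.ofReal h1
  · simpa [jetOf] using congrArg Complex.ofReal h2
  · simpa [jetOf] using congrArg Complex.ofReal h3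
  · simpa [jetOf] using congrArg Complex.ofReal h4
  · rfl

theorem contDiffAt_flagPt (hc : ContDiff ℝ ∞ c) (hr : ContDiffAt ℝ ∞ r t) :
    ContDiffAt ℝ ∞ (flagPt c r) t := by
  have h := contDiffAt_pi.1 (hc.contDiffAt (x := t))
  refine contDiffAt_pi.2 fun i => ?_
  fin_cases i
  exacts [contDiffAt_id, h 0, h 1, h 2, h 3, hr]

/-- If the conditions of `IsBranch` hold along a curve of flags, then its projection to `K` is a
graph that has the given curve in `M` as a branch. -/
theorem exists_branch_of_isBranch {t₀ : ℝ} (hc : ContDiff ℝ ∞ c)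
    (hr : ∀ᶠ t in 𝓝 t₀, ContDiffAt ℝ ∞ r t)
    (hb : ∀ᶠ t in 𝓝 t₀, IsBranch (jetOf c t) (r t) (deriv r t) (deriv (deriv r) t)) :
    ∃ ε : ℤˣ, ∃ η ∈ BranchDom ε, branch ε η = (jetOf c t₀).toComplex := by
  set X : ℝ → ℝ := fun t => -1 / r t with hXdef
  have hX : ∀ᶠ t in 𝓝 t₀, ContDiffAt ℝ ∞ X t := by
    filter_upwards [hr, hb] with t h1 h2
    exact contDiffAt_const.div h1 h2.r_ne
  have hX' : ∀ᶠ t in 𝓝 t₀, HasDerivAt X (deriv r t / r t ^ 2) t := by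
    filter_upwards [hr, hb] with t h1 h2
    exact ((hasDerivAt_const t (-1 : ℝ)).div (h1.differentiableAt (by simp)).hasDerivAt
      h2.r_ne).congr_deriv (by ring)
  have hX0 : deriv X t₀ ≠ 0 := by
    rw [hX'.self_of_nhds.deriv]
    exact div_ne_zero hb.self_of_nhds.r₁_ne (pow_ne_zero 2 hb.self_of_nhds.r_ne)
  obtain ⟨k, hk0, hk, hkr, hkl⟩ := exists_smooth_local_inverse hX hX0
  have hkt : Tendsto k (𝓝 (X t₀)) (𝓝 t₀) := by
    have := hk.self_of_nhds.continuousAt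
    rwa [ContinuousAt, hk0] at this
  have hXt : Tendsto X (𝓝 t₀) (𝓝 (X t₀)) := hX.self_of_nhds.continuousAt
  set γ : ℝ → Fin 4 → ℝ := fun s i => dropLast (phi (flagPt c r (k s))) i.succ with hγdef
  have hγ : ∀ᶠ s in 𝓝 (X t₀), ContDiffAt ℝ ∞ γ s := by
    filter_upwards [hk, hkt.eventually (hr.and hb)] with s h1 h2
    have h3 : ContDiffAt ℝ ∞ phi (flagPt c r (k s)) := contDiffOn_phi.contDiffAt
      ((isOpen_ne_fun (continuous_apply 5) continuous_const).mem_nhds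
        (show flagPt c r (k s) 5 ≠ 0 from h2.2.r_ne))
    have h4 := (h3.comp (k s) (contDiffAt_flagPt hc h2.1)).comp s h1
    exact contDiffAt_pi.2 fun i => contDiffAt_pi.1 h4 i.succ.castSucc
  have hgr : ∀ᶠ t in 𝓝 t₀, graphPt γ (X t) = dropLast (phi (flagPt c r t)) := by
    filter_upwards [hkl] with t ht
    funext i
    refine Fin.cases rfl (fun j => ?_) i
    simp [graphPt, hγdef, ht]
  have hmem : ∀ᶠ t in 𝓝 t₀, jetOf γ (X t) ∈ GenK ∧
      ∃ ε : ℤˣ, (c t 2 : ℂ) = lam ε (upsilon (jetOf γ (X t))) := by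
    filter_upwards [hXt.eventually hγ, hr, hX, hX', hb,
      (hgr.and (hb.mono fun t ht => ht.r_ne)).eventually_nhds] with t h1 h2 h3 h4 h5 h6
    exact mem_GenK_of_isBranch hc h1 h2 h3 h4.deriv h5 (h6.mono fun s hs => ⟨hs.2, hs.1⟩)
  obtain ⟨hη, ε, hε⟩ := hmem.self_of_nhds
  -- the secant point moves continuously, and it does not collide with the other one
  have hJ : ContinuousAt (fun s => jetOf γ s) (X t₀) :=
    (holonomicAt_jetOf hγ.self_of_nhds).continuousAt
  have hlam : ContinuousAt (fun t => lam (-ε) (upsilon (jetOf γ (X t)))) t₀ :=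
    (((isAlg_lam.continuousOn subset_rfl (-ε)).continuousAt (isOpen_GenK.mem_nhds hη)).comp hJ).comp
      (f := X) hX.self_of_nhds.continuousAt
  have hq : ContinuousAt (fun t => (c t 2 : ℂ)) t₀ :=
    Complex.continuous_ofReal.continuousAt.comp
      (continuousAt_pi.1 hc.continuous.continuousAt 2)
  have hsep : ∀ᶠ t in 𝓝 t₀, (c t 2 : ℂ) ≠ lam (-ε) (upsilon (jetOf γ (X t))) :=
    (hq.ne_iff_eventually_ne hlam).1 (by rw [hε]; exact lam_ne hη.2.1 hη.2.2 ε)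
  have hpt : ∀ᶠ t in 𝓝 t₀, branchPt ε (jetOf γ (X t)) = fun i => (graphPt c t i : ℂ) := by
    filter_upwards [hmem, hsep, hgr, hb] with t h1 h2 h3 h4
    obtain ⟨-, ε', hε'⟩ := h1
    have units : ∀ ε ε' : ℤˣ, ε = ε' ∨ ε = -ε' := by decide
    rcases units ε' ε with rfl | rfl
    · exact branchPt_of_lam h4.r_ne h3 hε'
    · exact absurd hε' h2
  have hpt' : ∀ᶠ s in 𝓝 (X t₀), branchPt ε (jetOf γ s) = fun i => (graphPt c (k s) i : ℂ) := by
    filter_upwards [hkt.eventually hpt, hkr] with s h1 h2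
    rwa [h2] at h1
  have hdom : jetOf γ (X t₀) ∈ BranchDom ε := by
    refine ⟨hη, fun h0 => ?_⟩
    have h1 := ((isAlg_branchPt 0).totalD_and_chain isOpen_GenK subset_rfl le_rfl).2 ε _ 1 _
      (holonomicAt_jetOf hγ.self_of_nhds) hη
    rw [one_smul, h0] at h1
    have h2 : HasDerivAt k (deriv k (X t₀)) (X t₀) :=
      (hk.self_of_nhds.differentiableAt (by simp)).hasDerivAt
    have h3 := h1.unique (h2.ofReal_comp.congr_of_eventuallyEq
      (hpt'.mono fun s hs => congrFun hs 0))
    have h4 : HasDerivAt X (deriv X t₀) (k (X t₀)) := by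
      rw [hk0]; exact (hX.self_of_nhds.differentiableAt (by simp)).hasDerivAt
    have h5 := (h4.comp _ h2).unique ((hasDerivAt_id _).congr_of_eventuallyEq hkr)
    have h6 : deriv k (X t₀) = 0 := by exact_mod_cast h3.symm
    rw [h6, mul_zero] at h5
    exact zero_ne_one h5
  refine ⟨ε, _, hdom, ?_⟩
  rw [branch_jetOf hγ hc hdom hpt', hk0]

end FlagCurve

namespace FlagCurve

/-- The value of `r'` for which the third coefficient of the cubic form is that of a cube. -/
noncomputable def rate (θ : Jet ℝ 4) (r : ℝ) : ℝ :=
  ((C10.evalAt θ + r * C11.evalAt θ) ^ 2 / (3 * C0.evalAt θ) - C20.evalAt θ - r * C21.evalAt θ -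
    r ^ 2 * C22.evalAt θ) / C23.evalAt θ

/-- The derivative of `rate` along its integral curves, in terms of the jet, `r` and `r'`. -/
noncomputable def rate' (θ : Jet ℝ 4) (r r₁ : ℝ) : ℝ :=
  ((2 * (C10.evalAt θ + r * C11.evalAt θ) * ((JetPoly.D C10).evalAt θ +
      (r₁ * C11.evalAt θ + r * (JetPoly.D C11).evalAt θ)) -
    3 * (JetPoly.D C0).evalAt θ * (C20.evalAt θ + r * C21.evalAt θ + r ^ 2 * C22.evalAt θ +
      r₁ * C23.evalAt θ)) / (3 * C0.evalAt θ) - ((JetPoly.D C20).evalAt θ + (r₁ * C21.evalAt θ +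
    r * (JetPoly.D C21).evalAt θ) + (2 * r * r₁ * C22.evalAt θ + r ^ 2 * (JetPoly.D C22).evalAt θ) +
    r₁ * (JetPoly.D C23).evalAt θ)) / C23.evalAt θ

theorem contDiff_evalAt_jetOf {c : ℝ → Fin 4 → ℝ} (hc : ContDiff ℝ ∞ c) (P : JetPoly) :
    ContDiff ℝ ∞ (fun t => P.evalAt (jetOf c t)) := by
  induction P using MvPolynomial.induction_on with
  | C a => simp only [JetPoly.evalAt_C]; exact contDiff_const
  | add p q hp hq => simp only [JetPoly.evalAt_add]; exact hp.add hq
  | mul_X p v hp =>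
    simp only [JetPoly.evalAt_mul]
    refine hp.mul ?_
    rcases v with _ | ⟨k, i⟩
    · simp only [JetPoly.evalAt_X_none]
      exact contDiff_id
    · simp only [JetPoly.evalAt_X_some, jetOf]
      have h : ContDiff ℝ ∞ (iteratedDeriv k c) := by
        rw [iteratedDeriv_eq_iterate]
        exact hc.iterate_deriv k
      exact contDiff_pi.1 h i

/-- The jet of a curve through which there is a suitable curve of flags. -/
def goodJet : Jet ℝ 4 :=
  (0, fun k => if k = 1 then ![1, 1, 0, 0] else if k = 3 then ![0, 0, 1, 0] else 0)

theorem D_u (k : ℕ) (i : Fin 4) : JetPoly.D (u k i) = u (k + 1) i := JetPoly.D_X_some k i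

theorem D_num (a : ℝ) : JetPoly.D (num a) = 0 := JetPoly.D.map_algebraMap a

theorem D_add (P Q : JetPoly) : JetPoly.D (P + Q) = JetPoly.D P + JetPoly.D Q := map_add _ _ _

theorem isBranch_goodJet : C23.evalAt goodJet ≠ 0 ∧
    IsBranch goodJet 1 (rate goodJet 1) (rate' goodJet 1 (rate goodJet 1)) := by
  have h0 : C0.evalAt goodJet = 16 := by
    simp [C0, evalAt_num, evalAt_u, JetPoly.evalAt_add, JetPoly.evalAt_mul, JetPoly.evalAt_pow, goodJet]
  have h10 : C10.evalAt goodJet = 0 := by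
    simp [C10, evalAt_num, evalAt_u, JetPoly.evalAt_add, JetPoly.evalAt_mul, JetPoly.evalAt_pow, goodJet]
  have h11 : C11.evalAt goodJet = 24 := by
    simp [C11, evalAt_num, evalAt_u, JetPoly.evalAt_add, JetPoly.evalAt_mul, JetPoly.evalAt_pow, goodJet]
  have h20 : C20.evalAt goodJet = 0 := by
    simp [C20, evalAt_num, evalAt_u, JetPoly.evalAt_add, JetPoly.evalAt_mul, JetPoly.evalAt_pow, goodJet]
  have h21 : C21.evalAt goodJet = 0 := by
    simp [C21, evalAt_num, evalAt_u, JetPoly.evalAt_add, JetPoly.evalAt_mul, goodJet]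
  have h22 : C22.evalAt goodJet = -24 := by
    simp [C22, evalAt_num, evalAt_u, JetPoly.evalAt_add, JetPoly.evalAt_mul, goodJet]
  have h23 : C23.evalAt goodJet = 24 := by
    simp [C23, evalAt_num, evalAt_u, JetPoly.evalAt_add, JetPoly.evalAt_mul, JetPoly.evalAt_pow, goodJet]
  have d0 : (JetPoly.D C0).evalAt goodJet = 0 := by
    simp [C0, pow_succ, D_u, D_num, D_add, evalAt_num, evalAt_u, JetPoly.evalAt_add,
      JetPoly.evalAt_mul, goodJet]
  have d10 : (JetPoly.D C10).evalAt goodJet = 0 := by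
    simp [C10, pow_succ, D_u, D_num, D_add, evalAt_num, evalAt_u, JetPoly.evalAt_add,
      JetPoly.evalAt_mul, goodJet]
  have d11 : (JetPoly.D C11).evalAt goodJet = 0 := by
    simp [C11, pow_succ, D_u, D_num, D_add, evalAt_num, evalAt_u, JetPoly.evalAt_add,
      JetPoly.evalAt_mul, goodJet]
  have d20 : (JetPoly.D C20).evalAt goodJet = 0 := by
    simp [C20, pow_succ, D_u, D_num, D_add, evalAt_num, evalAt_u, JetPoly.evalAt_add,
      JetPoly.evalAt_mul, goodJet]
  have d21 : (JetPoly.D C21).evalAt goodJet = 18 := by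
    simp [C21, D_u, D_num, D_add, evalAt_num, evalAt_u, JetPoly.evalAt_add,
      JetPoly.evalAt_mul, goodJet]
  have d22 : (JetPoly.D C22).evalAt goodJet = 0 := by
    simp [C22, D_u, D_num, D_add, evalAt_num, evalAt_u, JetPoly.evalAt_add,
      JetPoly.evalAt_mul, goodJet]
  have d23 : (JetPoly.D C23).evalAt goodJet = 0 := by
    simp [C23, pow_succ, D_u, D_num, D_add, evalAt_num, evalAt_u, JetPoly.evalAt_add,
      JetPoly.evalAt_mul, goodJet]
  have hs : rate goodJet 1 = 3 / 2 := by
    rw [rate, h0, h10, h11, h20, h21, h22, h23]; norm_num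
  have hs' : rate' goodJet 1 (3 / 2) = 15 / 4 := by
    rw [rate', h0, h10, h11, h20, h21, h22, h23, d0, d10, d11, d20, d21, d22, d23]; norm_num
  rw [hs, hs']
  constructor
  · rw [h23]; norm_num
  · constructor
    · norm_num
    · norm_num
    · simp [contact, goodJet]
    · rw [h0]; norm_num
    · rw [h10, h11]; norm_num
    · rw [h0, h10, h11, h20, h21, h22, h23]; norm_num
    · rw [h0, h10, h11]; simp [C3, goodJet]; norm_num

/-- The set of the jets, together with `r`, `r'`, `r''`, on which the inequalities of `IsBranch`
hold. -/
def ineqSet : Set (Jet ℝ 4 × ℝ × ℝ × ℝ) := {x | x.2.1 ≠ 0 ∧ x.2.2.1 ≠ 0 ∧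
    contact x.1 x.2.1 ≠ 0 ∧ C0.evalAt x.1 ≠ 0 ∧ C10.evalAt x.1 + x.2.1 * C11.evalAt x.1 ≠ 0 ∧
    27 * C0.evalAt x.1 ^ 2 * C3 x.1 x.2.1 x.2.2.1 x.2.2.2 ≠
      (C10.evalAt x.1 + x.2.1 * C11.evalAt x.1) ^ 3}

theorem isOpen_ineqSet : IsOpen ineqSet := by
  have k0 := continuous_evalAt (𝔽 := ℝ) C0
  have k10 := continuous_evalAt (𝔽 := ℝ) C10
  have k11 := continuous_evalAt (𝔽 := ℝ) C11
  have k3 : Continuous fun x : Jet ℝ 4 × ℝ × ℝ × ℝ => C3 x.1 x.2.1 x.2.2.1 x.2.2.2 := by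
    unfold C3; fun_prop
  have kc : Continuous fun x : Jet ℝ 4 × ℝ × ℝ × ℝ => contact x.1 x.2.1 := by
    unfold contact; fun_prop
  refine (isOpen_ne_fun (by fun_prop) (by fun_prop)).inter
    ((isOpen_ne_fun (by fun_prop) (by fun_prop)).inter
    ((isOpen_ne_fun kc (by fun_prop)).inter ((isOpen_ne_fun (by fun_prop) (by fun_prop)).inter
    ((isOpen_ne_fun (by fun_prop) (by fun_prop)).inter
      (isOpen_ne_fun (by fun_prop) (by fun_prop))))))

theorem IsBranch.mem_ineqSet {θ : Jet ℝ 4} {r r₁ r₂ : ℝ} (h : IsBranch θ r r₁ r₂) :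
    (θ, r, r₁, r₂) ∈ ineqSet :=
  ⟨h.r_ne, h.r₁_ne, h.contact_ne, h.c0_ne, h.c1_ne, h.disc⟩

theorem rate_eq {θ : Jet ℝ 4} {r : ℝ} (h0 : C0.evalAt θ ≠ 0) (h23 : C23.evalAt θ ≠ 0) :
    3 * C0.evalAt θ * (C20.evalAt θ + r * C21.evalAt θ + r ^ 2 * C22.evalAt θ +
      rate θ r * C23.evalAt θ) = (C10.evalAt θ + r * C11.evalAt θ) ^ 2 := by
  rw [rate]
  field_simp
  ring

theorem isBranch_of_mem_ineqSet {θ : Jet ℝ 4} {r r₁ r₂ : ℝ} (h : (θ, r, r₁, r₂) ∈ ineqSet)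
    (h23 : C23.evalAt θ ≠ 0) (h1 : r₁ = rate θ r) : IsBranch θ r r₁ r₂ := by
  obtain ⟨a1, a2, a3, a4, a5, a6⟩ := h
  exact ⟨a1, a2, a3, a4, a5, h1 ▸ rate_eq a4 h23, a6⟩

/-- The derivative of the equation for `r'` determines `r''`. -/
theorem eq_rate'_of_hasDerivAt {c : ℝ → Fin 4 → ℝ} {r r₁ : ℝ → ℝ} {r₂ t : ℝ}
    (hc : ContDiff ℝ ∞ c) (hr : HasDerivAt r (r₁ t) t) (hr' : HasDerivAt r₁ r₂ t)
    (h0 : C0.evalAt (jetOf c t) ≠ 0) (h23 : C23.evalAt (jetOf c t) ≠ 0)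
    (h : ∀ᶠ s in 𝓝 t, C0.evalAt (jetOf c s) ≠ 0 ∧ C23.evalAt (jetOf c s) ≠ 0 ∧
      r₁ s = rate (jetOf c s) (r s)) : r₂ = rate' (jetOf c t) (r t) (r₁ t) := by
  have k : ∀ P : JetPoly, HasDerivAt (fun t => P.evalAt (jetOf c t))
      ((JetPoly.D P).evalAt (jetOf c t)) t := fun P => by
    simpa using (holonomicAt_jetOf (hc.contDiffAt (x := t))).hasDerivAt_evalAt P
  have hC1 := (k C10).add (hr.mul (k C11))
  have hC2 := (((k C20).add (hr.mul (k C21))).add ((hr.pow 2).mul (k C22))).add (hr'.mul (k C23))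
  have heq := (((k C0).const_mul 3).mul hC2).unique ((hC1.pow 2).congr_of_eventuallyEq
    (h.mono fun s hs => by
      have := rate_eq (r := r s) hs.1 hs.2.1
      rw [← hs.2.2] at this
      exact this))
  rw [rate', eq_div_iff h23, eq_sub_iff_add_eq, eq_div_iff (mul_ne_zero three_ne_zero h0)]
  simp only [Pi.mul_apply, Pi.add_apply, Pi.pow_apply, Nat.cast_ofNat, Nat.add_one_sub_one,
    pow_one] at heq
  linear_combination heq

/-- A curve in `M` that satisfies the inequalities at one point is a branch of a curve in `K`: the
curve of flags is a solution of an ordinary differential equation. -/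
theorem exists_branch_of_ineq {c : ℝ → Fin 4 → ℝ} {t₀ : ℝ} (hc : ContDiff ℝ ∞ c)
    (h23 : C23.evalAt (jetOf c t₀) ≠ 0) (hb : IsBranch (jetOf c t₀) 1 (rate (jetOf c t₀) 1)
      (rate' (jetOf c t₀) 1 (rate (jetOf c t₀) 1))) :
    ∃ ε : ℤˣ, ∃ η ∈ BranchDom ε, branch ε η = (jetOf c t₀).toComplex := by
  set U : Set (ℝ × ℝ) := {y | C0.evalAt (jetOf c y.1) ≠ 0 ∧ C23.evalAt (jetOf c y.1) ≠ 0} with hU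
  have sm : ∀ P : JetPoly, ContDiff ℝ ∞ (fun y : ℝ × ℝ => P.evalAt (jetOf c y.1)) := fun P =>
    (contDiff_evalAt_jetOf hc P).comp contDiff_fst
  have hUo : IsOpen U := (isOpen_ne_fun (sm C0).continuous continuous_const).inter
    (isOpen_ne_fun (sm C23).continuous continuous_const)
  have hF : ContDiffOn ℝ ∞ (fun y : ℝ × ℝ => rate (jetOf c y.1) y.2) U := by
    have s0 := (sm C0).contDiffOn (s := U)
    have s10 := sm C10
    have s11 := sm C11
    have s20 := sm C20
    have s21 := sm C21
    have s22 := sm C22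
    unfold rate
    refine ContDiffOn.div (ContDiffOn.sub (ContDiffOn.sub (ContDiffOn.sub (ContDiffOn.div ?_ ?_ ?_)
      ?_) ?_) ?_) (sm C23).contDiffOn fun y hy => hy.2
    · exact ((s10.add (contDiff_snd.mul s11)).pow 2).contDiffOn
    · exact contDiffOn_const.mul s0
    · exact fun y hy => mul_ne_zero three_ne_zero hy.1
    · exact s20.contDiffOn
    · exact (contDiff_snd.mul s21).contDiffOn
    · exact ((contDiff_snd.pow 2).mul s22).contDiffOn
  obtain ⟨r, hr0, hr⟩ := exists_smooth_solution hUo hF (t₀ := t₀) (r₀ := 1) ⟨hb.c0_ne, h23⟩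
  have hd : ∀ᶠ t in 𝓝 t₀, deriv r t = rate (jetOf c t) (r t) := hr.mono fun t ht => ht.2.1.deriv
  have hr1 : ContDiffAt ℝ ∞ (deriv r) t₀ := by
    refine ContDiffAt.congr_of_eventuallyEq ?_ hd
    exact (hF.contDiffAt (hUo.mem_nhds hr.self_of_nhds.1)).comp t₀
      (contDiffAt_id.prodMk hr.self_of_nhds.2.2)
  have hr2 : HasDerivAt (deriv r) (deriv (deriv r) t₀) t₀ :=
    (hr1.differentiableAt (by simp)).hasDerivAt
  have hr2c : ContinuousAt (deriv (deriv r)) t₀ :=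
    (hasDerivAt_deriv (contDiffAt_infty.1 hr1 2)).continuousAt
  have e1 : deriv r t₀ = rate (jetOf c t₀) 1 := by rw [hd.self_of_nhds, hr0]
  have hrd : HasDerivAt r (deriv r t₀) t₀ := by
    rw [hd.self_of_nhds]; exact hr.self_of_nhds.2.1
  have e2 : deriv (deriv r) t₀ = rate' (jetOf c t₀) 1 (rate (jetOf c t₀) 1) := by
    rw [← e1, ← hr0]
    exact eq_rate'_of_hasDerivAt hc hrd hr2 hb.c0_ne h23
      (by filter_upwards [hr, hd] with t h1 h2 using ⟨h1.1.1, h1.1.2, h2⟩)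
  have hcont : ContinuousAt (fun t => ((jetOf c t, r t, deriv r t, deriv (deriv r) t) :
      Jet ℝ 4 × ℝ × ℝ × ℝ)) t₀ :=
    (continuous_jetOf hc).continuousAt.prodMk (hrd.continuousAt.prodMk
      (hr2.continuousAt.prodMk hr2c))
  rw [← e2, ← e1, ← hr0] at hb
  have hev := hcont.eventually_mem (isOpen_ineqSet.mem_nhds hb.mem_ineqSet)
  refine exists_branch_of_isBranch hc (hr.mono fun t ht => ht.2.2) ?_
  filter_upwards [hev, hr, hd] with t h1 h2 h3
  exact isBranch_of_mem_ineqSet h1 h2.1.2 h3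

end FlagCurve

/-- Jets of curves are dense in the space of infinite jets. -/
theorem exists_curve_mem {U : Set (Jet ℝ 4)} (hU : IsOpen U) {θ : Jet ℝ 4} (hθ : θ ∈ U) :
    ∃ c : ℝ → Fin 4 → ℝ, ContDiff ℝ ∞ c ∧ jetOf c θ.1 ∈ U := by
  have h : Tendsto (fun N => jetOf (taylorCurve θ.1 N θ.2) θ.1) atTop (𝓝 θ) := by
    refine Prod.tendsto_iff _ _ |>.2 ⟨tendsto_const_nhds, tendsto_pi_nhds.2 fun k => ?_⟩
    refine tendsto_const_nhds.congr' ?_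
    filter_upwards [eventually_gt_atTop k] with N hN
    exact (iteratedDeriv_taylorCurve θ.1 k N θ.2 hN).symm
  obtain ⟨N, hN⟩ := (h.eventually_mem (hU.mem_nhds hθ)).exists
  exact ⟨_, contDiff_taylorCurve _ _ _, hN⟩

open FlagCurve in
/-- The jets of the branches are not contained in a hypersurface. -/
theorem exists_evalAt_branch_ne_zero {Q : JetPoly} (hQ : Q ≠ 0) :
    ∃ ε : ℤˣ, ∃ θ ∈ BranchDom ε, Q.evalAt (branch ε θ) ≠ 0 := by
  obtain ⟨h23, hb⟩ := isBranch_goodJet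
  have k := fun P : JetPoly => (continuous_evalAt (𝔽 := ℝ) P).continuousAt (x := goodJet)
  have hs : ContinuousAt (fun θ => rate θ 1) goodJet := by
    have := k C0; have := k C10; have := k C11; have := k C20; have := k C21; have := k C22
    have := k C23
    unfold rate
    exact ContinuousAt.div (by fun_prop (disch := exact mul_ne_zero three_ne_zero hb.c0_ne))
      (k C23) h23
  have hs' : ContinuousAt (fun θ => rate' θ 1 (rate θ 1)) goodJet := by
    have kc : ∀ a : ℝ, ContinuousAt (fun _ : Jet ℝ 4 => a) goodJet := fun a => continuousAt_const
    have h1 := (k C10).add ((kc 1).mul (k C11))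
    have h1' := (k (JetPoly.D C10)).add ((hs.mul (k C11)).add ((kc 1).mul (k (JetPoly.D C11))))
    have h2 := (((k C20).add ((kc 1).mul (k C21))).add ((kc (1 ^ 2)).mul (k C22))).add
      (hs.mul (k C23))
    have h2' := (((k (JetPoly.D C20)).add ((hs.mul (k C21)).add
      ((kc 1).mul (k (JetPoly.D C21))))).add ((((kc (2 * 1)).mul hs).mul (k C22)).add
      ((kc (1 ^ 2)).mul (k (JetPoly.D C22))))).add (hs.mul (k (JetPoly.D C23)))
    exact ((((((kc 2).mul h1).mul h1').sub (((kc 3).mul (k (JetPoly.D C0))).mul h2)).div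
      ((kc 3).mul (k C0)) (mul_ne_zero three_ne_zero hb.c0_ne)).sub h2').div (k C23) h23
  have hev : ∀ᶠ θ in 𝓝 goodJet, C23.evalAt θ ≠ 0 ∧ IsBranch θ 1 (rate θ 1) (rate' θ 1 (rate θ 1)) := by
    have h1 := (continuousAt_id.prodMk ((continuousAt_const (y := (1 : ℝ))).prodMk
      (hs.prodMk hs'))).eventually_mem (isOpen_ineqSet.mem_nhds hb.mem_ineqSet)
    filter_upwards [h1, (k C23).eventually_ne h23] with θ h2 h3
    exact ⟨h3, isBranch_of_mem_ineqSet h2 h3 rfl⟩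
  obtain ⟨V, hV, hVo, hV0⟩ := mem_nhds_iff.1 hev
  have hex : ∃ θ ∈ V, Q.evalAt θ ≠ 0 := by
    by_contra! h
    exact hQ (JetPoly.eq_zero_of_isOpen hVo ⟨_, hV0⟩ h)
  obtain ⟨θ, hθV, hθ⟩ := hex
  obtain ⟨c, hc, hcV, hcQ⟩ := exists_curve_mem
    (hVo.inter (isOpen_ne_fun (continuous_evalAt Q) continuous_const)) ⟨hθV, hθ⟩
  obtain ⟨h1, h2⟩ := hV hcV
  obtain ⟨ε, η, hη, e⟩ := exists_branch_of_ineq hc h1 h2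
  refine ⟨ε, η, hη, ?_⟩
  rw [e, JetPoly.evalAt_toComplex]
  exact_mod_cast hcQ

/-- The complement of a hypersurface of jets of curves in `K` is mapped by both branches to the
complement of a given hypersurface. -/
theorem exists_poly_evalAt_branch {Q : JetPoly} (hQ : Q ≠ 0) :
    ∃ T : JetPoly, T ≠ 0 ∧ ∀ θ, T.evalAt θ ≠ 0 →
      θ ∈ GenBranch ∧ ∀ ε : ℤˣ, Q.evalAt (branch ε θ) ≠ 0 :=
  exists_poly_evalAt_branch_of_exists (exists_evalAt_branch_ne_zero hQ)

theorem dense_evalAt_branch {Q : JetPoly} (hQ : Q ≠ 0) :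
    Dense {θ | θ ∈ GenBranch ∧ ∀ ε : ℤˣ, Q.evalAt (branch ε θ) ≠ 0} := by
  obtain ⟨T, hT, h⟩ := exists_poly_evalAt_branch hQ
  obtain ⟨θ, hθ⟩ := JetPoly.exists_evalAt_ne_zero hT
  exact (dense_evalAt_ne_zero hθ).mono h

/-! ### The average of a rational function over the branches -/

theorem isAlg_scalarProlong_branch (i : Fin 4) (j : ℕ) : IsAlg GenBranch (j + 2) (fun ε =>
    scalarProlong (fun θ => branchPt ε θ 0) (fun θ => branchPt ε θ i.succ) j) := by
  induction j with
  | zero => exact (isAlg_branchPt i.succ).mono le_rfl GenBranch_subset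
  | succ j ih =>
    have h2 : 2 ≤ j + 1 + 2 := by omega
    exact IsAlg.mul GenBranch_subset h2 (IsAlg.inv GenBranch_subset h2
      (isAlg_totalD_branchPt.mono (by omega) GenBranch_subset) fun θ hθ ε => hθ.2 ε)
      ((ih.totalD isOpen_GenBranch GenBranch_subset (by omega)).mono (by omega) subset_rfl)

/-- A polynomial of order `k`, evaluated at the branches, is algebraic of order `k + 2`. -/
theorem isAlg_evalAt_branch {k : ℕ} {P : JetPoly} (hP : P.OrderLE k) :
    IsAlg GenBranch (k + 2) (fun ε θ => P.evalAt (branch ε θ)) := by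
  refine JetPoly.OrderLE.induction (k := k)
    (p := fun P => IsAlg GenBranch (k + 2) (fun ε θ => P.evalAt (branch ε θ))) ?_ ?_ ?_ ?_ ?_ hP
  · intro c
    simp only [JetPoly.evalAt_C]
    exact IsAlg.const c
  · simp only [JetPoly.evalAt_X_none]
    exact (isAlg_branchPt 0).mono (by omega) GenBranch_subset
  · intro j hj i
    simp only [JetPoly.evalAt_X_some]
    exact ((isAlg_scalarProlong_branch i j).mono (by omega) subset_rfl).congr fun θ hθ ε =>
      branch_snd (GenBranch_subset_BranchDom ε hθ) j i
  · intro P Q h1 h2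
    simp only [JetPoly.evalAt_add]
    exact h1.add h2
  · intro P Q h1 h2
    simp only [JetPoly.evalAt_mul]
    exact IsAlg.mul GenBranch_subset (by omega) h1 h2

/-- In the average of `R₁ ± R₂ √δ` over the two signs the square root cancels. -/
theorem exists_average {k : ℕ} {P Q : JetPoly} (hP : P.OrderLE k) (hQ : Q.OrderLE k) :
    ∃ A B : JetPoly, A.OrderLE (k + 2) ∧ B.OrderLE (k + 2) ∧
      ∀ θ ∈ GenBranch, (∀ ε : ℤˣ, Q.evalAt (branch ε θ) ≠ 0) → B.evalAt θ ≠ 0 ∧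
        ((A.evalAt θ / B.evalAt θ : ℝ) : ℂ) =
          (P.evalAt (branch 1 θ) / Q.evalAt (branch 1 θ) +
            P.evalAt (branch (-1) θ) / Q.evalAt (branch (-1) θ)) / 2 := by
  set S : Set (Jet ℝ 4) := {θ | θ ∈ GenBranch ∧ ∀ ε : ℤˣ, Q.evalAt (branch ε θ) ≠ 0}
  have hS : S ⊆ GenBranch := fun θ h => h.1
  obtain ⟨R₁, R₂, ⟨A, B, hA, hB, hR⟩, -, e⟩ := IsAlg.div (hS.trans GenBranch_subset) (by omega)
    ((isAlg_evalAt_branch hP).mono le_rfl hS) ((isAlg_evalAt_branch hQ).mono le_rfl hS)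
    fun θ hθ => hθ.2
  beta_reduce at e
  refine ⟨A, B, hA, hB, fun θ hθ h => ⟨(hR θ ⟨hθ, h⟩).1, ?_⟩⟩
  rw [← (hR θ ⟨hθ, h⟩).2, e θ ⟨hθ, h⟩, e θ ⟨hθ, h⟩]
  push_cast
  ring

/-! ### The curves in `M` that belong to a curve in `K` -/

/-- A germ of a smooth curve is the germ of a curve that is smooth everywhere: the curve is
multiplied by a bump function. -/
theorem exists_contDiff_eventuallyEq {E : Type*} [NormedAddCommGroup E] [NormedSpace ℝ E]
    {f : ℝ → E} {a : ℝ} (hf : ∀ᶠ t in 𝓝 a, ContDiffAt ℝ ∞ f t) :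
    ∃ F : ℝ → E, ContDiff ℝ ∞ F ∧ F =ᶠ[𝓝 a] f := by
  obtain ⟨ρ, hρ, hball⟩ := Metric.eventually_nhds_iff_ball.1 hf
  let b : ContDiffBump a := ⟨ρ / 3, ρ / 2, by positivity, by linarith⟩
  refine ⟨fun t => b t • f t, contDiff_iff_contDiffAt.2 fun t => ?_, ?_⟩
  · by_cases ht : t ∈ Metric.ball a ρ
    · exact b.contDiffAt.smul (hball t ht)
    · have h1 : t ∉ tsupport b := by
        rw [b.tsupport_eq, Metric.mem_closedBall]
        rw [Metric.mem_ball] at ht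
        change ¬ dist t a ≤ ρ / 2
        linarith
      refine contDiffAt_const (c := (0 : E)) |>.congr_of_eventuallyEq ?_
      filter_upwards [(isClosed_tsupport b).isOpen_compl.mem_nhds h1] with s hs
      rw [image_eq_zero_of_notMem_tsupport hs, zero_smul]
  · filter_upwards [b.eventuallyEq_one] with t ht
    rw [ht, Pi.one_apply, one_smul]

/-- A parametrized curve transversal to `x = const` is a graph. -/
theorem exists_graphPt_eq {b : ℝ → Fin 5 → ℝ} {a : ℝ} (hb : ∀ᶠ t in 𝓝 a, ContDiffAt ℝ ∞ b t)
    (h : deriv (fun t => b t 0) a ≠ 0) :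
    ∃ c : ℝ → Fin 4 → ℝ, ContDiff ℝ ∞ c ∧ ∀ᶠ t in 𝓝 a, b t = graphPt c (b t 0) := by
  have hb' : ∀ i, ∀ᶠ t in 𝓝 a, ContDiffAt ℝ ∞ (fun t => b t i) t := fun i =>
    hb.mono fun t ht => contDiffAt_pi.1 ht i
  obtain ⟨k, hka, hk, -, hkb⟩ := exists_smooth_local_inverse (hb' 0) h
  have hkc : Tendsto k (𝓝 (b a 0)) (𝓝 a) := by
    have := hk.self_of_nhds.continuousAt
    rwa [ContinuousAt, hka] at this
  have hbc : Tendsto (fun t => b t 0) (𝓝 a) (𝓝 (b a 0)) := (hb' 0).self_of_nhds.continuousAt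
  obtain ⟨c, hc, e⟩ := exists_contDiff_eventuallyEq (f := fun s (i : Fin 4) => b (k s) i.succ)
    (a := b a 0) (by
      filter_upwards [hk, hkc.eventually hb] with s h1 h2
      exact contDiffAt_pi.2 fun i => (contDiffAt_pi.1 h2 i.succ).comp s h1)
  refine ⟨c, hc, ?_⟩
  filter_upwards [hkb, hbc.eventually e] with t h1 h2
  funext i
  refine Fin.cases rfl (fun j => ?_) i
  change b t j.succ = c (b t 0) j
  rw [h2, h1]

theorem IsRat.contDiffAt_jetOf {S : Set (Jet ℝ 4)} {k : ℕ} {R : Jet ℝ 4 → ℝ} (h : IsRat S k R)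
    (hS : IsOpen S) {γ : ℝ → Fin 4 → ℝ} (hγ : ContDiff ℝ ∞ γ) {t : ℝ} (ht : jetOf γ t ∈ S) :
    ContDiffAt ℝ ∞ (fun s => R (jetOf γ s)) t := by
  obtain ⟨N, W, -, -, e⟩ := h
  refine ((FlagCurve.contDiff_evalAt_jetOf hγ N).contDiffAt.div
    (FlagCurve.contDiff_evalAt_jetOf hγ W).contDiffAt (e _ ht).1).congr_of_eventuallyEq ?_
  filter_upwards [eventually_jetOf_mem hS hγ.contDiffAt ht] with s hs
  exact (e _ hs).2

/-- Where the discriminant is positive, algebraic functions are real and smooth along curves. -/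
theorem IsAlg.exists_real {k : ℕ} {F : ℤˣ → Jet ℝ 4 → ℂ} (hF : IsAlg GenK k F) :
    ∃ f : ℤˣ → Jet ℝ 4 → ℝ, ∀ θ ∈ GenK, 0 < secDisc (upsilon θ) → ∀ ε,
      F ε θ = f ε θ ∧ ∀ γ : ℝ → Fin 4 → ℝ, ContDiff ℝ ∞ γ → ∀ t, jetOf γ t = θ →
        ContDiffAt ℝ ∞ (fun s => f ε (jetOf γ s)) t := by
  obtain ⟨R₁, R₂, h1, h2, e⟩ := hF
  refine ⟨fun ε θ => R₁ θ + ((ε : ℤ) : ℝ) * √(secDisc (upsilon θ)) * R₂ θ,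
    fun θ hθ hd ε => ⟨?_, ?_⟩⟩
  · rw [e θ hθ, csqrt_of_nonneg hd.le]
    push_cast
    rfl
  · rintro γ hγ t rfl
    exact (h1.contDiffAt_jetOf isOpen_GenK hγ hθ).add ((contDiffAt_const.mul
      ((isRat_secDisc.contDiffAt_jetOf isOpen_contact hγ hθ.1).sqrt hd.ne')).mul
      (h2.contDiffAt_jetOf isOpen_GenK hγ hθ))

/-- Where the discriminant is positive, the projection of a lift is the graph of a curve in `M`. -/
theorem exists_branchCurve {γ : ℝ → Fin 4 → ℝ} (hγ : ContDiff ℝ ∞ γ) {x : ℝ} {ε : ℤˣ}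
    (hx : jetOf γ x ∈ BranchDom ε) (hd : 0 < secDisc (upsilon (jetOf γ x))) :
    ∃ (c : ℝ → Fin 4 → ℝ) (X : ℝ → ℝ), ContDiff ℝ ∞ c ∧ (∀ᶠ t in 𝓝 x, ContDiffAt ℝ ∞ X t) ∧
      deriv X x ≠ 0 ∧
      ∀ᶠ t in 𝓝 x, branchPt ε (jetOf γ t) = fun i => (graphPt c (X t) i : ℂ) := by
  choose f hf using fun i => (isAlg_branchPt i).exists_real
  have hev := eventually_jetOf_mem (isOpen_disc isOpen_Ioi) hγ.contDiffAt
    (show jetOf γ x ∈ {θ | θ ∈ GenK ∧ secDisc (upsilon θ) ∈ Ioi (0 : ℝ)} from ⟨hx.1, hd⟩)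
  have hb : ∀ᶠ t in 𝓝 x, ContDiffAt ℝ ∞ (fun t i => f i ε (jetOf γ t)) t :=
    hev.mono fun t ht => contDiffAt_pi.2 fun i => (hf i _ ht.1 ht.2 ε).2 γ hγ t rfl
  have e : ∀ᶠ t in 𝓝 x, ∀ i, branchPt ε (jetOf γ t) i = f i ε (jetOf γ t) :=
    hev.mono fun t ht i => (hf i _ ht.1 ht.2 ε).1
  have hX : deriv (fun t => f 0 ε (jetOf γ t)) x ≠ 0 := by
    intro h0
    have h1 := (((contDiffAt_pi.1 hb.self_of_nhds 0).differentiableAt (by simp)).hasDerivAt).ofReal_comp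
    rw [h0] at h1
    have h2 := ((isAlg_branchPt 0).totalD_and_chain isOpen_GenK subset_rfl le_rfl).2 ε _ 1 x
      (holonomicAt_jetOf hγ.contDiffAt) hx.1
    have h3 := h2.unique (h1.congr_of_eventuallyEq (e.mono fun t ht => ht 0))
    rw [one_smul] at h3
    exact hx.2 (by simpa using h3)
  obtain ⟨c, hc, hg⟩ := exists_graphPt_eq hb hX
  refine ⟨c, fun t => f 0 ε (jetOf γ t), hc, hb.mono fun t ht => contDiffAt_pi.1 ht 0, hX, ?_⟩
  filter_upwards [hg, e] with t h1 h2
  rw [← h1]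
  exact funext h2

/-! ### Invariance of the average under congruences of curves with real branches -/

theorem vecM_ofReal (m : Fin 5 → ℝ) (i : Fin 7) :
    ((vecM m i : ℝ) : ℂ) = vecM (fun i => (m i : ℂ)) i := by
  fin_cases i <;> simp [vecM]

/-- If a motion maps a real point of `M` to a point in the chart of the complexification, then this
point is real. -/
theorem exists_ofReal_of_moved {g : Matrix (Fin 7) (Fin 7) ℝ} {m : Fin 5 → ℝ} {n : Fin 5 → ℂ}
    (h : moved g (lineM fun i => (m i : ℂ)) = lineM n) :
    ∃ n' : Fin 5 → ℝ, (n = fun i => (n' i : ℂ)) ∧ moved g (lineM m) = lineM n' := by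
  set w := g.mulVec (vecM m) with hw
  have hw' : (g.map (algebraMap ℝ ℂ)).mulVec (vecM fun i => (m i : ℂ)) = fun i => (w i : ℂ) := by
    rw [hw, ← map_mulVec_ofReal]
    congr 1
    exact funext fun i => (vecM_ofReal m i).symm
  rw [moved_lineM, hw'] at h
  have hm : vecM n ∈ Submodule.span ℂ {fun i => (w i : ℂ)} :=
    h ▸ Submodule.mem_span_singleton_self _
  obtain ⟨c, hc⟩ := Submodule.mem_span_singleton.1 hm
  have h1 : c * w 1 = 1 := by simpa [vecM_one] using congrFun hc 1
  have hw1 : (w 1 : ℂ) ≠ 0 := right_ne_zero_of_mul_eq_one h1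
  have hc1 : c = ((w 1)⁻¹ : ℝ) := by
    rw [Complex.ofReal_inv]
    exact eq_inv_of_mul_eq_one_left h1
  have hv : ∀ i, vecM n i = (((w 1)⁻¹ * w i : ℝ) : ℂ) := fun i => by
    rw [← hc, hc1]
    simp
  have hstar : (fun i => star (n i)) = n := by
    refine vecM_injective (funext fun i => ?_)
    have : vecM (fun i => star (n i)) i = star (vecM n i) := by
      fin_cases i <;> simp [vecM]
    rw [this, hv, Complex.star_def, Complex.conj_ofReal]
  have hn : n = fun i => ((n i).re : ℂ) := funext fun i =>
    (Complex.conj_eq_iff_re.1 (congrFun hstar i)).symm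
  refine ⟨fun i => (n i).re, hn, ?_⟩
  rw [lineM, moved_span_singleton, lineM]
  have hr : vecM (fun i => (n i).re) = (w 1)⁻¹ • w := funext fun i => by
    have := hv i
    rw [hn, ← vecM_ofReal] at this
    exact_mod_cast this
  rw [hr, Submodule.span_singleton_smul_eq]
  exact isUnit_iff_ne_zero.2 (inv_ne_zero (by exact_mod_cast hw1))

/-- A branch point is real only if the discriminant is positive. -/
theorem secDisc_pos_of_branchPt {θ : Jet ℝ 4} (hθ : θ ∈ GenK) {ε : ℤˣ} {n : Fin 5 → ℝ}
    (h : branchPt ε θ = fun i => (n i : ℂ)) : 0 < secDisc (upsilon θ) := by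
  by_contra hd
  have h3 : lam ε (upsilon θ) = (n 3 : ℂ) := by
    rw [← congrFun h 3, branchPt_eq]; rfl
  have h4 := star_lam_of_neg (lt_of_le_of_ne (not_lt.1 hd) hθ.2.2) ε
  rw [h3, Complex.star_def, Complex.conj_ofReal, ← h3] at h4
  exact lam_ne hθ.2.1 hθ.2.2 ε h4.symm

/-- A rational invariant of curves in `M` takes the same values at the branches of congruent
curves in `K`, up to a permutation of the branches. -/
theorem IsRatInvariant.branch_eq {k : ℕ} {P Q : JetPoly} (hI : IsRatInvariant lineM k P Q)
    {g : Matrix.GeneralLinearGroup (Fin 7) ℝ} (hg : g ∈ G2) {γ₁ γ₂ : ℝ → Fin 4 → ℝ}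
    (h₁ : ContDiff ℝ ∞ γ₁) (h₂ : ContDiff ℝ ∞ γ₂) {τ : ℝ → ℝ} {x : ℝ}
    (hc : CurvesCongruent planeK (g : Matrix (Fin 7) (Fin 7) ℝ) γ₁ γ₂ τ x)
    (hx₁ : jetOf γ₁ x ∈ GenBranch) (hx₂ : jetOf γ₂ (τ x) ∈ GenBranch)
    (hQ₁ : ∀ ε : ℤˣ, Q.evalAt (branch ε (jetOf γ₁ x)) ≠ 0)
    (hQ₂ : ∀ ε : ℤˣ, Q.evalAt (branch ε (jetOf γ₂ (τ x))) ≠ 0)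
    (hd : 0 < secDisc (upsilon (jetOf γ₁ x))) : ∃ σ : ℤˣ, ∀ ε : ℤˣ,
      P.evalAt (branch ε (jetOf γ₁ x)) / Q.evalAt (branch ε (jetOf γ₁ x)) =
        P.evalAt (branch (σ * ε) (jetOf γ₂ (τ x))) /
          Q.evalAt (branch (σ * ε) (jetOf γ₂ (τ x))) := by
  obtain ⟨hτ, hτ', -⟩ := id hc
  obtain ⟨σ, hσ⟩ := (congruent_iff_branchPt hg h₁ h₂ hτ hτ' hx₁.1 hx₂.1).1 hc
  refine ⟨σ, fun ε => ?_⟩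
  obtain ⟨c₁, X₁, hc₁, hX₁, hX₁', e₁⟩ :=
    exists_branchCurve h₁ (GenBranch_subset_BranchDom ε hx₁) hd
  have hd₂ : 0 < secDisc (upsilon (jetOf γ₂ (τ x))) := by
    have h := hσ.self_of_nhds ε
    rw [e₁.self_of_nhds] at h
    obtain ⟨n, hn, -⟩ := exists_ofReal_of_moved h
    exact secDisc_pos_of_branchPt hx₂.1 hn
  obtain ⟨c₂, X₂, hc₂, hX₂, hX₂', e₂⟩ :=
    exists_branchCurve h₂ (GenBranch_subset_BranchDom (σ * ε) hx₂) hd₂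
  obtain ⟨κ, hκx, hκ, hκ', -⟩ := exists_smooth_local_inverse hX₁ hX₁'
  have hκc : Tendsto κ (𝓝 (X₁ x)) (𝓝 x) := by
    have := hκ.self_of_nhds.continuousAt
    rwa [ContinuousAt, hκx] at this
  have hκd : deriv κ (X₁ x) ≠ 0 := by
    have a1 := (hκ.self_of_nhds.differentiableAt (by simp)).hasDerivAt
    have a2 : HasDerivAt X₁ (deriv X₁ x) (κ (X₁ x)) := by
      rw [hκx]
      exact (hX₁.self_of_nhds.differentiableAt (by simp)).hasDerivAt
    have a3 := (a2.comp (X₁ x) a1).unique ((hasDerivAt_id (X₁ x)).congr_of_eventuallyEq hκ')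
    exact right_ne_zero_of_mul_eq_one a3
  have hM : CurvesCongruent lineM (g : Matrix (Fin 7) (Fin 7) ℝ) c₁ c₂
      (fun s => X₂ (τ (κ s))) (X₁ x) := by
    have b1 : ContDiffAt ℝ ∞ τ (κ (X₁ x)) := by rwa [hκx]
    have b2 : ContDiffAt ℝ ∞ X₂ (τ (κ (X₁ x))) := by rw [hκx]; exact hX₂.self_of_nhds
    refine ⟨b2.comp (X₁ x) (b1.comp (X₁ x) hκ.self_of_nhds), ?_, ?_⟩
    · have d1 := (b2.differentiableAt (by simp)).hasDerivAt.comp (X₁ x)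
        ((b1.differentiableAt (by simp)).hasDerivAt.comp (X₁ x)
          (hκ.self_of_nhds.differentiableAt (by simp)).hasDerivAt)
      have d2 : deriv (fun s => X₂ (τ (κ s))) (X₁ x) = _ := d1.deriv
      rw [d2, hκx]
      exact mul_ne_zero hX₂' (mul_ne_zero hτ' hκd)
    · filter_upwards [hκ', hκc.eventually e₁, hκc.eventually (hτ.continuousAt.eventually e₂),
        hκc.eventually hσ] with s a1 a2 a3 a4
      have := a4 ε
      rw [a2, a3, a1] at this
      obtain ⟨n, hn, h⟩ := exists_ofReal_of_moved this
      rw [h]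
      congr 1
      funext i
      exact_mod_cast (congrFun hn i).symm
  have j₁ := branch_jetOf (Eventually.of_forall fun _ => h₁.contDiffAt) hc₁
    (GenBranch_subset_BranchDom ε hx₁) e₁
  have j₂ := branch_jetOf (Eventually.of_forall fun _ => h₂.contDiffAt) hc₂
    (GenBranch_subset_BranchDom (σ * ε) hx₂) e₂
  have q₁ := hQ₁ ε
  have q₂ := hQ₂ (σ * ε)
  rw [j₁, JetPoly.evalAt_toComplex, Complex.ofReal_ne_zero] at q₁
  rw [j₂, JetPoly.evalAt_toComplex, Complex.ofReal_ne_zero] at q₂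
  have key := hI.2.2.2 g hg c₁ c₂ hc₁ hc₂ _ _ hM q₁ (by
    simp only [hκx]
    exact q₂)
  simp only [hκx] at key
  rw [j₁, j₂, JetPoly.evalAt_toComplex, JetPoly.evalAt_toComplex, JetPoly.evalAt_toComplex,
    JetPoly.evalAt_toComplex]
  exact_mod_cast key

/-! ### The action of the group on jets of curves in `K` -/

/-- The denominator of the action of a matrix on the chart of `K`. -/
noncomputable def actDet (g : Matrix (Fin 7) (Fin 7) ℝ) (b : Fin 5 → ℝ) : ℝ :=
  g.mulVec (kA (hat b)) 1 * g.mulVec (kB (hat b)) 6 -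
    g.mulVec (kA (hat b)) 6 * g.mulVec (kB (hat b)) 1

/-- The action of a matrix on the chart of `K`. -/
noncomputable def act (g : Matrix (Fin 7) (Fin 7) ℝ) (b : Fin 5 → ℝ) : Fin 5 → ℝ :=
  unhat (chartK (g.mulVec (kA (hat b))) (g.mulVec (kB (hat b))))

theorem moved_planeK_eq {g : Matrix.GeneralLinearGroup (Fin 7) ℝ} (hg : g ∈ G2) {b : Fin 5 → ℝ}
    (h : actDet g b ≠ 0) : moved (g : Matrix (Fin 7) (Fin 7) ℝ) (planeK b) = planeK (act g b) := by
  rw [planeK_eq b, moved_span_pair]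
  refine span_eq_planeK ?_ h
  rw [← hg, octCross_kA_kB, Matrix.mulVec_zero]

theorem actDet_ne_zero_of_moved {g : Matrix.GeneralLinearGroup (Fin 7) ℝ} {b b' : Fin 5 → ℝ}
    (h : moved (g : Matrix (Fin 7) (Fin 7) ℝ) (planeK b) = planeK b') : actDet g b ≠ 0 := by
  have key : ∀ v ∈ planeK b, (g : Matrix (Fin 7) (Fin 7) ℝ).mulVec v =
      (g : Matrix (Fin 7) (Fin 7) ℝ).mulVec v 1 • kA (hat b') +
        (g : Matrix (Fin 7) (Fin 7) ℝ).mulVec v 6 • kB (hat b') := fun v hv => by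
    refine mem_span_pair_coords (i := 1) (j := 6) rfl rfl rfl rfl ?_
    rw [← planeK_eq, ← h, moved]
    exact Submodule.mem_map_of_mem hv
  exact det_ne_zero_of_mulVec (key _ (kA_mem b)) (key _ (kB_mem b))

theorem eq_act_of_moved {g : Matrix.GeneralLinearGroup (Fin 7) ℝ} (hg : g ∈ G2) {b b' : Fin 5 → ℝ}
    (h : moved (g : Matrix (Fin 7) (Fin 7) ℝ) (planeK b) = planeK b') : b' = act g b :=
  planeK_injective (h.symm.trans (moved_planeK_eq hg (actDet_ne_zero_of_moved h)))

theorem isRat_hat_pt {S : Set (Jet ℝ 4)} (i : Fin 5) : IsRat S 0 (fun θ => hat θ.pt i) := by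
  have c : ∀ i, IsRat S 0 (fun θ => θ.2 0 i) := fun i => IsRat.coord le_rfl i
  fin_cases i
  exacts [IsRat.fst, (c 0).div (IsRat.const √3) fun _ _ => sqrt3_ne, c 1,
    (c 2).div (IsRat.const √3) fun _ _ => sqrt3_ne, c 3]

theorem isRat_mulVec {S : Set (Jet ℝ 4)} {k : ℕ} (g : Matrix (Fin 7) (Fin 7) ℝ)
    {v : Jet ℝ 4 → Fin 7 → ℝ} (hv : ∀ i, IsRat S k (fun θ => v θ i)) (i : Fin 7) :
    IsRat S k (fun θ => g.mulVec (v θ) i) := by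
  have t : ∀ j, IsRat S k (fun θ => g i j * v θ j) := fun j => (IsRat.const (g i j)).mul (hv j)
  refine (((((((t 0).add (t 1)).add (t 2)).add (t 3)).add (t 4)).add (t 5)).add (t 6)).congr
    fun θ _ => ?_
  simp [Matrix.mulVec, dotProduct, Fin.sum_univ_seven]

theorem isRat_mulVec_kA {S : Set (Jet ℝ 4)} (g : Matrix (Fin 7) (Fin 7) ℝ) (i : Fin 7) :
    IsRat S 0 (fun θ => g.mulVec (kA (hat θ.pt)) i) := by
  refine isRat_mulVec g (fun j => ?_) i
  have b := fun i => isRat_hat_pt (S := S) i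
  fin_cases j
  exacts [b 1, IsRat.const 1, (b 2).neg, ((b 4).sub ((b 0).mul (b 2))).sub ((b 3).mul (b 1)),
    ((b 2).mul (b 3)).sub ((b 1).pow 2), b 3, IsRat.const 0]

theorem isRat_mulVec_kB {S : Set (Jet ℝ 4)} (g : Matrix (Fin 7) (Fin 7) ℝ) (i : Fin 7) :
    IsRat S 0 (fun θ => g.mulVec (kB (hat θ.pt)) i) := by
  refine isRat_mulVec g (fun j => ?_) i
  have b := fun i => isRat_hat_pt (S := S) i
  fin_cases j
  exacts [(b 3).neg, IsRat.const 0, b 1, ((b 0).mul (b 1)).sub ((b 3).pow 2),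
    (((IsRat.const 2).mul (b 3)).mul (b 1)).sub (b 4), (b 0).neg, IsRat.const 1]

theorem isRat_actDet {S : Set (Jet ℝ 4)} (g : Matrix (Fin 7) (Fin 7) ℝ) :
    IsRat S 0 (fun θ => actDet g θ.pt) :=
  ((isRat_mulVec_kA g 1).mul (isRat_mulVec_kB g 6)).sub
    ((isRat_mulVec_kA g 6).mul (isRat_mulVec_kB g 1))

theorem isRat_act (g : Matrix (Fin 7) (Fin 7) ℝ) (i : Fin 5) :
    IsRat {θ | actDet g θ.pt ≠ 0} 0 (fun θ => act g θ.pt i) := by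
  have a := fun i => isRat_mulVec_kA (S := {θ | actDet g θ.pt ≠ 0}) g i
  have b := fun i => isRat_mulVec_kB (S := {θ | actDet g θ.pt ≠ 0}) g i
  have q := fun {R : Jet ℝ 4 → ℝ} (hR : IsRat {θ | actDet g θ.pt ≠ 0} 0 R) =>
    hR.div (isRat_actDet g) fun θ hθ => hθ
  have s : IsRat {θ | actDet g θ.pt ≠ 0} 0 (fun _ => √3) := IsRat.const √3
  have c0 := q (((a 1).mul (b 5)).sub ((b 1).mul (a 5))).neg
  have c1 := q (((b 6).mul (a 0)).sub ((a 6).mul (b 0)))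
  have c2 := q (((b 6).mul (a 2)).sub ((a 6).mul (b 2))).neg
  have c3 := q (((b 6).mul (a 5)).sub ((a 6).mul (b 5)))
  have c4 := q (((a 1).mul (b 4)).sub ((b 1).mul (a 4)))
  fin_cases i
  exacts [c0, s.mul c1, c2, s.mul c3, (((IsRat.const 2).mul c3).mul c1).sub c4]

/-- The jets on which the prolonged action of a matrix is defined. -/
def actDom (g : Matrix (Fin 7) (Fin 7) ℝ) : Set (Jet ℝ 4) :=
  {θ | actDet g θ.pt ≠ 0 ∧ totalD (fun η => act g η.pt 0) θ ≠ 0}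

/-- The prolonged action on jets of curves. -/
noncomputable def actJet (g : Matrix (Fin 7) (Fin 7) ℝ) : Jet ℝ 4 → Jet ℝ 4 :=
  prolong (fun θ => act g θ.pt 0) (fun θ i => act g θ.pt i.succ)

theorem isOpen_actDet (g : Matrix (Fin 7) (Fin 7) ℝ) : IsOpen {θ : Jet ℝ 4 | actDet g θ.pt ≠ 0} := by
  have := (isRat_actDet (S := univ) g).continuousOn
  rw [continuousOn_univ] at this
  exact isOpen_ne_fun this continuous_const

theorem isRat_totalD_act (g : Matrix (Fin 7) (Fin 7) ℝ) :
    IsRat {θ | actDet g θ.pt ≠ 0} 1 (totalD fun η => act g η.pt 0) :=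
  (isRat_act g 0).totalD (isOpen_actDet g)

theorem isOpen_actDom (g : Matrix (Fin 7) (Fin 7) ℝ) : IsOpen (actDom g) :=
  (isRat_totalD_act g).continuousOn.isOpen_inter_preimage (isOpen_actDet g) isOpen_compl_singleton

theorem actDom_subset (g : Matrix (Fin 7) (Fin 7) ℝ) : actDom g ⊆ {θ | actDet g θ.pt ≠ 0} :=
  fun _ h => h.1

theorem isJetClass_actJet (g : Matrix (Fin 7) (Fin 7) ℝ) :
    IsJetClass (actDom g) (fun θ => act g θ.pt 0) {F : Jet ℝ 4 → ℝ | ∃ k, IsRat (actDom g) k F} :=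
  isJetClass_isRat (isOpen_actDom g) ((isRat_act g 0).mono le_rfl (actDom_subset g)) fun _ h => h.2

theorem actJet_components (g : Matrix (Fin 7) (Fin 7) ℝ) (i : Fin 4) :
    (fun θ : Jet ℝ 4 => act g θ.pt i.succ) ∈ {F : Jet ℝ 4 → ℝ | ∃ k, IsRat (actDom g) k F} :=
  ⟨0, (isRat_act g i.succ).mono le_rfl (actDom_subset g)⟩

theorem exists_isRat_evalAt_actJet (g : Matrix (Fin 7) (Fin 7) ℝ) (P : JetPoly) :
    ∃ k, IsRat (actDom g) k (fun θ => P.evalAt (actJet g θ)) := by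
  induction P using MvPolynomial.induction_on with
  | C c => simp only [JetPoly.evalAt_C]; exact ⟨0, IsRat.const c⟩
  | add p q hp hq =>
    obtain ⟨k, hp⟩ := hp
    obtain ⟨l, hq⟩ := hq
    simp only [JetPoly.evalAt_add]
    exact ⟨max k l, (hp.mono (le_max_left _ _) subset_rfl).add
      (hq.mono (le_max_right _ _) subset_rfl)⟩
  | mul_X p v hp =>
    obtain ⟨k, hp⟩ := hp
    simp only [JetPoly.evalAt_mul]
    suffices h : ∃ l, IsRat (actDom g) l (fun θ => JetPoly.evalAt (MvPolynomial.X v) (actJet g θ)) by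
      obtain ⟨l, hq⟩ := h
      exact ⟨max k l, (hp.mono (le_max_left _ _) subset_rfl).mul
        (hq.mono (le_max_right _ _) subset_rfl)⟩
    rcases v with _ | ⟨j, i⟩
    · simp only [JetPoly.evalAt_X_none]
      exact ⟨0, (isRat_act g 0).mono le_rfl (actDom_subset g)⟩
    · simp only [JetPoly.evalAt_X_some]
      obtain ⟨l, hl⟩ := (isJetClass_actJet g).scalarProlong_mem (actJet_components g i) j
      exact ⟨l, hl.congr fun θ hθ => (isJetClass_actJet g).prolongCoeff_apply (isOpen_actDom g)
        (actJet_components g) j θ hθ i⟩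

theorem holonomicAt_actJet {g : Matrix (Fin 7) (Fin 7) ℝ} {J : ℝ → Jet ℝ 4} {μ t : ℝ}
    (hJ : HolonomicAt J μ t) (ht : J t ∈ actDom g) : HolonomicAt (fun s => actJet g (J s))
      (μ • totalD (fun η => act g η.pt 0) (J t)) t :=
  ⟨(isRat_act g 0).chain (isOpen_actDet g) hJ ht.1, fun k => hasDerivAt_pi.1
    ((isJetClass_actJet g).hasDerivAt_prolongCoeff (U := fun θ i => act g θ.pt i.succ)
      (isOpen_actDom g) (actJet_components g) k hJ ht ht.2)⟩

theorem actJet_pt (g : Matrix (Fin 7) (Fin 7) ℝ) (θ : Jet ℝ 4) : (actJet g θ).pt = act g θ.pt :=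
  funext fun i => Fin.cases rfl (fun _ => rfl) i

/-- The prolonged action gives the jets of congruent curves. -/
theorem CurvesCongruent.jetOf_eq {g : Matrix.GeneralLinearGroup (Fin 7) ℝ} (hg : g ∈ G2)
    {γ₁ γ₂ : ℝ → Fin 4 → ℝ} (h₁ : ContDiff ℝ ∞ γ₁) (h₂ : ContDiff ℝ ∞ γ₂) {τ : ℝ → ℝ} {x : ℝ}
    (h : CurvesCongruent planeK (g : Matrix (Fin 7) (Fin 7) ℝ) γ₁ γ₂ τ x) :
    jetOf γ₁ x ∈ actDom g ∧ jetOf γ₂ (τ x) = actJet g (jetOf γ₁ x) := by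
  obtain ⟨hτ, hτ', h⟩ := h
  have hdet : ∀ᶠ t in 𝓝 x, actDet g (jetOf γ₁ t).pt ≠ 0 := h.mono fun t ht => by
    rw [jetOf_pt]; exact actDet_ne_zero_of_moved ht
  have hpt : ∀ᶠ t in 𝓝 x, graphPt γ₂ (τ t) = act g (jetOf γ₁ t).pt := h.mono fun t ht => by
    rw [jetOf_pt]; exact eq_act_of_moved hg ht
  have hτ1 : ∀ᶠ t in 𝓝 x, HasDerivAt τ (deriv τ t) t :=
    ((contDiffAt_infty.1 hτ 2).eventually (by simp)).mono fun t ht =>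
      (ht.differentiableAt (by simp)).hasDerivAt
  have hJ : ∀ t, HolonomicAt (jetOf γ₁) 1 t := fun t => holonomicAt_jetOf h₁.contDiffAt
  have hx : totalD (fun η => act g η.pt 0) (jetOf γ₁ x) = deriv τ x := by
    have h1 := (isRat_act g 0).chain (isOpen_actDet g) (hJ x) hdet.self_of_nhds
    have h2 := h1.unique (hτ1.self_of_nhds.congr_of_eventuallyEq
      (hpt.mono fun t ht => (congrFun ht 0).symm))
    simpa using h2
  have hmem : jetOf γ₁ x ∈ actDom g := ⟨hdet.self_of_nhds, by rwa [hx]⟩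
  refine ⟨hmem, (HolonomicAt.unique (J := fun t => actJet g (jetOf γ₁ t))
    (J' := fun t => jetOf γ₂ (τ t)) (x := x)
    (μ := fun t => (1 : ℝ) • totalD (fun η => act g η.pt 0) (jetOf γ₁ t)) ?_ (hτ1.mono fun t ht =>
      (holonomicAt_jetOf h₂.contDiffAt).comp ht) ?_ (hpt.mono fun t ht => ?_)).symm⟩
  · exact (eventually_jetOf_mem (isOpen_actDom g) h₁.contDiffAt hmem).mono fun t ht =>
      holonomicAt_actJet (hJ t) ht
  · exact (eventually_jetOf_mem (isOpen_actDom g) h₁.contDiffAt hmem).mono fun t ht => by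
      rw [one_smul]; exact ht.2
  · rw [actJet_pt, ← ht, jetOf_pt]

/-- Every non-empty open subset of the domain of the action contains the jet of a curve with a
congruent curve. -/
theorem exists_congruent {g : Matrix.GeneralLinearGroup (Fin 7) ℝ} (hg : g ∈ G2)
    {O : Set (Jet ℝ 4)} (hO : IsOpen O) (hO' : O ⊆ actDom g) (hne : O.Nonempty) :
    ∃ (γ₁ γ₂ : ℝ → Fin 4 → ℝ) (τ : ℝ → ℝ) (x : ℝ), ContDiff ℝ ∞ γ₁ ∧ ContDiff ℝ ∞ γ₂ ∧
      jetOf γ₁ x ∈ O ∧ CurvesCongruent planeK (g : Matrix (Fin 7) (Fin 7) ℝ) γ₁ γ₂ τ x := by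
  obtain ⟨θ, hθ⟩ := hne
  obtain ⟨γ₁, h₁, hx⟩ := exists_curve_mem hO hθ
  set x := θ.1
  have hev := eventually_jetOf_mem hO h₁.contDiffAt hx
  have hb : ∀ᶠ t in 𝓝 x, ContDiffAt ℝ ∞ (fun s => act g (jetOf γ₁ s).pt) t :=
    hev.mono fun t ht => contDiffAt_pi.2 fun i =>
      (isRat_act g i).contDiffAt_jetOf (isOpen_actDet g) h₁ (hO' ht).1
  have hd : deriv (fun s => act g (jetOf γ₁ s).pt 0) x ≠ 0 := by
    rw [((isRat_act g 0).chain (isOpen_actDet g) (holonomicAt_jetOf h₁.contDiffAt)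
      (hO' hx).1).deriv, one_mul]
    exact (hO' hx).2
  obtain ⟨γ₂, h₂, e⟩ := exists_graphPt_eq hb hd
  refine ⟨γ₁, γ₂, _, x, h₁, h₂, hx, contDiffAt_pi.1 hb.self_of_nhds 0, hd, ?_⟩
  filter_upwards [e, hev] with t h1 h2
  rw [← h1, jetOf_pt]
  exact moved_planeK_eq hg (by rw [← jetOf_pt]; exact (hO' h2).1)

theorem CurvesCongruent.symm {g : Matrix.GeneralLinearGroup (Fin 7) ℝ} (hg : g ∈ G2)
    {γ₁ γ₂ : ℝ → Fin 4 → ℝ} (h₁ : ContDiff ℝ ∞ γ₁) {τ : ℝ → ℝ} {x : ℝ}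
    (h : CurvesCongruent planeK (g : Matrix (Fin 7) (Fin 7) ℝ) γ₁ γ₂ τ x) : ∃ κ : ℝ → ℝ,
      κ (τ x) = x ∧ CurvesCongruent planeK
        ((g⁻¹ : Matrix.GeneralLinearGroup (Fin 7) ℝ) : Matrix (Fin 7) (Fin 7) ℝ) γ₂ γ₁ κ (τ x) := by
  obtain ⟨hτ, hτ', h⟩ := h
  -- the change of parameter is a coordinate of the action, hence smooth near `x`
  have hs : ∀ᶠ t in 𝓝 x, ContDiffAt ℝ ∞ τ t := h.eventually_nhds.mono fun t ht =>
    ((isRat_act g 0).contDiffAt_jetOf (isOpen_actDet g) h₁ (t := t) (by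
      rw [mem_ofPred_eq, jetOf_pt]
      exact actDet_ne_zero_of_moved ht.self_of_nhds)).congr_of_eventuallyEq
      (ht.mono fun s hs => by
        have := congrFun (eq_act_of_moved hg hs) 0
        rw [← jetOf_pt γ₁] at this
        exact this)
  obtain ⟨κ, hκx, hκ, hκ', -⟩ := exists_smooth_local_inverse hs hτ'
  have hκc : Tendsto κ (𝓝 (τ x)) (𝓝 x) := by
    have := hκ.self_of_nhds.continuousAt
    rwa [ContinuousAt, hκx] at this
  refine ⟨κ, hκx, hκ.self_of_nhds, ?_, ?_⟩
  · have a1 := (hκ.self_of_nhds.differentiableAt (by simp)).hasDerivAt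
    have a2 : HasDerivAt τ (deriv τ x) (κ (τ x)) := by
      rw [hκx]
      exact (hτ.differentiableAt (by simp)).hasDerivAt
    have a3 := (a2.comp (τ x) a1).unique ((hasDerivAt_id (τ x)).congr_of_eventuallyEq hκ')
    exact right_ne_zero_of_mul_eq_one a3
  · filter_upwards [hκ', hκc.eventually h] with s h1 h2
    rw [h1] at h2
    rw [← h2, ← moved_mul, ← Units.val_mul, inv_mul_cancel]
    simp [moved]

/-! ### Rational invariants are determined on open sets -/

/-- A rational function that is invariant under congruences of the curves whose jets satisfy an open
condition is invariant: the condition of invariance is an identity of rational functions. -/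
theorem isRatInvariant_planeK_of_isOpen {k : ℕ} {A B T : JetPoly} (hA : A.OrderLE k)
    (hB : B.OrderLE k) (hT : T ≠ 0) {V : Set (Jet ℝ 4)} (hV : IsOpen V) (hV' : V.Nonempty)
    (hTB : ∀ θ : Jet ℝ 4, T.evalAt θ ≠ 0 → B.evalAt θ ≠ 0)
    (h : ∀ g ∈ G2, ∀ γ₁ γ₂ : ℝ → Fin 4 → ℝ, ContDiff ℝ ∞ γ₁ → ContDiff ℝ ∞ γ₂ →
      ∀ (τ : ℝ → ℝ) (x : ℝ), CurvesCongruent planeK (g : Matrix (Fin 7) (Fin 7) ℝ) γ₁ γ₂ τ x →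
        T.evalAt (jetOf γ₁ x) ≠ 0 → T.evalAt (jetOf γ₂ (τ x)) ≠ 0 → jetOf γ₁ x ∈ V →
          A.evalAt (jetOf γ₁ x) / B.evalAt (jetOf γ₁ x) =
            A.evalAt (jetOf γ₂ (τ x)) / B.evalAt (jetOf γ₂ (τ x))) :
    IsRatInvariant planeK k A B := by
  have hB0 : B ≠ 0 := by
    rintro rfl
    obtain ⟨θ, hθ⟩ := JetPoly.exists_evalAt_ne_zero hT
    exact hTB θ hθ (JetPoly.evalAt_zero θ)
  refine ⟨hB0, hA, hB, fun g hg γ₁ γ₂ h₁ h₂ τ x hc hB₁ hB₂ => ?_⟩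
  obtain ⟨hx, hx'⟩ := hc.jetOf_eq hg h₁ h₂
  have dense : ∀ {P : JetPoly}, P ≠ 0 → Dense {θ : Jet ℝ 4 | P.evalAt θ ≠ 0} := fun hP => by
    obtain ⟨θ, hθ⟩ := JetPoly.exists_evalAt_ne_zero hP
    exact dense_evalAt_ne_zero hθ
  have open' : ∀ P : JetPoly, IsOpen {θ : Jet ℝ 4 | P.evalAt θ ≠ 0} := fun P =>
    isOpen_ne_fun (continuous_evalAt P) continuous_const
  -- the domain of the action contains the complement of a hypersurface, so it meets `V`
  have hmeet : (V ∩ actDom g).Nonempty := by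
    obtain ⟨N₁, W₁, -, -, e₁⟩ := isRat_actDet (S := univ) (g : Matrix (Fin 7) (Fin 7) ℝ)
    obtain ⟨N₂, W₂, -, -, e₂⟩ := isRat_totalD_act (g : Matrix (Fin 7) (Fin 7) ℝ)
    beta_reduce at e₁
    have hN₁ : N₁ ≠ 0 := fun h0 => hx.1 (by
      rw [(e₁ _ (mem_univ _)).2, h0, JetPoly.evalAt_zero, zero_div])
    have hN₂ : N₂ ≠ 0 := fun h0 => hx.2 (by
      rw [(e₂ _ hx.1).2, h0, JetPoly.evalAt_zero, zero_div])
    obtain ⟨θ, hθ, h0⟩ := (dense (mul_ne_zero hN₁ hN₂)).inter_open_nonempty V hV hV'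
    rw [mem_ofPred_eq, JetPoly.evalAt_mul] at h0
    have hd : actDet g θ.pt ≠ 0 := by
      rw [(e₁ _ (mem_univ _)).2]
      exact div_ne_zero (left_ne_zero_of_mul h0) (e₁ _ (mem_univ _)).1
    refine ⟨θ, hθ, hd, ?_⟩
    rw [(e₂ _ hd).2]
    exact div_ne_zero (right_ne_zero_of_mul h0) (e₂ _ hd).1
  obtain ⟨a, hAg⟩ := exists_isRat_evalAt_actJet g A
  obtain ⟨b, hBg⟩ := exists_isRat_evalAt_actJet g B
  obtain ⟨c, N₂, W₂, -, -, hTg⟩ := exists_isRat_evalAt_actJet g T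
  set m := max k (max a b)
  obtain ⟨N₁, W₁, -, -, hE⟩ :=
    ((IsRat.evalAt (hA.mono (show k ≤ m by omega))).mul (hBg.mono (show b ≤ m by omega) subset_rfl)).sub
      ((hAg.mono (show a ≤ m by omega) subset_rfl).mul (IsRat.evalAt (hB.mono (show k ≤ m by omega))))
  beta_reduce at hTg hE
  have hN₂ : N₂ ≠ 0 := by
    intro h0
    have hTg0 : ∀ θ ∈ actDom g, T.evalAt (actJet g θ) = 0 := fun θ hθ => by
      rw [(hTg θ hθ).2, h0, JetPoly.evalAt_zero, zero_div]
    obtain ⟨κ, hκ, hc'⟩ := hc.symm hg h₁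
    have hy := (hc'.jetOf_eq (inv_mem hg) h₂ h₁).1
    obtain ⟨η₁, η₂, ρ, y, k₁, k₂, ⟨-, hy₂⟩, hcy⟩ := exists_congruent (inv_mem hg)
      ((isOpen_actDom _).inter (open' T)) inter_subset_left
      ((dense hT).inter_open_nonempty _ (isOpen_actDom _) ⟨_, hy⟩)
    obtain ⟨ν, hν, hcν⟩ := hcy.symm (inv_mem hg) k₁
    rw [inv_inv] at hcν
    obtain ⟨z₁, z₂⟩ := hcν.jetOf_eq hg k₂ k₁
    rw [hν] at z₂
    exact hy₂ (by rw [z₂]; exact hTg0 _ z₁)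
  have hN₁ : N₁ = 0 := by
    suffices hprod : T * (N₁ * N₂) = 0 from
      ((mul_eq_zero.1 hprod).resolve_left hT |> mul_eq_zero.1).resolve_right hN₂
    refine JetPoly.eq_zero_of_isOpen (hV.inter (isOpen_actDom g)) hmeet fun θ hθ => ?_
    by_contra h0
    obtain ⟨γ₁, γ₂, τ, x, h₁, h₂, ⟨⟨hxV, hxg⟩, hx0⟩, hc⟩ := exists_congruent hg
      ((hV.inter (isOpen_actDom g)).inter (open' (T * (N₁ * N₂))))
      (inter_subset_left.trans inter_subset_right) ⟨θ, hθ, h0⟩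
    rw [mem_ofPred_eq, JetPoly.evalAt_mul, JetPoly.evalAt_mul] at hx0
    have e := (hc.jetOf_eq hg h₁ h₂).2
    have t₁ := left_ne_zero_of_mul hx0
    have t₂ : T.evalAt (jetOf γ₂ (τ x)) ≠ 0 := by
      rw [e, (hTg _ hxg).2]
      exact div_ne_zero (right_ne_zero_of_mul (right_ne_zero_of_mul hx0)) (hTg _ hxg).1
    have key := h g hg γ₁ γ₂ h₁ h₂ τ x hc t₁ t₂ hxV
    rw [div_eq_div_iff (hTB _ t₁) (hTB _ t₂), e] at key
    have hz := (hE _ hxg).2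
    rw [key, sub_self] at hz
    exact (div_ne_zero (left_ne_zero_of_mul (right_ne_zero_of_mul hx0)) (hE _ hxg).1) hz.symm
  have hz := (hE _ hx).2
  rw [hN₁, JetPoly.evalAt_zero, zero_div, ← hx', sub_eq_zero] at hz
  rw [div_eq_div_iff hB₁ hB₂, hz]

/-- The average of an invariant of curves in `M` over the two branches is an invariant of curves
in `K`. -/
theorem exists_isRatInvariant_average {k : ℕ} {P Q : JetPoly} (hI : IsRatInvariant lineM k P Q) :
    ∃ A B : JetPoly, IsRatInvariant planeK (k + 2) A B ∧
      ∀ θ ∈ GenBranch, (∀ ε : ℤˣ, Q.evalAt (branch ε θ) ≠ 0) → B.evalAt θ ≠ 0 →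
        ((A.evalAt θ / B.evalAt θ : ℝ) : ℂ) =
          (P.evalAt (branch 1 θ) / Q.evalAt (branch 1 θ) +
            P.evalAt (branch (-1) θ) / Q.evalAt (branch (-1) θ)) / 2 := by
  obtain ⟨A, B, hA, hB, hav⟩ := exists_average hI.2.1 hI.2.2.1
  obtain ⟨T, hT, hT'⟩ := exists_poly_evalAt_branch hI.1
  refine ⟨A, B, isRatInvariant_planeK_of_isOpen hA hB hT (isOpen_disc (isOpen_Ioi (a := 0)))
    ⟨sampleJet 1, sampleJet_mem_GenK one_ne_zero, ?_⟩
    (fun θ hθ => (hav θ (hT' θ hθ).1 (hT' θ hθ).2).1) ?_, fun θ hθ h _ => (hav θ hθ h).2⟩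
  · rw [secDisc_sampleJet, mem_Ioi]
    have := sqrt3_pos
    linarith
  · intro g hg γ₁ γ₂ h₁ h₂ τ x hc t₁ t₂ hx
    obtain ⟨b₁, q₁⟩ := hT' _ t₁
    obtain ⟨b₂, q₂⟩ := hT' _ t₂
    obtain ⟨σ, hσ⟩ := hI.branch_eq hg h₁ h₂ hc b₁ b₂ q₁ q₂ hx.2
    have e₁ := (hav _ b₁ q₁).2
    have e₂ := (hav _ b₂ q₂).2
    have : ((A.evalAt (jetOf γ₁ x) / B.evalAt (jetOf γ₁ x) : ℝ) : ℂ) =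
        ((A.evalAt (jetOf γ₂ (τ x)) / B.evalAt (jetOf γ₂ (τ x)) : ℝ) : ℂ) := by
      rw [e₁, e₂, hσ 1, hσ (-1)]
      rcases Int.units_eq_one_or σ with rfl | rfl
      · rw [one_mul, one_mul]
      · rw [mul_one, neg_mul_neg, one_mul, add_comm]
    exact_mod_cast this

theorem mainTheorem5 :
    -- the double fibration `G₂/P₁ ← G₂/P₁₂ → G₂/P₂` and its affine charts
    (Prod.fst '' FlagP12 = FlagP1 ∧ Prod.snd '' FlagP12 = FlagP2 ∧
      BijOn (lineM (𝔽 := ℝ)) univ {L | L ∈ FlagP1 ∧ ∃ v ∈ L, v 1 ≠ 0} ∧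
      BijOn planeK univ {P | P ∈ FlagP2 ∧ ∀ v ∈ P, v 1 = 0 → v 6 = 0 → v = 0} ∧
      BijOn flagMhat univ {F | F ∈ FlagP12 ∧ (∃ v ∈ F.1, v 1 ≠ 0) ∧
        ∀ v ∈ F.2, v 1 = 0 → v 5 = 0 → v = 0} ∧
      BijOn flagKhat univ {F | F ∈ FlagP12 ∧ (∃ v ∈ F.1, v 1 ≠ 0) ∧
        ∀ v ∈ F.2, v 1 = 0 → v 6 = 0 → v = 0}) ∧
    -- the diffeomorphism `φ` identifies the two prolongations and interchanges the generators
    (BijOn phi {m | m 5 ≠ 0} {n | n 0 ≠ 0} ∧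
      ContDiffOn ℝ ∞ phi {m | m 5 ≠ 0} ∧
      (∃ ψ : (Fin 6 → ℝ) → (Fin 6 → ℝ), ContDiffOn ℝ ∞ ψ {n | n 0 ≠ 0} ∧
        InvOn ψ phi {m | m 5 ≠ 0} {n | n 0 ≠ 0}) ∧
      ∀ m : Fin 6 → ℝ, m 5 ≠ 0 →
        flagKhat (phi m) = flagMhat m ∧ toM (phi m) = dropLast m ∧
        (∃ c : ℝ, c ≠ 0 ∧ fderiv ℝ phi m (horMhat m) = c • vert) ∧
        (∃ c : ℝ, c ≠ 0 ∧ fderiv ℝ phi m vert = c • horKhat (phi m))) ∧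
    -- the left lift: one-to-one, on an open dense set, right inverse to the projection, invariant
    (IsOpen GenM ∧ Dense GenM ∧
      (∀ θ ∈ GenM, (jLeft θ).proj = θ ∧
        ∀ r : ℝ, metricM θ.pt θ.vel (dirM θ.pt r) = 0 ↔ r = rLeft θ) ∧
      (∀ γ : ℝ → Fin 4 → ℝ, ContDiff ℝ ∞ γ → ∀ x : ℝ, jetOf γ x ∈ GenM →
        jLeft (jetOf γ x) =
          jetOf (fun t => ![γ t 0, γ t 1, γ t 2, γ t 3, rLeft (jetOf γ t)]) x) ∧
      (∀ g ∈ G2, ∀ γ₁ γ₂ : ℝ → Fin 4 → ℝ, ContDiff ℝ ∞ γ₁ → ContDiff ℝ ∞ γ₂ →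
        ∀ (τ : ℝ → ℝ) (x : ℝ), CurvesCongruent lineM (g : Matrix (Fin 7) (Fin 7) ℝ) γ₁ γ₂ τ x →
          jetOf γ₁ x ∈ GenM → jetOf γ₂ (τ x) ∈ GenM →
            moved (g : Matrix (Fin 7) (Fin 7) ℝ) (flagMhat (jLeft (jetOf γ₁ x)).pt).2 =
              (flagMhat (jLeft (jetOf γ₂ (τ x))).pt).2)) ∧
    -- the vector `Υ` compares the 2-jet with that of the distinguished curve of the same 1-jet
    (∀ θ : Jet ℝ 4, contactDefect θ ≠ 0 →
      (∃ δ : ℝ → Fin 4 → ℝ, ContDiffAt ℝ ∞ δ θ.1 ∧ IsDistinguished δ θ.1 ∧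
        δ θ.1 = θ.2 0 ∧ deriv δ θ.1 = θ.2 1) ∧
      (∀ δ : ℝ → Fin 4 → ℝ, ContDiffAt ℝ ∞ δ θ.1 → IsDistinguished δ θ.1 →
        δ θ.1 = θ.2 0 → deriv δ θ.1 = θ.2 1 →
          ∃ c : ℝ, Matrix.vecCons 0 (θ.2 2 - iteratedDeriv 2 δ θ.1) =
            frameD θ.pt (upsilon θ) + c • θ.vel)) ∧
    -- the right lifts: one-to-two, on an open dense set, right inverse to the projection
    (IsOpen GenK ∧ Dense GenK ∧
      (∀ θ ∈ GenK,
        (∀ ε : ℤˣ, (jRight ε θ).proj = θ.toComplex ∧ (jRight ε θ).pt 5 = lam ε (upsilon θ)) ∧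
        lam 1 (upsilon θ) ≠ lam (-1) (upsilon θ) ∧
        (∀ r : ℂ, IsSecantPt (upsilon θ) r ↔ ∃ ε : ℤˣ, r = lam ε (upsilon θ)) ∧
        (0 < secDisc (upsilon θ) →
          ∀ ε : ℤˣ, ∃ η : Jet ℝ 5, jRight ε θ = η.toComplex) ∧
        (secDisc (upsilon θ) < 0 → ∀ ε : ℤˣ, jRight (-ε) θ = (jRight ε θ).conj)) ∧
      (∀ γ : ℝ → Fin 4 → ℝ, ContDiff ℝ ∞ γ → ∀ x : ℝ, jetOf γ x ∈ GenK → ∀ ε : ℤˣ,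
        jRight ε (jetOf γ x) =
          jetOf (fun t => ![(γ t 0 : ℂ), (γ t 1 : ℂ), (γ t 2 : ℂ), (γ t 3 : ℂ),
            lam ε (upsilon (jetOf γ t))]) x) ∧
      (∀ γ : ℝ → Fin 4 → ℝ, ContDiff ℝ ∞ γ → ∀ s : Set ℝ, IsPreconnected s →
        (∀ t ∈ s, jetOf γ t ∈ GenK) → ∀ ρ : ℝ → ℂ, ContinuousOn ρ s →
          ((∀ t ∈ s, IsSecantPt (upsilon (jetOf γ t)) (ρ t)) ↔
            ∃ ε : ℤˣ, ∀ t ∈ s, ρ t = lam ε (upsilon (jetOf γ t))))) ∧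
    -- the two branches in `M` of a generic curve in `K`
    (IsOpen GenBranch ∧ Dense GenBranch ∧
      (∀ θ ∈ GenK, branchPt 1 θ ≠ branchPt (-1) θ ∧
        lineM (branchPt 1 θ) ⊔ lineM (branchPt (-1) θ) =
          Submodule.span ℂ {(fun i => (vecK₁ θ.pt i : ℂ)), (fun i => (vecK₂ θ.pt i : ℂ))}) ∧
      (∀ θ ∈ GenBranch, 0 < secDisc (upsilon θ) →
        ∀ ε : ℤˣ, ∃ η : Jet ℝ 4, branch ε θ = η.toComplex) ∧
      (∀ γ c : ℝ → Fin 4 → ℝ, ContDiff ℝ ∞ γ → ContDiff ℝ ∞ c → ∀ (X : ℝ → ℝ) (x : ℝ),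
        jetOf γ x ∈ GenBranch → ∀ ε : ℤˣ,
          (∀ᶠ t in 𝓝 x, branchPt ε (jetOf γ t) = fun i => (graphPt c (X t) i : ℂ)) →
            branch ε (jetOf γ x) = (jetOf c (X x)).toComplex) ∧
      (∀ Q : JetPoly, Q ≠ 0 → Dense {θ | θ ∈ GenBranch ∧ ∀ ε : ℤˣ, Q.evalAt (branch ε θ) ≠ 0})) ∧
    -- reduction of the equivalence problem
    (∀ g ∈ G2, ∀ γ₁ γ₂ : ℝ → Fin 4 → ℝ, ContDiff ℝ ∞ γ₁ → ContDiff ℝ ∞ γ₂ →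
      ∀ (τ : ℝ → ℝ) (x : ℝ), ContDiffAt ℝ ∞ τ x → deriv τ x ≠ 0 →
        jetOf γ₁ x ∈ GenK → jetOf γ₂ (τ x) ∈ GenK →
          (CurvesCongruent planeK (g : Matrix (Fin 7) (Fin 7) ℝ) γ₁ γ₂ τ x ↔
            ∃ σ : ℤˣ, ∀ᶠ t in 𝓝 x, ∀ ε : ℤˣ,
              moved (g : Matrix (Fin 7) (Fin 7) ℝ) (lineM (branchPt ε (jetOf γ₁ t))) =
                lineM (branchPt (σ * ε) (jetOf γ₂ (τ t))))) ∧
    -- reduction of the invariants: averaging over the two branches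
    (∀ (k : ℕ) (P Q : JetPoly), IsRatInvariant lineM k P Q →
      ∃ A B : JetPoly, IsRatInvariant planeK (k + 2) A B ∧
        ∀ θ ∈ GenBranch, (∀ ε : ℤˣ, Q.evalAt (branch ε θ) ≠ 0) → B.evalAt θ ≠ 0 →
          ((A.evalAt θ / B.evalAt θ : ℝ) : ℂ) =
            (P.evalAt (branch 1 θ) / Q.evalAt (branch 1 θ) +
              P.evalAt (branch (-1) θ) / Q.evalAt (branch (-1) θ)) / 2) := by
  refine ⟨⟨fst_image_FlagP12, snd_image_FlagP12, bijOn_lineM, bijOn_planeK, bijOn_flagMhat,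
    bijOn_flagKhat⟩, diffeomorphism_phi, ⟨isOpen_GenM, dense_GenM,
    fun θ hθ => ⟨jLeft_proj hθ, metricM_eq_zero_iff hθ⟩, fun γ hγ x hx => jLeft_jetOf hγ hx,
    ?_⟩, fun θ hθ => ⟨exists_distinguished hθ, fun δ hs hd h0 h1 => upsilon_distinguished hθ hs hd h0 h1⟩,
    ⟨isOpen_GenK, dense_GenK, fun θ hθ => ⟨fun ε => ⟨jRight_proj hθ ε, rfl⟩,
      lam_ne hθ.2.1 hθ.2.2 1, isSecantPt_iff hθ.2.1 hθ.2.2, fun hd ε => jRight_real hθ hd ε,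
      fun hd ε => jRight_conj hθ hd ε⟩, fun γ hγ x hx ε => jRight_jetOf hγ hx ε,
      fun γ hγ s hs h ρ hρ => continuous_lift_iff hγ hs h hρ⟩, ?_, ?_, ?_⟩
  · intro g hg γ₁ γ₂ h1 h2 τ x hc hx1 hx2
    exact jLeft_equivariant hg h1 h2 hc hx1 hx2
  · exact ⟨isOpen_GenBranch, dense_GenBranch, fun θ hθ => ⟨branchPt_ne hθ, lineM_sup_branchPt hθ⟩,
      fun θ hθ hd ε => branch_real hθ hd ε, fun γ c hγ hc X x hx ε h => branch_jetOf
        (Eventually.of_forall fun _ => hγ.contDiffAt) hc (GenBranch_subset_BranchDom ε hx) h,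
      fun Q hQ => dense_evalAt_branch hQ⟩
  · exact fun g hg γ₁ γ₂ h1 h2 τ x hτ hτ' hx₁ hx₂ => congruent_iff_branchPt hg h1 h2 hτ hτ' hx₁ hx₂
  · exact fun k P Q hI => exists_isRatInvariant_average hI
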